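/- \textbf{Setting.} A table $\mathcal D=\mathbb R^2\setminus(\mathcal O_1\cup\mathcal O_2\cup\mathcal O_3)$ is given by three labelled compact convex obstacles whose boundaries are real-analytic simple closed curves of nowhere vanishing curvature, such that the convex hull of any two obstacles is disjoint from the third. The billiard map acts on pairs $(s,r)$, where $s$ is an arc-length parameter on the boundary and $r=\sin\varphi$ is the tangential component of the outgoing unit velocity. Let $(12)$ be the $2$-periodic orbit bouncing between $\mathcal O_1$ and $\mathcal O_2$, let $\ell$ be the distance between its two bounce points, and let the arc-length parameters on $\partial\mathcal O_1,\partial\mathcal O_2$ vanish at these points. The set $\mathbf B_{\mathrm{sym}}$ consists of the tables for which the Taylor series at $0$ of the curvature functions of $\partial\mathcal O_1$ and $\partial\mathcal O_2$ coincide and contain only even powers. Let $\mathcal K>0$ and $\mathcal K''$ be the common values, at the two bounce points, of the curvature and of its second derivative with respect to arc length. \textbf{Folded table.} A folded table $\mathcal D^*$ of $\mathcal D\in\mathbf B_{\mathrm{sym}}$ consists of one of the obstacles $\mathcal O_1,\mathcal O_2$, called $1^*$; of a flat wall $2^*$, a segment centred at the midpoint of the trace of $(12)$, contained in the perpendicular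 bisector of this trace and disjoint from $\mathcal O_3$; and of an arc $3^*$ of $\partial\mathcal O_3$ contained in the closed half-plane that is bounded by the bisector and contains the bounce point on $1^*$. Let $\mathcal F^*$ be its billiard map and $T^*=(\mathcal F^*)^2$, considered near its fixed point $(0,0)$, the point of the $2$-periodic orbit $(1^*2^*)$ on $1^*$. A Birkhoff Normal Form of $T^*$ is a map $$N^*(\xi,\eta)=\big(\Delta^*(\xi\eta)\,\xi,\ \Delta^*(\xi\eta)^{-1}\eta\big),\qquad \Delta^*(z)=\lambda+a_1z+a_2z^2+\cdots,\quad 0<\lambda<1,$$ with $\Delta^*$ real-analytic near $0$, such that $R\circ T^*=N^*\circ R$ near $(0,0)$ for some real-analytic local change of coordinates $R$ with $R(0,0)=(0,0)$ and $d\xi\wedge d\eta=ds\wedge dr$. \textbf{Topologies.} Let $r\in\{0,1,2,\dots\}\cup\{\infty,\omega\}$, ordered so that $n<\infty<\omega$ for every integer $n$. Equip $C^\omega(\mathbb R/2\pi\mathbb Z,\mathbb R^2)$ with the $C^r$ topology: uniform convergence of all derivatives of order at most $r$ if $r\le\infty$ (thus the sup norm if $r=0$), and, if $r=\omega$, the inductive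 limit as $\rho\to0$ of the topologies of uniform convergence of holomorphic extensions on the strips $|\mathrm{Im}\,z|<\rho$. Equip the set of triples of regularly parametrized simple closed curves bounding convex regions which are the obstacles of a table in $\mathbf B_{\mathrm{sym}}$ with the induced product topology, and $\mathbf B_{\mathrm{sym}}$ with the topology coinduced by the map sending such a triple to its table. This is the $C^r$ topology on $\mathbf B_{\mathrm{sym}}$. \textbf{Lemma.} (1) There are a continuous function $c^*\colon(0,\infty)^2\to\mathbb R\setminus\{0\}$ and a continuous function $f^*\colon\mathbb R^2\to\mathbb R$ such that, for every $\mathcal D\in\mathbf B_{\mathrm{sym}}$, folded tables exist, and, for every folded table, $T^*$ has a Birkhoff Normal Form and the first Birkhoff invariant of any such form is $$a_1=a_1(\mathcal D)=c^*(\ell,\mathcal K)\,\mathcal K''+f^*(\ell,\mathcal K).$$ (2) The set $\{\mathcal D\in\mathbf B_{\mathrm{sym}}: a_1(\mathcal D)\neq0\}$ is open for the $C^r$ topology for every $4\le r\le\omega$, and it is dense for the $C^r$ topology for every $0\le r\le\omega$. In particular it is open and dense for the analytic topology ($r=\omega$). -/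

import Mathlib

open Set Filter Topology
open scoped ContDiff

noncomputable section

/-- The Euclidean plane. -/
abbrev Plane := EuclideanSpace ℝ (Fin 2)

/-- `Υ` is an arc-length parametrization of the boundary of `O` by an analytic simple closed curve
with nowhere vanishing curvature (so that the convex set `O` is strictly convex). The parameter
lives in `ℝ`; the induced map on `ℝ / L ℤ` is injective. -/
structure IsArcLengthParam (O : Set Plane) (Υ : ℝ → Plane) : Prop where
  analytic : AnalyticOnNhd ℝ Υ univ
  unit_speed : ∀ s, ‖deriv Υ s‖ = 1
  closed_simple : ∃ L : ℝ, 0 < L ∧ Function.Periodic Υ L ∧ InjOn Υ (Ico 0 L)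
  range_eq : range Υ = frontier O
  curved : ∀ s, iteratedDeriv 2 Υ s ≠ 0

/-- A strictly convex obstacle with analytic boundary. -/
structure IsObstacle (O : Set Plane) : Prop where
  compact : IsCompact O
  convex : Convex ℝ O
  boundary : ∃ Υ, IsArcLengthParam O Υ

/-- The class `B = B(3)`: three labelled strictly convex analytic obstacles (labels `0, 1, 2` stand
for `1, 2, 3`) satisfying the non-eclipse condition. The table is the complement of their union. -/
structure IsTable (D : Fin 3 → Set Plane) : Prop where
  obstacle : ∀ i, IsObstacle (D i)
  non_eclipse : ∀ i j k, i ≠ j → k ≠ i → k ≠ j → Disjoint (convexHull ℝ (D i ∪ D j)) (D k)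

/-- The graph of the billiard map outside the scatterers `S`, between a boundary piece parametrized
by arc length by `α` and one parametrized by `β`, in coordinates `(s, r)`. Here `r = sin φ` is the
tangential component of the unit outgoing velocity; at the second point it is the one after the
reflection, which preserves tangential components. The segment between two consecutive collisions
is free of scatterers. -/
def BilliardStep (S : Set Plane) (α β : ℝ → Plane) (x y : ℝ × ℝ) : Prop :=
  α x.1 ∈ S ∧ β y.1 ∈ S ∧ α x.1 ≠ β y.1 ∧
  Disjoint (openSegment ℝ (α x.1) (β y.1)) S ∧
  x.2 = inner ℝ (deriv α x.1) ((dist (α x.1) (β y.1))⁻¹ • (β y.1 - α x.1)) ∧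
  y.2 = inner ℝ (deriv β y.1) ((dist (α x.1) (β y.1))⁻¹ • (β y.1 - α x.1))

/-- The curvature of an arc-length parametrized curve (positive on our obstacles). -/
def curvature (Υ : ℝ → Plane) (s : ℝ) : ℝ := ‖iteratedDeriv 2 Υ s‖

/-- `Υ` consists of arc-length parametrizations of the three obstacles of the table `D`, those of
the first two being normalized in such a way that the points of parameter `0` are the bounces of
the `2`-periodic orbit `(12)`. -/
structure IsMarking (D : Fin 3 → Set Plane) (Υ : Fin 3 → ℝ → Plane) : Prop where
  param : ∀ i, IsArcLengthParam (D i) (Υ i)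
  go : BilliardStep (⋃ i, D i) (Υ 0) (Υ 1) (0, 0) (0, 0)
  back : BilliardStep (⋃ i, D i) (Υ 1) (Υ 0) (0, 0) (0, 0)

/-- The symmetry assumption: at the two bounces of the orbit `(12)`, the jets of the curvature are
equal and even. -/
structure IsSymMarking (D : Fin 3 → Set Plane) (Υ : Fin 3 → ℝ → Plane) : Prop where
  table : IsTable D
  marking : IsMarking D Υ
  same_jets : ∀ k, iteratedDeriv k (curvature (Υ 0)) 0 = iteratedDeriv k (curvature (Υ 1)) 0
  even_jet_zero : ∀ k, Odd k → iteratedDeriv k (curvature (Υ 0)) 0 = 0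
  even_jet_one : ∀ k, Odd k → iteratedDeriv k (curvature (Υ 1)) 0 = 0

/-- The class `B_sym` of symmetric billiard tables. -/
def Bsym : Set (Fin 3 → Set Plane) := {D | ∃ Υ, IsSymMarking D Υ}

/-- The midpoint of the trace of the orbit `(12)`. -/
def foldCenter (Υ : Fin 3 → ℝ → Plane) : Plane := midpoint ℝ (Υ 0 0) (Υ 1 0)

/-- The choices in the construction of the folded table `D*`: the side (label `0` or `1`) that is
kept; a flat wall on the perpendicular bisector of the trace of `(12)`, centred at its midpoint,
with unit direction `dir` and half-length `len`, disjoint from the third obstacle; and an arc of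
the boundary of the third obstacle, inside the closed half-plane that contains the kept side. -/
structure Folding (D : Fin 3 → Set Plane) (Υ : Fin 3 → ℝ → Plane) where
  side : Fin 3
  side_eq : side = 0 ∨ side = 1
  dir : Plane
  dir_norm : ‖dir‖ = 1
  dir_perp : inner ℝ dir (Υ 1 0 - Υ 0 0) = 0
  len : ℝ
  len_pos : 0 < len
  wall_free : ∀ t : ℝ, |t| ≤ len → foldCenter Υ + t • dir ∉ D 2
  arcStart : ℝ
  arcEnd : ℝ
  arc_lt : arcStart < arcEnd
  arc_half : ∀ t ∈ Icc arcStart arcEnd,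
    0 ≤ inner ℝ (Υ 2 t - foldCenter Υ) (Υ side 0 - foldCenter Υ)

namespace Folding

variable {D : Fin 3 → Set Plane} {Υ : Fin 3 → ℝ → Plane}

/-- Arc-length parametrization of the line that carries the wall `2*`. -/
def wallParam (W : Folding D Υ) (t : ℝ) : Plane := foldCenter Υ + t • W.dir

/-- The union of the three obstacles `1*`, `2*`, `3*` of the folded table `D*`. -/
def scatterers (W : Folding D Υ) : Set Plane :=
  D W.side ∪ W.wallParam '' Icc (-W.len) W.len ∪ Υ 2 '' Icc W.arcStart W.arcEnd

/-- `T` represents, near `(0, 0)`, the square `T* = (F*)²` of the billiard map of the folded table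
at the point of the period two orbit `(1*2*)` that lies on `1*`: first a bounce on the wall, then a
bounce on `1*`. -/
def IsReturnMap (W : Folding D Υ) (T : ℝ × ℝ → ℝ × ℝ) : Prop :=
  T 0 = 0 ∧ ContinuousAt T 0 ∧
  ∀ᶠ x in 𝓝 (0 : ℝ × ℝ), ∃ y,
    BilliardStep W.scatterers (Υ W.side) W.wallParam x y ∧
    BilliardStep W.scatterers W.wallParam (Υ W.side) y (T x)

end Folding

/-- The germ at `0` of the map `N (ξ, η) = (Δ(ξη) ξ, Δ(ξη)⁻¹ η)`, with `Δ` analytic and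
`Δ(0) = λ ∈ (0, 1)`, is the Birkhoff Normal Form of the germ of `T` at its fixed point `0`: there
is a local analytic change of coordinates `R`, preserving the area form, with `R ∘ T = N ∘ R`. -/
def IsBirkhoffNormalForm (T : ℝ × ℝ → ℝ × ℝ) (Δ : ℝ → ℝ) : Prop :=
  AnalyticAt ℝ Δ 0 ∧ 0 < Δ 0 ∧ Δ 0 < 1 ∧
  ∃ R : ℝ × ℝ → ℝ × ℝ, R 0 = 0 ∧ AnalyticAt ℝ R 0 ∧
    (∀ᶠ x in 𝓝 (0 : ℝ × ℝ), (fderiv ℝ R x).det = 1) ∧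
    ∀ᶠ x in 𝓝 (0 : ℝ × ℝ),
      R (T x) = (Δ ((R x).1 * (R x).2) * (R x).1, (Δ ((R x).1 * (R x).2))⁻¹ * (R x).2)

/-- `a` is the first Birkhoff invariant `a₁` of `N*`, i.e. the coefficient of `z` in the expansion
`Δ(z) = λ + a₁ z + a₂ z² + ⋯`. -/
def Folding.IsFirstBirkhoffInvariant {D : Fin 3 → Set Plane} {Υ : Fin 3 → ℝ → Plane}
    (W : Folding D Υ) (a : ℝ) : Prop :=
  ∃ T Δ, W.IsReturnMap T ∧ IsBirkhoffNormalForm T Δ ∧ deriv Δ 0 = a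

/-- The nondegeneracy condition `a₁(D) ≠ 0`. -/
def IsNondegenerate (D : Fin 3 → Set Plane) : Prop :=
  ∃ Υ, IsSymMarking D Υ ∧ ∃ (W : Folding D Υ) (a : ℝ), W.IsFirstBirkhoffInvariant a ∧ a ≠ 0

/-- The space `C^ω(ℝ / 2πℤ, ℝ²)`. -/
def AnalyticLoop : Type :=
  {f : ℝ → Plane // AnalyticOnNhd ℝ f univ ∧ Function.Periodic f (2 * Real.pi)}

/-- `F` is a holomorphic extension of `f` to the strip `|Im z| < ρ`. -/
def AnalyticLoop.IsExtension (f : AnalyticLoop) (ρ : ℝ) (F : ℂ → Fin 2 → ℂ) : Prop :=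
  DifferentiableOn ℂ F {z | |z.im| < ρ} ∧ ∀ (x : ℝ) (i : Fin 2), F (x : ℂ) i = ((f.1 x i : ℝ) : ℂ)

/-- The analytic topology: the inductive limit, as the width `ρ` of the strip tends to `0`, of the
topologies of uniform convergence of the holomorphic extensions on strips. -/
@[reducible] def analyticTopology : TopologicalSpace AnalyticLoop where
  IsOpen V := ∀ ρ : ℝ, 0 < ρ → ∀ f ∈ V, ∀ F, f.IsExtension ρ F →
    ∃ ε : ℝ, 0 < ε ∧ ∀ (g : AnalyticLoop) (G : ℂ → Fin 2 → ℂ), g.IsExtension ρ G →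
      (∀ z : ℂ, |z.im| < ρ → ‖G z - F z‖ ≤ ε) → g ∈ V
  isOpen_univ := fun _ _ _ _ _ _ => ⟨1, one_pos, fun _ _ _ _ => mem_univ _⟩
  isOpen_inter := by
    intro U V hU hV ρ hρ f hf F hF
    obtain ⟨ε, hε, h⟩ := hU ρ hρ f hf.1 F hF
    obtain ⟨δ, hδ, k⟩ := hV ρ hρ f hf.2 F hF
    refine ⟨min ε δ, lt_min hε hδ, fun g G hG hd => ⟨?_, ?_⟩⟩
    · exact h g G hG fun z hz => (hd z hz).trans (min_le_left _ _)
    · exact k g G hG fun z hz => (hd z hz).trans (min_le_right _ _)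
  isOpen_sUnion := by
    intro 𝒱 h𝒱 ρ hρ f hf F hF
    obtain ⟨V, hV, hfV⟩ := hf
    obtain ⟨ε, hε, h⟩ := h𝒱 V hV ρ hρ f hfV F hF
    exact ⟨ε, hε, fun g G hG hd => ⟨V, hV, h g G hG hd⟩⟩

/-- The `C^r` topology on analytic loops. For `r ≤ ∞` it is the topology of uniform convergence of
all derivatives of order at most `r` (for `r = 0`, that of the sup norm); for `r = ω` it is the
analytic topology. -/
@[reducible] def loopTopology : WithTop ℕ∞ → TopologicalSpace AnalyticLoop
  | ⊤ => analyticTopology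
  | WithTop.some r => ⨅ (j : ℕ) (_ : (j : ℕ∞) ≤ r),
      TopologicalSpace.induced (fun f : AnalyticLoop => UniformFun.ofFun (iteratedDeriv j f.1))
        (inferInstance : TopologicalSpace (UniformFun ℝ Plane))

/-- The closed region enclosed by a convex loop. -/
def region (f : AnalyticLoop) : Set Plane := convexHull ℝ (range f.1)

/-- The set `Conv`: regularly parametrized simple closed curves that bound a convex region (that
is, the curve is the whole boundary of its convex hull). -/
structure IsConvexLoop (f : AnalyticLoop) : Prop where
  regular : ∀ θ, deriv f.1 θ ≠ 0
  simple : InjOn f.1 (Ico 0 (2 * Real.pi))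
  convex : frontier (region f) = range f.1

/-- The set `W_sym` of triples of convex loops that enclose the obstacles of a symmetric table. -/
def Wsym : Set (Fin 3 → AnalyticLoop) :=
  {f | (∀ i, IsConvexLoop (f i)) ∧ (fun i => region (f i)) ∈ Bsym}

/-- The map `Φ : W_sym → B_sym`. -/
def toTable (f : Wsym) : Bsym := ⟨fun i => region (f.1 i), f.2.2⟩

/-- The topology on `B_sym` coinduced by `Φ` from the product `C^r` topology on `W_sym`. -/
@[reducible] def tableTopology (r : WithTop ℕ∞) : TopologicalSpace Bsym :=
  TopologicalSpace.coinduced toTable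
    (TopologicalSpace.induced Subtype.val
      (@Pi.topologicalSpace (Fin 3) (fun _ => AnalyticLoop) (fun _ => loopTopology r)))

end

/-! Since the wall is flat, reflecting in it turns two steps of the folded billiard into one
straight flight from a boundary point to the mirror image of another. In tangential and normal
coordinates x, y of the boundary at the bounce, the length of this flight is L(s, s') = √((x(s) −
x(s'))² + (ℓ + y(s) + y(s'))²). With k = ∂₁L the return map is given by r = −k(s, s'), r' = k(s',
s), and its orbits are the solutions of k(sₙ, sₙ₋₁) + k(sₙ, sₙ₊₁) = 0
(`IsBounce.step_iff_twistStep`).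

Formula for a₁. If a Birkhoff Normal Form N exists, orbits read sₙ = S(Nⁿ(ξ, η)) with S analytic.
The cubic Taylor polynomial of k has no quadratic part, because K' = 0 at the bounce, and K'' enters
only its s³ coefficient. Comparing the coefficients of ξ²η in the orbit equation gives a₁: the
unknown coefficient of S drops out because this monomial is resonant, and the product of the two
first derivatives of S is fixed by preservation of area (`IsTwist.deriv_normalForm`,
`birkhoff_formula`).

Existence of the normal form. One looks for S and Δ by a Lyapunov–Schmidt reduction. While δ = Δ(ξη)
is treated as a number, the dynamics is linear and diagonal on monomials ξⁱηʲ, with symbol δ^(i−j) +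
δ^(j−i) − (λ + λ⁻¹). Away from |i − j| = 1 the symbol is bounded below after normalization, so the
nonresonant part is solved by the implicit function theorem in the ℓ¹ algebra of power series
(`exists_nonresonant`). Time reversal merges the two resonant equations into one scalar equation in
(ξη, δ), which determines Δ (`exists_orbit_family`). The resulting conjugacy has a Jacobian
invariant under the normal form, hence a function of ξη, and a rescaling by a function of ξη makes
it area preserving (`exists_eq_comp_prod_of_invariant`, `isBirkhoffNormalForm_of_semiconj`).

Openness. The two bounce points are the only pair realizing the distance between the first two
obstacles. In a given triple of loops they are therefore found by minimization, and a₁ is a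
continuous function of the 4-jet of a loop at the minimizer. Compactness of the parameter square
shows that a₁ ≠ 0 persists (`Wsym.eventually_isNondegenerate`).

Density. Stretching the plane by a factor μ along the common tangent direction at the two bounces
keeps the orbit, its length and the symmetry. It replaces K by K/μ² and K'' by K''/μ⁴ + 3K³(μ² −
1)/μ⁶. If a₁ = 0 for the original table then a₁ ≠ 0 for every μ ≠ 1, and the stretched loops tend to
the original ones in the analytic topology as μ → 1 (`IsSymMarking.isNondegenerate_stretch`,
`AnalyticLoop.tendsto_stretch`). -/

/-! ### The Banach algebra of absolutely summable power series in two variables -/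

/-- Polynomials in two variables, to be normed by the sum of the absolute values of the
coefficients. -/
def BiPoly : Type := AddMonoidAlgebra ℝ (ℕ × ℕ)

noncomputable instance : CommRing BiPoly := inferInstanceAs (CommRing (AddMonoidAlgebra ℝ (ℕ × ℕ)))
noncomputable instance : Algebra ℝ BiPoly :=
  inferInstanceAs (Algebra ℝ (AddMonoidAlgebra ℝ (ℕ × ℕ)))

namespace BiPoly

noncomputable def coeffs (a : BiPoly) : (ℕ × ℕ) →₀ ℝ := AddMonoidAlgebra.coeff a

theorem coeffs_add (a b : BiPoly) : coeffs (a + b) = coeffs a + coeffs b := rfl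
theorem coeffs_smul (r : ℝ) (a : BiPoly) : coeffs (r • a) = r • coeffs a := rfl
theorem coeffs_zero : coeffs 0 = 0 := rfl
theorem coeffs_injective : Function.Injective coeffs := AddMonoidAlgebra.coeff_injective

noncomputable def mono (i : ℕ × ℕ) : BiPoly := AddMonoidAlgebra.single i 1

theorem coeffs_mono (i : ℕ × ℕ) : coeffs (mono i) = Finsupp.single i 1 := rfl

theorem mono_add (i j : ℕ × ℕ) : mono (i + j) = mono i * mono j := by
  have := AddMonoidAlgebra.single_mul_single (R := ℝ) i j 1 1
  rw [one_mul] at this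
  exact this.symm

theorem mono_zero : mono 0 = 1 := rfl

theorem eq_sum (a : BiPoly) : a = (coeffs a).sum fun i r => r • mono i := by
  apply coeffs_injective
  let φ : BiPoly →+ ((ℕ × ℕ) →₀ ℝ) := ⟨⟨coeffs, rfl⟩, coeffs_add⟩
  change φ a = φ _
  rw [map_finsuppSum]
  change coeffs a = (coeffs a).sum fun i r => coeffs (r • mono i)
  simp only [coeffs_smul, coeffs_mono, Finsupp.smul_single, smul_eq_mul, mul_one]
  exact (Finsupp.sum_single _).symm

theorem induction {p : BiPoly → Prop} (a : BiPoly) (h0 : p 0)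
    (hadd : ∀ a b, p a → p b → p (a + b)) (hm : ∀ i (r : ℝ), p (r • mono i)) : p a := by
  rw [eq_sum a, Finsupp.sum]
  exact Finset.sum_induction _ p hadd h0 fun i _ => hm _ _

noncomputable def nrm (a : BiPoly) : ℝ := (coeffs a).sum fun _ r => |r|

theorem nrm_eq {a : BiPoly} {s : Finset (ℕ × ℕ)} (h : (coeffs a).support ⊆ s) :
    nrm a = ∑ i ∈ s, |coeffs a i| :=
  Finsupp.sum_of_support_subset _ h _ (by simp)

theorem nrm_add_le (a b : BiPoly) : nrm (a + b) ≤ nrm a + nrm b := by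
  classical
  set s := (coeffs a).support ∪ (coeffs b).support
  rw [nrm_eq (s := s) (a := a + b) (by rw [coeffs_add]; exact Finsupp.support_add),
    nrm_eq (a := a) (s := s) Finset.subset_union_left,
    nrm_eq (a := b) (s := s) Finset.subset_union_right, ← Finset.sum_add_distrib]
  exact Finset.sum_le_sum fun i _ => by rw [coeffs_add]; exact abs_add_le _ _

theorem nrm_smul (r : ℝ) (a : BiPoly) : nrm (r • a) = |r| * nrm a := by
  rw [nrm_eq (s := (coeffs a).support) (by rw [coeffs_smul]; exact Finsupp.support_smul),
    nrm_eq (a := a) subset_rfl, Finset.mul_sum]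
  exact Finset.sum_congr rfl fun i _ => by rw [coeffs_smul]; simp [abs_mul]

theorem nrm_mono (i : ℕ × ℕ) : nrm (mono i) = 1 := by
  rw [nrm, coeffs_mono, Finsupp.sum_single_index] <;> simp

theorem nrm_neg (a : BiPoly) : nrm (-a) = nrm a := by
  simpa using nrm_smul (-1) a

theorem nrm_zero : nrm 0 = 0 := by rw [nrm, coeffs_zero]; simp

theorem nrm_sum_le (s : Finset (ℕ × ℕ)) (f : ℕ × ℕ → BiPoly) :
    nrm (∑ i ∈ s, f i) ≤ ∑ i ∈ s, nrm (f i) :=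
  Finset.le_sum_of_subadditive nrm nrm_zero.le nrm_add_le s f

theorem nrm_mono_mul_le (i : ℕ × ℕ) (b : BiPoly) : nrm (mono i * b) ≤ nrm b := by
  conv_lhs => rw [eq_sum b, Finsupp.sum, Finset.mul_sum]
  refine (nrm_sum_le _ _).trans ?_
  rw [nrm_eq (a := b) subset_rfl]
  refine Finset.sum_le_sum fun j _ => ?_
  rw [mul_smul_comm, ← mono_add, nrm_smul, nrm_mono, mul_one]

theorem nrm_mul_le (a b : BiPoly) : nrm (a * b) ≤ nrm a * nrm b := by
  conv_lhs => rw [eq_sum a, Finsupp.sum, Finset.sum_mul]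
  refine (nrm_sum_le _ _).trans ?_
  rw [nrm_eq (a := a) subset_rfl, Finset.sum_mul]
  refine Finset.sum_le_sum fun j _ => ?_
  rw [smul_mul_assoc, nrm_smul]
  exact mul_le_mul_of_nonneg_left (nrm_mono_mul_le _ _) (abs_nonneg _)

theorem eq_zero_of_nrm (a : BiPoly) (h : nrm a = 0) : a = 0 := by
  apply coeffs_injective
  rw [coeffs_zero]
  by_contra hne
  obtain ⟨i, hi⟩ := Finsupp.ne_iff.1 hne
  have := Finset.single_le_sum (f := fun i => |coeffs a i|) (fun _ _ => abs_nonneg _)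
    (Finsupp.mem_support_iff.2 hi)
  rw [nrm_eq subset_rfl] at h
  rw [h] at this
  exact hi (abs_nonpos_iff.1 this)

noncomputable def ringNorm : RingNorm BiPoly where
  toFun := nrm
  map_zero' := nrm_zero
  add_le' := nrm_add_le
  neg' := nrm_neg
  mul_le' := nrm_mul_le
  eq_zero_of_map_eq_zero' := eq_zero_of_nrm

end BiPoly

noncomputable instance : NormedCommRing BiPoly :=
  { BiPoly.ringNorm.toNormedRing, (inferInstance : CommRing BiPoly) with }

theorem BiPoly.norm_def (a : BiPoly) : ‖a‖ = BiPoly.nrm a := rfl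

noncomputable instance : NormedAlgebra ℝ BiPoly where
  norm_smul_le r a := by rw [BiPoly.norm_def, BiPoly.nrm_smul]; exact le_rfl

/-- Absolutely summable power series in two variables. -/
abbrev BiSeries : Type := UniformSpace.Completion BiPoly

namespace BiSeries

noncomputable def mono (i : ℕ × ℕ) : BiSeries := ((BiPoly.mono i : BiPoly) : BiSeries)

theorem mono_add (i j : ℕ × ℕ) : mono (i + j) = mono i * mono j := by
  rw [mono, BiPoly.mono_add, UniformSpace.Completion.coe_mul]; rfl

theorem mono_zero : mono 0 = 1 := by
  rw [mono, BiPoly.mono_zero, UniformSpace.Completion.coe_one]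

theorem norm_mono (i : ℕ × ℕ) : ‖mono i‖ = 1 := by
  rw [mono, UniformSpace.Completion.norm_coe, BiPoly.norm_def, BiPoly.nrm_mono]

theorem induction {p : BiSeries → Prop} (a : BiSeries) (hc : IsClosed {a | p a}) (h0 : p 0)
    (hadd : ∀ a b, p a → p b → p (a + b)) (hm : ∀ i (r : ℝ), p (r • mono i)) : p a := by
  induction a using UniformSpace.Completion.induction_on with
  | hp => exact hc
  | ih a =>
    induction a using BiPoly.induction with
    | h0 => rw [UniformSpace.Completion.coe_zero]; exact h0
    | hadd a b ha hb => rw [UniformSpace.Completion.coe_add]; exact hadd _ _ ha hb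
    | hm i r => rw [UniformSpace.Completion.coe_smul]; exact hm i r

variable {E : Type*} [NormedAddCommGroup E] [NormedSpace ℝ E]

theorem clm_ext {f g : BiSeries →L[ℝ] E} (h : ∀ i, f (mono i) = g (mono i)) : f = g := by
  ext a
  induction a using BiSeries.induction with
  | hc => exact isClosed_eq f.continuous g.continuous
  | h0 => simp
  | hadd a b ha hb => simp [ha, hb]
  | hm i r => simp [h]

variable [CompleteSpace E]

noncomputable def liftPoly (b : ℕ × ℕ → E) (C : ℝ) (hb : ∀ i, ‖b i‖ ≤ C) : BiPoly →L[ℝ] E :=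
  LinearMap.mkContinuous
    { toFun := fun a => (BiPoly.coeffs a).sum fun i r => r • b i
      map_add' := fun a a' => by
        rw [BiPoly.coeffs_add]
        exact Finsupp.sum_add_index' (fun _ => zero_smul _ _) fun _ _ _ => add_smul _ _ _
      map_smul' := fun r a => by
        rw [BiPoly.coeffs_smul, Finsupp.sum_smul_index' (h := fun _ (r : ℝ) => r • b _)
          fun _ => zero_smul _ _, RingHom.id_apply, Finsupp.smul_sum]
        simp only [smul_eq_mul, mul_smul] } C fun a => by
    rw [BiPoly.norm_def, BiPoly.nrm_eq subset_rfl, Finset.mul_sum]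
    refine (norm_sum_le _ _).trans (Finset.sum_le_sum fun i _ => ?_)
    rw [norm_smul, mul_comm, Real.norm_eq_abs]
    exact mul_le_mul_of_nonneg_right (hb i) (abs_nonneg _)

/-- The bounded linear map with prescribed bounded values on the monomials. -/
noncomputable def lift (b : ℕ × ℕ → E) (C : ℝ) (hb : ∀ i, ‖b i‖ ≤ C) : BiSeries →L[ℝ] E :=
  (liftPoly b C hb).extend UniformSpace.Completion.toComplL

theorem lift_mono (b : ℕ × ℕ → E) (C : ℝ) (hb : ∀ i, ‖b i‖ ≤ C) (i : ℕ × ℕ) :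
    lift b C hb (mono i) = b i := by
  have := ContinuousLinearMap.extend_eq (liftPoly b C hb)
    (e := (UniformSpace.Completion.toComplL : BiPoly →L[ℝ] BiSeries))
    UniformSpace.Completion.denseRange_coe
    (UniformSpace.Completion.isUniformInducing_coe _) (BiPoly.mono i)
  refine this.trans ?_
  change (BiPoly.coeffs (BiPoly.mono i)).sum (fun i r => r • b i) = b i
  rw [BiPoly.coeffs_mono, Finsupp.sum_single_index] <;> simp

theorem norm_lift_le (b : ℕ × ℕ → E) (C : ℝ) (hb : ∀ i, ‖b i‖ ≤ C) : ‖lift b C hb‖ ≤ C := by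
  have hC : 0 ≤ C := (norm_nonneg _).trans (hb 0)
  have := ContinuousLinearMap.opNorm_extend_le (liftPoly b C hb)
    (e := (UniformSpace.Completion.toComplL : BiPoly →L[ℝ] BiSeries)) (N := 1)
    UniformSpace.Completion.denseRange_coe (by simp)
  refine this.trans ?_
  rw [NNReal.coe_one, one_mul]
  exact LinearMap.mkContinuous_norm_le _ hC _

/-- Bounded sequences indexed by the monomials. -/
abbrev Mult : Type := lp (fun _ : ℕ × ℕ => ℝ) ⊤

theorem norm_apply_le (μ : Mult) (i : ℕ × ℕ) : ‖μ i‖ ≤ ‖μ‖ := lp.norm_apply_le_norm (by simp) μ i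

/-- The diagonal operator on power series with multipliers `μ`. -/
noncomputable def diag : Mult →L[ℝ] BiSeries →L[ℝ] BiSeries :=
  LinearMap.mkContinuous
    { toFun := fun μ => lift (fun i => μ i • mono i) ‖μ‖ fun i => by
        rw [norm_smul, norm_mono, mul_one]; exact norm_apply_le μ i
      map_add' := fun μ ν => clm_ext fun i => by
        simp only [lift_mono, _root_.add_apply, lp.coeFn_add, Pi.add_apply, add_smul]
      map_smul' := fun r μ => clm_ext fun i => by
        simp [lift_mono, smul_smul] } 1 fun μ => by
    rw [one_mul]; exact norm_lift_le _ _ _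

theorem diag_mono (μ : Mult) (i : ℕ × ℕ) : diag μ (mono i) = μ i • mono i :=
  lift_mono _ _ _ _

theorem diag_mul (μ ν : Mult) (a : BiSeries) : diag (μ * ν) a = diag μ (diag ν a) := by
  have : diag (μ * ν) = (diag μ).comp (diag ν) := clm_ext fun i => by
    simp [diag_mono, smul_smul, mul_comm]
  rw [this]; rfl

theorem diag_one (a : BiSeries) : diag 1 a = a := by
  have : diag 1 = ContinuousLinearMap.id ℝ BiSeries := clm_ext fun i => by
    simp [diag_mono]
  rw [this]; rfl

/-- The sum of the coefficients. -/
noncomputable def tot : BiSeries →L[ℝ] ℝ := lift (fun _ => 1) 1 (by simp)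

theorem tot_mono (i : ℕ × ℕ) : tot (mono i) = 1 := lift_mono _ _ _ _

/-- Exchange of the two variables. -/
noncomputable def swp : BiSeries →L[ℝ] BiSeries :=
  lift (fun i => mono i.swap) 1 fun _ => (norm_mono _).le

theorem swp_mono (i : ℕ × ℕ) : swp (mono i) = mono i.swap := lift_mono _ _ _ _

theorem norm_swp_le : ‖swp‖ ≤ 1 := norm_lift_le _ _ _

/-- Both sides are bilinear and continuous, and the monomials span a dense subspace, so
multiplicativity need only be tested on monomials. -/
theorem map_mul_of_mono {B : Type*} [NormedCommRing B] [NormedAlgebra ℝ B]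
    (f : BiSeries →L[ℝ] B) (h : ∀ i j, f (mono i * mono j) = f (mono i) * f (mono j))
    (a b : BiSeries) : f (a * b) = f a * f b := by
  induction a using BiSeries.induction with
  | hc => exact isClosed_eq (by fun_prop) (by fun_prop)
  | h0 => simp
  | hadd a a' ha hb => simp [add_mul, ha, hb]
  | hm i r =>
    induction b using BiSeries.induction with
    | hc => exact isClosed_eq (by fun_prop) (by fun_prop)
    | h0 => simp
    | hadd a a' ha hb => rw [mul_add, map_add, map_add, ha, hb, mul_add]
    | hm j t => simp [h]

theorem swp_mul (a b : BiSeries) : swp (a * b) = swp a * swp b :=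
  map_mul_of_mono _ (fun i j => by
    rw [← mono_add, swp_mono, swp_mono, swp_mono, Prod.swap_add, mono_add]) a b

theorem swp_one : swp 1 = 1 := by rw [← mono_zero, swp_mono]; rfl

theorem swp_diag (μ ν : Mult) (h : ∀ i, ν i.swap = μ i) (a : BiSeries) :
    swp (diag μ a) = diag ν (swp a) := by
  have : swp.comp (diag μ) = (diag ν).comp swp := clm_ext fun i => by
    simp [swp_mono, diag_mono, h]
  exact DFunLike.congr_fun this a

/-- The value `∑ χ i aᵢ` of a series `∑ aᵢ` at a multiplier `χ`. -/
noncomputable def ev (χ : Mult) : BiSeries →L[ℝ] ℝ := tot.comp (diag χ)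

theorem ev_mono (χ : Mult) (i : ℕ × ℕ) : ev χ (mono i) = χ i := by
  simp [ev, diag_mono, tot_mono]

theorem ev_diag (χ μ : Mult) (a : BiSeries) : ev χ (diag μ a) = ev (χ * μ) a := by
  simp only [ev, ContinuousLinearMap.comp_apply, diag_mul]

theorem ev_mul {χ : Mult} (h : ∀ i j, χ (i + j) = χ i * χ j) (a b : BiSeries) :
    ev χ (a * b) = ev χ a * ev χ b :=
  map_mul_of_mono _ (fun i j => by rw [← mono_add, ev_mono, ev_mono, ev_mono, h]) a b

theorem ev_one {χ : Mult} (h : χ 0 = 1) : ev χ 1 = 1 := by rw [← mono_zero, ev_mono, h]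

theorem ev_swp (χ ψ : Mult) (h : ∀ i, ψ i.swap = χ i) (a : BiSeries) :
    ev ψ (swp a) = ev χ a := by
  have : (ev ψ).comp swp = ev χ := clm_ext fun i => by simp [swp_mono, ev_mono, h]
  exact DFunLike.congr_fun this a

theorem norm_ev_le (χ : Mult) (h : ‖χ‖ ≤ 1) (a : BiSeries) : ‖ev χ a‖ ≤ ‖a‖ := by
  have : ev χ = lift (fun i => χ i) 1 fun i => (norm_apply_le χ i).trans h :=
    clm_ext fun i => by rw [ev_mono, lift_mono]
  rw [this]
  refine ((lift _ _ _).le_opNorm a).trans ?_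
  exact mul_le_of_le_one_left (norm_nonneg _) (norm_lift_le _ _ _)

/-- The indicator of a set of monomials. -/
noncomputable def ind (s : ℕ × ℕ → Prop) [DecidablePred s] : Mult :=
  ⟨fun i => if s i then 1 else 0, memℓp_infty ⟨1, by
    rintro _ ⟨i, rfl⟩; dsimp only; split_ifs <;> simp⟩⟩

theorem ind_apply (s : ℕ × ℕ → Prop) [DecidablePred s] (i : ℕ × ℕ) :
    ind s i = if s i then 1 else 0 := rfl

theorem norm_ind_le (s : ℕ × ℕ → Prop) [DecidablePred s] : ‖ind s‖ ≤ 1 :=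
  lp.norm_le_of_forall_le zero_le_one fun i => by rw [ind_apply]; split_ifs <;> simp

/-- The power series of `x ↦ (x ^ f i)ᵢ`. -/
noncomputable def geoSeries (f : ℕ × ℕ → ℕ) : FormalMultilinearSeries ℝ ℝ Mult := fun n =>
  ContinuousMultilinearMap.mkPiRing ℝ (Fin n) (ind fun i => f i = n)

/-- The multiplier `(x ^ f i)ᵢ`, for `|x| < 1`. -/
noncomputable def geo (f : ℕ × ℕ → ℕ) (x : ℝ) : Mult := (geoSeries f).sum x

/-- The coefficients of the series are indicators of level sets of `f`, of sup norm at most one.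
Hence x ↦ (x ^ f i)ᵢ is analytic on |x| < 1 as a map into bounded sequences, uniformly in i; this is
what makes the multipliers below analytic in δ. -/
theorem one_le_radius_geoSeries (f : ℕ × ℕ → ℕ) : 1 ≤ (geoSeries f).radius := by
  have := (geoSeries f).le_radius_of_bound (r := 1) 1 fun n => by
    rw [NNReal.coe_one, one_pow, mul_one, geoSeries, ContinuousMultilinearMap.norm_mkPiRing]
    exact norm_ind_le _
  simpa using this

theorem analyticAt_geo (f : ℕ × ℕ → ℕ) {x : ℝ} (hx : |x| < 1) : AnalyticAt ℝ (geo f) x := by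
  have h := (geoSeries f).hasFPowerSeriesOnBall
    (zero_lt_one.trans_le (one_le_radius_geoSeries f))
  refine h.analyticAt_of_mem (Metric.eball_subset_eball (one_le_radius_geoSeries f) ?_)
  rw [Metric.mem_eball, edist_dist, dist_zero_right, Real.norm_eq_abs]
  exact ENNReal.ofReal_lt_one.2 hx

theorem geo_apply (f : ℕ × ℕ → ℕ) {x : ℝ} (hx : |x| < 1) (i : ℕ × ℕ) : geo f x i = x ^ f i := by
  have h := (geoSeries f).hasFPowerSeriesOnBall
    (zero_lt_one.trans_le (one_le_radius_geoSeries f))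
  have hs := h.hasSum (y := x) (Metric.eball_subset_eball (one_le_radius_geoSeries f) (by
    rw [Metric.mem_eball, edist_dist, dist_zero_right, Real.norm_eq_abs]
    exact ENNReal.ofReal_lt_one.2 hx))
  rw [zero_add] at hs
  have hs' := (lp.evalCLM ℝ (fun _ : ℕ × ℕ => ℝ) ⊤ i).hasSum hs
  have hn : (fun n => lp.evalCLM ℝ (fun _ : ℕ × ℕ => ℝ) ⊤ i (geoSeries f n fun _ => x)) =
      fun n => if n = f i then x ^ f i else 0 := by
    funext n
    change ((geoSeries f n fun _ => x : Mult) i : ℝ) = _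
    simp only [geoSeries, ContinuousMultilinearMap.mkPiRing_apply, Finset.prod_const,
      Finset.card_univ, Fintype.card_fin]
    change x ^ n • (ind (fun i => f i = n) i) = _
    rw [ind_apply]
    by_cases hn : n = f i
    · simp [hn]
    · simp [hn, Ne.symm hn]
  rw [hn] at hs'
  exact hs'.unique (hasSum_ite_eq _ _)

end BiSeries

/-! ### Analytic functions of two variables act on commutative Banach algebras -/

namespace FormalMultilinearSeries

variable (B : Type*) [NormedCommRing B] [NormedAlgebra ℝ B]

/-- The word in the two basis vectors of `ℝ × ℝ` given by a sequence of booleans. -/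
def basisWord {n : ℕ} (σ : Fin n → Bool) : Fin n → ℝ × ℝ :=
  fun i => if σ i then (1, 0) else (0, 1)

/-- The series obtained from a power series on `ℝ × ℝ` by substituting two elements of a
commutative algebra for the coordinates. -/
noncomputable def subst (p : FormalMultilinearSeries ℝ (ℝ × ℝ) ℝ) :
    FormalMultilinearSeries ℝ (B × B) B := fun n =>
  ∑ σ : Fin n → Bool, p n (basisWord σ) •
    (ContinuousMultilinearMap.mkPiAlgebra ℝ (Fin n) B).compContinuousLinearMap
      fun i => if σ i then ContinuousLinearMap.fst ℝ B B else ContinuousLinearMap.snd ℝ B B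

theorem subst_apply (p : FormalMultilinearSeries ℝ (ℝ × ℝ) ℝ) (n : ℕ) (v : B × B) :
    (p.subst B n fun _ => v) =
      ∑ σ : Fin n → Bool, p n (basisWord σ) • ∏ i, if σ i then v.1 else v.2 := by
  simp only [subst, _root_.sum_apply, _root_.smul_apply,
    ContinuousMultilinearMap.compContinuousLinearMap_apply,
    ContinuousMultilinearMap.mkPiAlgebra_apply]
  refine Finset.sum_congr rfl fun σ _ => ?_
  congr 1
  refine Finset.prod_congr rfl fun i _ => ?_
  split_ifs <;> rfl

/-- Expanding each argument in the two basis vectors by multilinearity produces exactly the sum over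
words that defines `subst`. Over ℝ the functional calculus is therefore the original function, which
is how characters recover it. -/
theorem subst_real (p : FormalMultilinearSeries ℝ (ℝ × ℝ) ℝ) (n : ℕ) (v : ℝ × ℝ) :
    (p.subst ℝ n fun _ => v) = p n fun _ => v := by
  have hv : (fun _ : Fin n => v) =
      fun _ : Fin n => ∑ b : Bool, (if b then v.1 else v.2) • (if b then ((1, 0) : ℝ × ℝ) else (0, 1)) := by
    funext i
    simp
  rw [subst_apply, hv, ContinuousMultilinearMap.map_sum]
  refine Finset.sum_congr rfl fun σ _ => ?_
  have := (p n).map_smul_univ (fun i => if σ i then v.1 else v.2) (basisWord σ)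
  simp only [basisWord] at this ⊢
  rw [this, smul_eq_mul, smul_eq_mul, mul_comm]

theorem subst_map {B' : Type*} [NormedCommRing B'] [NormedAlgebra ℝ B']
    (p : FormalMultilinearSeries ℝ (ℝ × ℝ) ℝ) (n : ℕ) (v : B × B) (φ : B →ₐ[ℝ] B') :
    φ (p.subst B n fun _ => v) = p.subst B' n fun _ => (φ v.1, φ v.2) := by
  simp only [subst_apply, map_sum, map_smul, map_prod, apply_ite φ]

/-- There are 2 ^ n words of length n and each contributes at most ‖p n‖, so substitution at worst
halves the radius of convergence. -/
theorem norm_subst_le [NormOneClass B] (p : FormalMultilinearSeries ℝ (ℝ × ℝ) ℝ) (n : ℕ) :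
    ‖p.subst B n‖ ≤ 2 ^ n * ‖p n‖ := by
  refine (norm_sum_le _ _).trans ?_
  refine (Finset.sum_le_card_nsmul _ _ ‖p n‖ fun σ _ => ?_).trans (by simp)
  rw [norm_smul]
  have h1 : ‖p n (basisWord σ)‖ ≤ ‖p n‖ := by
    refine ((p n).le_opNorm _).trans (mul_le_of_le_one_right (norm_nonneg _) ?_)
    refine Finset.prod_le_one (fun _ _ => norm_nonneg _) fun i _ => ?_
    simp only [basisWord]
    split_ifs <;> simp [Prod.norm_def]
  refine (mul_le_mul h1 ?_ (norm_nonneg _) (norm_nonneg _)).trans (mul_one _).le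
  refine (ContinuousMultilinearMap.norm_compContinuousLinearMap_le _ _).trans ?_
  rw [ContinuousMultilinearMap.norm_mkPiAlgebra, one_mul]
  refine Finset.prod_le_one (fun _ _ => norm_nonneg _) fun i _ => ?_
  split_ifs
  · exact ContinuousLinearMap.norm_fst_le ..
  · exact ContinuousLinearMap.norm_snd_le ..

theorem radius_subst_pos [NormOneClass B] (p : FormalMultilinearSeries ℝ (ℝ × ℝ) ℝ)
    (h : 0 < p.radius) : 0 < (p.subst B).radius := by
  obtain ⟨r, hr0, hr⟩ := ENNReal.lt_iff_exists_nnreal_btwn.1 h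
  obtain ⟨C, -, hC⟩ := p.norm_mul_pow_le_of_lt_radius hr
  have : ((r / 2 : NNReal) : ENNReal) ≤ (p.subst B).radius :=
    le_radius_of_bound _ C fun n => by
      refine le_trans ?_ (hC n)
      refine (mul_le_mul_of_nonneg_right (norm_subst_le B p n) (by positivity)).trans_eq ?_
      push_cast
      rw [div_pow]
      field_simp
  refine lt_of_lt_of_le ?_ this
  have : 0 < r := by exact_mod_cast hr0
  exact_mod_cast half_pos this

end FormalMultilinearSeries

open FormalMultilinearSeries in
/-- An analytic function of two variables acts on a commutative Banach algebra, compatibly with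
contractive characters and endomorphisms. -/
theorem AnalyticAt.exists_functional_calculus (B : Type) [NormedCommRing B] [NormedAlgebra ℝ B]
    [NormOneClass B] [CompleteSpace B] {F : ℝ × ℝ → ℝ} (hF : AnalyticAt ℝ F 0) :
    ∃ G : B × B → B, AnalyticAt ℝ G 0 ∧ (F 0 = 0 → G 0 = 0) ∧
      (HasFDerivAt F (0 : ℝ × ℝ →L[ℝ] ℝ) 0 → HasFDerivAt G (0 : B × B →L[ℝ] B) 0) ∧
      (∀ᶠ v in 𝓝 (0 : B × B), ∀ φ : B →ₐ[ℝ] ℝ, (∀ b, ‖φ b‖ ≤ ‖b‖) →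
        φ (G v) = F (φ v.1, φ v.2)) ∧
      ∀ᶠ v in 𝓝 (0 : B × B), ∀ φ : B →ₐ[ℝ] B, (∀ b, ‖φ b‖ ≤ ‖b‖) →
        φ (G v) = G (φ v.1, φ v.2) := by
  obtain ⟨p, r, hp⟩ := hF
  have hpos := radius_subst_pos B p (hp.r_pos.trans_le hp.r_le)
  have hG := (p.subst B).hasFPowerSeriesOnBall hpos
  have hcontr : ∀ {B' : Type} [NormedCommRing B'] [NormedAlgebra ℝ B'] (φ : B →ₐ[ℝ] B'),
      (∀ b, ‖φ b‖ ≤ ‖b‖) → ∀ (v : B × B) {s : ENNReal}, v ∈ Metric.eball (0 : B × B) s →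
      ((φ v.1, φ v.2) : B' × B') ∈ Metric.eball (0 : B' × B') s := by
    intro B' _ _ φ hφ v s hv
    rw [Metric.mem_eball, edist_dist, dist_zero_right] at hv ⊢
    refine lt_of_le_of_lt (ENNReal.ofReal_le_ofReal ?_) hv
    exact max_le_max (hφ _) (hφ _)
  refine ⟨(p.subst B).sum, hG.analyticAt, ?_, ?_, ?_, ?_⟩
  · intro h0
    have hp0 : p 0 = 0 := by
      ext v
      rw [hp.coeff_zero v, h0]; rfl
    have hs0 : p.subst B 0 = 0 := Finset.sum_eq_zero fun σ _ => by
      rw [hp0, _root_.zero_apply]; ext; simp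
    rw [← hG.coeff_zero fun _ => 0, hs0]; rfl
  · intro h1
    have hp1 : p 1 = 0 := by
      have := hp.hasFPowerSeriesAt.hasFDerivAt.unique h1
      exact (LinearIsometryEquiv.map_eq_zero_iff _).1 this
    have hs1 : p.subst B 1 = 0 := Finset.sum_eq_zero fun σ _ => by
      rw [hp1, _root_.zero_apply]; ext; simp
    have := hG.hasFPowerSeriesAt.hasFDerivAt
    rwa [hs1, map_zero] at this
  · have hU : Metric.eball (0 : B × B) (min r (p.subst B).radius) ∈ 𝓝 0 :=
      Metric.eball_mem_nhds _ (lt_min hp.r_pos hpos)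
    filter_upwards [hU] with v hv φ hφ
    have e1 := hG.hasSum (y := v) (Metric.eball_subset_eball (min_le_right _ _) hv)
    have e2 := hp.hasSum (y := (φ v.1, φ v.2))
      (Metric.eball_subset_eball (min_le_left _ _) (hcontr φ hφ v hv))
    rw [zero_add] at e1 e2
    let φL : B →L[ℝ] ℝ := φ.toLinearMap.mkContinuous 1 fun b => by rw [one_mul]; exact hφ b
    have e3 := φL.hasSum e1
    refine e3.unique (e2.congr_fun fun n => ?_)
    change φ _ = _
    rw [subst_map, subst_real]
  · have hU : Metric.eball (0 : B × B) (p.subst B).radius ∈ 𝓝 0 := Metric.eball_mem_nhds _ hpos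
    filter_upwards [hU] with v hv φ hφ
    have e1 := hG.hasSum (y := v) hv
    have e2 := hG.hasSum (y := (φ v.1, φ v.2)) (hcontr φ hφ v hv)
    rw [zero_add] at e1 e2
    let φL : B →L[ℝ] B := φ.toLinearMap.mkContinuous 1 fun b => by rw [one_mul]; exact hφ b
    have e3 := φL.hasSum e1
    refine e3.unique (e2.congr_fun fun n => ?_)
    change φ _ = _
    rw [subst_map]

/-! ### Implicit functions of a real variable -/

theorem AnalyticAt.exists_implicit_real {E : Type*} [NormedAddCommGroup E] [NormedSpace ℝ E]
    [CompleteSpace E] {f : E × ℝ → ℝ} {a : E} {b d : ℝ} (hf : AnalyticAt ℝ f (a, b))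
    (h0 : f (a, b) = 0) (hd : HasDerivAt (fun y => f (a, y)) d b) (hd0 : d ≠ 0) :
    ∃ ψ : E → ℝ, AnalyticAt ℝ ψ a ∧ ψ a = b ∧ (∀ᶠ x in 𝓝 a, f (x, ψ x) = 0) ∧
      ∀ᶠ v in 𝓝 (a, b), f v = 0 ↔ ψ v.1 = v.2 := by
  have cdf : ContDiffAt ℝ ω f (a, b) := hf.contDiffAt
  have hinr : HasDerivAt (fun y => f (a, y)) ((fderiv ℝ f (a, b)) (0, 1)) b := by
    have h1 : HasDerivAt (fun y : ℝ => (a, y)) ((0 : E), (1 : ℝ)) b :=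
      (hasDerivAt_const b a).prodMk (hasDerivAt_id b)
    exact hf.differentiableAt.hasFDerivAt.comp_hasDerivAt b h1
  have hdd := hinr.unique hd
  have if₂ : (fderiv ℝ f (a, b) ∘L .inr ℝ E ℝ).IsInvertible := by
    refine ⟨ContinuousLinearEquiv.unitsEquivAut ℝ (Units.mk0 d hd0), ?_⟩
    ext
    simp [hdd]
  refine ⟨cdf.implicitFunction (by simp) if₂, ?_, cdf.implicitFunction_apply_self _ _, ?_, ?_⟩
  · exact (cdf.contDiffAt_implicitFunction (by simp) if₂).analyticAt
  · simpa [h0] using cdf.eventually_apply_implicitFunction (by simp) if₂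
  · simpa [h0] using cdf.eventually_apply_eq_iff_implicitFunction (by simp) if₂

/-! ### Multipliers of the linearized orbit equation: absence of small divisors. -/

namespace BiSeries

instance : NormOneClass BiSeries := ⟨by rw [← mono_zero, norm_mono]⟩

/-- The absolute value of the weight `i.1 - i.2` of a monomial. -/
def wt (i : ℕ × ℕ) : ℕ := (i.1 - i.2) + (i.2 - i.1)

theorem wt_swap (i : ℕ × ℕ) : wt i.swap = wt i := Nat.add_comm _ _

/-- The projection onto the nonresonant monomials. -/
noncomputable def off : Mult := ind fun i => wt i ≠ 1

/-- The linearized operator on nonresonant monomials, multiplied by `δ ^ wt`. -/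
noncomputable def symb (l δ : ℝ) : Mult :=
  1 + geo wt δ * geo wt δ - (l + l⁻¹) • geo wt δ

/-- The symbol vanishes at δ = l on the resonant weights |i₁ − i₂| = 1. There it is replaced by 1,
so that the result is invertible among bounded multipliers. -/
noncomputable def den (l δ : ℝ) : Mult := off * symb l δ + ind fun i => wt i = 1

noncomputable def core (l δ : ℝ) : Mult := Ring.inverse (den l δ) * off

/-- The substitution (ξ, η) ↦ (δξ, η/δ) multiplies a monomial by δ^(i₁ − i₂), which is unbounded
over all monomials. With w = |i₁ − i₂|, the solution operator is δ^w / `symb`, so three consecutive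
terms carry the exponents w, 2(i₁ − i₂)⁺ and 2(i₂ − i₁)⁺. All are nonnegative, and truncated
subtraction expresses the positive parts. -/
noncomputable def mulZ (l δ : ℝ) : Mult := core l δ * geo wt δ
noncomputable def mulP (l δ : ℝ) : Mult := core l δ * geo (fun i => 2 * (i.1 - i.2)) δ
noncomputable def mulM (l δ : ℝ) : Mult := core l δ * geo (fun i => 2 * (i.2 - i.1)) δ

theorem mult_ext {μ ν : Mult} (h : ∀ i, μ i = ν i) : μ = ν := lp.ext (funext h)

theorem mult_mul (μ ν : Mult) (i : ℕ × ℕ) : (μ * ν) i = μ i * ν i := by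
  rw [lp.infty_coeFn_mul]; rfl

theorem mult_one (i : ℕ × ℕ) : (1 : Mult) i = 1 := by rw [lp.infty_coeFn_one]; rfl

theorem mult_add (μ ν : Mult) (i : ℕ × ℕ) : (μ + ν) i = μ i + ν i := by
  rw [lp.coeFn_add]; rfl

theorem mult_sub (μ ν : Mult) (i : ℕ × ℕ) : (μ - ν) i = μ i - ν i := by
  rw [lp.coeFn_sub]; rfl

theorem mult_smul (r : ℝ) (μ : Mult) (i : ℕ × ℕ) : (r • μ) i = r * μ i := by
  rw [lp.coeFn_smul]; rfl

theorem off_mul_off : off * off = off :=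
  mult_ext fun i => by rw [mult_mul, off, ind_apply]; split_ifs <;> simp

theorem res_mul_off : (ind fun i => wt i = 1) * off = 0 :=
  mult_ext fun i => by
    rw [mult_mul, off, ind_apply, ind_apply, lp.coeFn_zero]; split_ifs <;> simp_all

theorem core_mul_symb {l δ : ℝ} (h : IsUnit (den l δ)) : core l δ * symb l δ = off := by
  have h1 : den l δ * off = off * symb l δ := by
    rw [den, add_mul, res_mul_off, add_zero, mul_right_comm, off_mul_off]
  rw [core, mul_assoc, ← h1, ← mul_assoc, Ring.inverse_mul_cancel _ h, one_mul]

theorem symb_apply (l : ℝ) {δ : ℝ} (h : |δ| < 1) (i : ℕ × ℕ) :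
    symb l δ i = 1 + δ ^ wt i * δ ^ wt i - (l + l⁻¹) * δ ^ wt i := by
  simp only [symb, mult_sub, mult_add, mult_mul, mult_smul, mult_one, geo_apply _ h]

theorem mulP_add_mulM {l δ : ℝ} (hδ : |δ| < 1) (h : IsUnit (den l δ)) :
    mulP l δ + mulM l δ - (l + l⁻¹) • mulZ l δ = off := by
  rw [← core_mul_symb h]
  have : geo (fun i => 2 * (i.1 - i.2)) δ + geo (fun i => 2 * (i.2 - i.1)) δ
      - (l + l⁻¹) • geo wt δ = symb l δ := mult_ext fun i => by
    rw [symb_apply l hδ, mult_sub, mult_add, mult_smul, geo_apply _ hδ, geo_apply _ hδ,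
      geo_apply _ hδ, wt, ← pow_add]
    rcases le_total i.1 i.2 with h | h
    · rw [Nat.sub_eq_zero_of_le h, mul_zero, zero_add, pow_zero, two_mul]
    · rw [Nat.sub_eq_zero_of_le h, mul_zero, add_zero, pow_zero, two_mul]; ring
  rw [mulP, mulM, mulZ, ← this, mul_sub, mul_add, mul_smul_comm]

/-- For weight w ≥ 2 the symbol factors as (1 − l^(w−1))(1 − l^(w+1)), and for w = 0 it is −(1 −
l)²/l. Hyperbolicity thus gives a uniform lower bound: there are no small divisors. -/
theorem one_sub_sq_le_symb {l : ℝ} (h0 : 0 < l) (h1 : l < 1) {i : ℕ × ℕ} (hi : wt i ≠ 1) :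
    (1 - l) ^ 2 ≤ |symb l l i| := by
  rw [symb_apply l (by rwa [abs_of_pos h0])]
  generalize wt i = n at hi
  rcases n with _ | _ | n
  · have : 1 + l ^ 0 * l ^ 0 - (l + l⁻¹) * l ^ 0 = -((1 - l) ^ 2 / l) := by
      field_simp; ring
    rw [this, abs_neg, abs_of_nonneg (by positivity)]
    rw [le_div_iff₀ h0]
    nlinarith [sq_nonneg (1 - l)]
  · exact absurd rfl hi
  · have e : 1 + l ^ (n + 1 + 1) * l ^ (n + 1 + 1) - (l + l⁻¹) * l ^ (n + 1 + 1)
        = (1 - l ^ (n + 1)) * (1 - l ^ (n + 3)) := by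
      field_simp; ring
    have a1 : l ^ (n + 1) ≤ l := by
      simpa using pow_le_pow_of_le_one h0.le h1.le (Nat.le_add_left 1 n)
    have a2 : l ^ (n + 3) ≤ l := by
      simpa using pow_le_pow_of_le_one h0.le h1.le (show 1 ≤ n + 3 by omega)
    rw [e, abs_of_nonneg (mul_nonneg (by linarith) (by linarith)), sq]
    exact mul_le_mul (by linarith) (by linarith) (by linarith) (by linarith)

theorem isUnit_den {l : ℝ} (h0 : 0 < l) (h1 : l < 1) : IsUnit (den l l) := by
  have hlow : ∀ i, (1 - l) ^ 2 ≤ |den l l i| := fun i => by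
    rw [den, mult_add, mult_mul, off, ind_apply, ind_apply]
    by_cases hi : wt i = 1
    · simp [hi]
      rw [abs_of_pos (sub_pos.2 h1)]; linarith
    · simpa [hi] using one_sub_sq_le_symb h0 h1 hi
  have hpos : 0 < (1 - l) ^ 2 := by have := sub_pos.2 h1; positivity
  have hmem : Memℓp (fun i => (den l l i)⁻¹) ⊤ := memℓp_infty ⟨((1 - l) ^ 2)⁻¹, by
    rintro _ ⟨i, rfl⟩
    dsimp only
    rw [norm_inv]
    exact inv_anti₀ hpos (hlow i)⟩
  refine IsUnit.of_mul_eq_one (⟨_, hmem⟩ : Mult) (mult_ext fun i => ?_)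
  rw [mult_mul, mult_one]
  refine mul_inv_cancel₀ fun h => ?_
  have := hlow i
  rw [h, abs_zero] at this
  linarith

theorem analyticAt_den (l : ℝ) {δ : ℝ} (h : |δ| < 1) : AnalyticAt ℝ (den l) δ := by
  have := analyticAt_geo wt h
  unfold den symb
  fun_prop

theorem analyticAt_core {l δ : ℝ} (h : |δ| < 1) (hu : IsUnit (den l δ)) :
    AnalyticAt ℝ (core l) δ := by
  obtain ⟨u, hu⟩ := hu
  have h1 : AnalyticAt ℝ (Ring.inverse : Mult → Mult) (den l δ) := hu ▸ analyticAt_inverse u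
  exact (h1.comp (analyticAt_den l h)).mul analyticAt_const

theorem analyticAt_mulZ {l δ : ℝ} (h : |δ| < 1) (hu : IsUnit (den l δ)) :
    AnalyticAt ℝ (mulZ l) δ := (analyticAt_core h hu).mul (analyticAt_geo _ h)
theorem analyticAt_mulP {l δ : ℝ} (h : |δ| < 1) (hu : IsUnit (den l δ)) :
    AnalyticAt ℝ (mulP l) δ := (analyticAt_core h hu).mul (analyticAt_geo _ h)
theorem analyticAt_mulM {l δ : ℝ} (h : |δ| < 1) (hu : IsUnit (den l δ)) :
    AnalyticAt ℝ (mulM l) δ := (analyticAt_core h hu).mul (analyticAt_geo _ h)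

theorem eventually_isUnit_den {l : ℝ} (h0 : 0 < l) (h1 : l < 1) :
    ∀ᶠ δ in 𝓝 l, IsUnit (den l δ) :=
  (analyticAt_den l (by rwa [abs_of_pos h0])).continuousAt.eventually
    (Units.isOpen.mem_nhds (isUnit_den h0 h1))

/-! #### Point evaluations -/

/-- The character of evaluation at a point of the open unit bidisc. -/
noncomputable def chi (x : ℝ × ℝ) : Mult := geo Prod.fst x.1 * geo Prod.snd x.2

/-- The open unit bidisc. -/
def bidisc : Set (ℝ × ℝ) := {x | |x.1| < 1 ∧ |x.2| < 1}

theorem isOpen_bidisc : IsOpen bidisc :=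
  (isOpen_lt continuous_fst.abs continuous_const).inter
    (isOpen_lt continuous_snd.abs continuous_const)

theorem zero_mem_bidisc : (0 : ℝ × ℝ) ∈ bidisc := by simp [bidisc]

theorem chi_apply {x : ℝ × ℝ} (hx : x ∈ bidisc) (i : ℕ × ℕ) :
    chi x i = x.1 ^ i.1 * x.2 ^ i.2 := by
  rw [chi, mult_mul, geo_apply _ hx.1, geo_apply _ hx.2]

theorem norm_chi_le {x : ℝ × ℝ} (hx : x ∈ bidisc) : ‖chi x‖ ≤ 1 :=
  lp.norm_le_of_forall_le zero_le_one fun i => by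
    rw [chi_apply hx, norm_mul, norm_pow, norm_pow]
    exact mul_le_one₀ (pow_le_one₀ (norm_nonneg _) hx.1.le) (by positivity)
      (pow_le_one₀ (norm_nonneg _) hx.2.le)

theorem analyticAt_chi {x : ℝ × ℝ} (hx : x ∈ bidisc) : AnalyticAt ℝ chi x :=
  ((analyticAt_geo _ hx.1).fun_comp analyticAt_fst).mul
    ((analyticAt_geo _ hx.2).fun_comp analyticAt_snd)

/-- Evaluation as a character. -/
noncomputable def evHom {x : ℝ × ℝ} (hx : x ∈ bidisc) : BiSeries →ₐ[ℝ] ℝ :=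
  AlgHom.ofLinearMap (ev (chi x)).toLinearMap
    (ev_one (by rw [chi_apply hx]; simp))
    (ev_mul fun i j => by
      rw [chi_apply hx, chi_apply hx, chi_apply hx, Prod.fst_add, Prod.snd_add]; ring)

theorem evHom_apply {x : ℝ × ℝ} (hx : x ∈ bidisc) (a : BiSeries) : evHom hx a = ev (chi x) a := rfl

noncomputable def swpHom : BiSeries →ₐ[ℝ] BiSeries :=
  AlgHom.ofLinearMap swp.toLinearMap swp_one swp_mul

theorem norm_swp_apply_le (a : BiSeries) : ‖swp a‖ ≤ ‖a‖ :=
  (swp.le_opNorm a).trans (mul_le_of_le_one_left (norm_nonneg _) norm_swp_le)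

theorem chi_swap {x : ℝ × ℝ} (hx : x ∈ bidisc) (i : ℕ × ℕ) : chi x.swap i.swap = chi x i := by
  rw [chi_apply hx, chi_apply (x := x.swap) ⟨hx.2, hx.1⟩]; exact mul_comm _ _

theorem hasDerivAt_geo (f : ℕ × ℕ → ℕ) : HasDerivAt (geo f) (ind fun i => f i = 1) 0 := by
  have h := (geoSeries f).hasFPowerSeriesOnBall
    (zero_lt_one.trans_le (one_le_radius_geoSeries f))
  refine h.hasFPowerSeriesAt.hasDerivAt.congr_deriv ?_
  simp [geoSeries]

theorem hasFDerivAt_chi : HasFDerivAt chi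
    ((ContinuousLinearMap.fst ℝ ℝ ℝ).smulRight (ind fun i => i = (1, 0)) +
      (ContinuousLinearMap.snd ℝ ℝ ℝ).smulRight (ind fun i => i = (0, 1))) 0 := by
  have h1 : HasFDerivAt (fun x : ℝ × ℝ => geo Prod.fst x.1) _ 0 :=
    (hasDerivAt_geo Prod.fst).hasFDerivAt.comp (0 : ℝ × ℝ) hasFDerivAt_fst
  have h2 : HasFDerivAt (fun x : ℝ × ℝ => geo Prod.snd x.2) _ 0 :=
    (hasDerivAt_geo Prod.snd).hasFDerivAt.comp (0 : ℝ × ℝ) hasFDerivAt_snd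
  refine (h1.mul h2).congr_fderiv ?_
  refine ContinuousLinearMap.ext fun v => mult_ext fun i => ?_
  simp only [_root_.add_apply, ContinuousLinearMap.comp_apply, _root_.smul_apply,
    ContinuousLinearMap.smulRight_apply, ContinuousLinearMap.coe_fst', ContinuousLinearMap.coe_snd',
    ContinuousLinearMap.toSpanSingleton_apply, smul_eq_mul, mult_add, mult_mul, mult_smul,
    ind_apply, Prod.fst_zero, Prod.snd_zero,
    geo_apply (x := 0) _ (by simp)]
  obtain ⟨k, l⟩ := i
  rcases k with _ | _ | k <;> rcases l with _ | _ | l <;> simp [Prod.ext_iff]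

end BiSeries

namespace BiSeries

/-! ### The nonresonant part of the orbit equation -/

theorem den_swap (l : ℝ) {δ : ℝ} (h : |δ| < 1) (i : ℕ × ℕ) : den l δ i.swap = den l δ i := by
  simp only [den, mult_add, mult_mul, off, ind_apply, wt_swap, symb_apply l h]

theorem core_swap {l δ : ℝ} (h : |δ| < 1) (hu : IsUnit (den l δ)) (i : ℕ × ℕ) :
    core l δ i.swap = core l δ i := by
  have key : ∀ i, (Ring.inverse (den l δ) : Mult) i = (den l δ i)⁻¹ := fun i => by
    have := congrArg (fun μ : Mult => μ i) (Ring.inverse_mul_cancel _ hu)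
    simp only [mult_mul, mult_one] at this
    exact eq_inv_of_mul_eq_one_left this
  rw [core, mult_mul, mult_mul, key, key, den_swap l h, off, ind_apply, ind_apply, wt_swap]

/-- Three consecutive terms of an orbit, as power series, in terms of the amplitude `q.1`, the
multiplier `q.2` and the nonresonant source term `v`. -/
noncomputable def orbZ (l : ℝ) (q : ℝ × ℝ) (v : BiSeries) : BiSeries :=
  q.1 • (mono (1, 0) + mono (0, 1)) + diag (mulZ l q.2) v
noncomputable def orbP (l : ℝ) (q : ℝ × ℝ) (v : BiSeries) : BiSeries :=
  q.1 • (q.2 • mono (1, 0) + q.2⁻¹ • mono (0, 1)) + diag (mulP l q.2) v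
noncomputable def orbM (l : ℝ) (q : ℝ × ℝ) (v : BiSeries) : BiSeries :=
  q.1 • (q.2⁻¹ • mono (1, 0) + q.2 • mono (0, 1)) + diag (mulM l q.2) v

/-- The nonlinear part of the orbit equation. -/
noncomputable def resid (G : BiSeries × BiSeries → BiSeries) (l : ℝ) (q : ℝ × ℝ) (v : BiSeries) :
    BiSeries :=
  G (orbZ l q v, orbM l q v) + G (orbZ l q v, orbP l q v)

theorem analyticAt_diag {E : Type*} [NormedAddCommGroup E] [NormedSpace ℝ E] {μ : E → Mult}
    {v : E → BiSeries} {x : E} (hμ : AnalyticAt ℝ μ x) (hv : AnalyticAt ℝ v x) :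
    AnalyticAt ℝ (fun x => diag (μ x) (v x)) x :=
  (diag.analyticAt_bilinear (μ x, v x)).comp₂ hμ hv

theorem analyticAt_ev {E : Type*} [NormedAddCommGroup E] [NormedSpace ℝ E] {μ : E → Mult}
    {v : E → BiSeries} {x : E} (hμ : AnalyticAt ℝ μ x) (hv : AnalyticAt ℝ v x) :
    AnalyticAt ℝ (fun x => ev (μ x) (v x)) x :=
  (tot.analyticAt _).fun_comp (analyticAt_diag hμ hv)

section
variable {E : Type*} [NormedAddCommGroup E] [NormedSpace ℝ E] {l : ℝ} {q : E → ℝ × ℝ}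
    {v : E → BiSeries} {x : E}

theorem analyticAt_orb (h0 : (q x).2 ≠ 0) (h1 : |(q x).2| < 1) (hu : IsUnit (den l (q x).2))
    (hq : AnalyticAt ℝ q x) (hv : AnalyticAt ℝ v x) :
    AnalyticAt ℝ (fun x => orbZ l (q x) (v x)) x ∧ AnalyticAt ℝ (fun x => orbP l (q x) (v x)) x ∧
      AnalyticAt ℝ (fun x => orbM l (q x) (v x)) x := by
  have a1 : AnalyticAt ℝ (fun x => (q x).1) x := analyticAt_fst.fun_comp hq
  have a2 : AnalyticAt ℝ (fun x => (q x).2) x := analyticAt_snd.fun_comp hq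
  have a3 : AnalyticAt ℝ (fun x => ((q x).2)⁻¹) x := a2.inv h0
  refine ⟨?_, ?_, ?_⟩
  · exact (a1.smul analyticAt_const).add
      (analyticAt_diag (AnalyticAt.fun_comp (f := fun x => (q x).2)
        (analyticAt_mulZ h1 hu) a2) hv)
  · exact (a1.smul ((a2.smul analyticAt_const).add (a3.smul analyticAt_const))).add
      (analyticAt_diag (AnalyticAt.fun_comp (f := fun x => (q x).2)
        (analyticAt_mulP h1 hu) a2) hv)
  · exact (a1.smul ((a3.smul analyticAt_const).add (a2.smul analyticAt_const))).add
      (analyticAt_diag (AnalyticAt.fun_comp (f := fun x => (q x).2)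
        (analyticAt_mulM h1 hu) a2) hv)

end

/-- Exchanging ξ and η is time reversal: the middle term is kept and its two neighbours are
interchanged. -/
theorem swp_orb {l : ℝ} {q : ℝ × ℝ} (h1 : |q.2| < 1) (hu : IsUnit (den l q.2)) (v : BiSeries) :
    swp (orbZ l q v) = orbZ l q (swp v) ∧ swp (orbP l q v) = orbM l q (swp v) ∧
      swp (orbM l q v) = orbP l q (swp v) := by
  have e1 := swp_diag (mulZ l q.2) (mulZ l q.2) (fun i => by
    rw [mulZ, mult_mul, mult_mul, core_swap h1 hu, geo_apply _ h1, geo_apply _ h1, wt_swap]) v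
  have e2 := swp_diag (mulP l q.2) (mulM l q.2) (fun i => by
    rw [mulP, mulM, mult_mul, mult_mul, core_swap h1 hu, geo_apply _ h1, geo_apply _ h1]; rfl) v
  have e3 := swp_diag (mulM l q.2) (mulP l q.2) (fun i => by
    rw [mulP, mulM, mult_mul, mult_mul, core_swap h1 hu, geo_apply _ h1, geo_apply _ h1]; rfl) v
  simp only [orbZ, orbP, orbM, map_add, map_smul, swp_mono, Prod.swap_prod_mk, e1, e2, e3]
  refine ⟨?_, ?_, ?_⟩
  · rw [add_comm (mono (0, 1))]
  · rw [add_comm (q.2 • mono (0, 1))]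
  · rw [add_comm (q.2⁻¹ • mono (0, 1))]

theorem orb_zero {l : ℝ} (δ : ℝ) : orbZ l (0, δ) 0 = 0 ∧ orbP l (0, δ) 0 = 0 ∧
    orbM l (0, δ) 0 = 0 := by simp [orbZ, orbP, orbM]

/-- At the origin only the constant coefficient survives, and on it all powers of δ have exponent
zero, so the three multipliers agree. -/
theorem ev_chi_zero_mul {l : ℝ} {q : ℝ × ℝ} (h1 : |q.2| < 1) (v : BiSeries) :
    ev (chi 0) (orbZ l q v) = core l q.2 0 * ev (chi 0) v ∧
    ev (chi 0) (orbP l q v) = core l q.2 0 * ev (chi 0) v ∧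
    ev (chi 0) (orbM l q v) = core l q.2 0 * ev (chi 0) v := by
  have key : ∀ f : ℕ × ℕ → ℕ, f 0 = 0 →
      ev (chi 0) (diag (core l q.2 * geo f q.2) v) = core l q.2 0 * ev (chi 0) v := by
    intro f hf
    have : (ev (chi 0)).comp (diag (core l q.2 * geo f q.2)) = (core l q.2 0) • ev (chi 0) :=
      clm_ext fun i => by
        simp only [ContinuousLinearMap.comp_apply, _root_.smul_apply, diag_mono, map_smul, ev_mono,
          smul_eq_mul, mult_mul, geo_apply _ h1, chi_apply zero_mem_bidisc]
        by_cases hi : i = 0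
        · subst hi; simp [hf]
        · have : ((0 : ℝ × ℝ).1 ^ i.1 * (0 : ℝ × ℝ).2 ^ i.2 : ℝ) = 0 := by
            obtain ⟨k, m⟩ := i
            rcases k with _ | k
            · rcases m with _ | m
              · exact absurd rfl hi
              · simp
            · simp
          rw [this]; simp
    exact DFunLike.congr_fun this v
  have m0 : ev (chi 0) (mono (1, 0)) = 0 ∧ ev (chi 0) (mono (0, 1)) = 0 := by
    simp [ev_mono, chi_apply zero_mem_bidisc]
  simp only [orbZ, orbP, orbM, map_add, map_smul, m0.1, m0.2, smul_zero, add_zero, zero_add]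
  exact ⟨key _ rfl, key _ rfl, key _ rfl⟩

theorem ev_chi_zero_off (a : BiSeries) : ev (chi 0) (diag off a) = ev (chi 0) a := by
  have : (ev (chi 0)).comp (diag off) = ev (chi 0) := clm_ext fun i => by
    simp only [ContinuousLinearMap.comp_apply, diag_mono, map_smul, ev_mono, smul_eq_mul,
      chi_apply zero_mem_bidisc, off, ind_apply]
    obtain ⟨k, m⟩ := i
    rcases k with _ | k <;> rcases m with _ | m <;> simp [wt]
  exact DFunLike.congr_fun this a

set_option maxHeartbeats 1000000 in
/-- The solution of the nonresonant part of the orbit equation. -/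
theorem exists_nonresonant {g : ℝ × ℝ → ℝ} (hg : AnalyticAt ℝ g 0) (g0 : g 0 = 0)
    (hg' : HasFDerivAt g (0 : ℝ × ℝ →L[ℝ] ℝ) 0) {l : ℝ} (h0 : 0 < l) (h1 : l < 1) :
    ∃ (G : BiSeries × BiSeries → BiSeries) (V : ℝ × ℝ → BiSeries), AnalyticAt ℝ V (0, l) ∧
      ∀ᶠ q in 𝓝 ((0 : ℝ), l), V q = diag off (resid G l q (V q)) ∧
        swp (resid G l q (V q)) = resid G l q (V q) ∧
        (∀ x ∈ bidisc, ev (chi x) (resid G l q (V q)) =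
          g (ev (chi x) (orbZ l q (V q)), ev (chi x) (orbM l q (V q))) +
          g (ev (chi x) (orbZ l q (V q)), ev (chi x) (orbP l q (V q)))) ∧
        ev (chi 0) (V q) = 0 ∧
        AnalyticAt ℝ (fun q => resid G l q (V q)) q := by
  obtain ⟨G, hGa, hG0, hG', hGev, hGsw⟩ := hg.exists_functional_calculus BiSeries
  replace hG0 := hG0 g0
  replace hG' := hG' hg'
  have hl : |l| < 1 := by rwa [abs_of_pos h0]
  have hul := isUnit_den h0 h1
  set base : (ℝ × ℝ) × BiSeries := ((0, l), 0)
  have ho := analyticAt_orb (q := fun u : (ℝ × ℝ) × BiSeries => u.1) (v := fun u => u.2)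
    (x := base) h0.ne' hl hul analyticAt_fst analyticAt_snd
  obtain ⟨oz, op, om⟩ := ho
  obtain ⟨z1, z2, z3⟩ := orb_zero (l := l) l
  have pzm := oz.prod om
  have pzp := oz.prod op
  have vzm : ((orbZ l base.1 base.2, orbM l base.1 base.2) : BiSeries × BiSeries) = 0 := by
    rw [z1, z3]; rfl
  have vzp : ((orbZ l base.1 base.2, orbP l base.1 base.2) : BiSeries × BiSeries) = 0 := by
    rw [z1, z2]; rfl
  have ra : AnalyticAt ℝ (fun u : (ℝ × ℝ) × BiSeries => resid G l u.1 u.2) base :=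
    (AnalyticAt.fun_comp_of_eq hGa pzm vzm).add (AnalyticAt.fun_comp_of_eq hGa pzp vzp)
  have rd : HasFDerivAt (fun u : (ℝ × ℝ) × BiSeries => resid G l u.1 u.2)
      (0 : (ℝ × ℝ) × BiSeries →L[ℝ] BiSeries) base := by
    have d1 : HasFDerivAt G (0 : BiSeries × BiSeries →L[ℝ] BiSeries)
      (orbZ l base.1 base.2, orbM l base.1 base.2) := by rw [vzm]; exact hG'
    have d2 : HasFDerivAt G (0 : BiSeries × BiSeries →L[ℝ] BiSeries)
      (orbZ l base.1 base.2, orbP l base.1 base.2) := by rw [vzp]; exact hG'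
    have e1 := d1.comp base pzm.differentiableAt.hasFDerivAt
    have e2 := d2.comp base pzp.differentiableAt.hasFDerivAt
    exact (e1.add e2).congr_fderiv (by simp)
  have r0 : resid G l base.1 base.2 = 0 := by
    rw [resid, vzm, vzp, hG0, add_zero]
  set Φ : (ℝ × ℝ) × BiSeries → BiSeries := fun u => u.2 - diag off (resid G l u.1 u.2)
  have Φa : AnalyticAt ℝ Φ base := analyticAt_snd.sub (((diag off).analyticAt _).fun_comp ra)
  have Φ0 : Φ base = 0 := by
    change base.2 - diag off (resid G l base.1 base.2) = 0
    rw [r0, map_zero, sub_zero]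
  -- The residual vanishes to second order, so the derivative of Φ in the unknown series is the
  -- identity and nothing has to be inverted.
  have Φd : HasFDerivAt Φ (ContinuousLinearMap.snd ℝ (ℝ × ℝ) BiSeries) base := by
    exact ((hasFDerivAt_snd (𝕜 := ℝ) (p := base)).sub
      ((diag off).hasFDerivAt.comp base rd)).congr_fderiv (by simp)
  have if₂ : (fderiv ℝ Φ base ∘L .inr ℝ (ℝ × ℝ) BiSeries).IsInvertible := by
    rw [Φd.fderiv]
    refine ⟨ContinuousLinearEquiv.refl ℝ BiSeries, ?_⟩
    ext; simp
  have cdf : ContDiffAt ℝ ω Φ base := Φa.contDiffAt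
  set V := cdf.implicitFunction (by simp) if₂
  have Va : AnalyticAt ℝ V (0, l) :=
    (cdf.contDiffAt_implicitFunction (by simp) if₂).analyticAt
  have V0 : V (0, l) = 0 := cdf.implicitFunction_apply_self (by simp) if₂
  have Veq : ∀ᶠ q in 𝓝 ((0 : ℝ), l), Φ (q, V q) = 0 := by
    simpa [Φ0] using cdf.eventually_apply_implicitFunction (by simp) if₂
  have Vun : ∀ᶠ u in 𝓝 base, Φ u = 0 ↔ V u.1 = u.2 := by
    simpa [Φ0] using cdf.eventually_apply_eq_iff_implicitFunction (by simp) if₂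
  have Vt : Tendsto (fun q => (q, V q)) (𝓝 ((0 : ℝ), l)) (𝓝 base) := by
    have : ContinuousAt (fun q => (q, V q)) ((0 : ℝ), l) := continuousAt_id.prodMk Va.continuousAt
    simpa only [ContinuousAt, V0] using this
  have Vst : Tendsto (fun q => (q, swp (V q))) (𝓝 ((0 : ℝ), l)) (𝓝 base) := by
    have : ContinuousAt (fun q => (q, swp (V q))) ((0 : ℝ), l) :=
      continuousAt_id.prodMk (swp.continuous.continuousAt.comp Va.continuousAt)
    simpa only [ContinuousAt, V0, map_zero] using this
  have tzm : Tendsto (fun q => (orbZ l q (V q), orbM l q (V q))) (𝓝 ((0 : ℝ), l)) (𝓝 0) := by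
    have := pzm.continuousAt.tendsto.comp Vt
    rwa [vzm] at this
  have tzp : Tendsto (fun q => (orbZ l q (V q), orbP l q (V q))) (𝓝 ((0 : ℝ), l)) (𝓝 0) := by
    have := pzp.continuousAt.tendsto.comp Vt
    rwa [vzp] at this
  have hsnd : Tendsto (fun q : ℝ × ℝ => q.2) (𝓝 ((0 : ℝ), l)) (𝓝 l) :=
    continuous_snd.continuousAt
  have hq1 : ∀ᶠ q in 𝓝 ((0 : ℝ), l), |q.2| < 1 :=
    hsnd.eventually ((continuous_abs.continuousAt).eventually (gt_mem_nhds hl))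
  have hqu : ∀ᶠ q in 𝓝 ((0 : ℝ), l), IsUnit (den l q.2) :=
    hsnd.eventually (eventually_isUnit_den h0 h1)
  have swr : ∀ᶠ q in 𝓝 ((0 : ℝ), l),
      swp (resid G l q (V q)) = resid G l q (swp (V q)) := by
    filter_upwards [hq1, hqu, tzm.eventually hGsw, tzp.eventually hGsw] with q a1 a2 a3 a4
    obtain ⟨s1, s2, s3⟩ := swp_orb a1 a2 (V q)
    have b3 : swp (G (orbZ l q (V q), orbM l q (V q))) =
        G (swp (orbZ l q (V q)), swp (orbM l q (V q))) := a3 swpHom norm_swp_apply_le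
    have b4 : swp (G (orbZ l q (V q), orbP l q (V q))) =
        G (swp (orbZ l q (V q)), swp (orbP l q (V q))) := a4 swpHom norm_swp_apply_le
    rw [resid, map_add, b3, b4, s1, s2, s3, add_comm, resid]
  have offsw : ∀ a, swp (diag off a) = diag off (swp a) := fun a =>
    swp_diag off off (fun i => by rw [off, ind_apply, ind_apply, wt_swap]) a
  -- The exchanged series solves the same equation, so local uniqueness of the implicit function
  -- makes the solution symmetric.
  have Vsw : ∀ᶠ q in 𝓝 ((0 : ℝ), l), swp (V q) = V q := by
    filter_upwards [Veq, Vst.eventually Vun, swr] with q a1 a2 a3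
    refine (a2.1 ?_).symm
    change swp (V q) - diag off (resid G l q (swp (V q))) = 0
    rw [← a3, ← offsw, ← map_sub]
    have : V q - diag off (resid G l q (V q)) = 0 := a1
    rw [this, map_zero]
  have hev : ∀ᶠ q in 𝓝 ((0 : ℝ), l), ∀ x ∈ bidisc, ev (chi x) (resid G l q (V q)) =
          g (ev (chi x) (orbZ l q (V q)), ev (chi x) (orbM l q (V q))) +
          g (ev (chi x) (orbZ l q (V q)), ev (chi x) (orbP l q (V q))) := by
    filter_upwards [tzm.eventually hGev, tzp.eventually hGev] with q a3 a4 x hx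
    rw [resid, map_add]
    congr 1
    · exact a3 (evHom hx) fun b => norm_ev_le _ (norm_chi_le hx) b
    · exact a4 (evHom hx) fun b => norm_ev_le _ (norm_chi_le hx) b
  have hVe : ∀ᶠ q in 𝓝 ((0 : ℝ), l), V q = diag off (resid G l q (V q)) := by
    filter_upwards [Veq] with q a
    exact sub_eq_zero.1 a
  -- The constant term t satisfies t = 2 g(ct, ct) with c bounded by C. Since g has zero derivative,
  -- ‖g y‖ ≤ ‖y‖/(4C) near 0, whence |t| ≤ |t|/2.
  have hzero : ∀ᶠ q in 𝓝 ((0 : ℝ), l), ev (chi 0) (V q) = 0 := by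
    have hc : ContinuousAt (fun q : ℝ × ℝ => core l q.2 0) (0, l) := by
      have e := ((analyticAt_core hl hul).continuousAt.comp_of_eq
        (continuous_snd.continuousAt (x := ((0 : ℝ), l))) rfl)
      exact (lp.evalCLM ℝ (fun _ : ℕ × ℕ => ℝ) ⊤ 0).continuous.continuousAt.comp e
    set C := |core l l 0| + 1
    have hCpos : 0 < C := by positivity
    have hcC : ∀ᶠ q in 𝓝 ((0 : ℝ), l), |core l q.2 0| < C :=
      hc.abs.eventually (gt_mem_nhds (lt_add_one _))
    have hsmall : ∀ᶠ y in 𝓝 (0 : ℝ × ℝ), ‖g y‖ ≤ (4 * C)⁻¹ * ‖y‖ := by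
      have := hg'.isLittleO.bound (show 0 < (4 * C)⁻¹ by positivity)
      simpa [g0] using this
    have ht : Tendsto (fun q => (core l q.2 0 * ev (chi 0) (V q), core l q.2 0 * ev (chi 0) (V q)))
        (𝓝 ((0 : ℝ), l)) (𝓝 (0 : ℝ × ℝ)) := by
      have e : Tendsto (fun q => core l q.2 0 * ev (chi 0) (V q)) (𝓝 ((0 : ℝ), l)) (𝓝 0) := by
        have : Tendsto (fun q => core l q.2 0 * ev (chi 0) (V q)) (𝓝 ((0 : ℝ), l))
            (𝓝 (core l l 0 * ev (chi 0) (V (0, l)))) :=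
          hc.mul ((ev (chi 0)).continuous.continuousAt.comp Va.continuousAt)
        rwa [V0, map_zero, mul_zero] at this
      exact e.prodMk_nhds e
    filter_upwards [hq1, hVe, hev, hcC, ht.eventually hsmall] with q a1 a2 a3 a4 a5
    obtain ⟨b1, b2, b3⟩ := ev_chi_zero_mul (l := l) a1 (V q)
    have e : ev (chi 0) (V q) = 2 * g (core l q.2 0 * ev (chi 0) (V q),
        core l q.2 0 * ev (chi 0) (V q)) := by
      conv_lhs => rw [a2, ev_chi_zero_off, a3 0 zero_mem_bidisc, b1, b2, b3]
      ring
    set t := ev (chi 0) (V q)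
    set c := core l q.2 0
    have : |t| ≤ 2 * ((4 * C)⁻¹ * (|c| * |t|)) := by
      conv_lhs => rw [e]
      rw [abs_mul, abs_two]
      refine mul_le_mul_of_nonneg_left (a5.trans_eq ?_) zero_le_two
      rw [Prod.norm_def, max_self, Real.norm_eq_abs, abs_mul]
    have h2 : |c| * |t| ≤ C * |t| := mul_le_mul_of_nonneg_right a4.le (abs_nonneg _)
    have h3 : 2 * ((4 * C)⁻¹ * (C * |t|)) = |t| / 2 := by field_simp; ring
    have h4 : 2 * ((4 * C)⁻¹ * (|c| * |t|)) ≤ |t| / 2 := by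
      rw [← h3]
      exact mul_le_mul_of_nonneg_left (mul_le_mul_of_nonneg_left h2 (by positivity)) zero_le_two
    have : |t| ≤ 0 := by linarith
    exact abs_nonpos_iff.1 this
  have hra : ∀ᶠ q in 𝓝 ((0 : ℝ), l), AnalyticAt ℝ (fun q => resid G l q (V q)) q := by
    filter_upwards [Vt.eventually ra.eventually_analyticAt, Va.eventually_analyticAt] with q b1 b2
    exact b1.comp₂ (h := fun u : (ℝ × ℝ) × BiSeries => resid G l u.1 u.2) analyticAt_id b2
  refine ⟨G, V, Va, ?_⟩
  filter_upwards [hVe, Vsw, swr, hev, hzero, hra] with q a1 a2 a3 a4 a5 a6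
  exact ⟨a1, by rw [a3, a2], a4, a5, a6⟩

end BiSeries

/-- The hyperbolic normal form `(ξ, η) ↦ (Δ(ξη) ξ, Δ(ξη)⁻¹ η)`. -/
noncomputable def hypMap (Δ : ℝ → ℝ) (x : ℝ × ℝ) : ℝ × ℝ :=
  (Δ (x.1 * x.2) * x.1, (Δ (x.1 * x.2))⁻¹ * x.2)

theorem hypMap_prod {Δ : ℝ → ℝ} {x : ℝ × ℝ} (h : Δ (x.1 * x.2) ≠ 0) :
    (hypMap Δ x).1 * (hypMap Δ x).2 = x.1 * x.2 := by
  simp only [hypMap]; field_simp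

theorem analyticAt_hypMap {Δ : ℝ → ℝ} {x : ℝ × ℝ} (hΔ : AnalyticAt ℝ Δ (x.1 * x.2))
    (h : Δ (x.1 * x.2) ≠ 0) : AnalyticAt ℝ (hypMap Δ) x := by
  have hz : AnalyticAt ℝ (fun x : ℝ × ℝ => x.1 * x.2) x := analyticAt_fst.mul analyticAt_snd
  have h1 : AnalyticAt ℝ (fun x : ℝ × ℝ => Δ (x.1 * x.2)) x :=
    AnalyticAt.fun_comp (f := fun x : ℝ × ℝ => x.1 * x.2) hΔ hz
  exact (h1.mul analyticAt_fst).prod ((h1.inv h).mul analyticAt_snd)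

theorem hypMap_zero (Δ : ℝ → ℝ) : hypMap Δ 0 = 0 := by simp [hypMap]

/-! ### Resonant monomials and the bifurcation equation for Δ. -/

namespace BiSeries

/-- The projections onto the two resonant families of monomials. -/
noncomputable def resP : Mult := ind fun i => i.1 = i.2 + 1
noncomputable def resM : Mult := ind fun i => i.2 = i.1 + 1

theorem off_add_res : off + resP + resM = 1 := mult_ext fun i => by
  rw [mult_add, mult_add, mult_one, off, resP, resM, ind_apply, ind_apply, ind_apply]
  by_cases a : i.1 = i.2 + 1
  · rw [if_neg (by simp only [wt]; omega), if_pos a, if_neg (by omega)]; simp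
  by_cases c : i.2 = i.1 + 1
  · rw [if_neg (by simp only [wt]; omega), if_neg a, if_pos c]; simp
  · rw [if_pos (by simp only [wt]; omega), if_neg a, if_neg c]; simp

/-- Each monomial ξ^(j+1) η^j is ξ times a power of ξη. The factor multiplying ξ can therefore be
read off at any point with the same product and nonzero first coordinate. -/
theorem ev_resP {x y : ℝ × ℝ} (hx : x ∈ bidisc) (hy : y ∈ bidisc) (h1 : y.1 ≠ 0)
    (h : y.1 * y.2 = x.1 * x.2) (a : BiSeries) :
    ev (chi x) (diag resP a) = x.1 * (y.1⁻¹ * ev (chi y) (diag resP a)) := by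
  have : (ev (chi x)).comp (diag resP) = (x.1 * y.1⁻¹) • (ev (chi y)).comp (diag resP) :=
    clm_ext fun i => by
      simp only [ContinuousLinearMap.comp_apply, _root_.smul_apply, diag_mono, map_smul, ev_mono,
        smul_eq_mul, resP, ind_apply, chi_apply hx, chi_apply hy]
      split_ifs with hi
      · rw [hi]
        have e : x.1 ^ (i.2 + 1) * x.2 ^ i.2 = x.1 * (x.1 * x.2) ^ i.2 := by ring
        have e' : y.1 ^ (i.2 + 1) * y.2 ^ i.2 = y.1 * (y.1 * y.2) ^ i.2 := by ring
        rw [e, e', h]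
        field_simp
      · ring
  rw [← mul_assoc]
  exact DFunLike.congr_fun this a

theorem ev_resM {x : ℝ × ℝ} (hx : x ∈ bidisc) (a : BiSeries) :
    ev (chi x) (diag resM a) = ev (chi x.swap) (diag resP (swp a)) := by
  rw [← ev_swp (chi x) (chi x.swap) (chi_swap hx), swp_diag resM resP fun i => ?_]
  rw [resP, resM, ind_apply, ind_apply]; rfl

/-- For fixed δ the three series are consecutive terms of one sequence: moving the point by (δξ,
η/δ) turns the middle series into the next one, and the previous one into the middle one. -/
theorem ev_shift {l δ : ℝ} {x : ℝ × ℝ} (hδ : |δ| < 1) (h0 : δ ≠ 0) (hx : x ∈ bidisc)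
    (hy : (δ * x.1, δ⁻¹ * x.2) ∈ bidisc) (e : ℝ) (v : BiSeries) :
    ev (chi (δ * x.1, δ⁻¹ * x.2)) (orbZ l (e, δ) v) = ev (chi x) (orbP l (e, δ) v) ∧
    ev (chi (δ * x.1, δ⁻¹ * x.2)) (orbM l (e, δ) v) = ev (chi x) (orbZ l (e, δ) v) := by
  have key : ∀ f f' : ℕ × ℕ → ℕ, (∀ i, i.1 + f i = i.2 + f' i) →
      chi (δ * x.1, δ⁻¹ * x.2) * (core l δ * geo f δ) = chi x * (core l δ * geo f' δ) :=
    fun f f' h => mult_ext fun i => by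
      simp only [mult_mul, chi_apply hx, chi_apply hy, geo_apply _ hδ]
      have : δ ^ i.1 * δ ^ f i = δ ^ i.2 * δ ^ f' i := by rw [← pow_add, ← pow_add, h]
      have h2 : δ⁻¹ ^ i.2 * δ ^ i.2 = 1 := by rw [← mul_pow, inv_mul_cancel₀ h0, one_pow]
      rw [mul_pow, mul_pow]
      linear_combination x.1 ^ i.1 * x.2 ^ i.2 * core l δ i * δ⁻¹ ^ i.2 * this +
        x.1 ^ i.1 * x.2 ^ i.2 * core l δ i * δ ^ f' i * h2
  have p1 : chi (δ * x.1, δ⁻¹ * x.2) * mulZ l δ = chi x * mulP l δ :=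
    key _ _ fun i => by simp only [wt]; omega
  have p2 : chi (δ * x.1, δ⁻¹ * x.2) * mulM l δ = chi x * mulZ l δ :=
    key _ _ fun i => by simp only [wt]; omega
  simp only [orbZ, orbP, orbM, map_add, map_smul, ev_diag, p1, p2, ev_mono, chi_apply hx,
    chi_apply hy, smul_eq_mul]
  constructor
  · simp
  · congr 1; field_simp

/-- The multipliers invert the linear operator on nonresonant monomials; on ξ + η the operator
leaves only the defect δ + δ⁻¹ − (l + l⁻¹). -/
theorem ev_orb_sum {l δ : ℝ} {x : ℝ × ℝ} (hδ : |δ| < 1) (hu : IsUnit (den l δ)) (hx : x ∈ bidisc)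
    (e : ℝ) (v : BiSeries) :
    ev (chi x) (orbP l (e, δ) v) + ev (chi x) (orbM l (e, δ) v)
      - (l + l⁻¹) * ev (chi x) (orbZ l (e, δ) v) =
    e * (δ + δ⁻¹ - (l + l⁻¹)) * (x.1 + x.2) + ev (chi x) (diag off v) := by
  rw [← mulP_add_mulM hδ hu]
  simp only [orbZ, orbP, orbM, map_add, map_sub, map_smul, ev_mono, chi_apply hx, smul_eq_mul,
    _root_.add_apply, _root_.sub_apply, _root_.smul_apply]
  simp
  ring

/-- The linear part of a nonresonant series vanishes. -/
theorem hasFDerivAt_ev_off {v : BiSeries} (h : v = diag off v) :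
    HasFDerivAt (fun x => ev (chi x) v) (0 : ℝ × ℝ →L[ℝ] ℝ) 0 := by
  have h1 := (tot.comp (diag.flip v)).hasFDerivAt.comp (0 : ℝ × ℝ) hasFDerivAt_chi
  refine h1.congr_fderiv ?_
  have key : ∀ j : ℕ × ℕ, wt j = 1 → tot (diag (ind fun i => i = j) v) = 0 := fun j hj => by
    rw [h, ← diag_mul]
    have : (ind fun i => i = j) * off = 0 := mult_ext fun i => by
      rw [mult_mul, off, ind_apply, ind_apply, lp.coeFn_zero]
      by_cases hi : i = j
      · subst hi; simp [hj]
      · simp [hi]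
    rw [this]; simp
  ext
  · simp
    exact key (1, 0) rfl
  · simp
    exact key (0, 1) rfl

set_option maxHeartbeats 1000000 in
/-- A family of orbits of a second order difference equation near a hyperbolic equilibrium. -/
theorem exists_orbit_family {g : ℝ × ℝ → ℝ} (hg : AnalyticAt ℝ g 0) (g0 : g 0 = 0)
    (hg' : HasFDerivAt g (0 : ℝ × ℝ →L[ℝ] ℝ) 0) {l : ℝ} (h0 : 0 < l) (h1 : l < 1) :
    ∃ (ε : ℝ) (Δ : ℝ → ℝ) (S : ℝ × ℝ → ℝ), 0 < ε ∧ AnalyticAt ℝ Δ 0 ∧ Δ 0 = l ∧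
      AnalyticAt ℝ S 0 ∧ S 0 = 0 ∧
      HasFDerivAt S (ε • (ContinuousLinearMap.fst ℝ ℝ ℝ + ContinuousLinearMap.snd ℝ ℝ ℝ)) 0 ∧
      ∀ᶠ x in 𝓝 (0 : ℝ × ℝ), S (hypMap Δ (hypMap Δ x)) + S x - (l + l⁻¹) * S (hypMap Δ x) =
        g (S (hypMap Δ x), S x) + g (S (hypMap Δ x), S (hypMap Δ (hypMap Δ x))) := by
  obtain ⟨G, V, Va, hV⟩ := exists_nonresonant hg g0 hg' h0 h1
  have hl : |l| < 1 := by rwa [abs_of_pos h0]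
  have hVc := (hV.and Va.eventually_analyticAt).curry_nhds
  -- The amplitude is frozen at one small positive value for which everything holds for all
  -- multipliers δ near l; from here on only δ varies.
  obtain ⟨ε, hε, hεpos⟩ := ((hVc.filter_mono (nhdsWithin_le_nhds (s := Ioi 0))).and
    self_mem_nhdsWithin).exists
  have hεpos : 0 < ε := hεpos
  set U : ℝ → BiSeries := fun δ => V (ε, δ)
  set R : ℝ → BiSeries := fun δ => resid G l (ε, δ) (U δ)
  have hpair : ∀ δ, AnalyticAt ℝ (fun δ : ℝ => (ε, δ)) δ := fun δ =>
    analyticAt_const.prod analyticAt_id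
  have Ua : AnalyticAt ℝ U l := hε.self_of_nhds.2.fun_comp (hpair l)
  have Ra : AnalyticAt ℝ R l :=
    AnalyticAt.fun_comp (g := fun q => resid G l q (V q)) hε.self_of_nhds.1.2.2.2.2 (hpair l)
  have hδ1 : ∀ᶠ δ in 𝓝 l, |δ| < 1 :=
    (continuous_abs.continuousAt).eventually (gt_mem_nhds hl)
  have hδ0 : ∀ᶠ δ in 𝓝 l, 0 < δ := lt_mem_nhds h0
  have hδu := eventually_isUnit_den h0 h1
  -- A point of the bidisc with product z, analytic in z; its first coordinate 1/2 is the origin of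
  -- the factor 2 in `b`.
  set y : ℝ → ℝ × ℝ := fun z => (2⁻¹, 2 * z)
  have hy0 : y 0 ∈ bidisc := by simp [bidisc, y]; norm_num
  have ya : AnalyticAt ℝ y 0 := analyticAt_const.prod (analyticAt_const.mul analyticAt_id)
  have hy : ∀ᶠ z in 𝓝 (0 : ℝ), y z ∈ bidisc :=
    ya.continuousAt.eventually (isOpen_bidisc.mem_nhds hy0)
  set b : ℝ × ℝ → ℝ := fun u => 2 * ev (chi (y u.1)) (diag resP (R u.2))
  have ba : AnalyticAt ℝ b (0, l) := by
    refine analyticAt_const.mul (analyticAt_ev ?_ ?_)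
    · exact (analyticAt_chi hy0).fun_comp (f := fun u : ℝ × ℝ => y u.1)
        (ya.fun_comp (f := fun u : ℝ × ℝ => u.1) analyticAt_fst)
    · exact ((diag resP).analyticAt _).fun_comp (f := fun u : ℝ × ℝ => R u.2)
        (Ra.fun_comp (f := fun u : ℝ × ℝ => u.2) analyticAt_snd)
  have evP : ∀ z δ, y z ∈ bidisc → ∀ x ∈ bidisc, x.1 * x.2 = z →
      ev (chi x) (diag resP (R δ)) = x.1 * b (z, δ) := by
    intro z δ hz x hx hxz
    rw [ev_resP hx hz (by simp [y]) (by simp only [y]; rw [hxz]; ring)]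
    simp [b, y]
  have evM : ∀ z δ, swp (R δ) = R δ → y z ∈ bidisc → ∀ x ∈ bidisc, x.1 * x.2 = z →
      ev (chi x) (diag resM (R δ)) = x.2 * b (z, δ) := by
    intro z δ hs hz x hx hxz
    rw [ev_resM hx, hs, evP z δ hz x.swap ⟨hx.2, hx.1⟩ (by rw [← hxz]; exact mul_comm _ _)]
    rfl
  have evR : ∀ z δ, swp (R δ) = R δ → U δ = diag off (R δ) → y z ∈ bidisc → ∀ x ∈ bidisc,
      x.1 * x.2 = z → ev (chi x) (R δ) = ev (chi x) (U δ) + (x.1 + x.2) * b (z, δ) := by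
    intro z δ hs hu hz x hx hxz
    conv_lhs => rw [← diag_one (R δ), ← off_add_res, map_add, map_add, _root_.add_apply,
      _root_.add_apply, ← hu, map_add, map_add, evP z δ hz x hx hxz, evM z δ hs hz x hx hxz]
    ring
  have offU : ∀ δ, U δ = diag off (R δ) → U δ = diag off (U δ) := fun δ h => by
    conv_rhs => rw [h, ← diag_mul, off_mul_off]
    exact h
  -- the bifurcation function has no term independent of `ξη`
  have hb0 : ∀ᶠ δ in 𝓝 l, b (0, δ) = 0 := by
    filter_upwards [hε, hδ1] with δ hd hd1
    obtain ⟨⟨a1, a2, a3, a4, -⟩, -⟩ := hd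
    have an : ∀ a : BiSeries, AnalyticAt ℝ (fun x => ev (chi x) a) 0 := fun a =>
      analyticAt_ev (analyticAt_chi zero_mem_bidisc) analyticAt_const
    obtain ⟨v1, v2, v3⟩ := ev_chi_zero_mul (l := l) (q := (ε, δ)) hd1 (U δ)
    rw [show ev (chi 0) (U δ) = 0 from a4, mul_zero] at v1 v2 v3
    have gd : ∀ a c : BiSeries, ev (chi 0) a = 0 → ev (chi 0) c = 0 →
        HasFDerivAt (fun x => g (ev (chi x) a, ev (chi x) c)) (0 : ℝ × ℝ →L[ℝ] ℝ) 0 := by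
      intro a c ha hc
      have e : HasFDerivAt g (0 : ℝ × ℝ →L[ℝ] ℝ) (ev (chi 0) a, ev (chi 0) c) := by
        rw [ha, hc]; exact hg'
      exact (e.comp (0 : ℝ × ℝ) (((an a).prod (an c)).differentiableAt.hasFDerivAt)).congr_fderiv
        (by simp)
    have hR : HasFDerivAt (fun x => ev (chi x) (R δ)) (0 : ℝ × ℝ →L[ℝ] ℝ) 0 := by
      have := ((gd _ _ v1 v3).add (gd _ _ v1 v2)).congr_fderiv (add_zero _)
      refine this.congr_of_eventuallyEq ?_
      filter_upwards [isOpen_bidisc.mem_nhds zero_mem_bidisc] with x hx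
      exact a3 x hx
    have hU : HasFDerivAt (fun x => ev (chi x) (U δ)) (0 : ℝ × ℝ →L[ℝ] ℝ) 0 :=
      hasFDerivAt_ev_off (offU δ a1)
    have hline : HasDerivAt (fun t : ℝ => ((t, 0) : ℝ × ℝ)) (1, 0) 0 :=
      (hasDerivAt_id 0).prodMk (hasDerivAt_const _ _)
    have hdiff := HasFDerivAt.comp_hasDerivAt (f := fun t : ℝ => ((t, 0) : ℝ × ℝ)) (0 : ℝ)
      (hR.sub hU) hline
    have hlin : HasDerivAt (fun t : ℝ => t * b (0, δ)) (b (0, δ)) 0 := by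
      simpa using (hasDerivAt_id (0 : ℝ)).mul_const (b (0, δ))
    have heq : (fun t : ℝ => t * b (0, δ)) =ᶠ[𝓝 0]
        (((fun x => ev (chi x) (R δ)) - fun x => ev (chi x) (U δ)) ∘ fun t : ℝ => ((t, 0) : ℝ × ℝ)) := by
      have hc : ContinuousAt (fun t : ℝ => ((t, 0) : ℝ × ℝ)) 0 := by fun_prop
      filter_upwards [hc.eventually (isOpen_bidisc.mem_nhds zero_mem_bidisc)] with t ht
      have := evR 0 δ a2 a1 hy0 (t, 0) ht (by simp)
      simp only [Function.comp_apply, Pi.sub_apply, this]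
      ring
    have := hlin.unique (hdiff.congr_of_eventuallyEq heq)
    simpa using this
  -- The bifurcation function: the common coefficient of ξ and of η in the resonant part of the
  -- orbit equation. On z = 0 the term `b` vanishes, so its δ-derivative at l is ε(1 − l⁻²), which
  -- is nonzero.
  set H : ℝ × ℝ → ℝ := fun u => ε * (u.2 + u.2⁻¹ - (l + l⁻¹)) - b u
  have Ha : AnalyticAt ℝ H (0, l) := by
    have i1 : AnalyticAt ℝ (fun u : ℝ × ℝ => u.2⁻¹) (0, l) := analyticAt_snd.inv h0.ne'
    exact (analyticAt_const.mul ((analyticAt_snd.add i1).sub analyticAt_const)).sub ba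
  have H0 : H (0, l) = 0 := by simp [H, hb0.self_of_nhds]
  have Hd : HasDerivAt (fun δ => H (0, δ)) (ε * (1 + -(l ^ 2)⁻¹)) l := by
    have e : HasDerivAt (fun δ : ℝ => ε * (δ + δ⁻¹ - (l + l⁻¹))) (ε * (1 + -(l ^ 2)⁻¹)) l :=
      (((hasDerivAt_id l).add (hasDerivAt_inv h0.ne')).sub_const _).const_mul ε
    refine e.congr_of_eventuallyEq ?_
    filter_upwards [hb0] with δ hd
    simp [H, hd]
  have Hne : ε * (1 + -(l ^ 2)⁻¹) ≠ 0 := by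
    refine mul_ne_zero hεpos.ne' ?_
    have : 1 < (l ^ 2)⁻¹ := (one_lt_inv₀ (by positivity)).2 (by nlinarith)
    linarith
  obtain ⟨Δ, Δa, Δ0, Δeq, -⟩ := Ha.exists_implicit_real H0 Hd Hne
  have ztend : Tendsto (fun x : ℝ × ℝ => x.1 * x.2) (𝓝 0) (𝓝 0) := by
    have : Continuous fun x : ℝ × ℝ => x.1 * x.2 := by fun_prop
    simpa using this.tendsto 0
  have Δt : Tendsto Δ (𝓝 0) (𝓝 l) := by simpa [ContinuousAt, Δ0] using Δa.continuousAt
  set S : ℝ × ℝ → ℝ := fun x =>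
    ev (chi x) (orbZ l (ε, Δ (x.1 * x.2)) (U (Δ (x.1 * x.2))))
  have za : AnalyticAt ℝ (fun x : ℝ × ℝ => x.1 * x.2) 0 := analyticAt_fst.mul analyticAt_snd
  have Δza : AnalyticAt ℝ (fun x : ℝ × ℝ => Δ (x.1 * x.2)) 0 :=
    AnalyticAt.fun_comp_of_eq (f := fun x : ℝ × ℝ => x.1 * x.2) Δa za (by simp)
  have Δz0 : Δ ((0 : ℝ × ℝ).1 * (0 : ℝ × ℝ).2) = l := by simp [Δ0]
  have Uza : AnalyticAt ℝ (fun x : ℝ × ℝ => U (Δ (x.1 * x.2))) 0 :=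
    AnalyticAt.fun_comp_of_eq (f := fun x : ℝ × ℝ => Δ (x.1 * x.2)) Ua Δza Δz0
  set Z : ℝ × ℝ → BiSeries := fun x => diag (mulZ l (Δ (x.1 * x.2))) (U (Δ (x.1 * x.2)))
  have Za : AnalyticAt ℝ Z 0 := by
    refine analyticAt_diag ?_ Uza
    exact AnalyticAt.fun_comp_of_eq (f := fun x : ℝ × ℝ => Δ (x.1 * x.2))
      (analyticAt_mulZ hl (isUnit_den h0 h1)) Δza Δz0
  have Seq : ∀ x ∈ bidisc, S x = ε * (x.1 + x.2) + ev (chi x) (Z x) := by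
    intro x hx
    simp only [S, Z, orbZ, map_add, map_smul, ev_mono, chi_apply hx, smul_eq_mul]
    simp
  have hbid : ∀ᶠ x in 𝓝 (0 : ℝ × ℝ), x ∈ bidisc := isOpen_bidisc.mem_nhds zero_mem_bidisc
  have Sev : S =ᶠ[𝓝 0] fun x => ε * (x.1 + x.2) + ev (chi x) (Z x) := hbid.mono Seq
  have Sa : AnalyticAt ℝ S 0 := by
    refine AnalyticAt.congr ?_ Sev.symm
    exact (analyticAt_const.mul (analyticAt_fst.add analyticAt_snd)).add
      (analyticAt_ev (analyticAt_chi zero_mem_bidisc) Za)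
  have hgood : ∀ᶠ x in 𝓝 (0 : ℝ × ℝ), ev (chi 0) (Z x) = 0 := by
    filter_upwards [(Δt.comp ztend).eventually hε, (Δt.comp ztend).eventually hδ1] with x hx h1
    have := (ev_chi_zero_mul (l := l) (q := (0, Δ (x.1 * x.2))) h1 (U (Δ (x.1 * x.2)))).1
    rw [show ev (chi 0) (U (Δ (x.1 * x.2))) = 0 from hx.1.2.2.2.1, mul_zero] at this
    simpa [orbZ] using this
  have Zoff : Z 0 = diag off (Z 0) := by
    have : U l = diag off (U l) := offU l hε.self_of_nhds.1.1
    simp only [Z]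
    rw [Δz0, ← diag_mul, mul_comm, diag_mul, ← this]
  have Sd : HasFDerivAt S (ε • (ContinuousLinearMap.fst ℝ ℝ ℝ + ContinuousLinearMap.snd ℝ ℝ ℝ)) 0 := by
    have e1 : HasFDerivAt (fun x : ℝ × ℝ => ε * (x.1 + x.2))
        (ε • (ContinuousLinearMap.fst ℝ ℝ ℝ + ContinuousLinearMap.snd ℝ ℝ ℝ)) 0 :=
      (hasFDerivAt_fst.add hasFDerivAt_snd).const_mul ε
    -- By the product rule there are two contributions. Varying the series gives zero because its
    -- value at the origin vanishes identically, and varying the point gives zero because a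
    -- nonresonant series has no linear part.
    have e2 : HasFDerivAt (fun x => ev (chi x) (Z x)) (0 : ℝ × ℝ →L[ℝ] ℝ) 0 := by
      have b1 := (hasFDerivAt_ev_off Zoff)
      have c1 : HasFDerivAt (fun x => diag (chi x) (Z x)) _ 0 :=
        (diag.hasFDerivAt.comp (0 : ℝ × ℝ) hasFDerivAt_chi).clm_apply
          Za.differentiableAt.hasFDerivAt
      have c2 : HasFDerivAt (fun x => ev (chi x) (Z x)) _ 0 := tot.hasFDerivAt.comp (0 : ℝ × ℝ) c1
      have c3 : HasFDerivAt (fun x => ev (chi x) (Z 0)) _ 0 :=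
        (tot.comp (diag.flip (Z 0))).hasFDerivAt.comp (0 : ℝ × ℝ) hasFDerivAt_chi
      have c4 : HasFDerivAt (fun x => ev (chi 0) (Z x)) _ 0 :=
        (ev (chi 0)).hasFDerivAt.comp (0 : ℝ × ℝ) Za.differentiableAt.hasFDerivAt
      have c5 := c4.unique ((hasFDerivAt_const (0 : ℝ) (0 : ℝ × ℝ)).congr_of_eventuallyEq hgood)
      have c6 := c3.unique b1
      refine c2.congr_fderiv (ContinuousLinearMap.ext fun w => ?_)
      have d5 := DFunLike.congr_fun c5 w
      have d6 := DFunLike.congr_fun c6 w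
      simp only [ContinuousLinearMap.comp_apply, ContinuousLinearMap.flip_apply,
        _root_.zero_apply, ev] at d5 d6
      simp only [ContinuousLinearMap.comp_apply, _root_.add_apply, ContinuousLinearMap.flip_apply,
        map_add, _root_.zero_apply] at d5 d6 ⊢
      rw [d5, zero_add]
      exact d6
    exact ((e1.add e2).congr_fderiv (add_zero _)).congr_of_eventuallyEq Sev
  have Δne : Δ ((0 : ℝ × ℝ).1 * (0 : ℝ × ℝ).2) ≠ 0 := by rw [Δz0]; exact h0.ne'
  have Nc : ContinuousAt (hypMap Δ) 0 :=
    (analyticAt_hypMap (by simpa using Δa) Δne).continuousAt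
  have Nt : Tendsto (hypMap Δ) (𝓝 0) (𝓝 0) := by
    simpa [ContinuousAt, hypMap_zero] using Nc
  refine ⟨ε, Δ, S, hεpos, Δa, Δ0, Sa, ?_, Sd, ?_⟩
  · rw [Seq 0 zero_mem_bidisc, hgood.self_of_nhds]; simp
  filter_upwards [hbid, Nt.eventually hbid, (Nt.comp Nt).eventually hbid,
    ztend.eventually hy, ztend.eventually Δeq, (Δt.comp ztend).eventually hε,
    (Δt.comp ztend).eventually hδ1, (Δt.comp ztend).eventually hδ0,
    (Δt.comp ztend).eventually hδu] with x b0 b1 b2 b3 b4 b5 b6 b7 b8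
  simp only [Function.comp_apply] at b2 b5 b6 b7 b8
  obtain ⟨⟨a1, a2, a3, a4, -⟩, -⟩ := b5
  -- The normal form conserves ξη, so x and its next two images share the same δ and the analysis
  -- with constant multiplier applies.
  have hz1 : (hypMap Δ x).1 * (hypMap Δ x).2 = x.1 * x.2 := hypMap_prod b7.ne'
  set w := hypMap Δ x
  set z := x.1 * x.2
  set δ := Δ z
  have hN2 : hypMap Δ w = (δ * w.1, δ⁻¹ * w.2) := by simp only [hypMap, hz1]; rfl
  have hz2 : (hypMap Δ w).1 * (hypMap Δ w).2 = z := by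
    rw [hypMap_prod (by rw [hz1]; exact b7.ne'), hz1]
  have s0 : S x = ev (chi x) (orbZ l (ε, δ) (U δ)) := rfl
  have s1 : S w = ev (chi w) (orbZ l (ε, δ) (U δ)) := by simp only [S, hz1]; rfl
  have s2 : S (hypMap Δ w) = ev (chi (hypMap Δ w)) (orbZ l (ε, δ) (U δ)) := by
    simp only [S, hz2]; rfl
  have t0 : S x = ev (chi w) (orbM l (ε, δ) (U δ)) :=
    s0.trans (ev_shift b6 b7.ne' b0 b1 ε (U δ)).2.symm
  have t2 : S (hypMap Δ w) = ev (chi w) (orbP l (ε, δ) (U δ)) := by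
    rw [s2]
    rw [hN2] at b2 ⊢
    exact (ev_shift b6 b7.ne' b1 b2 ε (U δ)).1
  have main := ev_orb_sum b6 b8 b1 ε (U δ)
  rw [← offU δ a1] at main
  have r1 := evR z δ a2 a1 b3 w b1 hz1
  have r2 : ev (chi w) (R δ) = _ := a3 w b1
  have hH : ε * (δ + δ⁻¹ - (l + l⁻¹)) - b (z, δ) = 0 := b4
  rw [t2, t0, s1]
  change _ = g (ev (chi w) (orbZ l (ε, δ) (U δ)), ev (chi w) (orbM l (ε, δ) (U δ))) +
    g (ev (chi w) (orbZ l (ε, δ) (U δ)), ev (chi w) (orbP l (ε, δ) (U δ)))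
  rw [← r2, r1, main]
  linear_combination (w.1 + w.2) * hH

end BiSeries

/-! ### Functions invariant under a hyperbolic normal form -/

namespace BiSeries

/-- An analytic function of two variables is represented by a summable power series near `0`. -/
theorem exists_representation {J : ℝ × ℝ → ℝ} (hJ : AnalyticAt ℝ J 0) :
    ∃ (ρ : ℝ) (a : BiSeries), 0 < ρ ∧ ∀ x ∈ bidisc, J (ρ • x) = ev (chi x) a := by
  obtain ⟨G, -, -, -, hG, -⟩ := hJ.exists_functional_calculus BiSeries
  have ht : Tendsto (fun ρ : ℝ => (ρ • mono (1, 0), ρ • mono (0, 1))) (𝓝[>] 0)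
      (𝓝 (0 : BiSeries × BiSeries)) := by
    have : Continuous fun ρ : ℝ => ((ρ • mono (1, 0), ρ • mono (0, 1)) : BiSeries × BiSeries) := by
      fun_prop
    have := this.tendsto 0
    simp only [zero_smul] at this
    exact this.mono_left nhdsWithin_le_nhds
  -- For small ρ the pair (ρξ, ρη) lies where the functional calculus is compatible with characters;
  -- applying it to this pair gives the series of the rescaled function.
  obtain ⟨ρ, h1, h2⟩ := ((ht.eventually hG).and self_mem_nhdsWithin).exists
  refine ⟨ρ, G (ρ • mono (1, 0), ρ • mono (0, 1)), h2, fun x hx => ?_⟩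
  have := h1 (evHom hx) fun b => norm_ev_le _ (norm_chi_le hx) b
  rw [← evHom_apply hx, this]
  simp [evHom_apply, ev_mono, chi_apply hx, Prod.smul_def]

/-- Division by the product of the two variables, discarding the terms that are not divisible. -/
noncomputable def sh : BiSeries →L[ℝ] BiSeries :=
  lift (fun i => if i.1 = 0 ∨ i.2 = 0 then 0 else mono (i.1 - 1, i.2 - 1)) 1 fun i => by
    split_ifs
    · simp
    · exact (norm_mono _).le

theorem norm_sh_le (a : BiSeries) : ‖sh a‖ ≤ ‖a‖ :=
  (sh.le_opNorm a).trans (mul_le_of_le_one_left (norm_nonneg _) (norm_lift_le _ _ _))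

theorem bidisc_axes {x : ℝ × ℝ} (hx : x ∈ bidisc) : (x.1, (0 : ℝ)) ∈ bidisc ∧ ((0 : ℝ), x.2) ∈ bidisc :=
  ⟨⟨hx.1, by simp⟩, ⟨by simp, hx.2⟩⟩

theorem ev_sh {x : ℝ × ℝ} (hx : x ∈ bidisc) (a : BiSeries) :
    ev (chi x) a = x.1 * x.2 * ev (chi x) (sh a) + ev (chi (x.1, 0)) a + ev (chi (0, x.2)) a
      - ev (chi 0) a := by
  have : ev (chi x) = (x.1 * x.2) • (ev (chi x)).comp sh + ev (chi (x.1, 0)) + ev (chi (0, x.2))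
      - ev (chi 0) := clm_ext fun i => by
    obtain ⟨h1, h2⟩ := bidisc_axes hx
    simp only [_root_.sub_apply, _root_.add_apply, _root_.smul_apply, sh,
      ContinuousLinearMap.comp_apply, lift_mono, ev_mono, chi_apply hx, chi_apply h1, chi_apply h2,
      chi_apply zero_mem_bidisc, smul_eq_mul]
    obtain ⟨k, m⟩ := i
    rcases k with _ | k <;> rcases m with _ | m <;> simp [ev_mono, chi_apply hx]
    ring
  exact DFunLike.congr_fun this a

theorem analyticAt_ev_chi {x : ℝ × ℝ} (hx : x ∈ bidisc) (a : BiSeries) :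
    AnalyticAt ℝ (fun x => ev (chi x) a) x :=
  analyticAt_ev (analyticAt_chi hx) analyticAt_const

/-- Germwise invariance of a power series under the normal form. -/
def Inv (Δ : ℝ → ℝ) (a : BiSeries) : Prop :=
  ∀ᶠ x in 𝓝 (0 : ℝ × ℝ), ev (chi (hypMap Δ x)) a = ev (chi x) a

/-- Near 0 one has f(t) = f(lⁿt) → f(0), and the identity theorem extends this to the whole
interval. -/
theorem constant_of_contraction {f : ℝ → ℝ} (hf : ∀ t, |t| < 1 → AnalyticAt ℝ f t) {l : ℝ}
    (h0 : 0 < l) (h1 : l < 1) (h : ∀ᶠ t in 𝓝 (0 : ℝ), f (l * t) = f t) {t : ℝ} (ht : |t| < 1) :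
    f t = f 0 := by
  obtain ⟨r, hr, hb⟩ := Metric.eventually_nhds_iff.1 h
  have hnear : f =ᶠ[𝓝 0] fun _ => f 0 := by
    filter_upwards [Metric.ball_mem_nhds (0 : ℝ) hr] with t ht
    rw [Metric.mem_ball, dist_zero_right, Real.norm_eq_abs] at ht
    have it : ∀ n : ℕ, f (l ^ n * t) = f t := fun n => by
      induction n with
      | zero => simp
      | succ n ih =>
        have : |l ^ n * t| < r := by
          rw [abs_mul, abs_of_pos (pow_pos h0 n)]
          exact (mul_le_of_le_one_left (abs_nonneg _) (pow_le_one₀ h0.le h1.le)).trans_lt ht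
        rw [pow_succ', mul_assoc, hb (by simpa using this), ih]
    have lim : Tendsto (fun n : ℕ => f (l ^ n * t)) atTop (𝓝 (f 0)) := by
      have e : Tendsto (fun n : ℕ => l ^ n * t) atTop (𝓝 0) := by
        simpa using (tendsto_pow_atTop_nhds_zero_of_lt_one h0.le h1).mul_const t
      exact (hf 0 (by simp)).continuousAt.tendsto.comp e
    exact tendsto_nhds_unique (by simp only [it]; exact tendsto_const_nhds) lim
  have hA : AnalyticOnNhd ℝ f (Ioo (-1) 1) := fun t ht => hf t (abs_lt.2 ht)
  exact hA.eqOn_of_preconnected_of_eventuallyEq (fun t _ => analyticAt_const)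
    (convex_Ioo _ _).isPreconnected (show (0 : ℝ) ∈ Ioo (-1 : ℝ) 1 by norm_num) hnear (abs_lt.1 ht)

variable {Δ : ℝ → ℝ} {a : BiSeries}

/-- On the axes ξη = 0, so the map is linear there: a contraction by Δ(0) on the first axis and the
inverse dilation on the second. Both cases reduce to `constant_of_contraction`. -/
theorem Inv.axes (hi : Inv Δ a) (h0 : 0 < Δ 0) (h1 : Δ 0 < 1) {t : ℝ} (ht : |t| < 1) :
    ev (chi (t, 0)) a = ev (chi 0) a ∧ ev (chi (0, t)) a = ev (chi 0) a := by
  constructor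
  · refine constant_of_contraction (f := fun t => ev (chi (t, 0)) a) (fun t ht => ?_) h0 h1 ?_ ht
    · exact (analyticAt_ev_chi (x := (t, 0)) ⟨ht, by simp⟩ a).fun_comp
        (f := fun t : ℝ => (t, (0 : ℝ))) (analyticAt_id.prod analyticAt_const)
    · have hc : Tendsto (fun t : ℝ => (t, (0 : ℝ))) (𝓝 0) (𝓝 0) := by
        have : Continuous fun t : ℝ => (t, (0 : ℝ)) := by fun_prop
        exact this.tendsto 0
      filter_upwards [hc.eventually hi] with t ht
      simpa [hypMap] using ht
  · refine constant_of_contraction (f := fun t => ev (chi (0, t)) a) (fun t ht => ?_) h0 h1 ?_ ht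
    · exact (analyticAt_ev_chi (x := (0, t)) ⟨by simp, ht⟩ a).fun_comp
        (f := fun t : ℝ => ((0 : ℝ), t)) (analyticAt_const.prod analyticAt_id)
    · have hc : Tendsto (fun t : ℝ => ((0 : ℝ), Δ 0 * t)) (𝓝 0) (𝓝 0) := by
        have : Continuous fun t : ℝ => ((0 : ℝ), Δ 0 * t) := by fun_prop
        have := this.tendsto 0
        simp only [mul_zero] at this
        exact this
      filter_upwards [hc.eventually hi] with t ht
      simp only [hypMap, zero_mul, mul_zero] at ht
      rw [inv_mul_cancel_left₀ h0.ne'] at ht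
      exact ht.symm

/-- All values on the axes are the same constant, so invariance passes to ξη times the quotient
series. The factor ξη is conserved and can be cancelled off the axes, and density of that set with
continuity does the rest. -/
theorem Inv.sh (hi : Inv Δ a) (hΔ : AnalyticAt ℝ Δ 0) (h0 : 0 < Δ 0) (h1 : Δ 0 < 1) :
    Inv Δ (sh a) := by
  have Na : AnalyticAt ℝ (hypMap Δ) 0 := analyticAt_hypMap (by simpa using hΔ) (by simpa using h0.ne')
  have Nt : Tendsto (hypMap Δ) (𝓝 0) (𝓝 0) := by
    simpa [ContinuousAt, hypMap_zero] using Na.continuousAt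
  have hbid : ∀ᶠ x in 𝓝 (0 : ℝ × ℝ), x ∈ bidisc := isOpen_bidisc.mem_nhds zero_mem_bidisc
  have ztend : Tendsto (fun x : ℝ × ℝ => x.1 * x.2) (𝓝 0) (𝓝 0) := by
    have : Continuous fun x : ℝ × ℝ => x.1 * x.2 := by fun_prop
    simpa using this.tendsto 0
  have hpos : ∀ᶠ x in 𝓝 (0 : ℝ × ℝ), Δ (x.1 * x.2) ≠ 0 :=
    ztend.eventually (hΔ.continuousAt.eventually_ne h0.ne')
  have hoff : ∀ᶠ x in 𝓝 (0 : ℝ × ℝ), x.1 * x.2 ≠ 0 →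
      ev (chi (hypMap Δ x)) (BiSeries.sh a) = ev (chi x) (BiSeries.sh a) := by
    filter_upwards [hi, hbid, Nt.eventually hbid, hpos] with x e b1 b2 hx hz
    rw [ev_sh b1, ev_sh b2, hypMap_prod hx, (hi.axes h0 h1 b1.1).1, (hi.axes h0 h1 b1.2).2,
      (hi.axes h0 h1 b2.1).1, (hi.axes h0 h1 b2.2).2] at e
    exact mul_left_cancel₀ hz (by linarith)
  have hPa : AnalyticAt ℝ (fun x => ev (chi (hypMap Δ x)) (BiSeries.sh a)) 0 :=
    AnalyticAt.fun_comp_of_eq (g := fun x => ev (chi x) (BiSeries.sh a)) (f := hypMap Δ)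
      (analyticAt_ev_chi zero_mem_bidisc _) Na (hypMap_zero _)
  filter_upwards [hoff.eventually_nhds, hPa.eventually_analyticAt, hbid] with x e1 e2 e3
  have hd : Dense {x : ℝ × ℝ | x.1 * x.2 ≠ 0} := by
    have := (dense_compl_singleton (0 : ℝ)).prod (dense_compl_singleton (0 : ℝ))
    refine this.mono fun x hx => ?_
    exact mul_ne_zero hx.1 hx.2
  have : (𝓝[{x : ℝ × ℝ | x.1 * x.2 ≠ 0}] x).NeBot := mem_closure_iff_nhdsWithin_neBot.1 (hd x)
  refine tendsto_nhds_unique_of_eventuallyEq (l := 𝓝[{x : ℝ × ℝ | x.1 * x.2 ≠ 0}] x)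
    (e2.continuousAt.tendsto.mono_left nhdsWithin_le_nhds)
    ((analyticAt_ev_chi e3 (BiSeries.sh a)).continuousAt.tendsto.mono_left nhdsWithin_le_nhds) ?_
  exact eventually_nhdsWithin_iff.2 e1

/-- The difference of the values at two points of equal product z is z times the same difference for
the quotient series, which is again invariant and of no larger norm. Iterating bounds it by |z|ⁿ ·
2‖a‖, which tends to 0. -/
theorem Inv.ev_eq (hi : Inv Δ a) (hΔ : AnalyticAt ℝ Δ 0) (h0 : 0 < Δ 0) (h1 : Δ 0 < 1)
    {x y : ℝ × ℝ} (hx : x ∈ bidisc) (hy : y ∈ bidisc) (h : x.1 * x.2 = y.1 * y.2) :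
    ev (chi x) a = ev (chi y) a := by
  have hz : |x.1 * x.2| < 1 := by
    rw [abs_mul]
    exact mul_lt_one_of_nonneg_of_lt_one_left (abs_nonneg _) hx.1 hx.2.le
  have key : ∀ (n : ℕ) (b : BiSeries), Inv Δ b →
      |ev (chi x) b - ev (chi y) b| ≤ |x.1 * x.2| ^ n * (2 * ‖b‖) := by
    intro n
    induction n with
    | zero =>
      intro b _
      rw [pow_zero, one_mul, two_mul]
      exact (abs_sub _ _).trans
        (add_le_add (norm_ev_le _ (norm_chi_le hx) b) (norm_ev_le _ (norm_chi_le hy) b))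
    | succ n ih =>
      intro b hb
      have := ih (BiSeries.sh b) (hb.sh hΔ h0 h1)
      rw [ev_sh hx, ev_sh hy, (hb.axes h0 h1 hx.1).1, (hb.axes h0 h1 hx.2).2,
        (hb.axes h0 h1 hy.1).1, (hb.axes h0 h1 hy.2).2, ← h]
      have e : ∀ p q c : ℝ, x.1 * x.2 * p + c + c - c - (x.1 * x.2 * q + c + c - c) =
        x.1 * x.2 * (p - q) := fun p q c => by ring
      rw [e, abs_mul, pow_succ', mul_assoc]
      refine mul_le_mul_of_nonneg_left (this.trans ?_) (abs_nonneg _)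
      exact mul_le_mul_of_nonneg_left (by linarith [norm_sh_le b]) (by positivity)
  have lim : Tendsto (fun n : ℕ => |x.1 * x.2| ^ n * (2 * ‖a‖)) atTop (𝓝 0) := by
    simpa using (tendsto_pow_atTop_nhds_zero_of_lt_one (abs_nonneg _) hz).mul_const (2 * ‖a‖)
  have := ge_of_tendsto' lim fun n => key n a hi
  exact sub_eq_zero.1 (abs_nonpos_iff.1 this)

end BiSeries

open BiSeries in
/-- A function that is invariant under a hyperbolic normal form depends only on the product of the
coordinates. -/
theorem exists_eq_comp_prod_of_invariant {J : ℝ × ℝ → ℝ} {Δ : ℝ → ℝ} (hJ : AnalyticAt ℝ J 0)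
    (hΔ : AnalyticAt ℝ Δ 0) (h0 : 0 < Δ 0) (h1 : Δ 0 < 1)
    (hi : ∀ᶠ x in 𝓝 (0 : ℝ × ℝ), J (hypMap Δ x) = J x) :
    ∃ j : ℝ → ℝ, AnalyticAt ℝ j 0 ∧ ∀ᶠ x in 𝓝 (0 : ℝ × ℝ), J x = j (x.1 * x.2) := by
  obtain ⟨ρ, a, hρ, ha⟩ := exists_representation hJ
  -- Rescaling both coordinates by ρ multiplies their product by ρ².
  set Δ' : ℝ → ℝ := fun z => Δ (ρ ^ 2 * z)
  have hΔ' : AnalyticAt ℝ Δ' 0 :=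
    AnalyticAt.fun_comp_of_eq (f := fun z : ℝ => ρ ^ 2 * z) hΔ
      (analyticAt_const.mul analyticAt_id) (by simp)
  have h0' : 0 < Δ' 0 := by simpa [Δ'] using h0
  have h1' : Δ' 0 < 1 := by simpa [Δ'] using h1
  have hbid : ∀ᶠ x in 𝓝 (0 : ℝ × ℝ), x ∈ bidisc := isOpen_bidisc.mem_nhds zero_mem_bidisc
  have Nt : Tendsto (hypMap Δ') (𝓝 0) (𝓝 0) := by
    have Na : AnalyticAt ℝ (hypMap Δ') 0 :=
      analyticAt_hypMap (by simpa using hΔ') (by simpa using h0'.ne')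
    simpa [ContinuousAt, hypMap_zero] using Na.continuousAt
  have st : Tendsto (fun x : ℝ × ℝ => ρ • x) (𝓝 0) (𝓝 0) := by
    have : Continuous fun x : ℝ × ℝ => ρ • x := by fun_prop
    simpa using this.tendsto 0
  have hinv : Inv Δ' a := by
    filter_upwards [hbid, Nt.eventually hbid, st.eventually hi] with x b1 b2 e
    rw [← ha x b1, ← ha _ b2, ← e]
    congr 1
    simp only [hypMap, Δ', Prod.smul_def, smul_eq_mul]
    rw [show ρ * x.1 * (ρ * x.2) = ρ ^ 2 * (x.1 * x.2) by ring]
    ext <;> ring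
  have hy0 : ((2⁻¹ : ℝ), 2 * ((ρ ^ 2)⁻¹ * (0 : ℝ))) ∈ bidisc := by simp [bidisc]; norm_num
  have ya : AnalyticAt ℝ (fun z : ℝ => ((2⁻¹ : ℝ), 2 * ((ρ ^ 2)⁻¹ * z))) 0 :=
    analyticAt_const.prod (analyticAt_const.mul (analyticAt_const.mul analyticAt_id))
  refine ⟨fun z => ev (chi (2⁻¹, 2 * ((ρ ^ 2)⁻¹ * z))) a, ?_, ?_⟩
  · exact (analyticAt_ev_chi hy0 a).fun_comp (f := fun z : ℝ => ((2⁻¹ : ℝ), 2 * ((ρ ^ 2)⁻¹ * z))) ya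
  · have ct : Tendsto (fun x : ℝ × ℝ => ρ⁻¹ • x) (𝓝 0) (𝓝 0) := by
      have : Continuous fun x : ℝ × ℝ => ρ⁻¹ • x := by fun_prop
      simpa using this.tendsto 0
    have zt : Tendsto (fun x : ℝ × ℝ => x.1 * x.2) (𝓝 0) (𝓝 0) := by
      have : Continuous fun x : ℝ × ℝ => x.1 * x.2 := by fun_prop
      simpa using this.tendsto 0
    filter_upwards [ct.eventually hbid, (ya.continuousAt.tendsto.comp zt).eventually
      (isOpen_bidisc.mem_nhds hy0)] with x b1 b2
    have : J x = J (ρ • ρ⁻¹ • x) := by rw [smul_inv_smul₀ hρ.ne']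
    rw [this, ha _ b1]
    refine hinv.ev_eq hΔ' h0' h1' b1 b2 ?_
    simp only [Prod.smul_fst, Prod.smul_snd, smul_eq_mul]
    field_simp

/-! ### Complexification and primitives -/

/-- A real-analytic function extends to a holomorphic function near each real point. -/
theorem AnalyticAt.exists_complexification {f : ℝ → ℝ} {x : ℝ} (hf : AnalyticAt ℝ f x) :
    ∃ F : ℂ → ℂ, AnalyticAt ℂ F x ∧ ∀ᶠ y : ℝ in 𝓝 x, F y = f y := by
  obtain ⟨p, r, hp⟩ := hf
  set q : FormalMultilinearSeries ℂ ℂ ℂ :=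
    FormalMultilinearSeries.ofScalars ℂ fun n => ((p.coeff n : ℝ) : ℂ)
  have hq : r ≤ q.radius := by
    refine le_trans hp.r_le ?_
    refine FormalMultilinearSeries.radius_le_of_le (fun n => ?_)
    rw [FormalMultilinearSeries.ofScalars_norm, Complex.norm_real,
      FormalMultilinearSeries.norm_apply_eq_norm_coef]
  have hQ := q.hasFPowerSeriesOnBall (hp.r_pos.trans_le hq)
  refine ⟨fun z => q.sum (z - x), ?_, ?_⟩
  · exact AnalyticAt.fun_comp_of_eq (f := fun z : ℂ => z - x) hQ.analyticAt
      (analyticAt_id.sub analyticAt_const) (sub_self _)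
  · filter_upwards [Metric.eball_mem_nhds x hp.r_pos] with y hy
    have hy' : y - x ∈ Metric.eball (0 : ℝ) r := by
      rw [Metric.mem_eball] at hy ⊢
      rwa [edist_dist, dist_zero_right, ← dist_eq_norm, ← edist_dist]
    have h1 := hp.hasSum hy'
    have h2 := hQ.hasSum (y := ((y : ℂ) - x)) (by
      refine Metric.eball_subset_eball hq ?_
      rw [Metric.mem_eball, edist_dist, dist_zero_right] at hy' ⊢
      rwa [← Complex.ofReal_sub, Complex.norm_real])
    rw [zero_add] at h2
    rw [add_sub_cancel] at h1
    have h3 := Complex.ofRealCLM.hasSum h1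
    refine h2.unique (h3.congr_fun fun n => ?_)
    rw [FormalMultilinearSeries.ofScalars_apply_eq, p.apply_eq_pow_smul_coeff]
    simp only [smul_eq_mul, Complex.ofRealCLM_apply, Complex.ofReal_mul, Complex.ofReal_pow,
      Complex.ofReal_sub]
    ring

/-- A real-analytic function has a real-analytic primitive near each point. -/
theorem AnalyticAt.exists_primitive {f : ℝ → ℝ} {x : ℝ} (hf : AnalyticAt ℝ f x) :
    ∃ F : ℝ → ℝ, AnalyticAt ℝ F x ∧ ∀ᶠ y in 𝓝 x, HasDerivAt F (f y) y := by
  -- A holomorphic function on a disc has a primitive; the real part of its restriction to the real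
  -- axis is the primitive sought.
  obtain ⟨G, hG, hGf⟩ := hf.exists_complexification
  obtain ⟨r, hr, hb⟩ := Metric.eventually_nhds_iff_ball.1 hG.eventually_analyticAt
  have hd : DifferentiableOn ℂ G (Metric.ball (x : ℂ) r) := fun z hz =>
    (hb z hz).differentiableAt.differentiableWithinAt
  obtain ⟨P, hP⟩ := hd.isExactOn_ball
  refine ⟨fun y => (P y).re, ?_, ?_⟩
  · have hPa : AnalyticAt ℂ P x := by
      have : DifferentiableOn ℂ P (Metric.ball (x : ℂ) r) := fun z hz =>
        (hP z hz).differentiableAt.differentiableWithinAt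
      exact this.analyticAt (Metric.ball_mem_nhds _ hr)
    have h1 : AnalyticAt ℝ P x := hPa.restrictScalars
    have h2 : AnalyticAt ℝ (fun y : ℝ => P y) x :=
      AnalyticAt.fun_comp (f := fun y : ℝ => (y : ℂ)) h1 (Complex.ofRealCLM.analyticAt x)
    exact (Complex.reCLM.analyticAt _).fun_comp h2
  · filter_upwards [hGf, Metric.ball_mem_nhds x hr] with y hy hyr
    have := (hP y (by rwa [Metric.mem_ball, Complex.dist_of_im_eq (by simp), Complex.ofReal_re,
      Complex.ofReal_re, ← Metric.mem_ball])).real_of_complex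
    rwa [hy, Complex.ofReal_re] at this

/-! ### Local inverses and Jacobian determinants in the plane -/

/-- The analytic inverse function theorem. -/
theorem AnalyticAt.exists_local_inverse {E : Type*} [NormedAddCommGroup E] [NormedSpace ℝ E]
    [CompleteSpace E] {f : E → E} {a : E} {f' : E ≃L[ℝ] E} (hf : AnalyticAt ℝ f a)
    (hf' : HasFDerivAt f (f' : E →L[ℝ] E) a) :
    ∃ g : E → E, AnalyticAt ℝ g (f a) ∧ g (f a) = a ∧ (∀ᶠ x in 𝓝 a, g (f x) = x) ∧
      ∀ᶠ y in 𝓝 (f a), f (g y) = y := by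
  have hc : ContDiffAt ℝ ω f a := hf.contDiffAt
  have hs := hc.hasStrictFDerivAt' hf' (by simp)
  exact ⟨hc.localInverse hf' (by simp), (hc.to_localInverse hf' (by simp)).analyticAt,
    hs.localInverse_apply_image, hs.eventually_left_inverse, hs.eventually_right_inverse⟩

theorem AnalyticAt.exists_local_inverse_real {f : ℝ → ℝ} {a d : ℝ} (hf : AnalyticAt ℝ f a)
    (hd : HasDerivAt f d a) (hd0 : d ≠ 0) :
    ∃ g : ℝ → ℝ, AnalyticAt ℝ g (f a) ∧ g (f a) = a ∧ (∀ᶠ x in 𝓝 a, g (f x) = x) ∧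
      ∀ᶠ y in 𝓝 (f a), f (g y) = y :=
  hf.exists_local_inverse (f' := ContinuousLinearEquiv.unitsEquivAut ℝ (Units.mk0 d hd0)) <| by
    refine hd.hasFDerivAt.congr_fderiv ?_
    ext
    simp

theorem AnalyticAt.exists_local_inverse_plane {f : ℝ × ℝ → ℝ × ℝ} {a : ℝ × ℝ}
    (hf : AnalyticAt ℝ f a) (hd : (fderiv ℝ f a).det ≠ 0) :
    ∃ g : ℝ × ℝ → ℝ × ℝ, AnalyticAt ℝ g (f a) ∧ g (f a) = a ∧ (∀ᶠ x in 𝓝 a, g (f x) = x) ∧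
      ∀ᶠ y in 𝓝 (f a), f (g y) = y :=
  hf.exists_local_inverse (f' := (fderiv ℝ f a).toContinuousLinearEquivOfDetNeZero hd)
    hf.differentiableAt.hasFDerivAt

theorem ContinuousLinearMap.det_plane (L : ℝ × ℝ →L[ℝ] ℝ × ℝ) :
    L.det = (L (1, 0)).1 * (L (0, 1)).2 - (L (0, 1)).1 * (L (1, 0)).2 := by
  rw [ContinuousLinearMap.det, ← LinearMap.det_toMatrix (Module.Basis.finTwoProd ℝ),
    Matrix.det_fin_two]
  simp [LinearMap.toMatrix_apply]

theorem ContinuousLinearMap.det_comp_plane (L M : ℝ × ℝ →L[ℝ] ℝ × ℝ) :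
    (L.comp M).det = L.det * M.det :=
  LinearMap.det_comp _ _

theorem det_fderiv_comp {f g : ℝ × ℝ → ℝ × ℝ} {x : ℝ × ℝ} (hf : DifferentiableAt ℝ f (g x))
    (hg : DifferentiableAt ℝ g x) :
    (fderiv ℝ (fun y => f (g y)) x).det = (fderiv ℝ f (g x)).det * (fderiv ℝ g x).det := by
  rw [fderiv_fun_comp x hf hg, ContinuousLinearMap.det_comp_plane]

theorem AnalyticAt.det_fderiv {f : ℝ × ℝ → ℝ × ℝ} {x : ℝ × ℝ} (hf : AnalyticAt ℝ f x) :
    AnalyticAt ℝ (fun y => (fderiv ℝ f y).det) x := by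
  simp only [ContinuousLinearMap.det_plane]
  have h : ∀ v : ℝ × ℝ, AnalyticAt ℝ (fun y => fderiv ℝ f y v) x := fun v =>
    (ContinuousLinearMap.analyticAt (ContinuousLinearMap.apply ℝ (ℝ × ℝ) v) _).fun_comp hf.fderiv
  have h1 : ∀ v : ℝ × ℝ, AnalyticAt ℝ (fun y => (fderiv ℝ f y v).1) x := fun v =>
    (ContinuousLinearMap.fst ℝ ℝ ℝ).analyticAt _ |>.fun_comp (h v)
  have h2 : ∀ v : ℝ × ℝ, AnalyticAt ℝ (fun y => (fderiv ℝ f y v).2) x := fun v =>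
    (ContinuousLinearMap.snd ℝ ℝ ℝ).analyticAt _ |>.fun_comp (h v)
  exact ((h1 _).mul (h2 _)).sub ((h1 _).mul (h2 _))

theorem hasFDerivAt_prod_coords (x : ℝ × ℝ) :
    HasFDerivAt (fun x : ℝ × ℝ => x.1 * x.2)
      (x.1 • ContinuousLinearMap.snd ℝ ℝ ℝ + x.2 • ContinuousLinearMap.fst ℝ ℝ ℝ) x :=
  hasFDerivAt_fst.mul hasFDerivAt_snd

/-- The Jacobian of a map that multiplies the coordinates by functions of their product. -/
theorem det_fderiv_mul_coords {u v : ℝ → ℝ} {u' v' : ℝ} {x : ℝ × ℝ}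
    (hu : HasDerivAt u u' (x.1 * x.2)) (hv : HasDerivAt v v' (x.1 * x.2)) :
    (fderiv ℝ (fun x : ℝ × ℝ => (u (x.1 * x.2) * x.1, v (x.1 * x.2) * x.2)) x).det =
      u (x.1 * x.2) * v (x.1 * x.2) +
        x.1 * x.2 * (u' * v (x.1 * x.2) + u (x.1 * x.2) * v') := by
  have h1 := (hu.comp_hasFDerivAt x (hasFDerivAt_prod_coords x)).mul
    (hasFDerivAt_fst (𝕜 := ℝ) (p := x))
  have h2 := (hv.comp_hasFDerivAt x (hasFDerivAt_prod_coords x)).mul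
    (hasFDerivAt_snd (𝕜 := ℝ) (p := x))
  have h : HasFDerivAt (fun x : ℝ × ℝ => (u (x.1 * x.2) * x.1, v (x.1 * x.2) * x.2)) _ x :=
    h1.prodMk h2
  rw [h.fderiv, ContinuousLinearMap.det_plane]
  simp
  ring

/-! ### Maps generated by a twist function -/

/-- `k` is the germ at `0` of the first partial derivative of a symmetric generating function, with
linear part `A s - B s'`. -/
structure IsTwist (k : ℝ × ℝ → ℝ) (A B : ℝ) : Prop where
  analyticAt : AnalyticAt ℝ k 0
  map_zero : k 0 = 0
  hasFDerivAt : HasFDerivAt k (A • ContinuousLinearMap.fst ℝ ℝ ℝ - B • ContinuousLinearMap.snd ℝ ℝ ℝ) 0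
  symm : ∀ᶠ p in 𝓝 (0 : ℝ × ℝ), fderiv ℝ k p (0, 1) = fderiv ℝ k p.swap (0, 1)
  pos : 0 < B
  lt : B < A

/-- `y` is the image of `x` under the map generated by `k`. -/
def TwistStep (k : ℝ × ℝ → ℝ) (x y : ℝ × ℝ) : Prop :=
  x.2 = -k (x.1, y.1) ∧ y.2 = k (y.1, x.1)

variable {k : ℝ × ℝ → ℝ} {A B : ℝ}

/-- Since ∂₂k = −B ≠ 0 at 0, the relation r + k(s, σ) = 0 can be solved for σ(s, r). Differentiating
it in r gives ∂₂k(s, σ) ∂σ/∂r = −1, while the Jacobian of the map is −∂₂k(σ, s) ∂σ/∂r. The symmetry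
of the mixed derivative makes this equal to 1. -/
theorem IsTwist.exists_map (hk : IsTwist k A B) :
    ∃ T : ℝ × ℝ → ℝ × ℝ, T 0 = 0 ∧ AnalyticAt ℝ T 0 ∧
      (∀ᶠ x in 𝓝 (0 : ℝ × ℝ), (fderiv ℝ T x).det = 1) ∧
      ∀ᶠ p in 𝓝 (0 : (ℝ × ℝ) × (ℝ × ℝ)), TwistStep k p.1 p.2 ↔ p.2 = T p.1 := by
  have ka := hk.analyticAt
  have fa : AnalyticAt ℝ (fun v : (ℝ × ℝ) × ℝ => v.1.2 + k (v.1.1, v.2)) ((0 : ℝ × ℝ), (0 : ℝ)) := by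
    have h1 : AnalyticAt ℝ (fun v : (ℝ × ℝ) × ℝ => (v.1.1, v.2)) ((0 : ℝ × ℝ), (0 : ℝ)) :=
      (analyticAt_fst.fun_comp analyticAt_fst).prod analyticAt_snd
    refine AnalyticAt.add (analyticAt_snd.fun_comp analyticAt_fst) ?_
    exact AnalyticAt.fun_comp_of_eq (f := fun v : (ℝ × ℝ) × ℝ => (v.1.1, v.2)) ka h1 rfl
  have fd : HasDerivAt (fun y : ℝ => (0 : ℝ × ℝ).2 + k ((0 : ℝ × ℝ).1, y)) (-B) 0 := by
    have h1 : HasDerivAt (fun y : ℝ => ((0 : ℝ), y)) (0, 1) 0 :=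
      (hasDerivAt_const _ _).prodMk (hasDerivAt_id _)
    have := (hk.hasFDerivAt.comp_hasDerivAt_of_eq (0 : ℝ) h1 rfl).const_add (0 : ℝ)
    simpa using this
  obtain ⟨σ, σa, σ0, hσ, hiff⟩ := fa.exists_implicit_real (show (0 : ℝ) + k 0 = 0 by rw [hk.map_zero, add_zero]) fd
    (neg_ne_zero.2 hk.pos.ne')
  have pa : AnalyticAt ℝ (fun x : ℝ × ℝ => (σ x, x.1)) 0 := σa.prod analyticAt_fst
  have qa : AnalyticAt ℝ (fun x : ℝ × ℝ => (x.1, σ x)) 0 := analyticAt_fst.prod σa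
  have p0 : (σ 0, (0 : ℝ × ℝ).1) = 0 := by rw [σ0]; rfl
  have q0 : ((0 : ℝ × ℝ).1, σ 0) = 0 := by rw [σ0]; rfl
  have Ta : AnalyticAt ℝ (fun x : ℝ × ℝ => (σ x, k (σ x, x.1))) 0 :=
    σa.prod (AnalyticAt.fun_comp_of_eq (f := fun x : ℝ × ℝ => (σ x, x.1)) ka pa p0)
  refine ⟨fun x => (σ x, k (σ x, x.1)), ?_, Ta, ?_, ?_⟩
  · show (σ 0, k (σ 0, (0 : ℝ × ℝ).1)) = 0
    rw [p0, σ0, hk.map_zero]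
    rfl
  · have pt : Tendsto (fun x : ℝ × ℝ => (σ x, x.1)) (𝓝 0) (𝓝 0) := by
      have := pa.continuousAt.tendsto; rwa [p0] at this
    have qt : Tendsto (fun x : ℝ × ℝ => (x.1, σ x)) (𝓝 0) (𝓝 0) := by
      have := qa.continuousAt.tendsto; rwa [q0] at this
    filter_upwards [σa.eventually_analyticAt, hσ.eventually_nhds,
      pt.eventually ka.eventually_analyticAt, qt.eventually ka.eventually_analyticAt,
      qt.eventually hk.symm] with x s1 s2 k1 k2 sy
    have dσ := s1.differentiableAt.hasFDerivAt
    have d1 : HasFDerivAt (fun x : ℝ × ℝ => k (σ x, x.1)) _ x :=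
      k1.differentiableAt.hasFDerivAt.comp x (dσ.prodMk hasFDerivAt_fst)
    have d2 : HasFDerivAt (fun x : ℝ × ℝ => k (x.1, σ x)) _ x :=
      k2.differentiableAt.hasFDerivAt.comp x (hasFDerivAt_fst.prodMk dσ)
    have d3 : HasFDerivAt (fun x : ℝ × ℝ => x.2 + k (x.1, σ x)) _ x := hasFDerivAt_snd.add d2
    have z := (d3.congr_of_eventuallyEq (f₁ := fun _ => (0 : ℝ))
      (s2.mono fun y hy => hy.symm)).unique (hasFDerivAt_const _ _)
    have z2 := DFunLike.congr_fun z ((0 : ℝ), (1 : ℝ))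
    simp only [_root_.add_apply, ContinuousLinearMap.coe_snd', ContinuousLinearMap.comp_apply,
      ContinuousLinearMap.prod_apply, ContinuousLinearMap.coe_fst', _root_.zero_apply] at z2
    have d : HasFDerivAt (fun x : ℝ × ℝ => (σ x, k (σ x, x.1))) _ x := dσ.prodMk d1
    rw [d.fderiv, ContinuousLinearMap.det_plane]
    simp only [ContinuousLinearMap.comp_apply,
      ContinuousLinearMap.prod_apply, ContinuousLinearMap.coe_fst']
    simp only [Prod.swap_prod_mk] at sy
    generalize fderiv ℝ σ x (1, 0) = a at *
    generalize fderiv ℝ σ x (0, 1) = b at *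
    have e : ∀ (L : ℝ × ℝ →L[ℝ] ℝ) (p q : ℝ), L (p, q) = p * L (1, 0) + q * L (0, 1) := by
      intro L p q
      have : (p, q) = p • ((1 : ℝ), (0 : ℝ)) + q • ((0 : ℝ), (1 : ℝ)) := by simp
      rw [this, map_add, map_smul, map_smul]; rfl
    rw [e] at z2
    rw [e (fderiv ℝ k (σ x, x.1)) b 0, e (fderiv ℝ k (σ x, x.1)) a 1, ← sy]
    linear_combination -z2
  · have ct : Tendsto (fun p : (ℝ × ℝ) × (ℝ × ℝ) => (p.1, p.2.1)) (𝓝 0) (𝓝 (0, 0)) := by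
      have : Continuous fun p : (ℝ × ℝ) × (ℝ × ℝ) => (p.1, p.2.1) := by fun_prop
      exact this.tendsto 0
    filter_upwards [ct.eventually hiff] with p hp
    rw [TwistStep, Prod.ext_iff, ← add_eq_zero_iff_eq_neg, hp]
    constructor
    · rintro ⟨h1, h2⟩
      exact ⟨h1.symm, by rw [h2, h1]⟩
    · rintro ⟨h1, h2⟩
      exact ⟨h1.symm, by rw [h2, h1]⟩

theorem hypMap_det {Δ : ℝ → ℝ} {x : ℝ × ℝ} (h : DifferentiableAt ℝ Δ (x.1 * x.2))
    (h0 : Δ (x.1 * x.2) ≠ 0) : (fderiv ℝ (hypMap Δ) x).det = 1 := by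
  have := det_fderiv_mul_coords h.hasDerivAt (h.hasDerivAt.inv h0)
  refine Eq.trans this ?_
  simp only [Pi.inv_apply]
  field_simp
  ring

/-- Locally analytically conjugating with a positive Jacobian is enough for a Birkhoff normal
form. -/
theorem isBirkhoffNormalForm_of_semiconj {T C : ℝ × ℝ → ℝ × ℝ} {Δ : ℝ → ℝ}
    (Ta : AnalyticAt ℝ T 0) (Td : ∀ᶠ x in 𝓝 (0 : ℝ × ℝ), (fderiv ℝ T x).det = 1)
    (hΔ : AnalyticAt ℝ Δ 0) (h0 : 0 < Δ 0) (h1 : Δ 0 < 1)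
    (C0 : C 0 = 0) (Ca : AnalyticAt ℝ C 0) (Cd : 0 < (fderiv ℝ C 0).det)
    (hC : ∀ᶠ x in 𝓝 (0 : ℝ × ℝ), T (C x) = C (hypMap Δ x)) :
    ∃ Δ', IsBirkhoffNormalForm T Δ' := by
  have Na : AnalyticAt ℝ (hypMap Δ) 0 := analyticAt_hypMap (by simpa using hΔ) (by simpa using h0.ne')
  have Nt : Tendsto (hypMap Δ) (𝓝 0) (𝓝 0) := by
    simpa [ContinuousAt, hypMap_zero] using Na.continuousAt
  have Ct : Tendsto C (𝓝 0) (𝓝 0) := by simpa [ContinuousAt, C0] using Ca.continuousAt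
  have zt : Tendsto (fun x : ℝ × ℝ => x.1 * x.2) (𝓝 0) (𝓝 0) := by
    have : Continuous fun x : ℝ × ℝ => x.1 * x.2 := by fun_prop
    simpa using this.tendsto 0
  have Ja := Ca.det_fderiv
  -- Chain rule in T ∘ C = C ∘ N: both T and N preserve area, so the Jacobian of C is N-invariant.
  have hJ : ∀ᶠ x in 𝓝 (0 : ℝ × ℝ), (fderiv ℝ C (hypMap Δ x)).det = (fderiv ℝ C x).det := by
    filter_upwards [hC.eventually_nhds, Ct.eventually Td, Ct.eventually Ta.eventually_analyticAt,
      Ca.eventually_analyticAt, Nt.eventually Ca.eventually_analyticAt, Na.eventually_analyticAt,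
      zt.eventually hΔ.eventually_analyticAt,
      zt.eventually (hΔ.continuousAt.eventually_ne h0.ne')] with x e1 e2 e3 e4 e5 e6 e7 e8
    have := Filter.EventuallyEq.fderiv_eq (𝕜 := ℝ) e1
    have := congrArg ContinuousLinearMap.det this
    rw [det_fderiv_comp e3.differentiableAt e4.differentiableAt,
      det_fderiv_comp e5.differentiableAt e6.differentiableAt, e2,
      hypMap_det e7.differentiableAt e8] at this
    linarith
  obtain ⟨j, ja, hj⟩ := exists_eq_comp_prod_of_invariant Ja hΔ h0 h1 hJ
  have j0 : 0 < j 0 := by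
    have := hj.self_of_nhds
    simp only [Prod.fst_zero, Prod.snd_zero, mul_zero] at this
    rwa [← this]
  obtain ⟨P, Pa, hP⟩ := ja.exists_primitive
  set m : ℝ → ℝ := fun z => P z - P 0 with hm
  have ma : AnalyticAt ℝ m 0 := Pa.sub analyticAt_const
  have md : ∀ᶠ z in 𝓝 (0 : ℝ), HasDerivAt m (j z) z := hP.mono fun z hz => hz.sub_const _
  have m0 : m 0 = 0 := sub_self _
  have mz : ∀ z, m z = z * dslope m 0 z := fun z => by
    have := sub_smul_dslope m 0 z
    rw [m0, sub_zero, sub_zero] at this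
    exact this.symm
  have ba : AnalyticAt ℝ (dslope m 0) 0 := by
    obtain ⟨p, hp⟩ := ma
    exact hp.has_fpower_series_dslope_fslope.analyticAt
  have b0 : dslope m 0 0 = j 0 := by rw [dslope_same, md.self_of_nhds.deriv]
  -- The map Λ multiplies both coordinates by a(ξη), so its Jacobian is the derivative of z a(z)².
  -- The choice z a(z)² = m(z) with m' = j makes it equal to that of C.
  set a : ℝ → ℝ := fun z => √(dslope m 0 z) with ha
  have aa : AnalyticAt ℝ a 0 := by
    have : ContDiffAt ℝ ω (fun z => √z) (dslope m 0 0) :=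
      Real.contDiffAt_sqrt (by rw [b0]; exact j0.ne')
    exact this.analyticAt.fun_comp ba
  have bpos : ∀ᶠ z in 𝓝 (0 : ℝ), 0 < dslope m 0 z :=
    ba.continuousAt.eventually (lt_mem_nhds (by rwa [b0]))
  have asq : ∀ᶠ z in 𝓝 (0 : ℝ), z * a z ^ 2 = m z := bpos.mono fun z hz => by
    rw [mz z, ha]; simp only; rw [Real.sq_sqrt hz.le]
  obtain ⟨mi, mia, mi0, hmi, -⟩ := ma.exists_local_inverse_real md.self_of_nhds j0.ne'
  rw [m0] at mia mi0
  obtain ⟨Ci, Cia, Ci0, hCi, hCi'⟩ := Ca.exists_local_inverse_plane Cd.ne'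
  rw [C0] at Cia Ci0 hCi'
  set Λ : ℝ × ℝ → ℝ × ℝ := fun x => (a (x.1 * x.2) * x.1, a (x.1 * x.2) * x.2) with hΛ
  have aa' : AnalyticAt ℝ (fun x : ℝ × ℝ => a (x.1 * x.2)) 0 :=
    AnalyticAt.fun_comp_of_eq (f := fun x : ℝ × ℝ => x.1 * x.2) aa (analyticAt_fst.mul analyticAt_snd)
      (by simp)
  have Λa : AnalyticAt ℝ Λ 0 := (aa'.mul analyticAt_fst).prod (aa'.mul analyticAt_snd)
  have Λ0 : Λ 0 = 0 := by simp [hΛ]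
  have Λd : ∀ᶠ x in 𝓝 (0 : ℝ × ℝ), (fderiv ℝ Λ x).det = (fderiv ℝ C x).det := by
    filter_upwards [hj, zt.eventually aa.eventually_analyticAt, zt.eventually md,
      zt.eventually asq.eventually_nhds] with x e1 e2 e3 e4
    have h := e2.differentiableAt.hasDerivAt
    rw [e1, hΛ, det_fderiv_mul_coords h h]
    have h' : HasDerivAt (fun z => z * a z ^ 2) _ (x.1 * x.2) := (hasDerivAt_id _).mul (h.pow 2)
    have := (h'.congr_of_eventuallyEq (e4.mono fun z hz => hz.symm)).unique e3
    rw [← this]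
    simp
    ring
  have Cit : Tendsto Ci (𝓝 0) (𝓝 0) := by
    simpa [ContinuousAt, Ci0] using Cia.continuousAt
  -- The map Λ sends the product z to m(z), so in the new coordinates the multiplier becomes Δ ∘
  -- m⁻¹.
  refine ⟨fun z => Δ (mi z), ?_, ?_, ?_, fun x => Λ (Ci x), by simp only [Ci0, Λ0], ?_, ?_, ?_⟩
  · exact AnalyticAt.fun_comp_of_eq hΔ mia mi0
  · simpa only [mi0] using h0
  · simpa only [mi0] using h1
  · exact AnalyticAt.fun_comp_of_eq Λa Cia Ci0
  · filter_upwards [hCi'.eventually_nhds, Cit.eventually Λd, Cia.eventually_analyticAt,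
      Cit.eventually Ca.eventually_analyticAt, Cit.eventually Λa.eventually_analyticAt]
      with y e1 e2 e3 e4 e5
    rw [det_fderiv_comp e5.differentiableAt e3.differentiableAt, e2,
      ← det_fderiv_comp e4.differentiableAt e3.differentiableAt,
      Filter.EventuallyEq.fderiv_eq (𝕜 := ℝ) (f := fun y => y) e1]
    simp [ContinuousLinearMap.det_plane]
  · filter_upwards [hCi', Cit.eventually hC, (Nt.comp Cit).eventually hCi,
      (zt.comp Cit).eventually hmi, (zt.comp Cit).eventually asq,
      (zt.comp Cit).eventually (hΔ.continuousAt.eventually_ne h0.ne')] with y e1 e2 e3 e4 e5 e6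
    rw [e1] at e2
    simp only [Function.comp_apply] at e3 e4 e5 e6
    rw [e2, e3]
    set x := Ci y
    have hz : (Λ x).1 * (Λ x).2 = m (x.1 * x.2) := by rw [← e5, hΛ]; ring
    rw [hz, e4]
    simp only [hΛ]
    rw [hypMap_prod e6]
    simp only [hypMap]
    ext <;> ring

/-- A twist map has a Birkhoff normal form. -/
theorem IsTwist.exists_normalForm (hk : IsTwist k A B) {T : ℝ × ℝ → ℝ × ℝ}
    (Ta : AnalyticAt ℝ T 0) (Td : ∀ᶠ x in 𝓝 (0 : ℝ × ℝ), (fderiv ℝ T x).det = 1)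
    (hT : ∀ᶠ p in 𝓝 (0 : (ℝ × ℝ) × (ℝ × ℝ)), TwistStep k p.1 p.2 ↔ p.2 = T p.1) :
    ∃ Δ, IsBirkhoffNormalForm T Δ := by
  have B0 := hk.pos
  obtain ⟨l, l0, l1, hl⟩ : ∃ l : ℝ, 0 < l ∧ l < 1 ∧ B * (l + l⁻¹) = 2 * A := by
    -- The contracting eigenvalue is the smaller root of l + l⁻¹ = 2A/B.
    set t := A / B
    have t1 : 1 < t := (one_lt_div B0).2 hk.lt
    have s2 : √(t ^ 2 - 1) ^ 2 = t ^ 2 - 1 := Real.sq_sqrt (by nlinarith)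
    have s0 : 0 < √(t ^ 2 - 1) := Real.sqrt_pos.2 (by nlinarith)
    have st : √(t ^ 2 - 1) < t := by nlinarith
    refine ⟨t - √(t ^ 2 - 1), by linarith, by nlinarith, ?_⟩
    have : (t - √(t ^ 2 - 1))⁻¹ = t + √(t ^ 2 - 1) :=
      inv_eq_of_mul_eq_one_right (by nlinarith)
    rw [this]
    simp only [t]
    field_simp
    ring
  set g : ℝ × ℝ → ℝ := fun p => B⁻¹ * (k p - (A * p.1 - B * p.2)) with hg
  have gk : ∀ p, k p = A * p.1 - B * p.2 + B * g p := fun p => by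
    simp only [hg]; field_simp; ring
  have ga : AnalyticAt ℝ g 0 := analyticAt_const.mul (hk.analyticAt.sub
    ((analyticAt_const.mul analyticAt_fst).sub (analyticAt_const.mul analyticAt_snd)))
  have gd : HasFDerivAt g (0 : ℝ × ℝ →L[ℝ] ℝ) 0 := by
    have h1 : HasFDerivAt (fun p : ℝ × ℝ => A * p.1 - B * p.2)
        (A • ContinuousLinearMap.fst ℝ ℝ ℝ - B • ContinuousLinearMap.snd ℝ ℝ ℝ) 0 :=
      (hasFDerivAt_fst.const_mul A).sub (hasFDerivAt_snd.const_mul B)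
    exact ((hk.hasFDerivAt.sub h1).const_mul B⁻¹).congr_fderiv (by simp)
  obtain ⟨ε, Δ, S, ε0, hΔ, Δ0, Sa, S0, Sd, horb⟩ :=
    BiSeries.exists_orbit_family ga (by simp [hg, hk.map_zero]) gd l0 l1
  have Δpos : 0 < Δ 0 := by rwa [Δ0]
  have Na : AnalyticAt ℝ (hypMap Δ) 0 :=
    analyticAt_hypMap (by simpa using hΔ) (by simpa using Δpos.ne')
  have Nt : Tendsto (hypMap Δ) (𝓝 0) (𝓝 0) := by
    simpa [ContinuousAt, hypMap_zero] using Na.continuousAt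
  have St : Tendsto S (𝓝 0) (𝓝 0) := by simpa [ContinuousAt, S0] using Sa.continuousAt
  have SNa : AnalyticAt ℝ (fun x => S (hypMap Δ x)) 0 :=
    AnalyticAt.fun_comp_of_eq Sa Na (hypMap_zero _)
  have Nd : HasFDerivAt (hypMap Δ) ((l • ContinuousLinearMap.fst ℝ ℝ ℝ).prod
      (l⁻¹ • ContinuousLinearMap.snd ℝ ℝ ℝ)) 0 := by
    have hd : HasDerivAt Δ (deriv Δ 0) ((0 : ℝ × ℝ).1 * (0 : ℝ × ℝ).2) := by
      simpa using hΔ.differentiableAt.hasDerivAt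
    have u1 := (hd.comp_hasFDerivAt (0 : ℝ × ℝ) (hasFDerivAt_prod_coords 0)).mul
      (hasFDerivAt_fst (𝕜 := ℝ) (p := (0 : ℝ × ℝ)))
    have u2 := ((hd.inv (by simpa using Δpos.ne')).comp_hasFDerivAt (0 : ℝ × ℝ)
      (hasFDerivAt_prod_coords 0)).mul (hasFDerivAt_snd (𝕜 := ℝ) (p := (0 : ℝ × ℝ)))
    refine (u1.prodMk u2).congr_fderiv ?_
    simp [Δ0]
  have SNd : HasFDerivAt (fun x => S (hypMap Δ x))
      (ε • (l • ContinuousLinearMap.fst ℝ ℝ ℝ + l⁻¹ • ContinuousLinearMap.snd ℝ ℝ ℝ)) 0 := by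
    have Sd' := Sd
    rw [← hypMap_zero Δ] at Sd'
    refine (Sd'.comp (0 : ℝ × ℝ) Nd).congr_fderiv ?_
    ext <;> simp
  -- The momentum is prescribed by the generating relation with the next point S(N x). That C
  -- conjugates T to N is then exactly the orbit equation.
  set C : ℝ × ℝ → ℝ × ℝ := fun x => (S x, -k (S x, S (hypMap Δ x))) with hCdef
  have pair0 : (S 0, S (hypMap Δ 0)) = 0 := by rw [hypMap_zero, S0]; rfl
  have ka : AnalyticAt ℝ (fun x => k (S x, S (hypMap Δ x))) 0 :=
    AnalyticAt.fun_comp_of_eq (f := fun x => (S x, S (hypMap Δ x))) hk.analyticAt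
      (Sa.prod SNa) pair0
  have Ca : AnalyticAt ℝ C 0 := Sa.prod ka.neg
  have C0 : C 0 = 0 := by
    simp only [hCdef]; rw [pair0, S0, hk.map_zero]; simp
  have Cd : 0 < (fderiv ℝ C 0).det := by
    have h2 : HasFDerivAt (fun x => k (S x, S (hypMap Δ x))) _ 0 :=
      HasFDerivAt.comp (f := fun x => (S x, S (hypMap Δ x))) (0 : ℝ × ℝ)
        (pair0 ▸ hk.hasFDerivAt) (Sd.prodMk SNd)
    have h : HasFDerivAt C _ 0 := Sd.prodMk h2.neg
    rw [h.fderiv, ContinuousLinearMap.det_plane]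
    simp
    have : l < l⁻¹ := l1.trans ((one_lt_inv₀ l0).2 l1)
    have : 0 < ε * ε * B * (l⁻¹ - l) := by
      have : 0 < l⁻¹ - l := by linarith
      positivity
    nlinarith
  refine isBirkhoffNormalForm_of_semiconj Ta Td hΔ Δpos (by rwa [Δ0]) C0 Ca Cd ?_
  have Ct : Tendsto C (𝓝 0) (𝓝 0) := by simpa [ContinuousAt, C0] using Ca.continuousAt
  have pt : Tendsto (fun x => (C x, C (hypMap Δ x))) (𝓝 0) (𝓝 0) :=
    Ct.prodMk_nhds (Ct.comp Nt)
  filter_upwards [pt.eventually hT, horb] with x e1 e2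
  refine (e1.1 ⟨rfl, ?_⟩).symm
  simp only [hCdef, gk]
  have e3 : B * (S (hypMap Δ (hypMap Δ x)) + S x) - 2 * A * S (hypMap Δ x) =
      B * (g (S (hypMap Δ x), S x) + g (S (hypMap Δ x), S (hypMap Δ (hypMap Δ x)))) := by
    rw [← e2, ← hl]; ring
  linarith

section CubicJets

open Asymptotics

/-! ### Cubic jets -/

/-- `c₀ + c₁ t + c₂ t² + c₃ t³` is the cubic Taylor polynomial of `f` at `0`. -/
def HasCubicJet (f : ℝ → ℝ) (c₀ c₁ c₂ c₃ : ℝ) : Prop :=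
  (fun t => f t - (c₀ + c₁ * t + c₂ * t ^ 2 + c₃ * t ^ 3)) =O[𝓝 0] fun t => t ^ 4

namespace HasCubicJet

variable {f g : ℝ → ℝ} {a b c d a' b' c' d' : ℝ}

theorem const (x : ℝ) : HasCubicJet (fun _ => x) x 0 0 0 := by
  simp [HasCubicJet, isBigO_zero]

theorem id : HasCubicJet (fun t => t) 0 1 0 0 := by
  simp [HasCubicJet, isBigO_zero]

theorem add (hf : HasCubicJet f a b c d) (hg : HasCubicJet g a' b' c' d') :
    HasCubicJet (fun t => f t + g t) (a + a') (b + b') (c + c') (d + d') :=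
  (IsBigO.add hf hg).congr_left fun t => by ring

theorem of_eq (hf : HasCubicJet f a b c d) (h0 : a = a') (h1 : b = b') (h2 : c = c')
    (h3 : d = d') : HasCubicJet f a' b' c' d' := by
  subst h0 h1 h2 h3; exact hf

theorem congr' (hf : HasCubicJet f a b c d) (h : f =ᶠ[𝓝 0] g) : HasCubicJet g a b c d :=
  IsBigO.congr' hf (h.mono fun t ht => by simp only [ht]) EventuallyEq.rfl

theorem add_isBigO (hf : HasCubicJet f a b c d) (hg : g =O[𝓝 0] fun t => t ^ 4) :
    HasCubicJet (fun t => f t + g t) a b c d :=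
  (IsBigO.add hf hg).congr_left fun t => by ring

theorem tendsto (hf : HasCubicJet f a b c d) : Tendsto f (𝓝 0) (𝓝 a) := by
  have h1 : Tendsto (fun t : ℝ => t ^ 4) (𝓝 0) (𝓝 0) := by
    have : Continuous fun t : ℝ => t ^ 4 := by fun_prop
    simpa using this.tendsto 0
  have h2 : Tendsto (fun t : ℝ => a + b * t + c * t ^ 2 + d * t ^ 3) (𝓝 0) (𝓝 a) := by
    have : Continuous fun t : ℝ => a + b * t + c * t ^ 2 + d * t ^ 3 := by fun_prop
    simpa using this.tendsto 0
  simpa using (IsBigO.trans_tendsto hf h1).add h2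

theorem isBigO_mul_pow {u : ℝ → ℝ} (hu : ContinuousAt u 0) :
    (fun t => u t * t ^ 4) =O[𝓝 0] fun t => t ^ 4 := by
  simpa using (hu.isBigO_one ℝ).mul (isBigO_refl (fun t : ℝ => t ^ 4) _)

theorem mul (hf : HasCubicJet f a b c d) (hg : HasCubicJet g a' b' c' d') :
    HasCubicJet (fun t => f t * g t) (a * a') (a * b' + b * a') (a * c' + b * b' + c * a')
      (a * d' + b * c' + c * b' + d * a') := by
  have h1 : (fun t => (f t - (a + b * t + c * t ^ 2 + d * t ^ 3)) * g t) =O[𝓝 0] fun t => t ^ 4 := by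
    simpa using IsBigO.mul hf (hg.tendsto.isBigO_one ℝ)
  have h2 : (fun t => (a + b * t + c * t ^ 2 + d * t ^ 3) *
      (g t - (a' + b' * t + c' * t ^ 2 + d' * t ^ 3))) =O[𝓝 0] fun t => t ^ 4 := by
    have : ContinuousAt (fun t => a + b * t + c * t ^ 2 + d * t ^ 3) 0 := by fun_prop
    simpa using (this.isBigO_one ℝ).mul hg
  have h3 := isBigO_mul_pow (u := fun t => (b * d' + c * c' + d * b') + (c * d' + d * c') * t +
    d * d' * t ^ 2) (by fun_prop)
  exact ((h1.add h2).add h3).congr_left fun t => by ring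

theorem const_mul (hf : HasCubicJet f a b c d) (x : ℝ) :
    HasCubicJet (fun t => x * f t) (x * a) (x * b) (x * c) (x * d) :=
  ((const x).mul hf).of_eq (by ring) (by ring) (by ring) (by ring)

theorem isBigO_id (hf : HasCubicJet f 0 b c d) : f =O[𝓝 0] fun t => t := by
  have h1 : (fun t : ℝ => t ^ 4) =O[𝓝 0] fun t => t := by
    have : ContinuousAt (fun t : ℝ => t ^ 3) 0 := by fun_prop
    exact ((this.isBigO_one ℝ).mul (isBigO_refl (fun t : ℝ => t) _)).congr (fun t => by ring)
      fun t => by ring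
  have h2 : (fun t : ℝ => 0 + b * t + c * t ^ 2 + d * t ^ 3) =O[𝓝 0] fun t => t := by
    have : ContinuousAt (fun t : ℝ => b + c * t + d * t ^ 2) 0 := by fun_prop
    exact ((this.isBigO_one ℝ).mul (isBigO_refl (fun t : ℝ => t) _)).congr (fun t => by ring)
      fun t => by ring
  exact ((IsBigO.trans hf h1).add h2).congr_left fun t => by ring

theorem eq_zero_of_isBigO {c : ℝ} {n : ℕ} {u : ℝ → ℝ} (hu : ContinuousAt u 0)
    (h : (fun t => c + t * u t) =O[𝓝[≠] 0] fun t => t ^ (n + 1)) :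
    c = 0 ∧ u =O[𝓝[≠] 0] fun t => t ^ n := by
  have h1 : Tendsto (fun t : ℝ => t ^ (n + 1)) (𝓝[≠] 0) (𝓝 0) := by
    have : Continuous fun t : ℝ => t ^ (n + 1) := by fun_prop
    simpa using (this.tendsto 0).mono_left nhdsWithin_le_nhds
  have h2 : Tendsto (fun t => c + t * u t) (𝓝[≠] 0) (𝓝 c) := by
    have : ContinuousAt (fun t => c + t * u t) 0 := by fun_prop
    simpa [ContinuousAt] using this.tendsto.mono_left nhdsWithin_le_nhds
  have h0 : c = 0 := tendsto_nhds_unique h2 (h.trans_tendsto h1)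
  refine ⟨h0, ?_⟩
  subst h0
  have := (isBigO_refl (fun t : ℝ => t⁻¹) (𝓝[≠] 0)).mul h
  refine this.congr' ?_ ?_ <;> filter_upwards [self_mem_nhdsWithin] with t ht
  · have : t ≠ 0 := ht
    field_simp; ring
  · have : t ≠ 0 := ht
    field_simp; ring

theorem eq_zero (h : HasCubicJet (fun _ => 0) a b c d) : a = 0 ∧ b = 0 ∧ c = 0 ∧ d = 0 := by
  have h0 : (fun t => a + t * (b + t * (c + t * d))) =O[𝓝[≠] 0] fun t => t ^ 4 :=
    ((IsBigO.neg_left h).mono nhdsWithin_le_nhds).congr_left fun t => by ring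
  obtain ⟨ha, h1⟩ := eq_zero_of_isBigO (by fun_prop) h0
  obtain ⟨hb, h2⟩ := eq_zero_of_isBigO (by fun_prop) h1
  obtain ⟨hc, h3⟩ := eq_zero_of_isBigO (by fun_prop) h2
  have h4 : (fun t : ℝ => d + t * 0) =O[𝓝[≠] 0] fun t => t ^ (0 + 1) := h3.congr_left fun t => by ring
  exact ⟨ha, hb, hc, (eq_zero_of_isBigO (by fun_prop) h4).1⟩

theorem comp_sq {Δ : ℝ → ℝ} (h : AnalyticAt ℝ Δ 0) (z : ℝ) :
    HasCubicJet (fun t => Δ (z * t ^ 2)) (Δ 0) 0 (z * deriv Δ 0) 0 := by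
  obtain ⟨p, hp⟩ := h
  have h1 := hp.isBigO_sub_partialSum_pow 2
  have ht : Tendsto (fun t : ℝ => z * t ^ 2) (𝓝 0) (𝓝 0) := by
    have : Continuous fun t : ℝ => z * t ^ 2 := by fun_prop
    simpa using this.tendsto 0
  have h2 := h1.comp_tendsto ht
  refine (h2.trans ?_).congr_left fun t => ?_
  · have : (fun t : ℝ => z ^ 2 * t ^ 4) =O[𝓝 0] fun t => t ^ 4 :=
      (isBigO_refl (fun t : ℝ => t ^ 4) _).const_mul_left _
    refine this.congr_left fun t => ?_
    simp only [Function.comp_apply, Real.norm_eq_abs, sq_abs]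
    ring
  · have e0 : p.coeff 0 = Δ 0 := by simpa using hp.coeff_zero fun _ => 1
    have e1 : p.coeff 1 = deriv Δ 0 := hp.deriv.symm
    simp [FormalMultilinearSeries.partialSum, Finset.sum_range_succ, e0, e1]
    ring

end HasCubicJet

/-- A cubic Taylor polynomial in two variables, without constant term. -/
def cubic (l : Fin 2 → ℝ) (q : Fin 3 → ℝ) (r : Fin 4 → ℝ) (x : ℝ × ℝ) : ℝ :=
  l 0 * x.1 + l 1 * x.2 + (q 0 * x.1 ^ 2 + q 1 * (x.1 * x.2) + q 2 * x.2 ^ 2) +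
    (r 0 * x.1 ^ 3 + r 1 * (x.1 ^ 2 * x.2) + r 2 * (x.1 * x.2 ^ 2) + r 3 * x.2 ^ 3)

/-- The quadratic coefficient stays unnamed: in the cubic one, second-order coefficients of the
inner functions meet only the quadratic part of the outer function, which is zero when this is
applied to the generating function. -/
theorem HasCubicJet.comp_cubic {f : ℝ × ℝ → ℝ} {l : Fin 2 → ℝ} {q : Fin 3 → ℝ} {r : Fin 4 → ℝ}
    (hf : (fun x => f x - cubic l q r x) =O[𝓝 0] fun x => ‖x‖ ^ 4) {u v : ℝ → ℝ}
    {b c d b' c' d' : ℝ} (hu : HasCubicJet u 0 b c d) (hv : HasCubicJet v 0 b' c' d') :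
    ∃ e, HasCubicJet (fun t => f (u t, v t)) 0 (l 0 * b + l 1 * b') e
      (l 0 * d + l 1 * d' + (q 0 * (2 * b * c) + q 1 * (b * c' + c * b') + q 2 * (2 * b' * c')) +
        (r 0 * b ^ 3 + r 1 * (b ^ 2 * b') + r 2 * (b * b' ^ 2) + r 3 * b' ^ 3)) := by
  have ht : Tendsto (fun t => (u t, v t)) (𝓝 0) (𝓝 0) := hu.tendsto.prodMk_nhds hv.tendsto
  have hn : (fun t => ‖(u t, v t)‖) =O[𝓝 0] fun t => t :=
    ((hu.isBigO_id).prod_left hv.isBigO_id).norm_left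
  have h1 := (hf.comp_tendsto ht).trans (hn.pow 4)
  have hu2 := hu.mul hu
  have hv2 := hv.mul hv
  have huv := hu.mul hv
  have hP := ((((hu.const_mul (l 0)).add (hv.const_mul (l 1))).add
    (((hu2.const_mul (q 0)).add (huv.const_mul (q 1))).add (hv2.const_mul (q 2)))).add
    (((((hu2.mul hu).const_mul (r 0)).add ((hu2.mul hv).const_mul (r 1))).add
      ((hu.mul hv2).const_mul (r 2))).add ((hv2.mul hv).const_mul (r 3)))).add_isBigO h1
  refine ⟨_, (hP.congr' (.of_forall fun t => ?_)).of_eq ?_ ?_ rfl ?_⟩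
  · simp only [Function.comp_apply, cubic]; ring
  all_goals ring

theorem ContinuousMultilinearMap.exists_homogeneous_one
    (p : ContinuousMultilinearMap ℝ (fun _ : Fin 1 => ℝ × ℝ) ℝ) (x : ℝ × ℝ) :
    p (fun _ => x) = p (fun _ => (1, 0)) * x.1 + p (fun _ => (0, 1)) * x.2 := by
  have h : ∀ y : ℝ × ℝ, p (fun _ => y) = continuousMultilinearCurryFin1 ℝ (ℝ × ℝ) ℝ p y := by
    intro y
    rw [continuousMultilinearCurryFin1_apply]
    congr 1
  have : x = x.1 • ((1 : ℝ), (0 : ℝ)) + x.2 • ((0 : ℝ), (1 : ℝ)) := by simp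
  rw [h, h, h]
  conv_lhs => rw [this]
  rw [map_add, map_smul, map_smul]
  simp [mul_comm]

theorem ContinuousMultilinearMap.apply_diag_succ {n : ℕ}
    (p : ContinuousMultilinearMap ℝ (fun _ : Fin (n + 1) => ℝ × ℝ) ℝ) (x : ℝ × ℝ) :
    p (fun _ => x) = x.1 * p.curryLeft (1, 0) (fun _ => x) + x.2 * p.curryLeft (0, 1) (fun _ => x) := by
  have h : p (fun _ => x) = p.curryLeft x (fun _ => x) := by
    rw [ContinuousMultilinearMap.curryLeft_apply]
    congr 1
    ext i <;> refine Fin.cases ?_ (fun j => ?_) i <;> simp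
  have : x = x.1 • ((1 : ℝ), (0 : ℝ)) + x.2 • ((0 : ℝ), (1 : ℝ)) := by simp
  rw [h]
  conv_lhs => rw [show p.curryLeft x = p.curryLeft (x.1 • ((1 : ℝ), (0 : ℝ)) + x.2 • ((0 : ℝ), (1 : ℝ))) by rw [← this]]
  rw [map_add, map_smul, map_smul]
  simp

theorem AnalyticAt.exists_cubic {f : ℝ × ℝ → ℝ} (hf : AnalyticAt ℝ f 0) (h0 : f 0 = 0) :
    ∃ q r, (fun x => f x - cubic ![fderiv ℝ f 0 (1, 0), fderiv ℝ f 0 (0, 1)] q r x) =O[𝓝 0]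
      fun x => ‖x‖ ^ 4 := by
  obtain ⟨p, hp⟩ := hf
  have h := hp.isBigO_sub_partialSum_pow 4
  have e1 : ∀ y : ℝ × ℝ, p 1 (fun _ => y) = fderiv ℝ f 0 y := fun y => by
    rw [hp.fderiv_eq, continuousMultilinearCurryFin1_apply]
    congr 1
  have two : ∀ p : ContinuousMultilinearMap ℝ (fun _ : Fin 2 => ℝ × ℝ) ℝ, ∃ q : Fin 3 → ℝ,
      ∀ x, p (fun _ => x) = q 0 * x.1 ^ 2 + q 1 * (x.1 * x.2) + q 2 * x.2 ^ 2 := fun p => by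
    refine ⟨![p.curryLeft (1, 0) (fun _ => (1, 0)), p.curryLeft (1, 0) (fun _ => (0, 1)) +
      p.curryLeft (0, 1) (fun _ => (1, 0)), p.curryLeft (0, 1) (fun _ => (0, 1))], fun x => ?_⟩
    rw [p.apply_diag_succ, ContinuousMultilinearMap.exists_homogeneous_one,
      ContinuousMultilinearMap.exists_homogeneous_one (p.curryLeft (0, 1))]
    simp
    ring
  obtain ⟨q, hq⟩ := two (p 2)
  obtain ⟨s, hs⟩ := two ((p 3).curryLeft (1, 0))
  obtain ⟨s', hs'⟩ := two ((p 3).curryLeft (0, 1))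
  refine ⟨q, ![s 0, s 1 + s' 0, s 2 + s' 1, s' 2], h.congr_left fun x => ?_⟩
  rw [zero_add]
  have e0 : p 0 (fun _ => x) = 0 := by rw [hp.coeff_zero, h0]
  simp only [FormalMultilinearSeries.partialSum, Finset.sum_range_succ, Finset.sum_range_zero,
    e0, e1, hq, (p 3).apply_diag_succ, hs, hs', cubic]
  have e2 : fderiv ℝ f 0 x = x.1 * fderiv ℝ f 0 (1, 0) + x.2 * fderiv ℝ f 0 (0, 1) := by
    rw [← smul_eq_mul, ← smul_eq_mul, ← map_smul, ← map_smul, ← map_add]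
    simp
  rw [e2]
  simp
  ring

/-! ### The first Birkhoff invariant of a twist map -/

/-- The map `T` is generated by `k` near `0`. -/
def TwistRel (k : ℝ × ℝ → ℝ) (T : ℝ × ℝ → ℝ × ℝ) : Prop :=
  T 0 = 0 ∧ ContinuousAt T 0 ∧ ∀ᶠ x in 𝓝 (0 : ℝ × ℝ), TwistStep k x (T x)

variable {k : ℝ × ℝ → ℝ} {A B : ℝ}

theorem IsTwist.exists_twistRel (hk : IsTwist k A B) :
    ∃ T Δ, TwistRel k T ∧ IsBirkhoffNormalForm T Δ := by
  obtain ⟨T, T0, Ta, Td, hT⟩ := hk.exists_map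
  obtain ⟨Δ, hΔ⟩ := hk.exists_normalForm Ta Td hT
  refine ⟨T, Δ, ⟨T0, Ta.continuousAt, ?_⟩, hΔ⟩
  have ht : Tendsto (fun x => (x, T x)) (𝓝 0) (𝓝 0) := by
    have := continuousAt_id.tendsto.prodMk_nhds Ta.continuousAt
    rwa [T0] at this
  exact (ht.eventually hT).mono fun x hx => hx.2 rfl

/-- The inverse C of the normalizing change of coordinates parametrizes orbits; its first component
S satisfies the orbit equation. Along a ray the linear coefficient yields the eigenvalue relation,
and the ξ²η part of the cubic coefficient yields Δ'(0). Because ξ²η is resonant, the cubic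
coefficient of S cancels, and the condition det dC = 1 eliminates the scale of S. -/
theorem IsTwist.deriv_normalForm (hk : IsTwist k A B) {r : Fin 4 → ℝ}
    (hr : (fun x => k x - cubic ![A, -B] 0 r x) =O[𝓝 0] fun x => ‖x‖ ^ 4)
    {T : ℝ × ℝ → ℝ × ℝ} {Δ : ℝ → ℝ} (hT : TwistRel k T) (hN : IsBirkhoffNormalForm T Δ) :
    B * (Δ 0 + (Δ 0)⁻¹) = 2 * A ∧
    deriv Δ 0 * (B * ((Δ 0)⁻¹ - Δ 0)) ^ 2 = -(6 * Δ 0 * r 0 + 3 * (1 + Δ 0 ^ 2) * r 1 +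
      (4 * Δ 0 + (Δ 0)⁻¹ + Δ 0 ^ 3) * r 2 + 3 * (1 + Δ 0 ^ 2) * r 3) := by
  obtain ⟨hΔ, h0, h1, R, R0, Ra, Rd, hR⟩ := hN
  obtain ⟨T0, Tc, hT⟩ := hT
  obtain ⟨C, Ca, C0, hC, hC'⟩ := Ra.exists_local_inverse_plane
    (by rw [Rd.self_of_nhds]; exact one_ne_zero)
  rw [R0] at Ca C0 hC'
  have Na : AnalyticAt ℝ (hypMap Δ) 0 :=
    analyticAt_hypMap (by simpa using hΔ) (by simpa using h0.ne')
  have Nt : Tendsto (hypMap Δ) (𝓝 0) (𝓝 0) := by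
    simpa [ContinuousAt, hypMap_zero] using Na.continuousAt
  have Ct : Tendsto C (𝓝 0) (𝓝 0) := by simpa [ContinuousAt, C0] using Ca.continuousAt
  have Tt : Tendsto T (𝓝 0) (𝓝 0) := by rw [ContinuousAt, T0] at Tc; exact Tc
  have Cd : (fderiv ℝ C 0).det = 1 := by
    have := Filter.EventuallyEq.fderiv_eq (𝕜 := ℝ) (f₁ := fun x => R (C x)) (f := fun y => y) hC'
    have := congrArg ContinuousLinearMap.det this
    rw [det_fderiv_comp (by rw [C0]; exact Ra.differentiableAt) Ca.differentiableAt, C0,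
      Rd.self_of_nhds, one_mul] at this
    rw [this]
    simp [ContinuousLinearMap.det_plane]
  have hconj : ∀ᶠ x in 𝓝 (0 : ℝ × ℝ), T (C x) = C (hypMap Δ x) := by
    filter_upwards [hC', Ct.eventually hR, (Tt.comp Ct).eventually hC] with x e1 e2 e3
    rw [e1] at e2
    simp only [Function.comp_apply] at e3
    rw [← e3, e2]
    rfl
  set S : ℝ × ℝ → ℝ := fun x => (C x).1 with hS
  have Sa : AnalyticAt ℝ S 0 := analyticAt_fst.fun_comp Ca
  have S0 : S 0 = 0 := by simp [hS, C0]
  have h2 : ∀ᶠ x in 𝓝 (0 : ℝ × ℝ), (C x).2 = -k (S x, S (hypMap Δ x)) ∧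
      (C (hypMap Δ x)).2 = k (S (hypMap Δ x), S x) := by
    filter_upwards [Ct.eventually hT, hconj] with x e1 e2
    rw [e2] at e1
    exact e1
  have horb : ∀ᶠ x in 𝓝 (0 : ℝ × ℝ), k (S (hypMap Δ x), S x) +
      k (S (hypMap Δ x), S (hypMap Δ (hypMap Δ x))) = 0 := by
    filter_upwards [h2, Nt.eventually h2] with x e1 e2
    linarith [e1.2, e2.1]
  set α := fderiv ℝ S 0 (1, 0)
  set β := fderiv ℝ S 0 (0, 1)
  set m := Δ 0
  have Nd : HasFDerivAt (hypMap Δ) ((m • ContinuousLinearMap.fst ℝ ℝ ℝ).prod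
      (m⁻¹ • ContinuousLinearMap.snd ℝ ℝ ℝ)) 0 := by
    have hd : HasDerivAt Δ (deriv Δ 0) ((0 : ℝ × ℝ).1 * (0 : ℝ × ℝ).2) := by
      simpa using hΔ.differentiableAt.hasDerivAt
    have u1 := (hd.comp_hasFDerivAt (0 : ℝ × ℝ) (hasFDerivAt_prod_coords 0)).mul
      (hasFDerivAt_fst (𝕜 := ℝ) (p := (0 : ℝ × ℝ)))
    have u2 := ((hd.inv (by simpa using h0.ne')).comp_hasFDerivAt (0 : ℝ × ℝ)
      (hasFDerivAt_prod_coords 0)).mul (hasFDerivAt_snd (𝕜 := ℝ) (p := (0 : ℝ × ℝ)))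
    refine (u1.prodMk u2).congr_fderiv ?_
    simp [m]
  -- Since C(x) = (S x, −k(S x, S(N x))) near 0, its Jacobian at 0 only involves the partial
  -- derivatives α, β of S and the linear part of k.
  have area : α * β * (B * (m⁻¹ - m)) = 1 := by
    have Sd := Sa.differentiableAt.hasFDerivAt
    have SNd : HasFDerivAt (fun x => S (hypMap Δ x)) ((fderiv ℝ S 0).comp _) 0 :=
      HasFDerivAt.comp (g := S) (0 : ℝ × ℝ) (by rw [hypMap_zero]; exact Sd) Nd
    have pair0 : (S 0, S (hypMap Δ 0)) = 0 := by rw [hypMap_zero, S0]; rfl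
    have h3 : HasFDerivAt (fun x => k (S x, S (hypMap Δ x))) _ 0 :=
      HasFDerivAt.comp (f := fun x => (S x, S (hypMap Δ x))) (0 : ℝ × ℝ)
        (pair0 ▸ hk.hasFDerivAt) (Sd.prodMk SNd)
    have h4 : HasFDerivAt (fun x => (S x, -k (S x, S (hypMap Δ x)))) _ 0 := Sd.prodMk h3.neg
    have h5 : C =ᶠ[𝓝 0] fun x => (S x, -k (S x, S (hypMap Δ x))) :=
      h2.mono fun x hx => Prod.ext rfl hx.1
    rw [h5.fderiv_eq, h4.fderiv, ContinuousLinearMap.det_plane] at Cd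
    have e1 : fderiv ℝ S 0 (m, 0) = m * α := by
      rw [show (m, (0 : ℝ)) = m • ((1 : ℝ), (0 : ℝ)) by simp, map_smul]; rfl
    have e2 : fderiv ℝ S 0 (0, m⁻¹) = m⁻¹ * β := by
      rw [show ((0 : ℝ), m⁻¹) = m⁻¹ • ((0 : ℝ), (1 : ℝ)) by simp, map_smul]; rfl
    simp only [ContinuousLinearMap.prod_apply, ContinuousLinearMap.comp_apply, _root_.neg_apply,
      _root_.sub_apply, _root_.smul_apply, ContinuousLinearMap.coe_fst', ContinuousLinearMap.coe_snd',
      smul_eq_mul, mul_one, mul_zero, e1, e2] at Cd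
    rw [← Cd]
    ring
  obtain ⟨q, w, hSj⟩ : ∃ q w, (fun x => S x - cubic ![α, β] q w x) =O[𝓝 0] fun x => ‖x‖ ^ 4 :=
    Sa.exists_cubic S0
  have jetD : ∀ z, HasCubicJet (fun t => Δ (z * t ^ 2)) m 0 (z * deriv Δ 0) 0 :=
    HasCubicJet.comp_sq hΔ
  have jetI : ∀ z, HasCubicJet (fun t => (Δ (z * t ^ 2))⁻¹) m⁻¹ 0 (z * (-deriv Δ 0 / m ^ 2)) 0 := by
    intro z
    have := HasCubicJet.comp_sq (hΔ.fun_inv h0.ne') z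
    rwa [deriv_fun_inv'' hΔ.differentiableAt h0.ne'] at this
  -- These are the coefficients of t and t³ in the orbit equation at the point (ξt, ηt), for
  -- arbitrary ξ and η.
  have key : ∀ ξ η : ℝ, 2 * A * (α * (m * ξ) + β * (m⁻¹ * η)) -
        B * (α * ξ + β * η + (α * (m ^ 2 * ξ) + β * (m⁻¹ ^ 2 * η))) = 0 ∧
      2 * A * (deriv Δ 0 * (ξ * η) * (α * ξ - β * η / m ^ 2) + (w 0 * (m * ξ) ^ 3 + w 1 * (m * ξ ^ 2 * η) +
        w 2 * (m⁻¹ * ξ * η ^ 2) + w 3 * (m⁻¹ * η) ^ 3)) -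
      B * ((w 0 * ξ ^ 3 + w 1 * (ξ ^ 2 * η) + w 2 * (ξ * η ^ 2) + w 3 * η ^ 3) +
        (2 * deriv Δ 0 * (ξ * η) * (m * α * ξ - β * η / m ^ 3) + (w 0 * (m ^ 2 * ξ) ^ 3 +
          w 1 * (m ^ 2 * ξ ^ 2 * η) + w 2 * (m⁻¹ ^ 2 * ξ * η ^ 2) + w 3 * (m⁻¹ ^ 2 * η) ^ 3))) +
      (cubic 0 0 r (α * (m * ξ) + β * (m⁻¹ * η), α * ξ + β * η) +
        cubic 0 0 r (α * (m * ξ) + β * (m⁻¹ * η), α * (m ^ 2 * ξ) + β * (m⁻¹ ^ 2 * η))) = 0 := by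
    intro ξ η
    have x0 := HasCubicJet.id.const_mul ξ
    have y0 := HasCubicJet.id.const_mul η
    have x1 := (jetD (ξ * η)).mul x0
    have y1 := (jetI (ξ * η)).mul y0
    have x2 := (jetD (ξ * η)).mul x1
    have y2 := (jetI (ξ * η)).mul y1
    obtain ⟨e0, s0⟩ := HasCubicJet.comp_cubic hSj (x0.of_eq (by ring) rfl rfl rfl)
      (y0.of_eq (by ring) rfl rfl rfl)
    obtain ⟨e1, s1⟩ := HasCubicJet.comp_cubic hSj (x1.of_eq (by ring) rfl rfl rfl)
      (y1.of_eq (by ring) rfl rfl rfl)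
    obtain ⟨e2, s2⟩ := HasCubicJet.comp_cubic hSj (x2.of_eq (by ring) rfl rfl rfl)
      (y2.of_eq (by ring) rfl rfl rfl)
    obtain ⟨e3, k0⟩ := HasCubicJet.comp_cubic hr s1 s0
    obtain ⟨e4, k2⟩ := HasCubicJet.comp_cubic hr s1 s2
    have ht : Tendsto (fun t : ℝ => (ξ * t, η * t)) (𝓝 0) (𝓝 0) := by
      have : Continuous fun t : ℝ => (ξ * t, η * t) := by fun_prop
      have := this.tendsto 0
      simp only [mul_zero] at this
      exact this
    have ht2 : Tendsto (fun t : ℝ => ξ * η * t ^ 2) (𝓝 0) (𝓝 0) := by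
      have : Continuous fun t : ℝ => ξ * η * t ^ 2 := by fun_prop
      simpa using this.tendsto 0
    have hz : (fun t => k (S (hypMap Δ (ξ * t, η * t)), S (ξ * t, η * t)) + k (S (hypMap Δ (ξ * t, η * t)),
        S (hypMap Δ (hypMap Δ (ξ * t, η * t))))) =ᶠ[𝓝 0] fun _ => 0 := ht.eventually horb
    have := ((k0.add k2).congr' (g := fun t => k (S (hypMap Δ (ξ * t, η * t)), S (ξ * t, η * t)) +
      k (S (hypMap Δ (ξ * t, η * t)), S (hypMap Δ (hypMap Δ (ξ * t, η * t))))) (by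
        filter_upwards [ht2.eventually (hΔ.continuousAt.eventually_ne h0.ne')] with t h
        have hz : ξ * t * (η * t) = ξ * η * t ^ 2 := by ring
        have e1 : hypMap Δ (ξ * t, η * t) = (Δ (ξ * η * t ^ 2) * (ξ * t), (Δ (ξ * η * t ^ 2))⁻¹ * (η * t)) := by
          simp only [hypMap, hz]
        have e2 : hypMap Δ (hypMap Δ (ξ * t, η * t)) = (Δ (ξ * η * t ^ 2) * (Δ (ξ * η * t ^ 2) * (ξ * t)),
            (Δ (ξ * η * t ^ 2))⁻¹ * ((Δ (ξ * η * t ^ 2))⁻¹ * (η * t))) := by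
          have hp : (hypMap Δ (ξ * t, η * t)).1 * (hypMap Δ (ξ * t, η * t)).2 = ξ * η * t ^ 2 := by
            rw [hypMap_prod (by simpa only [hz] using h)]; exact hz
          rw [hypMap, hp, e1]
        rw [e2, e1])).congr' hz
    obtain ⟨-, z1, -, z3⟩ := this.eq_zero
    have hm := h0.ne'
    constructor
    · refine Eq.trans ?_ z1
      simp
      ring
    · refine Eq.trans ?_ z3
      simp only [cubic, Matrix.cons_val_zero, Matrix.cons_val_one, Pi.zero_apply]
      field_simp
      ring
  have hm : m ≠ 0 := h0.ne'
  have hαβ : α * β ≠ 0 := fun h => by simp [h] at area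
  have hα : α ≠ 0 := left_ne_zero_of_mul hαβ
  have lin : B * (m + m⁻¹) = 2 * A := by
    have := (key 1 0).1
    have h3 : α * m * (B * (m + m⁻¹) - 2 * A) = 0 := by
      field_simp
      linear_combination -this
    have := (mul_eq_zero.1 h3).resolve_left (mul_ne_zero hα hm)
    linarith
  refine ⟨lin, ?_⟩
  have k1 := (key 1 1).2
  have k2 := (key 1 (-1)).2
  have k4 := (key 0 1).2
  have hk' : deriv Δ 0 * (B * (m⁻¹ - m)) + α * β * (6 * m * r 0 + 3 * (1 + m ^ 2) * r 1 +
      (4 * m + m⁻¹ + m ^ 3) * r 2 + 3 * (1 + m ^ 2) * r 3) = 0 := by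
    -- Writing w₁ = αy lets the common factor α be divided out afterwards.
    obtain ⟨y, hy⟩ : ∃ y, w 1 = α * y := ⟨α⁻¹ * w 1, (mul_inv_cancel_left₀ hα _).symm⟩
    have kb : α * (2 * A * (deriv Δ 0 + y * m) - B * (y + 2 * deriv Δ 0 * m + y * m ^ 2) + α * β *
        (r 0 * (6 * m ^ 2 * m⁻¹) + r 1 * (m ^ 2 + 2 * m * m⁻¹ + m ^ 2 * m⁻¹ ^ 2 + 2 * m ^ 3 * m⁻¹) +
          r 2 * (2 * m + m⁻¹ + 2 * m ^ 3 * m⁻¹ ^ 2 + m ^ 4 * m⁻¹) +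
          r 3 * (3 + 3 * m ^ 4 * m⁻¹ ^ 2))) = 0 := by
      simp only [cubic, hy] at k1 k2 k4
      simp at k1 k2 k4
      -- For a cubic form f in (ξ, η), the combination (f(1, 1) − f(1, −1))/2 − f(0, 1) is the
      -- coefficient of ξ²η.
      linear_combination (k1 - k2) / 2 - k4
    replace kb := (mul_eq_zero.1 kb).resolve_left hα
    -- Inserting the eigenvalue relation removes y: its factor 2Am − B(1 + m²) is zero, which is the
    -- resonance.
    rw [← lin] at kb
    field_simp at kb ⊢
    linear_combination kb
  have : deriv Δ 0 * (B * (m⁻¹ - m)) ^ 2 = (deriv Δ 0 * (B * (m⁻¹ - m))) * (B * (m⁻¹ - m)) := by ring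
  rw [this, eq_neg_of_add_eq_zero_left hk']
  linear_combination (-(6 * m * r 0 + 3 * (1 + m ^ 2) * r 1 +
      (4 * m + m⁻¹ + m ^ 3) * r 2 + 3 * (1 + m ^ 2) * r 3)) * area

end CubicJets

/-! ### Orthonormal frames of the plane -/

theorem Plane.inner_eq {e u : Plane} (he : ‖e‖ = 1) (hu : ‖u‖ = 1) (h : inner ℝ e u = 0)
    (v w : Plane) : inner ℝ v w = inner ℝ v e * inner ℝ w e + inner ℝ v u * inner ℝ w u := by
  have hon : Orthonormal ℝ ![e, u] := by
    rw [orthonormal_vecCons_iff, orthonormal_vecCons_iff]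
    exact ⟨he, by simpa using h, hu, by simp, Orthonormal.of_isEmpty _⟩
  have hs : ⊤ ≤ Submodule.span ℝ (range ![e, u]) :=
    (hon.linearIndependent.span_eq_top_of_card_eq_finrank' (by simp)).ge
  have := (OrthonormalBasis.mk hon hs).sum_inner_mul_inner v w
  simp only [Fin.sum_univ_two, OrthonormalBasis.coe_mk, Matrix.cons_val_zero,
    Matrix.cons_val_one] at this
  rw [← this, real_inner_comm w e, real_inner_comm w u]

theorem Plane.norm_sq_eq {e u : Plane} (he : ‖e‖ = 1) (hu : ‖u‖ = 1) (h : inner ℝ e u = 0)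
    (v : Plane) : ‖v‖ ^ 2 = inner ℝ v e ^ 2 + inner ℝ v u ^ 2 := by
  rw [← real_inner_self_eq_norm_sq, Plane.inner_eq he hu h]
  ring

theorem Plane.eq_of_inner {e u : Plane} (he : ‖e‖ = 1) (hu : ‖u‖ = 1) (h : inner ℝ e u = 0)
    {v w : Plane} (h1 : inner ℝ v e = inner ℝ w e) (h2 : inner ℝ v u = inner ℝ w u) : v = w := by
  rw [← sub_eq_zero, ← norm_eq_zero, ← sq_eq_zero_iff, Plane.norm_sq_eq he hu h, inner_sub_left,
    inner_sub_left, h1, h2]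
  simp

/-! ### Taylor polynomials -/

theorem AnalyticAt.hasCubicJet {f : ℝ → ℝ} (hf : AnalyticAt ℝ f 0) :
    HasCubicJet f (f 0) (deriv f 0) (iteratedDeriv 2 f 0 / 2) (iteratedDeriv 3 f 0 / 6) := by
  refine (hf.hasFPowerSeriesAt.isBigO_sub_partialSum_pow 4).congr (fun t => ?_) fun t => ?_
  · simp [FormalMultilinearSeries.partialSum, Finset.sum_range_succ, Nat.factorial]
    ring
  · rw [Real.norm_eq_abs]
    exact (show Even 4 by decide).pow_abs t

theorem HasCubicJet.eventually_linear {f : ℝ → ℝ} {b c d : ℝ} (h : HasCubicJet f 0 b c d)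
    {ε : ℝ} (hε : 0 < ε) : ∀ᶠ t in 𝓝 (0 : ℝ), |f t - b * t| ≤ ε * |t| := by
  have h1 : (fun t => f t - b * t) =o[𝓝 0] fun t : ℝ => t := by
    have e1 : (fun t : ℝ => c * t ^ 2 + d * t ^ 3) =o[𝓝 0] fun t : ℝ => t :=
      ((Asymptotics.isLittleO_pow_id (by norm_num)).const_mul_left c).add
        ((Asymptotics.isLittleO_pow_id (by norm_num)).const_mul_left d)
    exact ((h.trans_isLittleO (Asymptotics.isLittleO_pow_id (by norm_num))).add e1).congr_left
      fun t => by ring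
  exact h1.def hε

theorem HasCubicJet.eventually_quadratic {f : ℝ → ℝ} {c d : ℝ} (h : HasCubicJet f 0 0 c d)
    {ε : ℝ} (hε : 0 < ε) : ∀ᶠ t in 𝓝 (0 : ℝ), |f t - c * t ^ 2| ≤ ε * t ^ 2 := by
  have h1 : (fun t => f t - c * t ^ 2) =o[𝓝 0] fun t : ℝ => t ^ 2 := by
    have e1 : (fun t : ℝ => d * t ^ 3) =o[𝓝 0] fun t : ℝ => t ^ 2 :=
      (Asymptotics.isLittleO_pow_pow (by norm_num)).const_mul_left d
    exact ((h.trans_isLittleO (Asymptotics.isLittleO_pow_pow (by norm_num))).add e1).congr_left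
      fun t => by ring
  refine (h1.def hε).mono fun t ht => ?_
  simpa using ht

/-! ### Arc-length parametrizations -/

namespace IsArcLengthParam

variable {O : Set Plane} {α : ℝ → Plane}

theorem contDiff (h : IsArcLengthParam O α) : ContDiff ℝ ω α :=
  contDiff_iff_contDiffAt.2 fun s => (h.analytic s (mem_univ s)).contDiffAt

theorem hasDerivAt_iteratedDeriv (h : IsArcLengthParam O α) (n : ℕ) (s : ℝ) :
    HasDerivAt (iteratedDeriv n α) (iteratedDeriv (n + 1) α s) s := by
  rw [iteratedDeriv_succ]
  exact ((h.contDiff.differentiable_iteratedDeriv n (by simp)) s).hasDerivAt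

theorem analyticAt_iteratedDeriv (h : IsArcLengthParam O α) (n : ℕ) (s : ℝ) :
    AnalyticAt ℝ (iteratedDeriv n α) s := by
  rw [iteratedDeriv_eq_iterate]
  exact (h.analytic s (mem_univ s)).iterated_deriv n

theorem norm_deriv (h : IsArcLengthParam O α) (s : ℝ) : ‖iteratedDeriv 1 α s‖ = 1 := by
  rw [iteratedDeriv_one]; exact h.unit_speed s

theorem hasDerivAt_inner (h : IsArcLengthParam O α) (m n : ℕ) (s : ℝ) :
    HasDerivAt (fun s => inner ℝ (iteratedDeriv m α s) (iteratedDeriv n α s))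
      (inner ℝ (iteratedDeriv m α s) (iteratedDeriv (n + 1) α s) +
        inner ℝ (iteratedDeriv (m + 1) α s) (iteratedDeriv n α s)) s :=
  (h.hasDerivAt_iteratedDeriv m s).inner ℝ (h.hasDerivAt_iteratedDeriv n s)

theorem inner_one_two (h : IsArcLengthParam O α) (s : ℝ) :
    inner ℝ (iteratedDeriv 1 α s) (iteratedDeriv 2 α s) = 0 := by
  have h1 := h.hasDerivAt_inner 1 1 s
  have h2 : (fun s => inner ℝ (iteratedDeriv 1 α s) (iteratedDeriv 1 α s)) = fun _ => (1 : ℝ) := by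
    ext s; rw [real_inner_self_eq_norm_sq, h.norm_deriv]; norm_num
  rw [h2] at h1
  have := h1.unique (hasDerivAt_const s 1)
  rw [real_inner_comm] at this
  simp only [Nat.reduceAdd] at this
  rw [real_inner_comm] at this
  have e := real_inner_comm (iteratedDeriv 1 α s) (iteratedDeriv 2 α s)
  linarith

theorem inner_one_three (h : IsArcLengthParam O α) (s : ℝ) :
    inner ℝ (iteratedDeriv 1 α s) (iteratedDeriv 3 α s) = -curvature α s ^ 2 := by
  have h1 := h.hasDerivAt_inner 1 2 s
  rw [show (fun s => inner ℝ (iteratedDeriv 1 α s) (iteratedDeriv 2 α s)) = fun _ => (0 : ℝ) from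
    funext h.inner_one_two] at h1
  have := h1.unique (hasDerivAt_const s 0)
  simp only [Nat.reduceAdd, real_inner_self_eq_norm_sq] at this
  rw [curvature]
  linarith

theorem curvature_pos (h : IsArcLengthParam O α) (s : ℝ) : 0 < curvature α s :=
  norm_pos_iff.2 (h.curved s)

theorem analyticAt_curvature (h : IsArcLengthParam O α) (s : ℝ) : AnalyticAt ℝ (curvature α) s := by
  have : ContDiffAt ℝ ω (fun s => ‖iteratedDeriv 2 α s‖) s :=
    ((h.analyticAt_iteratedDeriv 2 s).contDiffAt).norm ℝ (h.curved s)
  exact this.analyticAt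

theorem inner_two_two (s : ℝ) :
    inner ℝ (iteratedDeriv 2 α s) (iteratedDeriv 2 α s) = curvature α s ^ 2 :=
  real_inner_self_eq_norm_sq _

theorem inner_two_three (h : IsArcLengthParam O α) (s : ℝ) :
    inner ℝ (iteratedDeriv 2 α s) (iteratedDeriv 3 α s) = curvature α s * deriv (curvature α) s := by
  have h1 := h.hasDerivAt_inner 2 2 s
  rw [show (fun s => inner ℝ (iteratedDeriv 2 α s) (iteratedDeriv 2 α s)) =
    fun s => curvature α s ^ 2 from funext inner_two_two] at h1
  have := h1.unique ((h.analyticAt_curvature s).differentiableAt.hasDerivAt.pow 2)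
  simp only [Nat.reduceAdd] at this
  rw [real_inner_comm (iteratedDeriv 3 α s)] at this
  rw [real_inner_comm (iteratedDeriv 3 α s)]
  simp at this
  linarith [real_inner_comm (iteratedDeriv 3 α s) (iteratedDeriv 2 α s)]

theorem inner_two_four (h : IsArcLengthParam O α) (s : ℝ) :
    inner ℝ (iteratedDeriv 2 α s) (iteratedDeriv 4 α s) = deriv (curvature α) s ^ 2 +
      curvature α s * iteratedDeriv 2 (curvature α) s - ‖iteratedDeriv 3 α s‖ ^ 2 := by
  have h1 := h.hasDerivAt_inner 2 3 s
  rw [show (fun s => inner ℝ (iteratedDeriv 2 α s) (iteratedDeriv 3 α s)) =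
    fun s => curvature α s * deriv (curvature α) s from funext h.inner_two_three] at h1
  have h2 : HasDerivAt (deriv (curvature α)) (iteratedDeriv 2 (curvature α) s) s := by
    rw [iteratedDeriv_succ, iteratedDeriv_one]
    exact (h.analyticAt_curvature s).deriv.differentiableAt.hasDerivAt
  have := h1.unique ((h.analyticAt_curvature s).differentiableAt.hasDerivAt.mul h2)
  simp only [Nat.reduceAdd, real_inner_self_eq_norm_sq] at this
  linarith

theorem mem (h : IsArcLengthParam O α) (hc : IsClosed O) (s : ℝ) : α s ∈ O :=
  hc.frontier_subset (h.range_eq ▸ mem_range_self s)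

/-- If the affine span were proper, some v ≠ 0 would be orthogonal to all differences of points of
the curve, hence to α'(0) and α''(0). These are nonzero and mutually orthogonal, so they span the
plane. -/
theorem interior_nonempty (h : IsArcLengthParam O α) (hc : IsClosed O) (hO : Convex ℝ O) :
    (interior O).Nonempty := by
  rw [hO.interior_nonempty_iff_affineSpan_eq_top,
    ← AffineSubspace.direction_eq_top_iff_of_nonempty ⟨_, subset_affineSpan ℝ _ (h.mem hc 0)⟩,
    ← Submodule.orthogonal_eq_bot_iff, Submodule.eq_bot_iff]
  intro v hv
  have h0 : ∀ s, inner ℝ (α s - α 0) v = 0 := fun s =>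
    (Submodule.mem_orthogonal _ _).1 hv _ (AffineSubspace.vsub_mem_direction
      (subset_affineSpan ℝ _ (h.mem hc s)) (subset_affineSpan ℝ _ (h.mem hc 0)))
  have h1 : ∀ n s, inner ℝ (iteratedDeriv (n + 1) α s) v = 0 := by
    intro n
    induction n with
    | zero =>
      intro s
      have d1 := ((h.hasDerivAt_iteratedDeriv 0 s).sub_const (α 0)).inner ℝ (hasDerivAt_const s v)
      simp only [iteratedDeriv_zero, h0] at d1
      simpa using (d1.unique (hasDerivAt_const s 0))
    | succ n ih =>
      intro s
      have d1 := (h.hasDerivAt_iteratedDeriv (n + 1) s).inner ℝ (hasDerivAt_const s v)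
      simp only [ih] at d1
      simpa using (d1.unique (hasDerivAt_const s 0))
  have k0 := h.curvature_pos 0
  have hu : ‖(curvature α 0)⁻¹ • iteratedDeriv 2 α 0‖ = 1 := by
    rw [norm_smul, norm_inv, Real.norm_of_nonneg k0.le]
    exact inv_mul_cancel₀ k0.ne'
  refine Plane.eq_of_inner (h.norm_deriv 0) hu ?_ ?_ ?_
  · rw [inner_smul_right, h.inner_one_two, mul_zero]
  · rw [real_inner_comm, h1 0 0, inner_zero_left]
  · rw [inner_smul_right, real_inner_comm, h1 1 0, mul_zero, inner_zero_left]

end IsArcLengthParam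

/-! ### A bounce orthogonal to the boundary -/

/-- The boundary of `O` is met orthogonally at `α 0` by a segment `[α 0, q]` outside `O`. -/
structure IsBounce (O : Set Plane) (α : ℝ → Plane) (q : Plane) : Prop where
  param : IsArcLengthParam O α
  isClosed : IsClosed O
  convex : Convex ℝ O
  ne : α 0 ≠ q
  perp : inner ℝ (deriv α 0) (q - α 0) = 0
  free : Disjoint (openSegment ℝ (α 0) q) O

namespace IsBounce

variable {O : Set Plane} {α : ℝ → Plane} {q : Plane}

/-- The unit normal of the boundary at the bounce point that points into the obstacle. -/
noncomputable def normal (α : ℝ → Plane) (q : Plane) : Plane := (dist (α 0) q)⁻¹ • (α 0 - q)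

/-- The tangential coordinate of the boundary. -/
noncomputable def tan (α : ℝ → Plane) (s : ℝ) : ℝ := inner ℝ (α s - α 0) (deriv α 0)

/-- The normal coordinate of the boundary. -/
noncomputable def nor (α : ℝ → Plane) (q : Plane) (s : ℝ) : ℝ := inner ℝ (α s - α 0) (normal α q)

theorem dist_pos (h : IsBounce O α q) : 0 < dist (α 0) q := _root_.dist_pos.2 h.ne

theorem norm_normal (h : IsBounce O α q) : ‖normal α q‖ = 1 := by
  rw [normal, norm_smul, norm_inv, Real.norm_of_nonneg h.dist_pos.le, ← dist_eq_norm]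
  exact inv_mul_cancel₀ h.dist_pos.ne'

theorem perp_normal (h : IsBounce O α q) : inner ℝ (deriv α 0) (normal α q) = 0 := by
  rw [normal, inner_smul_right, ← neg_sub, inner_neg_right, h.perp, neg_zero, mul_zero]

theorem end_eq (h : IsBounce O α q) : q = α 0 - dist (α 0) q • normal α q := by
  rw [normal, smul_inv_smul₀ h.dist_pos.ne', sub_sub_cancel]

theorem inner_eq (h : IsBounce O α q) (v w : Plane) : inner ℝ v w =
    inner ℝ v (deriv α 0) * inner ℝ w (deriv α 0) + inner ℝ v (normal α q) * inner ℝ w (normal α q) :=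
  Plane.inner_eq (h.param.unit_speed 0) h.norm_normal h.perp_normal v w

theorem hasDerivAt_iteratedDeriv (h : IsBounce O α q) (v : Plane) (n : ℕ) (s : ℝ) :
    HasDerivAt (fun s => inner ℝ (iteratedDeriv n α s) v) (inner ℝ (iteratedDeriv (n + 1) α s) v) s := by
  simpa using (h.param.hasDerivAt_iteratedDeriv n s).inner ℝ (hasDerivAt_const s v)

theorem hasDerivAt_coord (h : IsBounce O α q) (v : Plane) (s : ℝ) :
    HasDerivAt (fun s => inner ℝ (α s - α 0) v) (inner ℝ (deriv α s) v) s := by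
  have := (h.hasDerivAt_iteratedDeriv v 0 s).sub_const (inner ℝ (α 0) v)
  simpa [inner_sub_left] using this

theorem iteratedDeriv_coord (h : IsBounce O α q) (v : Plane) (n : ℕ) :
    iteratedDeriv (n + 1) (fun s => inner ℝ (α s - α 0) v) =
      fun s => inner ℝ (iteratedDeriv (n + 1) α s) v := by
  induction n with
  | zero =>
    ext s
    rw [iteratedDeriv_one, iteratedDeriv_one]
    exact (h.hasDerivAt_coord v s).deriv
  | succ n ih =>
    ext s
    rw [iteratedDeriv_succ, ih]
    exact (h.hasDerivAt_iteratedDeriv v (n + 1) s).deriv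

theorem analyticAt_coord (h : IsBounce O α q) (v : Plane) (s : ℝ) :
    AnalyticAt ℝ (fun s => inner ℝ (α s - α 0) v) s := by
  have h1 : ContDiffAt ℝ ω (fun s => inner ℝ (α s - α 0) v) s :=
    ContDiffAt.inner ℝ (h.param.contDiff.contDiffAt.sub contDiffAt_const) contDiffAt_const
  exact h1.analyticAt

theorem inner_two_tan (h : IsBounce O α q) : inner ℝ (iteratedDeriv 2 α 0) (deriv α 0) = 0 := by
  rw [real_inner_comm, ← iteratedDeriv_one]
  exact h.param.inner_one_two 0

/-- A component of the second derivative is, up to sign, the curvature. -/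
theorem inner_two_normal_sq (h : IsBounce O α q) :
    inner ℝ (iteratedDeriv 2 α 0) (normal α q) ^ 2 = curvature α 0 ^ 2 := by
  have := h.inner_eq (iteratedDeriv 2 α 0) (iteratedDeriv 2 α 0)
  rw [IsArcLengthParam.inner_two_two, h.inner_two_tan] at this
  rw [this]; ring

theorem hasCubicJet_coord (h : IsBounce O α q) (v : Plane) :
    HasCubicJet (fun s => inner ℝ (α s - α 0) v) 0 (inner ℝ (deriv α 0) v)
      (inner ℝ (iteratedDeriv 2 α 0) v / 2) (inner ℝ (iteratedDeriv 3 α 0) v / 6) := by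
  refine (h.analyticAt_coord v 0).hasCubicJet.of_eq (by simp) ?_ ?_ ?_
  · rw [(h.hasDerivAt_coord v 0).deriv]
  · rw [h.iteratedDeriv_coord v 1]
  · rw [h.iteratedDeriv_coord v 2]

theorem hasCubicJet_tan (h : IsBounce O α q) :
    HasCubicJet (tan α) 0 1 0 (inner ℝ (iteratedDeriv 3 α 0) (deriv α 0) / 6) :=
  (h.hasCubicJet_coord (deriv α 0)).of_eq rfl
    (by rw [real_inner_self_eq_norm_sq, h.param.unit_speed]; norm_num)
    (by rw [h.inner_two_tan, zero_div]) rfl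

theorem hasCubicJet_nor (h : IsBounce O α q) :
    HasCubicJet (nor α q) 0 0 (inner ℝ (iteratedDeriv 2 α 0) (normal α q) / 2)
      (inner ℝ (iteratedDeriv 3 α 0) (normal α q) / 6) :=
  (h.hasCubicJet_coord (normal α q)).of_eq rfl h.perp_normal rfl rfl

theorem eventually_tan (h : IsBounce O α q) : ∀ᶠ s in 𝓝 (0 : ℝ), |tan α s - s| ≤ 2⁻¹ * |s| := by
  simpa using h.hasCubicJet_tan.eventually_linear (ε := 2⁻¹) (by norm_num)

/-- The obstacle lies, near the bounce, on the side away from `q`. -/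
theorem inner_two_normal (h : IsBounce O α q) :
    inner ℝ (iteratedDeriv 2 α 0) (normal α q) = curvature α 0 := by
  set c := inner ℝ (iteratedDeriv 2 α 0) (normal α q) with hc
  have k0 := h.param.curvature_pos 0
  rcases sq_eq_sq_iff_eq_or_eq_neg.1 h.inner_two_normal_sq with h1 | h1
  · exact h1
  -- With the opposite sign the boundary would bend towards q on both sides of α(0). A chord joining
  -- two nearby boundary points would then cross the open segment from α(0) to q inside the convex
  -- obstacle.
  exfalso
  have c0 : c < 0 := by rw [hc, h1]; linarith
  have l0 := h.dist_pos
  have hq := h.hasCubicJet_nor.eventually_quadratic (ε := -c / 4) (by linarith)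
  have hsm : ∀ᶠ s in 𝓝 (0 : ℝ), -c * s ^ 2 < dist (α 0) q := by
    have : Continuous fun s : ℝ => -c * s ^ 2 := by fun_prop
    exact this.tendsto' 0 0 (by simp) |>.eventually (gt_mem_nhds l0)
  have hall := (h.eventually_tan.and hq).and hsm
  have hneg : Tendsto (fun s : ℝ => -s) (𝓝 0) (𝓝 0) := by
    simpa using (continuous_neg (G := ℝ)).tendsto 0
  obtain ⟨s, ⟨⟨⟨t1, n1⟩, m1⟩, ⟨⟨t2, n2⟩, -⟩⟩, s0⟩ :=
    (((hall.and (hneg.eventually hall)).filter_mono (nhdsWithin_le_nhds (s := Ioi 0))).and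
      self_mem_nhdsWithin).exists
  have s0 : 0 < s := s0
  rw [← hc] at n1 n2
  rw [abs_of_pos s0, abs_le] at t1
  rw [abs_neg, abs_of_pos s0, abs_le] at t2
  rw [abs_le] at n1 n2
  rw [neg_sq] at n2
  have ss : 0 < s ^ 2 := by positivity
  set a := tan α s
  set b := tan α (-s)
  have a0 : 0 < a := by linarith
  have b0 : b < 0 := by linarith
  have y1 : nor α q s < 0 := by nlinarith
  have y2 : nor α q (-s) < 0 := by nlinarith
  have z1 : -dist (α 0) q < nor α q s := by nlinarith
  have z2 : -dist (α 0) q < nor α q (-s) := by nlinarith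
  have hab : 0 < a - b := by linarith
  -- The weights are those for which the tangential coordinate of the point of the chord vanishes,
  -- so that it lies on the normal line through α(0).
  set p : Plane := (-b / (a - b)) • α s + (a / (a - b)) • α (-s) with hp
  have w1 : 0 < -b / (a - b) := div_pos (by linarith) hab
  have w2 : 0 < a / (a - b) := div_pos a0 hab
  have w12 : -b / (a - b) + a / (a - b) = 1 := by field_simp; ring
  have pO : p ∈ O := h.convex (h.param.mem h.isClosed s) (h.param.mem h.isClosed (-s)) w1.le w2.le w12
  have pc : ∀ v, inner ℝ (p - α 0) v = -b / (a - b) * inner ℝ (α s - α 0) v +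
      a / (a - b) * inner ℝ (α (-s) - α 0) v := fun v => by
    rw [← real_inner_smul_left, ← real_inner_smul_left, ← inner_add_left]
    congr 1
    rw [smul_sub, smul_sub, hp]
    have : α 0 = (-b / (a - b)) • α 0 + (a / (a - b)) • α 0 := by rw [← add_smul, w12, one_smul]
    conv_lhs => rw [this]
    abel
  set r := -(inner ℝ (p - α 0) (normal α q)) with hr
  have r0 : r = -(-b / (a - b) * nor α q s + a / (a - b) * nor α q (-s)) := by rw [hr, pc]; rfl
  have rpos : 0 < r := by rw [r0]; nlinarith [mul_pos w1 (neg_pos.2 y1), mul_pos w2 (neg_pos.2 y2)]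
  have rlt : r < dist (α 0) q := by
    have e : dist (α 0) q = -b / (a - b) * dist (α 0) q + a / (a - b) * dist (α 0) q := by
      rw [← add_mul, w12, one_mul]
    rw [r0, e]
    nlinarith [mul_pos w1 (show 0 < dist (α 0) q + nor α q s by linarith),
      mul_pos w2 (show 0 < dist (α 0) q + nor α q (-s) by linarith)]
  have pe : p = α 0 - r • normal α q := by
    have : p - α 0 = -(r • normal α q) := by
      refine Plane.eq_of_inner (h.param.unit_speed 0) h.norm_normal h.perp_normal ?_ ?_
      · rw [pc, inner_neg_left, real_inner_smul_left,
          real_inner_comm (deriv α 0) (normal α q), h.perp_normal]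
        change -b / (a - b) * a + a / (a - b) * b = _
        field_simp; ring
      · rw [inner_neg_left, real_inner_smul_left, real_inner_self_eq_norm_sq, h.norm_normal, hr]
        ring
    rw [sub_eq_iff_eq_add.1 this]; abel
  refine Set.disjoint_left.1 h.free ?_ pO
  rw [openSegment_eq_image]
  refine ⟨r / dist (α 0) q, ⟨div_pos rpos l0, (div_lt_one l0).2 rlt⟩, ?_⟩
  simp only
  conv_lhs => rw [show q = α 0 - dist (α 0) q • normal α q from h.end_eq]
  rw [pe, smul_sub, smul_smul, ← h.end_eq, div_mul_cancel₀ _ l0.ne', sub_smul, one_smul]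
  abel

theorem eventually_nor (h : IsBounce O α q) :
    ∀ᶠ s in 𝓝 (0 : ℝ), curvature α 0 / 4 * s ^ 2 ≤ nor α q s := by
  have k0 := h.param.curvature_pos 0
  filter_upwards [h.hasCubicJet_nor.eventually_quadratic (ε := curvature α 0 / 4) (by linarith)]
    with s hs
  rw [h.inner_two_normal, abs_le] at hs
  linarith

/-- The normal to the boundary at a point near the bounce. -/
noncomputable def normalAt (α : ℝ → Plane) (q : Plane) (s : ℝ) : Plane :=
  inner ℝ (deriv α s) (deriv α 0) • normal α q - inner ℝ (deriv α s) (normal α q) • deriv α 0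

theorem continuous_deriv (h : IsBounce O α q) : Continuous (deriv α) :=
  h.param.contDiff.continuous_deriv (by simp)

theorem continuous_normalAt (h : IsBounce O α q) : Continuous (normalAt α q) := by
  have := h.continuous_deriv
  unfold normalAt
  fun_prop

theorem normalAt_zero (h : IsBounce O α q) : normalAt α q 0 = normal α q := by
  rw [normalAt, h.perp_normal, real_inner_self_eq_norm_sq, h.param.unit_speed]
  simp

/-- The obstacle lies on one side of its tangent lines near the bounce. -/
theorem eventually_supporting (h : IsBounce O α q) :
    ∀ᶠ s in 𝓝 (0 : ℝ), ∀ p ∈ O, 0 ≤ inner ℝ (p - α s) (normalAt α q s) := by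
  have k0 := h.param.curvature_pos 0
  -- A fixed boundary point strictly on the positive side; it decides the sign of the supporting
  -- functional for all s near 0.
  obtain ⟨s₁, hs₁, hs₁0⟩ := ((h.eventually_nor.filter_mono (nhdsWithin_le_nhds (s := {0}ᶜ))).and
    self_mem_nhdsWithin).exists
  have hs₁0 : s₁ ≠ 0 := hs₁0
  have hpos : 0 < inner ℝ (α s₁ - α 0) (normalAt α q 0) := by
    rw [h.normalAt_zero]
    exact lt_of_lt_of_le (by positivity) hs₁
  have hcont : Continuous fun s => inner ℝ (α s₁ - α s) (normalAt α q s) := by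
    have := h.continuous_normalAt
    have := h.param.contDiff.continuous
    fun_prop
  filter_upwards [hcont.continuousAt.eventually (lt_mem_nhds hpos)] with s hs p hp
  -- A functional supporting O at α(s) is maximal along the curve there, so it kills the tangent and
  -- is a multiple of `normalAt α q s`.
  obtain ⟨f, hf, hfO⟩ := geometric_hahn_banach_of_nonempty_interior_point h.convex
    (x := α s) (fun hi => (h.param.range_eq ▸ mem_range_self s : α s ∈ frontier O).2 hi)
    (h.param.interior_nonempty h.isClosed h.convex)
  have hd : f (deriv α s) = 0 := by
    have h1 : HasDerivAt α (deriv α s) s :=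
      (h.param.contDiff.differentiable (by simp) s).hasDerivAt
    have h2 : HasDerivAt (fun t => f (α t)) (f (deriv α s)) s := f.hasFDerivAt.comp_hasDerivAt s h1
    have h3 : IsLocalMax (fun t => f (α t)) s :=
      .of_forall fun t => hfO _ (h.param.mem h.isClosed t)
    exact h3.hasDerivAt_eq_zero h2
  obtain ⟨g, rfl⟩ := (InnerProductSpace.toDual ℝ Plane).surjective f
  simp only [InnerProductSpace.toDual_apply_apply] at hd hfO
  set a := inner ℝ (deriv α s) (deriv α 0) with ha
  set b := inner ℝ (deriv α s) (normal α q) with hb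
  have hab : a ^ 2 + b ^ 2 = 1 := by
    rw [← Plane.norm_sq_eq (h.param.unit_speed 0) h.norm_normal h.perp_normal,
      h.param.unit_speed, one_pow]
  set fe := inner ℝ g (deriv α 0) with hfe
  set fu := inner ℝ g (normal α q) with hfu
  rw [h.inner_eq] at hd
  have hfv : ∀ v, inner ℝ g v = (a * fu - b * fe) * inner ℝ v (normalAt α q s) := fun v => by
    rw [h.inner_eq g v, normalAt, inner_sub_right, inner_smul_right, inner_smul_right, ← ha, ← hb,
      ← hfe, ← hfu]
    rw [← ha, ← hb, ← hfe, ← hfu] at hd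
    linear_combination (-inner ℝ v (deriv α 0) * fe - inner ℝ v (normal α q) * fu) * hab +
      (inner ℝ v (deriv α 0) * a + inner ℝ v (normal α q) * b) * hd
  have key : ∀ p ∈ O, (a * fu - b * fe) * inner ℝ (p - α s) (normalAt α q s) ≤ 0 := fun p hp => by
    rw [← hfv, inner_sub_right]
    linarith [hfO p hp]
  have hneg : a * fu - b * fe < 0 := by
    refine lt_of_le_of_ne ?_ fun h0 => hf ?_
    · by_contra! hc
      exact absurd (key _ (h.param.mem h.isClosed s₁)) (not_le.2 (mul_pos hc hs))
    · ext v
      rw [InnerProductSpace.toDual_apply_apply, hfv, h0]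
      simp
  by_contra! hc
  exact absurd (key p hp) (not_le.2 (mul_pos_of_neg_of_neg hneg hc))

theorem supporting (h : IsBounce O α q) {p : Plane} (hp : p ∈ O) :
    0 ≤ inner ℝ (p - α 0) (normal α q) := by
  have := h.eventually_supporting.self_of_nhds p hp
  rwa [h.normalAt_zero] at this

end IsBounce

section GeneratingFunction

open Asymptotics

/-! ### The generating function of the folded billiard -/

/-- The derivative with respect to the first variable of the length
`√((x s - x s')² + (ℓ + y s + y s')²)`, where `x₁` and `y₁` are the derivatives of `x` and `y`. -/
noncomputable def foldedGen (ℓ : ℝ) (x y x₁ y₁ : ℝ → ℝ) (p : ℝ × ℝ) : ℝ :=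
  ((x p.1 - x p.2) * x₁ p.1 + (ℓ + y p.1 + y p.2) * y₁ p.1) /
    √((x p.1 - x p.2) ^ 2 + (ℓ + y p.1 + y p.2) ^ 2)

section Jets

theorem isBigO_monomial (i j : ℕ) :
    (fun p : ℝ × ℝ => p.1 ^ i * p.2 ^ j) =O[𝓝 0] fun p => ‖p‖ ^ (i + j) := by
  refine IsBigO.of_bound 1 (.of_forall fun p => ?_)
  rw [one_mul, norm_mul, norm_pow, norm_pow, norm_pow, norm_norm, pow_add]
  gcongr
  · exact norm_fst_le p
  · exact norm_snd_le p

theorem isBigO_norm_pow {m n : ℕ} (h : m ≤ n) :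
    (fun p : ℝ × ℝ => ‖p‖ ^ n) =O[𝓝 0] fun p => ‖p‖ ^ m := by
  have : ContinuousAt (fun p : ℝ × ℝ => ‖p‖ ^ (n - m)) 0 := by fun_prop
  refine ((this.isBigO_one ℝ).mul (isBigO_refl (fun p : ℝ × ℝ => ‖p‖ ^ m) _)).congr (fun p => ?_)
    fun p => one_mul _
  rw [← pow_add, Nat.sub_add_cancel h]

theorem HasCubicJet.comp_fst {f : ℝ → ℝ} {a b c d : ℝ} (h : HasCubicJet f a b c d) :
    (fun p : ℝ × ℝ => f p.1 - (a + b * p.1 + c * p.1 ^ 2 + d * p.1 ^ 3)) =O[𝓝 0]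
      fun p => ‖p‖ ^ 4 :=
  (h.comp_tendsto (continuous_fst.tendsto (0 : ℝ × ℝ))).trans
    ((isBigO_monomial 4 0).congr_left fun p => by simp)

theorem HasCubicJet.comp_snd {f : ℝ → ℝ} {a b c d : ℝ} (h : HasCubicJet f a b c d) :
    (fun p : ℝ × ℝ => f p.2 - (a + b * p.2 + c * p.2 ^ 2 + d * p.2 ^ 3)) =O[𝓝 0]
      fun p => ‖p‖ ^ 4 :=
  (h.comp_tendsto (continuous_snd.tendsto (0 : ℝ × ℝ))).trans
    ((isBigO_monomial 0 4).congr_left fun p => by simp)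

theorem isBigO_mul_sub_mul {f g F G u : ℝ × ℝ → ℝ} (h : (fun p => f p - F p) =O[𝓝 0] u)
    (h' : (fun p => g p - G p) =O[𝓝 0] u) (hg : ContinuousAt g 0) (hF : ContinuousAt F 0) :
    (fun p => f p * g p - F p * G p) =O[𝓝 0] u := by
  have h1 : (fun p => (f p - F p) * g p) =O[𝓝 0] u := by simpa using h.mul (hg.isBigO_one ℝ)
  have h2 : (fun p => F p * (g p - G p)) =O[𝓝 0] u := by simpa using (hF.isBigO_one ℝ).mul h'
  exact (h1.add h2).congr_left fun p => by ring

variable {ℓ K c E : ℝ} {x y x₁ y₁ : ℝ → ℝ}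

/-- The cubic coefficients of the generating function. -/
noncomputable def foldedCubic (ℓ K E : ℝ) : Fin 4 → ℝ :=
  ![ℓ⁻¹ * (-K ^ 2 / 6 + ℓ * E - (1 + K * ℓ) ^ 2 / (2 * ℓ ^ 2)),
    ℓ⁻¹ * (K ^ 2 / 2 + 3 * (1 + K * ℓ) / (2 * ℓ ^ 2)),
    ℓ⁻¹ * (K ^ 2 / 2 - ((1 + K * ℓ) ^ 2 + 2) / (2 * ℓ ^ 2)),
    ℓ⁻¹ * (K ^ 2 / 6 + (1 + K * ℓ) / (2 * ℓ ^ 2))]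

/-- Terms of order four are discarded throughout. The numerator is N₁ + N₃, of orders one and three,
and the square root is replaced by the quadratic polynomial H, so that no quadratic part can arise
in the quotient. The coefficient E enters only through p.1 ^ 3. -/
theorem foldedGen_cubic (hℓ : 0 < ℓ) (cx : Continuous x) (cy : Continuous y) (cx₁ : Continuous x₁)
    (cy₁ : Continuous y₁) (jx : HasCubicJet x 0 1 0 (-K ^ 2 / 6)) (jx₁ : HasCubicJet x₁ 1 0 (-K ^ 2 / 2) c)
    (jy : HasCubicJet y 0 0 (K / 2) 0) (jy₁ : HasCubicJet y₁ 0 K 0 E) :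
    (fun p => foldedGen ℓ x y x₁ y₁ p -
      cubic ![ℓ⁻¹ * (1 + K * ℓ), -ℓ⁻¹] 0 (foldedCubic ℓ K E) p) =O[𝓝 0] fun p => ‖p‖ ^ 4 := by
  set u : ℝ × ℝ → ℝ := fun p => ‖p‖ ^ 4
  have mono : ∀ (i j : ℕ) (g : ℝ × ℝ → ℝ), 4 ≤ i + j → Continuous g →
      (fun p : ℝ × ℝ => g p * (p.1 ^ i * p.2 ^ j)) =O[𝓝 0] u := fun i j g hij hg => by
    simpa using (hg.continuousAt.isBigO_one ℝ).mul
      ((isBigO_monomial i j).trans (isBigO_norm_pow hij))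
  have x0 : x 0 = 0 := tendsto_nhds_unique (cx.tendsto 0) jx.tendsto
  have y0 : y 0 = 0 := tendsto_nhds_unique (cy.tendsto 0) jy.tendsto
  set X : ℝ × ℝ → ℝ := fun p => p.1 - p.2 - K ^ 2 / 6 * (p.1 ^ 3 - p.2 ^ 3)
  set Y : ℝ × ℝ → ℝ := fun p => ℓ + K / 2 * (p.1 ^ 2 + p.2 ^ 2)
  have hX : (fun p : ℝ × ℝ => x p.1 - x p.2 - X p) =O[𝓝 0] u :=
    (jx.comp_fst.sub jx.comp_snd).congr_left fun p => by simp only [X]; ring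
  have hY : (fun p : ℝ × ℝ => ℓ + y p.1 + y p.2 - Y p) =O[𝓝 0] u :=
    (jy.comp_fst.add jy.comp_snd).congr_left fun p => by simp only [Y]; ring
  set N : ℝ × ℝ → ℝ := fun p => (x p.1 - x p.2) * x₁ p.1 + (ℓ + y p.1 + y p.2) * y₁ p.1
  set W : ℝ × ℝ → ℝ := fun p => (x p.1 - x p.2) ^ 2 + (ℓ + y p.1 + y p.2) ^ 2
  set N₁ : ℝ × ℝ → ℝ := fun p => (1 + K * ℓ) * p.1 - p.2
  set N₃ : ℝ × ℝ → ℝ := fun p => -K ^ 2 / 6 * (p.1 ^ 3 - p.2 ^ 3) - K ^ 2 / 2 * p.1 ^ 2 * (p.1 - p.2) +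
    ℓ * E * p.1 ^ 3 + K ^ 2 / 2 * p.1 * (p.1 ^ 2 + p.2 ^ 2)
  set Q : ℝ × ℝ → ℝ := fun p => (p.1 - p.2) ^ 2 + ℓ * K * (p.1 ^ 2 + p.2 ^ 2)
  -- The quadratic Taylor polynomial of the square root: W = ℓ² + Q + O(4), and H² differs from W
  -- only in order four.
  set H : ℝ × ℝ → ℝ := fun p => ℓ + Q p / (2 * ℓ)
  -- The quotient (N₁ + N₃)/H expanded with 1/H = 1/ℓ − Q/(2ℓ³) + O(4), keeping the terms of order
  -- at most three.
  set P : ℝ × ℝ → ℝ := fun p => ℓ⁻¹ * (N₁ p + N₃ p) - N₁ p * Q p / (2 * ℓ ^ 3)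
  have oN₁ : N₁ =O[𝓝 0] fun p => ‖p‖ ^ 1 :=
    (((isBigO_monomial 1 0).const_mul_left (1 + K * ℓ)).sub (isBigO_monomial 0 1)).congr_left
      fun p => by simp [N₁]
  have oQ : Q =O[𝓝 0] fun p => ‖p‖ ^ 2 :=
    ((((isBigO_monomial 2 0).const_mul_left (1 + ℓ * K)).add
      ((isBigO_monomial 0 2).const_mul_left (1 + ℓ * K))).sub
        ((isBigO_monomial 1 1).const_mul_left 2)).congr_left fun p => by simp [Q]; ring
  have oN₃ : N₃ =O[𝓝 0] fun p => ‖p‖ ^ 3 :=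
    (((((isBigO_monomial 3 0).const_mul_left (-K ^ 2 / 6 + ℓ * E)).add
      ((isBigO_monomial 0 3).const_mul_left (K ^ 2 / 6))).add
      ((isBigO_monomial 2 1).const_mul_left (K ^ 2 / 2))).add
      ((isBigO_monomial 1 2).const_mul_left (K ^ 2 / 2))).congr_left fun p => by simp [N₃]; ring
  have hN : (fun p => N p - (N₁ p + N₃ p)) =O[𝓝 0] u := by
    have h1 := isBigO_mul_sub_mul hX jx₁.comp_fst (by fun_prop) (by fun_prop)
    have h2 := isBigO_mul_sub_mul hY jy₁.comp_fst (by fun_prop) (by fun_prop)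
    have j := ((mono 4 0 (fun p => c + K ^ 2 / 6 * (K ^ 2 / 2 - c * p.1) * p.1) (by norm_num)
      (by fun_prop)).sub (mono 3 1 (fun _ => c) (by norm_num) (by fun_prop))).sub
      (mono 2 3 (fun p => K ^ 2 / 6 * (K ^ 2 / 2 - c * p.1)) (by norm_num) (by fun_prop))
    have j' := (mono 5 0 (fun _ => K / 2 * E) (by norm_num) (by fun_prop)).add
      (mono 3 2 (fun _ => K / 2 * E) (by norm_num) (by fun_prop))
    exact (((h1.add h2).add j).add j').congr_left fun p => by simp only [N, N₁, N₃, X, Y]; ring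
  have hW : (fun p => W p - H p ^ 2) =O[𝓝 0] u := by
    have h1 := isBigO_mul_sub_mul hX hX (by fun_prop) (by fun_prop)
    have h2 := isBigO_mul_sub_mul hY hY (by fun_prop) (by fun_prop)
    have q2 : (fun p => (4 * ℓ ^ 2)⁻¹ * (Q p * Q p)) =O[𝓝 0] u :=
      ((oQ.mul oQ).congr_right fun p => by simp only [u]; ring).const_mul_left _
    have j := ((((mono 4 0 (fun p => -K ^ 2 / 3 + (K ^ 2 / 6) ^ 2 * p.1 ^ 2 + (K / 2) ^ 2) (by norm_num)
      (by fun_prop)).add (mono 3 1 (fun _ => K ^ 2 / 3) (by norm_num) (by fun_prop))).add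
      (mono 1 3 (fun p => K ^ 2 / 3) (by norm_num) (by fun_prop))).add
      (mono 0 4 (fun p => -K ^ 2 / 3 + (K ^ 2 / 6) ^ 2 * p.2 ^ 2 + (K / 2) ^ 2) (by norm_num) (by fun_prop))).add
      ((mono 3 3 (fun p => -2 * (K ^ 2 / 6) ^ 2) (by norm_num) (by fun_prop)).add
        (mono 2 2 (fun p => 2 * (K / 2) ^ 2) (by norm_num) (by fun_prop)))
    refine (((h1.add h2).add j).sub q2).congr_left fun p => ?_
    simp only [W, H, X, Y, Q]
    field_simp
    ring
  have W0 : W 0 = ℓ ^ 2 := by simp [W, x0, y0]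
  have cW : Continuous W := by fun_prop
  have cN : Continuous N := by fun_prop
  have W1 : √(W 0) = ℓ := by rw [W0, Real.sqrt_sq hℓ.le]
  have cs : ContinuousAt (fun p => (√(W p))⁻¹) 0 :=
    (cW.sqrt.continuousAt).inv₀ (by rw [W1]; exact hℓ.ne')
  have hH : (fun p => √(W p) - H p) =O[𝓝 0] u := by
    have c2 : ContinuousAt (fun p => (√(W p) + H p)⁻¹) 0 := by
      refine ((cW.sqrt.continuousAt).add (by fun_prop)).inv₀ ?_
      simp [W1, H, Q]
      exact hℓ.ne'
    have h1 : (fun p => (W p - H p ^ 2) * (√(W p) + H p)⁻¹) =O[𝓝 0] u := by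
      simpa using hW.mul (c2.isBigO_one ℝ)
    have ev : ∀ᶠ p in 𝓝 (0 : ℝ × ℝ), 0 < W p ∧ 0 < H p := by
      have cH : Continuous H := by fun_prop
      exact (cW.continuousAt.eventually (lt_mem_nhds (by rw [W0]; positivity))).and
        (cH.continuousAt.eventually (lt_mem_nhds (by simp [H, Q, hℓ])))
    refine h1.congr' (ev.mono fun p hp => ?_) EventuallyEq.rfl
    have hs := Real.sq_sqrt hp.1.le
    have : √(W p) + H p ≠ 0 := (add_pos (Real.sqrt_pos.2 hp.1) hp.2).ne'
    simp only
    rw [← div_eq_mul_inv, div_eq_iff this]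
    linear_combination -hs
  have hPH : (fun p => P p * H p - (N₁ p + N₃ p)) =O[𝓝 0] u := by
    have h1 : (fun p => (2 * ℓ ^ 2)⁻¹ * (N₃ p * Q p)) =O[𝓝 0] u :=
      (((oN₃.mul oQ).congr_right fun p => (pow_add _ _ _).symm).trans
        (isBigO_norm_pow (by norm_num))).const_mul_left _
    have h2 : (fun p => (4 * ℓ ^ 4)⁻¹ * (N₁ p * Q p * Q p)) =O[𝓝 0] u :=
      ((((oN₁.mul oQ).mul oQ).congr_right fun p => by rw [← pow_add, ← pow_add]).trans
        (isBigO_norm_pow (by norm_num))).const_mul_left _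
    refine (h1.sub h2).congr_left fun p => ?_
    simp only [P, H]
    field_simp
    ring
  have hPW : (fun p => P p * √(W p) - P p * H p) =O[𝓝 0] u := by
    have cP : Continuous P := by fun_prop
    have : (fun p => P p * (√(W p) - H p)) =O[𝓝 0] u := by
      simpa using (cP.continuousAt.isBigO_one ℝ).mul hH
    exact this.congr_left fun p => by ring
  have hfin : (fun p => (N p - P p * √(W p)) * (√(W p))⁻¹) =O[𝓝 0] u := by
    simpa using ((hN.sub (hPW.add hPH)).congr_left fun p => by ring).mul (cs.isBigO_one ℝ)
  refine hfin.congr' ?_ EventuallyEq.rfl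
  filter_upwards [cW.continuousAt.eventually (lt_mem_nhds (by rw [W0]; positivity : 0 < W 0))] with p hp
  have hs : √(W p) ≠ 0 := (Real.sqrt_pos.2 hp).ne'
  have hk : foldedGen ℓ x y x₁ y₁ p = N p / √(W p) := rfl
  rw [hk, sub_mul, mul_inv_cancel_right₀ hs, ← div_eq_mul_inv]
  congr 1
  simp [P, N₁, N₃, Q, cubic, foldedCubic]
  field_simp
  ring

/-- The function is the partial derivative of a length symmetric in its two arguments, hence its
mixed derivative is symmetric. The inequality B < A is K > 0, that is, the dispersing character of
the boundary. -/
theorem isTwist_foldedGen (hℓ : 0 < ℓ) (hK : 0 < K) (ax : ∀ s, AnalyticAt ℝ x s) (ay : ∀ s, AnalyticAt ℝ y s)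
    (dx : ∀ s, HasDerivAt x (x₁ s) s) (dy : ∀ s, HasDerivAt y (y₁ s) s)
    (jx : HasCubicJet x 0 1 0 (-K ^ 2 / 6)) (jx₁ : HasCubicJet x₁ 1 0 (-K ^ 2 / 2) c)
    (jy : HasCubicJet y 0 0 (K / 2) 0) (jy₁ : HasCubicJet y₁ 0 K 0 E) :
    IsTwist (foldedGen ℓ x y x₁ y₁) (ℓ⁻¹ * (1 + K * ℓ)) ℓ⁻¹ := by
  obtain rfl : x₁ = deriv x := funext fun s => (dx s).deriv.symm
  obtain rfl : y₁ = deriv y := funext fun s => (dy s).deriv.symm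
  have cx : Continuous x := continuous_iff_continuousAt.2 fun s => (ax s).continuousAt
  have cy : Continuous y := continuous_iff_continuousAt.2 fun s => (ay s).continuousAt
  have cx₁ : Continuous (deriv x) := continuous_iff_continuousAt.2 fun s => (ax s).deriv.continuousAt
  have cy₁ : Continuous (deriv y) := continuous_iff_continuousAt.2 fun s => (ay s).deriv.continuousAt
  have x0 : x 0 = 0 := tendsto_nhds_unique (cx.tendsto 0) jx.tendsto
  have y0 : y 0 = 0 := tendsto_nhds_unique (cy.tendsto 0) jy.tendsto
  have y10 : deriv y 0 = 0 := tendsto_nhds_unique (cy₁.tendsto 0) jy₁.tendsto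
  have hz : foldedGen ℓ x y (deriv x) (deriv y) 0 = 0 := by simp [foldedGen, x0, y0, y10]
  set W : ℝ × ℝ → ℝ := fun p => (x p.1 - x p.2) ^ 2 + (ℓ + y p.1 + y p.2) ^ 2
  have cW : Continuous W := by fun_prop
  have W0 : 0 < W 0 := by simp [W, x0, y0]; positivity
  have a1 : ∀ {f : ℝ → ℝ}, (∀ s, AnalyticAt ℝ f s) → ∀ p : ℝ × ℝ, AnalyticAt ℝ (fun p : ℝ × ℝ => f p.1) p :=
    fun hf p => (hf p.1).fun_comp analyticAt_fst
  have a2 : ∀ {f : ℝ → ℝ}, (∀ s, AnalyticAt ℝ f s) → ∀ p : ℝ × ℝ, AnalyticAt ℝ (fun p : ℝ × ℝ => f p.2) p :=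
    fun hf p => (hf p.2).fun_comp analyticAt_snd
  have aX : AnalyticAt ℝ (fun p : ℝ × ℝ => x p.1 - x p.2) 0 := (a1 ax 0).sub (a2 ax 0)
  have aY : AnalyticAt ℝ (fun p : ℝ × ℝ => ℓ + y p.1 + y p.2) 0 :=
    (analyticAt_const.add (a1 ay 0)).add (a2 ay 0)
  have aW : AnalyticAt ℝ (fun p => √(W p)) 0 :=
    ((Real.contDiffAt_sqrt W0.ne').analyticAt).fun_comp ((aX.pow 2).add (aY.pow 2))
  have ak : AnalyticAt ℝ (foldedGen ℓ x y (deriv x) (deriv y)) 0 :=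
    ((aX.mul (a1 (fun s => (ax s).deriv) 0)).add (aY.mul (a1 (fun s => (ay s).deriv) 0))).div aW
      (Real.sqrt_pos.2 W0).ne'
  refine ⟨ak, hz, ?_, ?_, by positivity, by nlinarith [inv_pos.2 hℓ, mul_pos hK hℓ]⟩
  · have h := foldedGen_cubic hℓ cx cy cx₁ cy₁ jx jx₁ jy jy₁
    have h2 : (fun p : ℝ × ℝ => cubic ![0, 0] 0 (foldedCubic ℓ K E) p) =O[𝓝 0] fun p => ‖p‖ ^ 2 := by
      have m : ∀ i j, i + j = 3 → ∀ a : ℝ, (fun p : ℝ × ℝ => a * (p.1 ^ i * p.2 ^ j)) =O[𝓝 0]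
          fun p => ‖p‖ ^ 2 := fun i j h a => ((isBigO_monomial i j).trans
        (isBigO_norm_pow (by omega))).const_mul_left a
      exact ((((m 3 0 rfl (foldedCubic ℓ K E 0)).add (m 2 1 rfl (foldedCubic ℓ K E 1))).add
        (m 1 2 rfl (foldedCubic ℓ K E 2))).add (m 0 3 rfl (foldedCubic ℓ K E 3))).congr_left
        fun p => by simp [cubic]
    have h3 : (fun p : ℝ × ℝ => ‖p‖ ^ 2) =o[𝓝 0] fun p => p := by
      exact isLittleO_norm_pow_id (by norm_num)
    rw [hasFDerivAt_iff_isLittleO_nhds_zero]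
    refine (((h.trans (isBigO_norm_pow (by norm_num))).add h2).trans_isLittleO h3).congr_left
      fun p => ?_
    rw [zero_add, hz]
    simp [cubic]
    ring
  · filter_upwards [ak.eventually_analyticAt, cW.continuousAt.eventually (lt_mem_nhds W0),
      (continuous_swap.tendsto (0 : ℝ × ℝ)).eventually (ak.eventually_analyticAt)] with p h1 h2 h3
    -- The mixed second derivative is computed explicitly, and its symmetry under exchange of the
    -- arguments is then visible.
    have key : ∀ p : ℝ × ℝ, AnalyticAt ℝ (foldedGen ℓ x y (deriv x) (deriv y)) p → 0 < W p →
        fderiv ℝ (foldedGen ℓ x y (deriv x) (deriv y)) p (0, 1) =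
          ((-deriv x p.2 * deriv x p.1 + deriv y p.2 * deriv y p.1) * √(W p) -
          ((x p.1 - x p.2) * deriv x p.1 + (ℓ + y p.1 + y p.2) * deriv y p.1) *
          ((2 * (x p.1 - x p.2) * (-deriv x p.2) + 2 * (ℓ + y p.1 + y p.2) * deriv y p.2) /
            (2 * √(W p)))) / √(W p) ^ 2 := by
      intro p hp hW
      have d1 : HasDerivAt (fun t => (p.1, t)) ((0 : ℝ), (1 : ℝ)) p.2 :=
        (hasDerivAt_const _ _).prodMk (hasDerivAt_id _)
      have d2 := hp.differentiableAt.hasFDerivAt.comp_hasDerivAt p.2 d1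
      have dX := (dx p.2).const_sub (x p.1)
      have dY := (dy p.2).const_add (ℓ + y p.1)
      have d3 := ((dX.mul_const (deriv x p.1)).add (dY.mul_const (deriv y p.1))).div
        (((dX.pow 2).add (dY.pow 2)).sqrt hW.ne') (Real.sqrt_pos.2 hW).ne'
      rw [d2.unique d3]
      simp [W]
    have hWs : W p.swap = W p := by simp only [W, Prod.fst_swap, Prod.snd_swap]; ring
    rw [key p h1 h2, key p.swap h3 (by rw [hWs]; exact h2), hWs]
    simp only [Prod.fst_swap, Prod.snd_swap]
    have : √(W p) ≠ 0 := (Real.sqrt_pos.2 h2).ne'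
    field_simp
    ring

end Jets

end GeneratingFunction

/-! ### The folded billiard as a twist map -/

/-- The sine a/√(a² + Y²) determines the tangent a/Y when Y > 0: squaring gives a Y' = ± b Y, and
the sign is settled because a and b cannot have opposite signs. -/
theorem div_sqrt_inj {a b Y Y' : ℝ} (hY : 0 < Y) (hY' : 0 < Y')
    (h : (√(a ^ 2 + Y ^ 2))⁻¹ * a = (√(b ^ 2 + Y' ^ 2))⁻¹ * b) : a * Y' = b * Y := by
  have p1 : 0 < a ^ 2 + Y ^ 2 := by positivity
  have p2 : 0 < b ^ 2 + Y' ^ 2 := by positivity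
  have s1 := Real.sqrt_pos.2 p1
  have s2 := Real.sqrt_pos.2 p2
  have h' : a * √(b ^ 2 + Y' ^ 2) = b * √(a ^ 2 + Y ^ 2) := by
    field_simp at h; linarith
  have hsq : (a * Y') ^ 2 = (b * Y) ^ 2 := by
    have := congrArg (· ^ 2) h'
    simp only [mul_pow, Real.sq_sqrt p1.le, Real.sq_sqrt p2.le] at this
    nlinarith
  rcases sq_eq_sq_iff_eq_or_eq_neg.1 hsq with e | e
  · exact e
  · have hab : a * b ≤ 0 := by
      have : (a * b) * (Y * Y') = -(b * Y) ^ 2 := by linear_combination (b * Y) * e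
      by_contra! hc
      nlinarith [mul_pos hc (mul_pos hY hY')]
    have hab' : 0 ≤ a * b := by
      have : (a * b) * √(b ^ 2 + Y' ^ 2) = b ^ 2 * √(a ^ 2 + Y ^ 2) := by linear_combination b * h'
      by_contra! hc
      nlinarith [mul_neg_of_neg_of_pos hc s2, mul_nonneg (sq_nonneg b) s1.le]
    rcases mul_eq_zero.1 (le_antisymm hab hab') with z | z
    · rw [z] at e ⊢
      linarith
    · rw [z] at e ⊢
      linarith

/-- The distances to the point of reflection on the wall are the parts of the total length. -/
theorem sqrt_reflect {a g Y Z : ℝ} (hY : 0 < Y) (hZ : 0 < Z) (h : a * Z = g * Y) :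
    √(a ^ 2 + Y ^ 2) = Y / Z * √(g ^ 2 + Z ^ 2) := by
  have ha : a = g * Y / Z := by rw [eq_div_iff hZ.ne', h]
  rw [show a ^ 2 + Y ^ 2 = (Y / Z) ^ 2 * (g ^ 2 + Z ^ 2) by rw [ha]; field_simp,
    Real.sqrt_mul (sq_nonneg _), Real.sqrt_sq (by positivity)]

namespace IsBounce

variable {O : Set Plane} {α : ℝ → Plane} {q : Plane}

/-- The generating function of the square of the folded billiard map. -/
noncomputable def gen (α : ℝ → Plane) (q : Plane) : ℝ × ℝ → ℝ :=
  foldedGen (dist (α 0) q) (tan α) (nor α q) (fun s => inner ℝ (deriv α s) (deriv α 0))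
    (fun s => inner ℝ (deriv α s) (normal α q))

/-- The line that carries the wall. -/
noncomputable def wall (α : ℝ → Plane) (q dir : Plane) (t : ℝ) : Plane :=
  midpoint ℝ (α 0) q + t • dir

theorem deriv_wall (dir : Plane) (t : ℝ) : deriv (wall α q dir) t = dir := by
  have : HasDerivAt (wall α q dir) ((1 : ℝ) • dir) t :=
    ((hasDerivAt_id t).smul_const dir).const_add _
  rw [this.deriv, one_smul]

theorem midpoint_eq (h : IsBounce O α q) :
    midpoint ℝ (α 0) q = α 0 - (dist (α 0) q / 2) • normal α q := by
  rw [midpoint_eq_smul_add, invOf_eq_inv]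
  conv_lhs => rw [h.end_eq]
  module

variable {dir : Plane}

theorem inner_wall (h : IsBounce O α q) (hp : inner ℝ dir (normal α q) = 0) (s t : ℝ) :
    inner ℝ (wall α q dir t - α s) (deriv α 0) = t * inner ℝ dir (deriv α 0) - tan α s ∧
      inner ℝ (wall α q dir t - α s) (normal α q) = -(dist (α 0) q / 2 + nor α q s) := by
  have e : wall α q dir t - α s = t • dir - (dist (α 0) q / 2) • normal α q - (α s - α 0) := by
    rw [wall, h.midpoint_eq]; abel
  have e1 : inner ℝ (normal α q) (deriv α 0) = 0 := by rw [real_inner_comm]; exact h.perp_normal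
  constructor
  · rw [e, inner_sub_left, inner_sub_left, real_inner_smul_left, real_inner_smul_left, e1, tan]
    ring
  · rw [e, inner_sub_left, inner_sub_left, real_inner_smul_left, real_inner_smul_left, hp,
      real_inner_self_eq_norm_sq, h.norm_normal, nor]
    ring

theorem dist_wall (h : IsBounce O α q) (hp : inner ℝ dir (normal α q) = 0) (s t : ℝ) :
    dist (α s) (wall α q dir t) = √((t * inner ℝ dir (deriv α 0) - tan α s) ^ 2 +
      (dist (α 0) q / 2 + nor α q s) ^ 2) := by
  rw [dist_comm, dist_eq_norm, ← Real.sqrt_sq (norm_nonneg _),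
    Plane.norm_sq_eq (h.param.unit_speed 0) h.norm_normal h.perp_normal, (h.inner_wall hp s t).1,
    (h.inner_wall hp s t).2, neg_sq]

theorem continuous_nor (h : IsBounce O α q) : Continuous (nor α q) :=
  continuous_iff_continuousAt.2 fun s => (h.analyticAt_coord _ s).continuousAt

theorem continuous_tan (h : IsBounce O α q) : Continuous (tan α) :=
  continuous_iff_continuousAt.2 fun s => (h.analyticAt_coord _ s).continuousAt

theorem eventually_pos (h : IsBounce O α q) :
    ∀ᶠ s in 𝓝 (0 : ℝ), 0 < dist (α 0) q / 2 + nor α q s := by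
  have c : Continuous fun s => dist (α 0) q / 2 + nor α q s := by
    have := h.continuous_nor; fun_prop
  refine c.continuousAt.eventually (lt_mem_nhds ?_)
  have := h.dist_pos
  simp only [nor, sub_self, inner_zero_left, add_zero]
  linarith

/-- Near the bounce the way between the obstacle and the wall is free. -/
theorem eventually_free (h : IsBounce O α q) (hp : inner ℝ dir (normal α q) = 0) {S Z : Set Plane}
    (hS : S ⊆ O ∪ range (wall α q dir) ∪ Z) (hZ : IsClosed Z)
    (hZd : Disjoint (segment ℝ (α 0) (midpoint ℝ (α 0) q)) Z) :
    ∀ᶠ p in 𝓝 (0 : ℝ × ℝ), Disjoint (openSegment ℝ (α p.1) (wall α q dir p.2)) S := by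
  obtain ⟨m, hm⟩ : ∃ m, m = midpoint ℝ (α 0) q := ⟨_, rfl⟩
  have hw : ∀ t, wall α q dir t = m + t • dir := fun t => by rw [hm]; rfl
  have cα : Continuous α := h.param.contDiff.continuous
  have cw : Continuous (wall α q dir) := by
    rw [show wall α q dir = fun t => m + t • dir from funext hw]
    fun_prop
  rw [← hm] at hZd
  have hseg : IsCompact (segment ℝ (α 0) m) := by
    rw [segment_eq_image]
    exact isCompact_Icc.image (by fun_prop)
  obtain ⟨δ, hδ, hth⟩ := hseg.exists_thickening_subset_open hZ.isOpen_compl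
    (Set.subset_compl_iff_disjoint_right.2 hZd)
  have w0 : wall α q dir 0 = m := by simp [hw]
  have e1 : ∀ᶠ p in 𝓝 (0 : ℝ × ℝ), dist (α p.1) (α 0) < δ := by
    have c : Continuous fun p : ℝ × ℝ => dist (α p.1) (α 0) := by fun_prop
    have c0 : dist (α (0 : ℝ × ℝ).1) (α 0) < δ := by rw [Prod.fst_zero, dist_self]; exact hδ
    exact (c.tendsto 0).eventually_lt_const c0
  have e2 : ∀ᶠ p in 𝓝 (0 : ℝ × ℝ), dist (wall α q dir p.2) m < δ := by
    have c : Continuous fun p : ℝ × ℝ => dist (wall α q dir p.2) m := by fun_prop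
    have c0 : dist (wall α q dir (0 : ℝ × ℝ).2) m < δ := by
      rw [Prod.snd_zero, w0, dist_self]; exact hδ
    exact (c.tendsto 0).eventually_lt_const c0
  have e3 : ∀ᶠ p in 𝓝 (0 : ℝ × ℝ),
      inner ℝ (wall α q dir p.2 - α p.1) (normalAt α q p.1) < 0 := by
    have c : Continuous fun p : ℝ × ℝ => inner ℝ (wall α q dir p.2 - α p.1) (normalAt α q p.1) := by
      have := h.continuous_normalAt
      fun_prop
    have c0 : inner ℝ (wall α q dir (0 : ℝ × ℝ).2 - α (0 : ℝ × ℝ).1)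
        (normalAt α q (0 : ℝ × ℝ).1) < 0 := by
      rw [Prod.fst_zero, Prod.snd_zero, h.normalAt_zero, (h.inner_wall hp 0 0).2]
      have := h.eventually_pos.self_of_nhds
      linarith
    exact (c.tendsto 0).eventually_lt_const c0
  have f1 : Tendsto (Prod.fst : ℝ × ℝ → ℝ) (𝓝 0) (𝓝 0) := continuous_fst.tendsto 0
  have e4 : ∀ᶠ p in 𝓝 (0 : ℝ × ℝ), 0 < dist (α 0) q / 2 + nor α q p.1 :=
    f1.eventually h.eventually_pos
  have e5 : ∀ᶠ p in 𝓝 (0 : ℝ × ℝ), ∀ z ∈ O, 0 ≤ inner ℝ (z - α p.1) (normalAt α q p.1) :=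
    f1.eventually h.eventually_supporting
  refine (((e1.and e2).and (e3.and e4)).and e5).mono ?_
  rintro p ⟨⟨⟨h1, h2⟩, h3, h4⟩, h5⟩
  rw [Set.disjoint_left]
  rintro z ⟨a, b, ha, hb, hab, rfl⟩ hz
  -- The supporting line at the boundary point excludes O, the wall line is reached only at the
  -- endpoint, and Z is avoided because the segment stays in a thickening of the unperturbed one.
  rcases hS hz with (hz | ⟨t, ht⟩) | hz
  · have := h5 _ hz
    have e : a • α p.1 + b • wall α q dir p.2 - α p.1 = b • (wall α q dir p.2 - α p.1) := by
      have : a = 1 - b := by linarith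
      rw [this]; module
    rw [e, real_inner_smul_left] at this
    nlinarith
  · have e : wall α q dir p.2 - wall α q dir t = a • (wall α q dir p.2 - α p.1) := by
      have : b = 1 - a := by linarith
      rw [ht, this]; module
    have e' : inner ℝ (wall α q dir p.2 - wall α q dir t) (normal α q) = 0 := by
      rw [hw, hw, add_sub_add_left_eq_sub, ← sub_smul, real_inner_smul_left, hp, mul_zero]
    rw [e, real_inner_smul_left, (h.inner_wall hp _ _).2] at e'
    nlinarith
  · have hmem : a • α 0 + b • m ∈ segment ℝ (α 0) m := ⟨a, b, ha.le, hb.le, hab, rfl⟩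
    suffices hlt : dist (a • α p.1 + b • wall α q dir p.2) (a • α 0 + b • m) < δ from
      absurd hz (hth (Metric.mem_thickening_iff.2 ⟨_, hmem, hlt⟩))
    calc dist (a • α p.1 + b • wall α q dir p.2) (a • α 0 + b • m)
        ≤ dist (a • α p.1) (a • α 0) + dist (b • wall α q dir p.2) (b • m) :=
          dist_add_add_le _ _ _ _
      _ = a * dist (α p.1) (α 0) + b * dist (wall α q dir p.2) m := by
          rw [dist_smul₀, dist_smul₀, Real.norm_of_nonneg ha.le, Real.norm_of_nonneg hb.le]
      _ < a * δ + b * δ := add_lt_add (mul_lt_mul_of_pos_left h1 ha) (mul_lt_mul_of_pos_left h2 hb)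
      _ = δ := by rw [← add_mul, hab, one_mul]

/-- The bounce on the wall is eliminated. The law of reflection forces it to lie where the straight
segment to the mirror image crosses the wall, and the flight directions at both ends are then those
of the unfolded segment, that is, the derivatives of its length. Conversely, near the orbit this
point lies on the wall and both flights are unobstructed. -/
theorem step_iff_twistStep (h : IsBounce O α q) (hd : ‖dir‖ = 1)
    (hp : inner ℝ dir (normal α q) = 0) {S Z : Set Plane} (hO : O ⊆ S)
    (hw : ∀ᶠ t in 𝓝 (0 : ℝ), wall α q dir t ∈ S)
    (hS : S ⊆ O ∪ range (wall α q dir) ∪ Z) (hZ : IsClosed Z)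
    (hZd : Disjoint (segment ℝ (α 0) (midpoint ℝ (α 0) q)) Z) :
    ∀ᶠ p in 𝓝 (0 : (ℝ × ℝ) × (ℝ × ℝ)),
      (∃ y, BilliardStep S α (wall α q dir) p.1 y ∧ BilliardStep S (wall α q dir) α y p.2) ↔
        TwistStep (gen α q) p.1 p.2 := by
  set σ := inner ℝ dir (deriv α 0) with hσ
  -- The wall is parallel to the tangent at the bounce, so σ is a sign relating the two
  -- orientations.
  have σ2 : σ * σ = 1 := by
    have := h.inner_eq dir dir
    rw [hp, real_inner_self_eq_norm_sq, hd] at this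
    linarith
  have c1 := h.continuous_nor
  have c2 := h.continuous_tan
  -- the point of reflection
  set τ : ℝ → ℝ → ℝ := fun s s' => tan α s + (tan α s' - tan α s) * (dist (α 0) q / 2 + nor α q s) /
    (dist (α 0) q + nor α q s + nor α q s') with hτ
  have t0 : Tendsto (fun p : (ℝ × ℝ) × (ℝ × ℝ) => σ * τ p.1.1 p.2.1) (𝓝 0) (𝓝 0) := by
    have : ContinuousAt (fun p : (ℝ × ℝ) × (ℝ × ℝ) => σ * τ p.1.1 p.2.1) 0 := by
      have n0 : dist (α 0) q + nor α q (0 : (ℝ × ℝ) × (ℝ × ℝ)).1.1 +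
          nor α q (0 : (ℝ × ℝ) × (ℝ × ℝ)).2.1 ≠ 0 := by simpa [nor] using h.ne
      refine ContinuousAt.mul continuousAt_const (ContinuousAt.add (by fun_prop) ?_)
      exact ContinuousAt.div (by fun_prop) (by fun_prop) n0
    have := this.tendsto
    simpa [hτ, tan] using this
  have f1 : Tendsto (fun p : (ℝ × ℝ) × (ℝ × ℝ) => p.1.1) (𝓝 0) (𝓝 0) :=
    (continuous_fst.comp continuous_fst).tendsto 0
  have f2 : Tendsto (fun p : (ℝ × ℝ) × (ℝ × ℝ) => p.2.1) (𝓝 0) (𝓝 0) :=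
    (continuous_fst.comp continuous_snd).tendsto 0
  filter_upwards [t0.eventually hw, (f1.prodMk_nhds t0).eventually (h.eventually_free hp hS hZ hZd),
    (f2.prodMk_nhds t0).eventually (h.eventually_free hp hS hZ hZd),
    f1.eventually h.eventually_pos, f2.eventually h.eventually_pos] with p b1 b2 b3 b4 b5
  obtain ⟨⟨s, r⟩, ⟨s', r'⟩⟩ := p
  simp only at b1 b2 b3 b4 b5 ⊢
  set Y := dist (α 0) q / 2 + nor α q s with hY
  set Y' := dist (α 0) q / 2 + nor α q s' with hY'
  set g := tan α s' - tan α s with hg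
  have hZZ : dist (α 0) q + nor α q s + nor α q s' = Y + Y' := by rw [hY, hY']; ring
  have hZ' : dist (α 0) q + nor α q s' + nor α q s = Y + Y' := by rw [hY, hY']; ring
  have Zp : 0 < Y + Y' := by linarith
  set H := √(g ^ 2 + (Y + Y') ^ 2) with hH
  have H0 : 0 < H := Real.sqrt_pos.2 (by positivity)
  have g1 : gen α q (s, s') = ((tan α s - tan α s') * inner ℝ (deriv α s) (deriv α 0) +
      (Y + Y') * inner ℝ (deriv α s) (normal α q)) / H := by
    simp only [gen, foldedGen, hZZ]
    rw [hH, hg, ← neg_sq, neg_sub]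
  have g2 : gen α q (s', s) = (g * inner ℝ (deriv α s') (deriv α 0) +
      (Y + Y') * inner ℝ (deriv α s') (normal α q)) / H := by
    simp only [gen, foldedGen, hZ']
    rfl
  have gd : ∀ (β : Plane) (t u : ℝ), inner ℝ β (wall α q dir t - α u) =
      inner ℝ β (deriv α 0) * (t * σ - tan α u) -
        inner ℝ β (normal α q) * (dist (α 0) q / 2 + nor α q u) := fun β t u => by
    rw [h.inner_eq, (h.inner_wall hp u t).1, (h.inner_wall hp u t).2, ← hσ]; ring
  have gd' : ∀ (β : Plane) (t u : ℝ), inner ℝ β (α u - wall α q dir t) =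
      -inner ℝ β (wall α q dir t - α u) := fun β t u => by rw [← inner_neg_right, neg_sub]
  -- the reflection law in terms of the parameter of the wall
  have core : ∀ t : ℝ, (t * σ - tan α s) * (Y + Y') = g * Y →
      √((t * σ - tan α s) ^ 2 + Y ^ 2) = Y / (Y + Y') * H ∧
      √((t * σ - tan α s') ^ 2 + Y' ^ 2) = Y' / (Y + Y') * H ∧
      t * σ - tan α s = g * Y / (Y + Y') ∧ tan α s' - t * σ = g * Y' / (Y + Y') := fun t ht => by
    refine ⟨sqrt_reflect b4 Zp ht, ?_, ?_, ?_⟩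
    · have := sqrt_reflect (a := tan α s' - t * σ) (g := g) b5 Zp (by rw [hg] at ht ⊢; linarith)
      rw [← this, ← neg_sq (t * σ - tan α s'), neg_sub]
    · rw [eq_div_iff Zp.ne', ht]
    · rw [eq_div_iff Zp.ne']; rw [hg] at ht ⊢; linarith
  have H0' := H0.ne'
  have Z0' := Zp.ne'
  have Y0' := b4.ne'
  have Y0'' := b5.ne'
  have val : ∀ t : ℝ, (t * σ - tan α s) * (Y + Y') = g * Y →
      inner ℝ (deriv α s) ((dist (α s) (wall α q dir t))⁻¹ • (wall α q dir t - α s)) =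
        -gen α q (s, s') ∧
      inner ℝ (deriv α s') ((dist (wall α q dir t) (α s'))⁻¹ • (α s' - wall α q dir t)) =
        gen α q (s', s) ∧
      inner ℝ dir ((dist (α s) (wall α q dir t))⁻¹ • (wall α q dir t - α s)) =
        inner ℝ dir ((dist (wall α q dir t) (α s'))⁻¹ • (α s' - wall α q dir t)) := fun t ht => by
    obtain ⟨e1, e2, e3, e4⟩ := core t ht
    have e5 : t * σ - tan α s' = -(g * Y' / (Y + Y')) := by linarith
    rw [dist_comm (wall α q dir t), h.dist_wall hp, h.dist_wall hp, ← hσ, ← hY, ← hY', e1, e2, g1, g2]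
    simp only [inner_smul_right, gd', gd, ← hY, ← hY', hp, e3, e5]
    refine ⟨?_, ?_, ?_⟩
    · rw [show tan α s - tan α s' = -g by rw [hg]; ring]
      field_simp
      ring
    · field_simp
      ring
    · field_simp
      ring
  constructor
  · rintro ⟨⟨t, v⟩, ⟨-, -, -, -, m1, m2⟩, ⟨-, -, -, -, m3, m4⟩⟩
    simp only at m1 m2 m3 m4
    rw [deriv_wall] at m2 m3
    -- Equality of the incoming and outgoing tangential components at the wall fixes the parameter
    -- of the bounce through `div_sqrt_inj`.
    have ht : (t * σ - tan α s) * (Y + Y') = g * Y := by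
      have hl : (√((t * σ - tan α s) ^ 2 + Y ^ 2))⁻¹ * (t * σ - tan α s) =
          (√((tan α s' - t * σ) ^ 2 + Y' ^ 2))⁻¹ * (tan α s' - t * σ) := by
        have := m2.symm.trans m3
        rw [dist_comm (wall α q dir t), h.dist_wall hp, h.dist_wall hp, ← hσ, ← hY, ← hY',
          inner_smul_right, inner_smul_right, gd', gd, gd, hp, ← hσ] at this
        rw [← neg_sq (tan α s' - t * σ), neg_sub]
        have σ0 : σ ≠ 0 := fun hz => by rw [hz] at σ2; norm_num at σ2
        apply mul_left_cancel₀ σ0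
        linear_combination this
      have := div_sqrt_inj b4 b5 hl
      rw [hg]
      linear_combination this
    obtain ⟨v1, v2, -⟩ := val t ht
    exact ⟨m1.trans v1, m4.trans v2⟩
  · rintro ⟨m1, m2⟩
    simp only at m1 m2
    have ht : (σ * τ s s' * σ - tan α s) * (Y + Y') = g * Y := by
      rw [hτ]
      simp only
      rw [hZZ, ← hg, ← hY, show ∀ a : ℝ, σ * a * σ = (σ * σ) * a from fun a => by ring, σ2]
      field_simp
      ring
    obtain ⟨v1, v2, v3⟩ := val _ ht
    have nw : ∀ u, 0 < dist (α 0) q / 2 + nor α q u → α u ≠ wall α q dir (σ * τ s s') := fun u hu e => by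
      have := (h.inner_wall hp u (σ * τ s s')).2
      rw [← e, sub_self, inner_zero_left] at this
      linarith
    refine ⟨(σ * τ s s', inner ℝ dir ((dist (α s) (wall α q dir (σ * τ s s')))⁻¹ •
      (wall α q dir (σ * τ s s') - α s))), ⟨hO (h.param.mem h.isClosed s), b1, nw s b4, b2, ?_, ?_⟩,
      ⟨b1, hO (h.param.mem h.isClosed s'), (nw s' b5).symm, ?_, ?_, ?_⟩⟩
    · exact m1.trans v1.symm
    · rw [deriv_wall]
    · rw [openSegment_symm]; exact b3
    · rw [deriv_wall]; exact v3
    · exact m2.trans v2.symm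

theorem inner_three_tan (h : IsBounce O α q) :
    inner ℝ (iteratedDeriv 3 α 0) (deriv α 0) = -curvature α 0 ^ 2 := by
  rw [real_inner_comm, ← iteratedDeriv_one]; exact h.param.inner_one_three 0

theorem inner_three_normal (h : IsBounce O α q) (hκ : deriv (curvature α) 0 = 0) :
    inner ℝ (iteratedDeriv 3 α 0) (normal α q) = 0 := by
  have := h.param.inner_two_three 0
  rw [hκ, mul_zero, h.inner_eq, h.inner_two_tan, h.inner_two_normal, zero_mul, zero_add] at this
  exact (mul_eq_zero.1 this).resolve_left (h.param.curvature_pos 0).ne'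

/-- This is the only place where K'' enters the jet used: it appears in the normal component of the
fourth derivative, and so in the cubic coefficient of y'. -/
theorem inner_four_normal (h : IsBounce O α q) (hκ : deriv (curvature α) 0 = 0) :
    inner ℝ (iteratedDeriv 4 α 0) (normal α q) =
      iteratedDeriv 2 (curvature α) 0 - curvature α 0 ^ 3 := by
  have := h.param.inner_two_four 0
  rw [hκ, h.inner_eq, h.inner_two_tan, h.inner_two_normal, zero_mul, zero_add,
    Plane.norm_sq_eq (h.param.unit_speed 0) h.norm_normal h.perp_normal, h.inner_three_tan,
    h.inner_three_normal hκ] at this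
  apply mul_left_cancel₀ (h.param.curvature_pos 0).ne'
  rw [this]; ring

/-- The generating function is a twist function, with an explicit cubic Taylor polynomial. -/
theorem isTwist_gen (h : IsBounce O α q) (hκ : deriv (curvature α) 0 = 0) :
    IsTwist (gen α q) ((dist (α 0) q)⁻¹ * (1 + curvature α 0 * dist (α 0) q)) (dist (α 0) q)⁻¹ ∧
    (fun p => gen α q p - cubic ![(dist (α 0) q)⁻¹ * (1 + curvature α 0 * dist (α 0) q),
      -(dist (α 0) q)⁻¹] 0 (foldedCubic (dist (α 0) q) (curvature α 0)
        ((iteratedDeriv 2 (curvature α) 0 - curvature α 0 ^ 3) / 6)) p) =O[𝓝 0] fun p => ‖p‖ ^ 4 := by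
  have K0 := h.param.curvature_pos 0
  have d1 : ∀ v, HasCubicJet (fun s => inner ℝ (deriv α s) v) (inner ℝ (deriv α 0) v)
      (inner ℝ (iteratedDeriv 2 α 0) v) (inner ℝ (iteratedDeriv 3 α 0) v / 2)
      (inner ℝ (iteratedDeriv 4 α 0) v / 6) := fun v => by
    have e : (fun s => inner ℝ (deriv α s) v) = deriv (fun s => inner ℝ (α s - α 0) v) :=
      funext fun s => (h.hasDerivAt_coord v s).deriv.symm
    have a := (h.analyticAt_coord v 0).deriv.hasCubicJet
    rw [← iteratedDeriv_succ', ← iteratedDeriv_succ', h.iteratedDeriv_coord, h.iteratedDeriv_coord,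
      ← iteratedDeriv_one, ← iteratedDeriv_succ, h.iteratedDeriv_coord, h.iteratedDeriv_coord] at a
    simpa [e, iteratedDeriv_one] using a
  have i2 := h.inner_two_normal
  have i2' := h.inner_two_tan
  have i3 := h.inner_three_tan
  have i3' := h.inner_three_normal hκ
  have i4 := h.inner_four_normal hκ
  have jx := h.hasCubicJet_tan.of_eq rfl rfl rfl (show _ = -curvature α 0 ^ 2 / 6 by rw [i3])
  have jy := h.hasCubicJet_nor.of_eq rfl rfl (show _ = curvature α 0 / 2 by rw [i2])
    (show _ = 0 by rw [i3', zero_div])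
  have jx₁ := (d1 (deriv α 0)).of_eq (show _ = 1 by
    rw [real_inner_self_eq_norm_sq, h.param.unit_speed]; norm_num) (show _ = 0 from i2')
    (show _ = -curvature α 0 ^ 2 / 2 by rw [i3]) rfl
  have jy₁ := (d1 (normal α q)).of_eq h.perp_normal i2 (show _ = 0 by rw [i3', zero_div])
    (show _ = (iteratedDeriv 2 (curvature α) 0 - curvature α 0 ^ 3) / 6 by rw [i4])
  have c := h.continuous_deriv
  exact ⟨isTwist_foldedGen h.dist_pos K0 (h.analyticAt_coord _) (h.analyticAt_coord _)
    (h.hasDerivAt_coord _) (h.hasDerivAt_coord _) jx jx₁ jy jy₁,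
    foldedGen_cubic h.dist_pos h.continuous_tan h.continuous_nor (by fun_prop) (by fun_prop)
      jx jx₁ jy jy₁⟩

end IsBounce

/-! ### The first Birkhoff invariant of a symmetric table -/

theorem IsTable.isClosed {D : Fin 3 → Set Plane} (h : IsTable D) (i : Fin 3) : IsClosed (D i) :=
  (h.obstacle i).compact.isClosed

theorem IsMarking.isBounce {D : Fin 3 → Set Plane} {Υ : Fin 3 → ℝ → Plane} (hT : IsTable D)
    (hM : IsMarking D Υ) : IsBounce (D 0) (Υ 0) (Υ 1 0) ∧ IsBounce (D 1) (Υ 1) (Υ 0 0) := by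
  obtain ⟨-, -, n1, f1, r1, -⟩ := hM.go
  obtain ⟨-, -, n2, f2, r2, -⟩ := hM.back
  have aux : ∀ {v w : Plane} {d : ℝ}, d ≠ 0 → (0 : ℝ) = inner ℝ v (d⁻¹ • w) → inner ℝ v w = 0 :=
    fun hd h => by
      rw [inner_smul_right] at h
      exact (mul_eq_zero.1 h.symm).resolve_left (inv_ne_zero hd)
  exact ⟨⟨hM.param 0, hT.isClosed 0, (hT.obstacle 0).convex, n1, aux (dist_ne_zero.2 n1) r1,
      f1.mono_right (subset_iUnion D 0)⟩,
    ⟨hM.param 1, hT.isClosed 1, (hT.obstacle 1).convex, n2, aux (dist_ne_zero.2 n2) r2,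
      f2.mono_right (subset_iUnion D 1)⟩⟩

/-- The contracting eigenvalue. -/
noncomputable def foldedEigenvalue (p : ℝ × ℝ) : ℝ :=
  -- This is τ − √(τ² − 1) with τ = 1 + Kℓ. The truncation changes nothing for positive ℓ and K and
  -- keeps the value positive on the whole plane.
  1 + max 0 (p.2 * p.1) - √((1 + max 0 (p.2 * p.1)) ^ 2 - 1)

theorem continuous_foldedEigenvalue : Continuous foldedEigenvalue := by
  unfold foldedEigenvalue
  fun_prop

theorem foldedEigenvalue_eq {l τ : ℝ} (h0 : 0 < l) (h1 : l < 1) (h : l + l⁻¹ = 2 * τ) :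
    l = τ - √(τ ^ 2 - 1) := by
  have h2 : 1 < l⁻¹ := (one_lt_inv₀ h0).2 h1
  have : τ ^ 2 - 1 = ((l⁻¹ - l) / 2) ^ 2 := by
    have hτ : τ = (l + l⁻¹) / 2 := by linarith
    rw [hτ]
    field_simp
    ring
  rw [this, Real.sqrt_sq (by linarith)]
  linarith

theorem foldedEigenvalue_pos (p : ℝ × ℝ) : 0 < foldedEigenvalue p := by
  unfold foldedEigenvalue
  have : 0 ≤ max 0 (p.2 * p.1) := le_max_left _ _
  rw [sub_pos, Real.sqrt_lt' (by linarith)]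
  linarith

/-- The coefficient of the second derivative of the curvature in the first Birkhoff invariant. -/
noncomputable def birkhoffCoeff (p : ℝ × ℝ) : ℝ :=
  -(p.1 * foldedEigenvalue p) / (4 * p.2 * (2 + p.2 * p.1))

/-- The part of the first Birkhoff invariant that does not involve the second derivative of the
curvature. -/
noncomputable def birkhoffRest (p : ℝ × ℝ) : ℝ := foldedEigenvalue p * p.2 / 4

theorem birkhoffCoeff_ne_zero {p : ℝ × ℝ} (h1 : 0 < p.1) (h2 : 0 < p.2) : birkhoffCoeff p ≠ 0 := by
  have := foldedEigenvalue_pos p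
  exact div_ne_zero (neg_ne_zero.2 (by positivity)) (by positivity)

/-- All symmetric expressions in l reduce to τ = 1 + Kℓ through l + l⁻¹ = 2τ; in particular (l⁻¹ −
l)² = 4Kℓ(2 + Kℓ). What is left is −ℓ l K''/(4K(2 + Kℓ)) + l K/4. -/
theorem birkhoff_formula {ℓ K K₂ l a : ℝ} (hℓ : 0 < ℓ) (hK : 0 < K) (h0 : 0 < l) (h1 : l < 1)
    (hl : ℓ⁻¹ * (l + l⁻¹) = 2 * (ℓ⁻¹ * (1 + K * ℓ)))
    (ha : a * (ℓ⁻¹ * (l⁻¹ - l)) ^ 2 = -(6 * l * foldedCubic ℓ K ((K₂ - K ^ 3) / 6) 0 +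
      3 * (1 + l ^ 2) * foldedCubic ℓ K ((K₂ - K ^ 3) / 6) 1 +
      (4 * l + l⁻¹ + l ^ 3) * foldedCubic ℓ K ((K₂ - K ^ 3) / 6) 2 +
      3 * (1 + l ^ 2) * foldedCubic ℓ K ((K₂ - K ^ 3) / 6) 3)) :
    a = birkhoffCoeff (ℓ, K) * K₂ + birkhoffRest (ℓ, K) := by
  have hKl : 0 < K * ℓ := mul_pos hK hℓ
  have hτ : l + l⁻¹ = 2 * (1 + K * ℓ) := by
    apply mul_left_cancel₀ (inv_ne_zero hℓ.ne'); linarith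
  have he : foldedEigenvalue (ℓ, K) = l := by
    rw [foldedEigenvalue_eq h0 h1 hτ, foldedEigenvalue]
    simp only [max_eq_right hKl.le]
  have hq : (l⁻¹ - l) ^ 2 = 4 * (K * ℓ) * (2 + K * ℓ) := by
    have : (l⁻¹ - l) ^ 2 = (l + l⁻¹) ^ 2 - 4 := by field_simp; ring
    rw [this, hτ]; ring
  have hl2 : 1 + l ^ 2 = 2 * (1 + K * ℓ) * l := by
    rw [← hτ]; field_simp; ring
  have hl3 : 4 * l + l⁻¹ + l ^ 3 = l * (4 * (1 + K * ℓ) ^ 2 + 2) := by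
    have : 4 * (1 + K * ℓ) ^ 2 = (l + l⁻¹) ^ 2 := by rw [hτ]; ring
    rw [this]; field_simp; ring
  rw [hl2, hl3, mul_pow, hq] at ha
  simp only [birkhoffCoeff, birkhoffRest, he]
  have e : 4 * (K * ℓ) * (2 + K * ℓ) ≠ 0 := by positivity
  have e2 : (2 + K * ℓ) ≠ 0 := by positivity
  have hK' := hK.ne'
  have hℓ' := hℓ.ne'
  have ha' : a = ℓ ^ 2 / (4 * (K * ℓ) * (2 + K * ℓ)) * (a * (ℓ⁻¹ ^ 2 * (4 * (K * ℓ) * (2 + K * ℓ)))) := by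
    field_simp
  rw [ha', ha]
  simp [foldedCubic]
  field_simp
  ring

namespace IsSymMarking

open IsBounce

variable {D : Fin 3 → Set Plane} {Υ : Fin 3 → ℝ → Plane}

theorem disjoint_segment (h : IsSymMarking D Υ) : Disjoint (segment ℝ (Υ 0 0) (Υ 1 0)) (D 2) := by
  have h0 := (h.marking.param 0).mem (h.table.isClosed 0) 0
  have h1 := (h.marking.param 1).mem (h.table.isClosed 1) 0
  refine (h.table.non_eclipse 0 1 2 (by decide) (by decide) (by decide)).mono_left ?_
  exact (convex_convexHull ℝ _).segment_subset (subset_convexHull ℝ _ (Or.inl h0))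
    (subset_convexHull ℝ _ (Or.inr h1))

theorem foldCenter_notMem (h : IsSymMarking D Υ) : foldCenter Υ ∉ D 2 := fun hc =>
  Set.disjoint_left.1 h.disjoint_segment (midpoint_mem_segment _ _) hc

/-- The kept side of a folded table, with the opposite bounce point. -/
theorem exists_bounce (h : IsSymMarking D Υ) {i : Fin 3} (hi : i = 0 ∨ i = 1) :
    ∃ q, IsBounce (D i) (Υ i) q ∧ foldCenter Υ = midpoint ℝ (Υ i 0) q ∧
      dist (Υ i 0) q = dist (Υ 0 0) (Υ 1 0) ∧ curvature (Υ i) 0 = curvature (Υ 0) 0 ∧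
      iteratedDeriv 2 (curvature (Υ i)) 0 = iteratedDeriv 2 (curvature (Υ 0)) 0 ∧
      deriv (curvature (Υ i)) 0 = 0 ∧ Disjoint (segment ℝ (Υ i 0) (foldCenter Υ)) (D 2) ∧
      ∀ v, inner ℝ v (Υ 1 0 - Υ 0 0) = 0 → inner ℝ v (normal (Υ i) q) = 0 := by
  have hm : foldCenter Υ ∈ segment ℝ (Υ 0 0) (Υ 1 0) := midpoint_mem_segment _ _
  have c := convex_segment (𝕜 := ℝ) (Υ 0 0) (Υ 1 0)
  obtain ⟨b0, b1⟩ := h.marking.isBounce h.table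
  rcases hi with rfl | rfl
  · refine ⟨Υ 1 0, b0, rfl, rfl, rfl, rfl, ?_, ?_, fun v hv => ?_⟩
    · rw [← iteratedDeriv_one]; exact h.even_jet_zero 1 odd_one
    · exact h.disjoint_segment.mono_left (c.segment_subset (left_mem_segment ℝ _ _) hm)
    · rw [normal, inner_smul_right, ← neg_sub, inner_neg_right, hv, neg_zero, mul_zero]
  · refine ⟨Υ 0 0, b1, midpoint_comm _ _, dist_comm _ _, ?_, (h.same_jets 2).symm, ?_, ?_,
      fun v hv => ?_⟩
    · simpa using (h.same_jets 0).symm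
    · rw [← iteratedDeriv_one]; exact h.even_jet_one 1 odd_one
    · exact h.disjoint_segment.mono_left (c.segment_subset (right_mem_segment ℝ _ _) hm)
    · rw [normal, inner_smul_right, hv, mul_zero]

/-- The scatterers are the kept obstacle, part of the wall line and part of the third obstacle, and
the last one stays away from the half of the orbit segment on the kept side. Near the orbit the
return map is therefore the map generated by `gen`, whatever the choices in the folding. -/
theorem isReturnMap_iff (h : IsSymMarking D Υ) (W : Folding D Υ) {q : Plane}
    (hb : IsBounce (D W.side) (Υ W.side) q) (hc : foldCenter Υ = midpoint ℝ (Υ W.side 0) q)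
    (hp : inner ℝ W.dir (normal (Υ W.side) q) = 0)
    (hd : Disjoint (segment ℝ (Υ W.side 0) (foldCenter Υ)) (D 2)) (T : ℝ × ℝ → ℝ × ℝ) :
    W.IsReturnMap T ↔ TwistRel (gen (Υ W.side) q) T := by
  have hw : W.wallParam = wall (Υ W.side) q W.dir := by
    funext t; rw [Folding.wallParam, hc, wall]
  have hS : W.scatterers ⊆ D W.side ∪ range (wall (Υ W.side) q W.dir) ∪ D 2 := by
    rw [← hw, Folding.scatterers]
    refine union_subset_union (union_subset_union subset_rfl (image_subset_range _ _)) ?_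
    rintro _ ⟨t, -, rfl⟩
    exact (h.marking.param 2).mem (h.table.isClosed 2) t
  have hw' : ∀ᶠ t in 𝓝 (0 : ℝ), wall (Υ W.side) q W.dir t ∈ W.scatterers := by
    filter_upwards [Icc_mem_nhds (neg_lt_zero.2 W.len_pos) W.len_pos] with t ht
    rw [← hw]
    exact Or.inl (Or.inr (mem_image_of_mem _ ht))
  have key := hb.step_iff_twistStep W.dir_norm hp (subset_union_left.trans subset_union_left) hw' hS
    (h.table.isClosed 2) (hc ▸ hd)
  rw [← hw] at key
  refine and_congr_right fun h0 => and_congr_right fun hT => ?_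
  have ht : Tendsto (fun x => (x, T x)) (𝓝 0) (𝓝 (0, 0)) := by
    refine tendsto_id.prodMk_nhds ?_
    have := hT.tendsto
    rwa [h0] at this
  exact eventually_congr (ht.eventually key)

theorem isFirstBirkhoffInvariant_iff (h : IsSymMarking D Υ) (W : Folding D Υ) (a : ℝ) :
    W.IsFirstBirkhoffInvariant a ↔
      a = birkhoffCoeff (dist (Υ 0 0) (Υ 1 0), curvature (Υ 0) 0) *
          iteratedDeriv 2 (curvature (Υ 0)) 0 +
        birkhoffRest (dist (Υ 0 0) (Υ 1 0), curvature (Υ 0) 0) := by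
  obtain ⟨q, hb, hc, e1, e2, e3, e4, hd, hp⟩ := h.exists_bounce W.side_eq
  have hR := h.isReturnMap_iff W hb hc (hp _ W.dir_perp) hd
  obtain ⟨htw, hcub⟩ := hb.isTwist_gen e4
  have key : ∀ T Δ, TwistRel (gen (Υ W.side) q) T → IsBirkhoffNormalForm T Δ →
      deriv Δ 0 = birkhoffCoeff (dist (Υ 0 0) (Υ 1 0), curvature (Υ 0) 0) *
          iteratedDeriv 2 (curvature (Υ 0)) 0 +
        birkhoffRest (dist (Υ 0 0) (Υ 1 0), curvature (Υ 0) 0) := fun T Δ hT hN => by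
    obtain ⟨f1, f2⟩ := htw.deriv_normalForm hcub hT hN
    rw [← e1, ← e2, ← e3]
    exact birkhoff_formula hb.dist_pos (hb.param.curvature_pos 0) hN.2.1 hN.2.2.1 f1 f2
  constructor
  · rintro ⟨T, Δ, hT, hN, rfl⟩
    exact key T Δ ((hR T).1 hT) hN
  · rintro rfl
    obtain ⟨T, Δ, hT, hN⟩ := htw.exists_twistRel
    exact ⟨T, Δ, (hR T).2 hT, hN, key T Δ hT hN⟩

/-- The centre of the wall lies outside the third obstacle by the non-eclipse condition, so a short
wall is admissible. If some boundary point of the third obstacle is strictly on the side of the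
first bounce, a short arc there works; otherwise the whole boundary is on the other side and the
second obstacle is kept. -/
theorem nonempty_folding (h : IsSymMarking D Υ) : Nonempty (Folding D Υ) := by
  obtain ⟨b0, -⟩ := h.marking.isBounce h.table
  have n0 := h.foldCenter_notMem
  obtain ⟨ε, hε, hball⟩ := Metric.isOpen_iff.1 (h.table.isClosed 2).isOpen_compl _ n0
  have hd : ‖deriv (Υ 0) 0‖ = 1 := (h.marking.param 0).unit_speed 0
  have hperp : inner ℝ (deriv (Υ 0) 0) (Υ 1 0 - Υ 0 0) = 0 := b0.perp
  have hfree : ∀ t : ℝ, |t| ≤ ε / 2 → foldCenter Υ + t • deriv (Υ 0) 0 ∉ D 2 := fun t ht => by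
    refine hball ?_
    rw [Metric.mem_ball, dist_self_add_left, norm_smul, hd, mul_one, Real.norm_eq_abs]
    linarith
  have opp : Υ 1 0 - foldCenter Υ = -(Υ 0 0 - foldCenter Υ) := by
    rw [foldCenter, midpoint_eq_smul_add, invOf_eq_inv]
    module
  have cΥ := (h.marking.param 2).contDiff.continuous
  by_cases hc : ∃ t, 0 < inner ℝ (Υ 2 t - foldCenter Υ) (Υ 0 0 - foldCenter Υ)
  · obtain ⟨t, ht⟩ := hc
    have : ∀ᶠ u in 𝓝 t, 0 < inner ℝ (Υ 2 u - foldCenter Υ) (Υ 0 0 - foldCenter Υ) :=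
      ((cΥ.sub continuous_const).inner continuous_const).continuousAt.eventually_const_lt ht
    obtain ⟨δ, hδ, hb⟩ := Metric.eventually_nhds_iff.1 this
    refine ⟨⟨0, Or.inl rfl, deriv (Υ 0) 0, hd, hperp, ε / 2, half_pos hε, hfree, t, t + δ / 2,
      by linarith, fun u hu => (hb ?_).le⟩⟩
    rw [Real.dist_eq, abs_of_nonneg (by linarith [hu.1])]
    linarith [hu.2]
  · push Not at hc
    refine ⟨⟨1, Or.inr rfl, deriv (Υ 0) 0, hd, hperp, ε / 2, half_pos hε, hfree, 0, 1,
      one_pos, fun u _ => ?_⟩⟩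
    rw [opp, inner_neg_right]
    linarith [hc u]

end IsSymMarking

theorem continuousOn_birkhoffCoeff : ContinuousOn birkhoffCoeff {p | 0 < p.1 ∧ 0 < p.2} := by
  have := continuous_foldedEigenvalue
  refine ContinuousOn.div (by fun_prop) (by fun_prop) ?_
  rintro p ⟨h1, h2⟩
  positivity

theorem continuous_birkhoffRest : Continuous birkhoffRest := by
  have := continuous_foldedEigenvalue
  unfold birkhoffRest
  fun_prop

theorem isNondegenerate_iff {D : Fin 3 → Set Plane} :
    IsNondegenerate D ↔ ∃ Υ, IsSymMarking D Υ ∧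
      birkhoffCoeff (dist (Υ 0 0) (Υ 1 0), curvature (Υ 0) 0) *
          iteratedDeriv 2 (curvature (Υ 0)) 0 +
        birkhoffRest (dist (Υ 0 0) (Υ 1 0), curvature (Υ 0) 0) ≠ 0 := by
  refine exists_congr fun Υ => and_congr_right fun h => ⟨?_, fun hn => ?_⟩
  · rintro ⟨W, a, ha, h0⟩
    rwa [← (h.isFirstBirkhoffInvariant_iff W a).1 ha]
  · obtain ⟨W⟩ := h.nonempty_folding
    exact ⟨W, _, (h.isFirstBirkhoffInvariant_iff W _).2 rfl, hn⟩

/-! ### Continuity of jets of loops in the C^r topologies. -/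

theorem Plane.norm_le_add (v : Plane) : ‖v‖ ≤ |v 0| + |v 1| := by
  rw [EuclideanSpace.norm_eq, Real.sqrt_le_left (by positivity), Fin.sum_univ_two, Real.norm_eq_abs,
    Real.norm_eq_abs]
  nlinarith [mul_nonneg (abs_nonneg (v 0)) (abs_nonneg (v 1))]

theorem isOpen_strip (ρ : ℝ) : IsOpen {z : ℂ | |z.im| < ρ} :=
  isOpen_lt (Complex.continuous_im.abs) continuous_const

namespace AnalyticOnNhd

variable {g : ℝ → Plane}

theorem hasDerivAt_iteratedDeriv (h : AnalyticOnNhd ℝ g univ) (n : ℕ) (x : ℝ) :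
    HasDerivAt (iteratedDeriv n g) (iteratedDeriv (n + 1) g x) x := by
  rw [iteratedDeriv_succ, iteratedDeriv_eq_iterate]
  exact ((h x (mem_univ x)).iterated_deriv n).differentiableAt.hasDerivAt

theorem hasDerivAt_coord (h : AnalyticOnNhd ℝ g univ) (i : Fin 2) (n : ℕ) (x : ℝ) :
    HasDerivAt (fun x => iteratedDeriv n g x i) (iteratedDeriv (n + 1) g x i) x :=
  (EuclideanSpace.proj i : Plane →L[ℝ] ℝ).hasFDerivAt.comp_hasDerivAt x
    (h.hasDerivAt_iteratedDeriv n x)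

end AnalyticOnNhd

namespace AnalyticLoop

theorem continuous_iteratedDeriv (f : AnalyticLoop) (n : ℕ) : Continuous (iteratedDeriv n f.1) :=
  continuous_iff_continuousAt.2 fun x => (f.2.1.hasDerivAt_iteratedDeriv n x).continuousAt

theorem IsExtension.analyticAt {f : AnalyticLoop} {ρ : ℝ} {F : ℂ → Fin 2 → ℂ}
    (h : f.IsExtension ρ F) (i : Fin 2) {z : ℂ} (hz : |z.im| < ρ) :
    AnalyticAt ℂ (fun z => F z i) z :=
  (differentiableOn_pi.1 h.1 i).analyticAt ((isOpen_strip ρ).mem_nhds hz)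

theorem IsExtension.iteratedDeriv_eq {f : AnalyticLoop} {ρ : ℝ} (hρ : 0 < ρ) {F : ℂ → Fin 2 → ℂ}
    (h : f.IsExtension ρ F) (i : Fin 2) (n : ℕ) (x : ℝ) :
    iteratedDeriv n (fun z => F z i) x = (iteratedDeriv n f.1 x i : ℝ) := by
  induction n generalizing x with
  | zero => exact h.2 x i
  | succ n ih =>
    have h1 : HasDerivAt (iteratedDeriv n fun z => F z i)
        (iteratedDeriv (n + 1) (fun z => F z i) x) (x : ℂ) := by
      rw [iteratedDeriv_succ, iteratedDeriv_eq_iterate]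
      exact ((h.analyticAt i (by simpa using hρ)).iterated_deriv n).differentiableAt.hasDerivAt
    have h2 := h1.comp_ofReal
    rw [funext ih] at h2
    exact h2.unique (f.2.1.hasDerivAt_coord i n x).ofReal_comp

/-- Cauchy's estimate for each coordinate on discs of radius ρ/2 centred on the real axis; the
factor 2 accounts for the two coordinates. It shows that the analytic topology controls every
derivative uniformly. -/
theorem norm_iteratedDeriv_sub_le {f g : AnalyticLoop} {ρ : ℝ} (hρ : 0 < ρ) {F G : ℂ → Fin 2 → ℂ}
    (hf : f.IsExtension ρ F) (hg : g.IsExtension ρ G) {ε : ℝ}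
    (h : ∀ z : ℂ, |z.im| < ρ → ‖G z - F z‖ ≤ ε) (n : ℕ) (x : ℝ) :
    dist (iteratedDeriv n g.1 x) (iteratedDeriv n f.1 x) ≤
      2 * (n.factorial * ε / (ρ / 2) ^ n) := by
  have key : ∀ i, |(iteratedDeriv n g.1 x - iteratedDeriv n f.1 x) i| ≤
      n.factorial * ε / (ρ / 2) ^ n := fun i => by
    have hstrip : ∀ z ∈ Metric.closedBall (x : ℂ) (ρ / 2), |z.im| < ρ := fun z hz => by
      have h1 := (Complex.abs_im_le_norm (z - x)).trans (mem_closedBall_iff_norm.1 hz)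
      rw [Complex.sub_im, Complex.ofReal_im, sub_zero] at h1
      linarith
    have hx : |(x : ℂ).im| < ρ := by simpa using hρ
    have e : iteratedDeriv n (fun z => G z i - F z i) (x : ℂ) =
        (((iteratedDeriv n g.1 x - iteratedDeriv n f.1 x) i : ℝ) : ℂ) := by
      have := iteratedDeriv_sub (n := n) (hg.analyticAt i hx).contDiffAt
        (hf.analyticAt i hx).contDiffAt
      rw [show (fun z => G z i - F z i) = (fun z => G z i) - fun z => F z i from rfl, this,
        hg.iteratedDeriv_eq hρ, hf.iteratedDeriv_eq hρ]
      simp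
    have := Complex.norm_iteratedDeriv_le_of_forall_mem_sphere_norm_le n (half_pos hρ)
      (c := (x : ℂ)) (f := fun z => G z i - F z i) (C := ε) ?_ fun z hz => ?_
    · rw [e, Complex.norm_real] at this
      exact this
    · refine DifferentiableOn.diffContOnCl fun z hz => ?_
      have hz' := hstrip z (Metric.closure_ball_subset_closedBall hz)
      exact ((hg.analyticAt i hz').sub (hf.analyticAt i hz')).differentiableAt.differentiableWithinAt
    · exact (norm_le_pi_norm (G z - F z) i).trans (h z (hstrip z (Metric.sphere_subset_closedBall hz)))
  rw [dist_eq_norm]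
  refine (Plane.norm_le_add _).trans ?_
  linarith [key 0, key 1]

theorem continuous_ofFun_iteratedDeriv {r : WithTop ℕ∞} {j : ℕ} (hj : (j : WithTop ℕ∞) ≤ r) :
    @Continuous AnalyticLoop (UniformFun ℝ Plane) (loopTopology r) _
      fun f => UniformFun.ofFun (iteratedDeriv j f.1) := by
  rw [continuous_iff_le_induced]
  match r, hj with
  | WithTop.some r, hj =>
    exact iInf₂_le (f := fun (j : ℕ) (_ : (j : ℕ∞) ≤ r) => TopologicalSpace.induced
      (fun f : AnalyticLoop => UniformFun.ofFun (iteratedDeriv j f.1)) _) j (by exact_mod_cast hj)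
  | ⊤, _ =>
    rintro _ ⟨V, hV, rfl⟩ ρ hρ f hf F hF
    obtain ⟨δ, hδ, hV'⟩ := ((UniformFun.hasBasis_nhds_of_basis ℝ Plane _
      Metric.uniformity_basis_dist).mem_iff).1 (hV.mem_nhds hf)
    have hc : 0 < 2 * (j.factorial / (ρ / 2) ^ j) := by positivity
    refine ⟨δ / 2 / (2 * (j.factorial / (ρ / 2) ^ j)), by positivity, fun g G hG hd =>
      hV' fun x => ?_⟩
    have := norm_iteratedDeriv_sub_le hρ hF hG hd j x
    simp only [mem_ofPred_eq]
    rw [dist_comm]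
    refine this.trans_lt ?_
    have e : 2 * (j.factorial * (δ / 2 / (2 * (j.factorial / (ρ / 2) ^ j))) / (ρ / 2) ^ j) = δ / 2 := by
      field_simp
    rw [e]
    linarith

theorem loopTopology_top_le (r : WithTop ℕ∞) : loopTopology ⊤ ≤ loopTopology r := by
  match r with
  | ⊤ => exact le_rfl
  | WithTop.some r =>
    exact le_iInf₂ fun j _ => continuous_iff_le_induced.1 (continuous_ofFun_iteratedDeriv le_top)

/-- The jets of a loop depend continuously on the loop and on the parameter. -/
theorem continuous_jet {r : WithTop ℕ∞} {j : ℕ} (hj : (j : WithTop ℕ∞) ≤ r) :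
    let := loopTopology r
    Continuous fun p : AnalyticLoop × ℝ => iteratedDeriv j p.1.1 p.2 := by
  let := loopTopology r
  rw [continuous_iff_continuousAt]
  rintro ⟨f, x⟩
  have h1 : Tendsto (fun p : AnalyticLoop × ℝ => p.1) (𝓝 (f, x)) (𝓝 f) := continuous_fst.tendsto _
  have h2 : Tendsto (fun p : AnalyticLoop × ℝ => p.2) (𝓝 (f, x)) (𝓝 x) := continuous_snd.tendsto _
  rw [ContinuousAt, Metric.tendsto_nhds]
  intro ε hε
  have e1 : ∀ᶠ g : AnalyticLoop in 𝓝 f, ∀ y,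
      dist (iteratedDeriv j f.1 y) (iteratedDeriv j g.1 y) < ε / 2 :=
    (continuous_ofFun_iteratedDeriv hj).continuousAt.eventually
      ((UniformFun.hasBasis_nhds_of_basis ℝ Plane _ Metric.uniformity_basis_dist).mem_of_mem
        (half_pos hε))
  have e2 := Metric.tendsto_nhds.1 ((f.continuous_iteratedDeriv j).tendsto x) _ (half_pos hε)
  filter_upwards [h1.eventually e1, h2.eventually e2] with p hp1 hp2
  have := hp1 p.2
  rw [dist_comm] at this
  linarith [dist_triangle (iteratedDeriv j p.1.1 p.2) (iteratedDeriv j f.1 p.2)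
    (iteratedDeriv j f.1 x)]

end AnalyticLoop

/-! ### Local reparametrizations, and the orbit (12) as the unique shortest segment. -/

namespace IsArcLengthParam

variable {O : Set Plane} {α : ℝ → Plane}

theorem hasDerivAt (h : IsArcLengthParam O α) (s : ℝ) : HasDerivAt α (deriv α s) s := by
  simpa using h.hasDerivAt_iteratedDeriv 0 s

/-- The points of the curve near `α 0` have small parameters. -/
theorem exists_param_of_dist_lt (h : IsArcLengthParam O α) {ε : ℝ} (hε : 0 < ε) :
    ∃ δ > 0, ∀ p ∈ frontier O, dist p (α 0) < δ → ∃ s, |s| < ε ∧ α s = p := by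
  obtain ⟨L, hL, hper, hinj⟩ := h.closed_simple
  have c := h.contDiff.continuous
  -- One period centred at 0 with a neighbourhood of 0 removed: by simplicity of the curve, α avoids
  -- α(0) on this compact set, hence stays at a positive distance.
  set C := Icc (-(L / 2)) (L / 2) ∩ {s : ℝ | ε ≤ |s|} with hC
  have hCc : IsCompact C := isCompact_Icc.inter_right (isClosed_le continuous_const continuous_abs)
  have hne : ∀ s ∈ C, 0 < dist (α s) (α 0) := by
    rintro s ⟨⟨h1, h2⟩, h3⟩
    have h3 : ε ≤ |s| := h3
    refine dist_pos.2 fun he => ?_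
    rcases le_or_gt 0 s with h0 | h0
    · have := hinj ⟨h0, by linarith⟩ ⟨le_rfl, hL⟩ he
      rw [this, abs_zero] at h3
      linarith
    · rw [← hper s] at he
      have := hinj ⟨by linarith, by linarith⟩ ⟨le_rfl, hL⟩ he
      linarith
  obtain ⟨δ, hδ, hδC⟩ : ∃ δ > 0, ∀ s ∈ C, δ ≤ dist (α s) (α 0) := by
    rcases C.eq_empty_or_nonempty with h0 | h0
    · exact ⟨1, one_pos, by simp [h0]⟩
    · obtain ⟨s, hs, hmin⟩ := hCc.exists_isMinOn h0
        (f := fun s => dist (α s) (α 0)) (c.dist continuous_const).continuousOn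
      exact ⟨_, hne s hs, fun t ht => hmin ht⟩
  refine ⟨δ, hδ, fun p hp hd => ?_⟩
  rw [← h.range_eq] at hp
  obtain ⟨s, rfl⟩ := hp
  obtain ⟨t, ht, hst⟩ := hper.exists_mem_Ico hL s (-(L / 2))
  refine ⟨t, ?_, hst.symm⟩
  by_contra! hc
  rw [hst] at hd
  exact absurd (hδC t ⟨⟨ht.1, by linarith [ht.2]⟩, hc⟩) (not_le.2 hd)

/-- A curve in the boundary is locally a reparametrization of the arc-length parametrization. -/
theorem exists_reparam (h : IsArcLengthParam O α) {g : ℝ → Plane} {θ : ℝ} (hg : AnalyticAt ℝ g θ)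
    (hgO : ∀ᶠ y in 𝓝 θ, g y ∈ frontier O) (h0 : g θ = α 0) :
    ∃ σ : ℝ → ℝ, AnalyticAt ℝ σ θ ∧ σ θ = 0 ∧ ∀ᶠ y in 𝓝 θ, g y = α (σ y) := by
  -- The tangential coordinate at α(0) is a local analytic parameter of the curve; σ is obtained by
  -- reading it along g.
  set T : Plane → ℝ := fun p => inner ℝ (p - α 0) (deriv α 0) with hT
  have Ta : ∀ {f : ℝ → Plane} {x : ℝ}, AnalyticAt ℝ f x → AnalyticAt ℝ (fun y => T (f y)) x :=
    fun {f x} hf => by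
      have : ContDiffAt ℝ ω (fun y => inner ℝ (f y - α 0) (deriv α 0)) x :=
        ContDiffAt.inner ℝ (hf.contDiffAt.sub contDiffAt_const) contDiffAt_const
      exact this.analyticAt
  have Td : HasDerivAt (fun s => T (α s)) 1 0 := by
    have := ((h.hasDerivAt 0).sub_const (α 0)).inner ℝ (hasDerivAt_const 0 (deriv α 0))
    simpa [h.unit_speed 0, real_inner_self_eq_norm_sq] using this
  obtain ⟨τ, τa, τ0, hτ, -⟩ := (Ta (h.analytic 0 (mem_univ 0))).exists_local_inverse_real Td one_ne_zero
  have T0 : T (α 0) = 0 := by simp [hT]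
  rw [T0] at τa τ0
  refine ⟨fun y => τ (T (g y)), AnalyticAt.fun_comp_of_eq (f := fun y => T (g y)) τa (Ta hg)
    (by rw [h0, T0]), by simp only [h0, T0, τ0], ?_⟩
  obtain ⟨ε, hε, hb⟩ := Metric.eventually_nhds_iff.1 hτ
  obtain ⟨δ, hδ, hs⟩ := h.exists_param_of_dist_lt hε
  have hd : ∀ᶠ y in 𝓝 θ, dist (g y) (α 0) < δ := by
    have := hg.continuousAt.tendsto
    rw [h0] at this
    exact Metric.tendsto_nhds.1 this δ hδ
  filter_upwards [hgO, hd] with y h1 h2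
  obtain ⟨s, hs1, hs2⟩ := hs _ h1 h2
  rw [← hs2, hb (by simpa using hs1)]

end IsArcLengthParam

namespace IsBounce

variable {O : Set Plane} {α : ℝ → Plane} {q : Plane}

/-- The supporting line at the bounce point meets the obstacle at that point only. -/
theorem eq_of_inner_normal_eq_zero (h : IsBounce O α q) {p : Plane} (hp : p ∈ O)
    (h0 : inner ℝ (p - α 0) (normal α q) = 0) : p = α 0 := by
  set t := inner ℝ (p - α 0) (deriv α 0) with ht
  have d1 := h.param.hasDerivAt 0
  have d2 : ∀ v, HasDerivAt (fun s => inner ℝ (deriv α s) v) (inner ℝ (iteratedDeriv 2 α 0) v) 0 :=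
    fun v => by simpa using h.hasDerivAt_iteratedDeriv v 1 0
  have dn : HasDerivAt (normalAt α q) (-(curvature α 0) • deriv α 0) 0 := by
    have := ((d2 (deriv α 0)).smul_const (normal α q)).sub ((d2 (normal α q)).smul_const (deriv α 0))
    rw [h.inner_two_tan, h.inner_two_normal, zero_smul, zero_sub, ← neg_smul] at this
    exact this
  have d := (d1.const_sub p).inner ℝ dn
  rw [h.normalAt_zero, inner_neg_left, h.perp_normal, inner_smul_right, ← ht, neg_zero, add_zero] at d
  -- If p lies on the supporting line at α(0), its nonnegative height over the nearby tangent lines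
  -- is minimal at s = 0. The derivative there is −κ t, so the tangential offset t vanishes.
  have hmin : IsLocalMin (fun s => inner ℝ (p - α s) (normalAt α q s)) 0 := by
    filter_upwards [h.eventually_supporting] with s hs
    rw [h.normalAt_zero, h0]
    exact hs p hp
  have := hmin.hasDerivAt_eq_zero d
  have ht0 : t = 0 := by
    have k0 := h.param.curvature_pos 0
    rcases mul_eq_zero.1 this with h1 | h1
    · linarith
    · exact h1
  have e := h.inner_eq (p - α 0) (p - α 0)
  rw [h0, ← ht, ht0, mul_zero, add_zero, inner_self_eq_zero] at e
  exact sub_eq_zero.1 e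

end IsBounce

namespace IsMarking

variable {D : Fin 3 → Set Plane} {Υ : Fin 3 → ℝ → Plane}

/-- Cauchy–Schwarz with the unit vector along the orbit; the two inward normals are opposite. As
both obstacles lie behind their supporting lines, the bounce points realize the distance between
them. -/
theorem dist_le_inner (hT : IsTable D) (hM : IsMarking D Υ) (p p' : Plane) :
    dist (Υ 0 0) (Υ 1 0) + inner ℝ (p - Υ 0 0) (IsBounce.normal (Υ 0) (Υ 1 0)) +
      inner ℝ (p' - Υ 1 0) (IsBounce.normal (Υ 1) (Υ 0 0)) ≤ dist p p' := by
  obtain ⟨b0, b1⟩ := hM.isBounce hT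
  set n := IsBounce.normal (Υ 0) (Υ 1 0) with hn
  have e : IsBounce.normal (Υ 1) (Υ 0 0) = -n := by
    rw [hn, IsBounce.normal, IsBounce.normal, dist_comm, ← smul_neg, neg_sub]
  have e2 : inner ℝ (Υ 0 0 - Υ 1 0) n = dist (Υ 0 0) (Υ 1 0) := by
    conv_lhs => rw [b0.end_eq]
    rw [sub_sub_cancel, real_inner_smul_left, real_inner_self_eq_norm_sq, b0.norm_normal]
    ring
  rw [e, ← e2, inner_neg_right, ← inner_neg_left, ← inner_add_left, ← inner_add_left, dist_eq_norm]
  have : Υ 0 0 - Υ 1 0 + (p - Υ 0 0) + -(p' - Υ 1 0) = p - p' := by abel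
  rw [this]
  refine (real_inner_le_norm _ _).trans ?_
  rw [b0.norm_normal, mul_one]

theorem dist_le (hT : IsTable D) (hM : IsMarking D Υ) {p p' : Plane} (hp : p ∈ D 0)
    (hp' : p' ∈ D 1) : dist (Υ 0 0) (Υ 1 0) ≤ dist p p' := by
  obtain ⟨b0, b1⟩ := hM.isBounce hT
  linarith [hM.dist_le_inner hT p p', b0.supporting hp, b1.supporting hp']

theorem eq_of_dist_le (hT : IsTable D) (hM : IsMarking D Υ) {p p' : Plane} (hp : p ∈ D 0)
    (hp' : p' ∈ D 1) (h : dist p p' ≤ dist (Υ 0 0) (Υ 1 0)) : p = Υ 0 0 ∧ p' = Υ 1 0 := by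
  obtain ⟨b0, b1⟩ := hM.isBounce hT
  have h1 := hM.dist_le_inner hT p p'
  have h2 := b0.supporting hp
  have h3 := b1.supporting hp'
  exact ⟨b0.eq_of_inner_normal_eq_zero hp (by linarith), b1.eq_of_inner_normal_eq_zero hp' (by linarith)⟩

end IsMarking

/-! ### The curvature in terms of the jet of a regular parametrization -/

/-- The determinant of two vectors of the plane. -/
def Plane.cross (v w : Plane) : ℝ := v 0 * w 1 - v 1 * w 0

theorem Plane.cross_sq (v w : Plane) : Plane.cross v w ^ 2 = ‖v‖ ^ 2 * ‖w‖ ^ 2 - inner ℝ v w ^ 2 := by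
  rw [EuclideanSpace.real_norm_sq_eq, EuclideanSpace.real_norm_sq_eq, PiLp.inner_apply]
  simp only [Fin.sum_univ_two, Plane.cross, RCLike.inner_apply, conj_trivial]
  ring

/-- The curvature of a curve with the jet `J`. -/
noncomputable def jetCurvature (J : ℕ → Plane) : ℝ :=
  √(Plane.cross (J 1) (J 2) ^ 2 / (‖J 1‖ ^ 2) ^ 3)

/-- The second derivative of the curvature, with respect to arc length, of a curve with the jet `J`,
at a critical point of the curvature. -/
noncomputable def jetCurvature₂ (J : ℕ → Plane) : ℝ :=
  (2 * Plane.cross (J 1) (J 3) ^ 2 +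
    2 * Plane.cross (J 1) (J 2) * (Plane.cross (J 2) (J 3) + Plane.cross (J 1) (J 4)) -
    Plane.cross (J 1) (J 2) ^ 2 / (‖J 1‖ ^ 2) ^ 3 *
      (6 * ‖J 1‖ ^ 2 * (2 * inner ℝ (J 1) (J 2)) ^ 2 +
        3 * (‖J 1‖ ^ 2) ^ 2 * (2 * (‖J 2‖ ^ 2 + inner ℝ (J 1) (J 3))))) /
    (2 * jetCurvature J * (‖J 1‖ ^ 2) ^ 4)

theorem AnalyticOnNhd.hasDerivAt_cross {g : ℝ → Plane} (hg : AnalyticOnNhd ℝ g univ) (m n : ℕ) (y : ℝ) :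
    HasDerivAt (fun y => Plane.cross (iteratedDeriv m g y) (iteratedDeriv n g y))
      (Plane.cross (iteratedDeriv m g y) (iteratedDeriv (n + 1) g y) +
        Plane.cross (iteratedDeriv (m + 1) g y) (iteratedDeriv n g y)) y := by
  have := ((hg.hasDerivAt_coord 0 m y).mul (hg.hasDerivAt_coord 1 n y)).sub
    ((hg.hasDerivAt_coord 1 m y).mul (hg.hasDerivAt_coord 0 n y))
  refine this.congr_deriv ?_
  simp only [Plane.cross]
  ring

theorem AnalyticOnNhd.hasDerivAt_inner {g : ℝ → Plane} (hg : AnalyticOnNhd ℝ g univ) (m n : ℕ) (y : ℝ) :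
    HasDerivAt (fun y => inner ℝ (iteratedDeriv m g y) (iteratedDeriv n g y))
      (inner ℝ (iteratedDeriv m g y) (iteratedDeriv (n + 1) g y) +
        inner ℝ (iteratedDeriv (m + 1) g y) (iteratedDeriv n g y)) y :=
  (hg.hasDerivAt_iteratedDeriv m y).inner ℝ (hg.hasDerivAt_iteratedDeriv n y)

theorem Plane.cross_self (v : Plane) : Plane.cross v v = 0 := by
  rw [Plane.cross]; ring

/-- With g = α ∘ σ locally, cross(g', g'')² = |g'|⁶ κ(σ)². This identity is differentiated twice at
θ; since κ'(0) = 0, the second derivative of κ(σ)² there is 2κκ''σ'², with σ'² = |g'|². No choice of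
orientation matters because of the square. -/
theorem IsArcLengthParam.jet_eq {O : Set Plane} {α : ℝ → Plane} (h : IsArcLengthParam O α)
    (hκ : deriv (curvature α) 0 = 0) {g : ℝ → Plane} {θ : ℝ} (hg : AnalyticOnNhd ℝ g univ)
    (hgO : ∀ y, g y ∈ frontier O) (h0 : g θ = α 0) (hd : deriv g θ ≠ 0) :
    jetCurvature (fun j => iteratedDeriv j g θ) = curvature α 0 ∧
      jetCurvature₂ (fun j => iteratedDeriv j g θ) = iteratedDeriv 2 (curvature α) 0 := by
  obtain ⟨σ, σa, σ0, hσ⟩ := h.exists_reparam (hg θ (mem_univ θ)) (.of_forall hgO) h0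
  have κpos := h.curvature_pos 0
  set G : ℕ → ℝ → Plane := fun j => iteratedDeriv j g with hG
  have σd : ∀ᶠ y in 𝓝 θ, HasDerivAt σ (deriv σ y) y :=
    σa.eventually_analyticAt.mono fun y hy => hy.differentiableAt.hasDerivAt
  have σd2 : ∀ᶠ y in 𝓝 θ, HasDerivAt (deriv σ) (deriv (deriv σ) y) y :=
    σa.eventually_analyticAt.mono fun y hy => hy.deriv.differentiableAt.hasDerivAt
  have g1 : ∀ᶠ y in 𝓝 θ, G 1 y = deriv σ y • deriv α (σ y) := by
    filter_upwards [hσ.eventually_nhds, σd] with y h1 h2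
    have h3 := (h.hasDerivAt (σ y)).scomp y h2
    rw [hG]
    simp only [iteratedDeriv_one]
    exact ((EventuallyEq.hasDerivAt_iff (f₀ := g) h1).2 h3).deriv
  have g2 : ∀ᶠ y in 𝓝 θ, G 2 y = deriv σ y ^ 2 • iteratedDeriv 2 α (σ y) +
      deriv (deriv σ) y • deriv α (σ y) := by
    filter_upwards [g1.eventually_nhds, σd, σd2] with y h1 h2 h3
    have h4 : HasDerivAt (deriv α) (iteratedDeriv 2 α (σ y)) (σ y) := by
      simpa using h.hasDerivAt_iteratedDeriv 1 (σ y)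
    have h5 := h3.smul (h4.scomp y h2)
    have h6 := ((EventuallyEq.hasDerivAt_iff (f₀ := G 1) h1).2 h5).unique
      (hg.hasDerivAt_iteratedDeriv 1 y)
    rw [show G 2 y = iteratedDeriv (1 + 1) g y from rfl, ← h6, pow_two, mul_smul]
    rfl
  have nG : ∀ᶠ y in 𝓝 θ, inner ℝ (G 1 y) (G 1 y) = deriv σ y ^ 2 := by
    filter_upwards [g1] with y h1
    rw [h1, real_inner_self_eq_norm_sq, norm_smul, h.unit_speed, mul_one, Real.norm_eq_abs, sq_abs]
  set k : ℝ → ℝ := fun y => curvature α (σ y) ^ 2 with hk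
  have main : ∀ᶠ y in 𝓝 θ, Plane.cross (G 1 y) (G 2 y) ^ 2 = inner ℝ (G 1 y) (G 1 y) ^ 3 * k y := by
    filter_upwards [g1, g2, nG] with y h1 h2 h3
    rw [h3, h1, h2]
    have e : Plane.cross (deriv σ y • deriv α (σ y)) (deriv σ y ^ 2 • iteratedDeriv 2 α (σ y) +
      deriv (deriv σ) y • deriv α (σ y)) =
        deriv σ y ^ 3 * Plane.cross (deriv α (σ y)) (iteratedDeriv 2 α (σ y)) := by
      simp only [Plane.cross, PiLp.add_apply, PiLp.smul_apply, smul_eq_mul]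
      ring
    have e2 := h.inner_one_two (σ y)
    rw [iteratedDeriv_one] at e2
    rw [e, mul_pow, Plane.cross_sq, h.unit_speed, e2]
    simp only [hk, curvature]
    ring
  have κd : ∀ s, HasDerivAt (curvature α) (deriv (curvature α) s) s := fun s =>
    (h.analyticAt_curvature s).differentiableAt.hasDerivAt
  have κd2 : HasDerivAt (deriv (curvature α)) (iteratedDeriv 2 (curvature α) 0) 0 := by
    rw [iteratedDeriv_succ, iteratedDeriv_one]
    exact (h.analyticAt_curvature 0).deriv.differentiableAt.hasDerivAt
  set k₁ : ℝ → ℝ := fun y => 2 * curvature α (σ y) * (deriv (curvature α) (σ y) * deriv σ y) with hk₁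
  have kd : ∀ᶠ y in 𝓝 θ, HasDerivAt k (k₁ y) y := by
    filter_upwards [σd] with y h1
    have := ((κd (σ y)).comp y h1).pow 2
    refine this.congr_deriv ?_
    simp [hk₁]
  have main₁ : ∀ᶠ y in 𝓝 θ, 2 * Plane.cross (G 1 y) (G 2 y) * Plane.cross (G 1 y) (G 3 y) =
      3 * inner ℝ (G 1 y) (G 1 y) ^ 2 * (2 * inner ℝ (G 1 y) (G 2 y)) * k y +
        inner ℝ (G 1 y) (G 1 y) ^ 3 * k₁ y := by
    filter_upwards [main.eventually_nhds, kd] with y h1 h2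
    have d1 := (hg.hasDerivAt_cross 1 2 y).pow 2
    have d2 := ((hg.hasDerivAt_inner 1 1 y).pow 3).mul h2
    have := ((EventuallyEq.hasDerivAt_iff h1).1 d1).unique d2
    simp only [Nat.reduceAdd, Plane.cross_self, add_zero, Nat.cast_ofNat, Nat.reduceSub, pow_one,
      real_inner_comm (iteratedDeriv 1 g y) (iteratedDeriv 2 g y), Pi.pow_apply] at this
    rw [this]
    ring
  have k1θ : k₁ θ = 0 := by simp only [hk₁, σ0, hκ, zero_mul, mul_zero]
  have k2 : HasDerivAt k₁ (2 * curvature α 0 * (iteratedDeriv 2 (curvature α) 0 * deriv σ θ ^ 2)) θ := by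
    have c1 := ((κd (σ θ)).comp θ σd.self_of_nhds).const_mul 2
    rw [← σ0] at κd2
    have c2 := (κd2.comp θ σd.self_of_nhds).mul σd2.self_of_nhds
    refine (c1.mul c2).congr_deriv ?_
    simp only [Function.comp, σ0, hκ, Pi.mul_apply]
    ring
  have m0 := main.self_of_nhds
  have m2 : 2 * Plane.cross (G 1 θ) (G 3 θ) ^ 2 + 2 * Plane.cross (G 1 θ) (G 2 θ) *
      (Plane.cross (G 2 θ) (G 3 θ) + Plane.cross (G 1 θ) (G 4 θ)) =
      (6 * inner ℝ (G 1 θ) (G 1 θ) * (2 * inner ℝ (G 1 θ) (G 2 θ)) ^ 2 +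
        3 * inner ℝ (G 1 θ) (G 1 θ) ^ 2 *
          (2 * (inner ℝ (G 2 θ) (G 2 θ) + inner ℝ (G 1 θ) (G 3 θ)))) * k θ +
        inner ℝ (G 1 θ) (G 1 θ) ^ 3 *
          (2 * curvature α 0 * (iteratedDeriv 2 (curvature α) 0 * deriv σ θ ^ 2)) := by
    have d1 := ((hg.hasDerivAt_cross 1 2 θ).const_mul 2).mul (hg.hasDerivAt_cross 1 3 θ)
    have d2 := (((((hg.hasDerivAt_inner 1 1 θ).pow 2).const_mul 3).mul
      ((hg.hasDerivAt_inner 1 2 θ).const_mul 2)).mul kd.self_of_nhds).add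
        (((hg.hasDerivAt_inner 1 1 θ).pow 3).mul k2)
    have := ((EventuallyEq.hasDerivAt_iff main₁).1 d1).unique d2
    simp only [Nat.reduceAdd, Plane.cross_self, add_zero, Nat.cast_ofNat, Nat.reduceSub, pow_one,
      real_inner_comm (iteratedDeriv 1 g θ) (iteratedDeriv 2 g θ), Pi.pow_apply, Pi.mul_apply,
      k1θ, mul_zero] at this
    simp only [hG]
    linear_combination this
  have M0 : inner ℝ (G 1 θ) (G 1 θ) ≠ 0 := by
    simp only [hG, iteratedDeriv_one]
    exact inner_self_ne_zero.2 hd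
  have kθ : k θ = curvature α 0 ^ 2 := by simp only [hk, σ0]
  have J1 : jetCurvature (fun j => iteratedDeriv j g θ) = curvature α 0 := by
    rw [jetCurvature, ← real_inner_self_eq_norm_sq, m0, mul_div_cancel_left₀ _ (pow_ne_zero 3 M0),
      kθ, Real.sqrt_sq κpos.le]
  refine ⟨J1, ?_⟩
  rw [jetCurvature₂, J1]
  simp only [← real_inner_self_eq_norm_sq]
  rw [m2, m0, mul_div_cancel_left₀ _ (pow_ne_zero 3 M0), ← nG.self_of_nhds]
  have := κpos.ne'
  field_simp
  ring

/-- The first Birkhoff invariant in terms of the length of the orbit and of a jet of the boundary. -/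
noncomputable def jetInvariant (ℓ : ℝ) (J : ℕ → Plane) : ℝ :=
  birkhoffCoeff (ℓ, jetCurvature J) * jetCurvature₂ J + birkhoffRest (ℓ, jetCurvature J)

@[fun_prop]
theorem Plane.continuous_cross {X : Type*} [TopologicalSpace X] {a b : X → Plane}
    (ha : Continuous a) (hb : Continuous b) : Continuous fun x => Plane.cross (a x) (b x) := by
  unfold Plane.cross
  fun_prop

/-- The second derivative of the curvature involves the fourth derivative of the loop, which is why
openness requires r ≥ 4. -/
theorem continuousAt_jetInvariant {X : Type*} [TopologicalSpace X] {ℓ : X → ℝ} {J : X → ℕ → Plane}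
    (hℓ : Continuous ℓ) (hJ : ∀ j ≤ 4, Continuous fun x => J x j) {x : X} (h0 : 0 < ℓ x)
    (h1 : J x 1 ≠ 0) (h2 : 0 < jetCurvature (J x)) :
    ContinuousAt (fun x => jetInvariant (ℓ x) (J x)) x := by
  have c1 := hJ 1 (by norm_num)
  have c2 := hJ 2 (by norm_num)
  have c3 := hJ 3 (by norm_num)
  have c4 := hJ 4 le_rfl
  have n1 : ‖J x 1‖ ≠ 0 := norm_ne_zero_iff.2 h1
  have q : ContinuousAt (fun x => Plane.cross (J x 1) (J x 2) ^ 2 / (‖J x 1‖ ^ 2) ^ 3) x :=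
    ContinuousAt.div (by fun_prop) (by fun_prop) (by positivity)
  have k : ContinuousAt (fun x => jetCurvature (J x)) x := q.sqrt
  have k2 : ContinuousAt (fun x => jetCurvature₂ (J x)) x := by
    refine ContinuousAt.div (ContinuousAt.sub (by fun_prop) (q.mul (by fun_prop)))
      (ContinuousAt.mul (by fun_prop) (by fun_prop)) ?_
    positivity
  have hb : ContinuousAt birkhoffCoeff (ℓ x, jetCurvature (J x)) :=
    continuousOn_birkhoffCoeff.continuousAt (IsOpen.mem_nhds
      ((isOpen_lt continuous_const continuous_fst).inter (isOpen_lt continuous_const continuous_snd))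
      ⟨h0, h2⟩)
  have p : ContinuousAt (fun x => (ℓ x, jetCurvature (J x))) x := hℓ.continuousAt.prodMk k
  exact ((ContinuousAt.comp (f := fun x => (ℓ x, jetCurvature (J x))) hb p).mul k2).add
    (ContinuousAt.comp (f := fun x => (ℓ x, jetCurvature (J x)))
      continuous_birkhoffRest.continuousAt p)

/-! ### Openness of nondegeneracy. -/

namespace Wsym

variable {f : Fin 3 → AnalyticLoop}

theorem mem_frontier (hf : f ∈ Wsym) (i : Fin 3) (y : ℝ) : (f i).1 y ∈ frontier (region (f i)) := by
  rw [(hf.1 i).convex]; exact mem_range_self y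

theorem mem_region (i : Fin 3) (y : ℝ) : (f i).1 y ∈ region (f i) :=
  subset_convexHull ℝ _ (mem_range_self y)

theorem exists_param (hf : f ∈ Wsym) {Υ : Fin 3 → ℝ → Plane}
    (h : IsSymMarking (fun i => region (f i)) Υ) (i : Fin 3) (s : ℝ) :
    ∃ θ ∈ Icc 0 (2 * Real.pi), (f i).1 θ = Υ i s := by
  have : Υ i s ∈ range (f i).1 := by
    rw [← (hf.1 i).convex, ← (h.marking.param i).range_eq]; exact mem_range_self s
  obtain ⟨y, hy⟩ := this
  obtain ⟨θ, hθ, he⟩ := (f i).2.2.exists_mem_Ico₀ Real.two_pi_pos y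
  exact ⟨θ, Ico_subset_Icc_self hθ, by rw [← he, hy]⟩

theorem jet_eq (hf : f ∈ Wsym) {Υ : Fin 3 → ℝ → Plane}
    (h : IsSymMarking (fun i => region (f i)) Υ) {θ : ℝ} (h0 : (f 0).1 θ = Υ 0 0) :
    jetCurvature (fun j => iteratedDeriv j (f 0).1 θ) = curvature (Υ 0) 0 ∧
      jetCurvature₂ (fun j => iteratedDeriv j (f 0).1 θ) = iteratedDeriv 2 (curvature (Υ 0)) 0 :=
  (h.marking.param 0).jet_eq (by rw [← iteratedDeriv_one]; exact h.even_jet_zero 1 odd_one)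
    (f 0).2.1
    (fun y => mem_frontier hf 0 y) h0 ((hf.1 0).regular θ)

/-- Nondegeneracy persists under perturbations of the triple of loops. -/
theorem eventually_isNondegenerate {r : WithTop ℕ∞} (hr : 4 ≤ r) (hf : f ∈ Wsym)
    (hn : IsNondegenerate fun i => region (f i)) :
    let := loopTopology r
    ∀ᶠ g in 𝓝 f, g ∈ Wsym → IsNondegenerate fun i => region (g i) := by
  let := loopTopology r
  obtain ⟨Υ, h, hΥ⟩ := isNondegenerate_iff.1 hn
  have cj : ∀ j ≤ 4, ∀ i, Continuous fun p : (Fin 3 → AnalyticLoop) × ℝ =>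
      iteratedDeriv j (p.1 i).1 p.2 := fun j hj i =>
    Continuous.comp (f := fun p : (Fin 3 → AnalyticLoop) × ℝ => (p.1 i, p.2))
      (AnalyticLoop.continuous_jet (r := r) (le_trans (by exact_mod_cast hj) hr))
      (((continuous_apply i).comp continuous_fst).prodMk continuous_snd)
  have c0 : ∀ j ≤ 4, Continuous fun p : (Fin 3 → AnalyticLoop) × (ℝ × ℝ) =>
      iteratedDeriv j (p.1 0).1 p.2.1 := fun j hj =>
    (cj j hj 0).comp (continuous_fst.prodMk (continuous_fst.comp continuous_snd))
  have c1 : Continuous fun p : (Fin 3 → AnalyticLoop) × (ℝ × ℝ) => (p.1 1).1 p.2.2 :=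
    (cj 0 (by norm_num) 1).comp (continuous_fst.prodMk (continuous_snd.comp continuous_snd))
  have cd : Continuous fun p : (Fin 3 → AnalyticLoop) × (ℝ × ℝ) =>
      dist ((p.1 0).1 p.2.1) ((p.1 1).1 p.2.2) := (c0 0 (by norm_num)).dist c1
  -- The claim is local in (g, y) and the parameter square is compact, so it suffices to prove it
  -- near (f, y) for each y; no continuous selection of minimizers is needed.
  have key : ∀ᶠ g in 𝓝 f, ∀ y ∈ Icc 0 (2 * Real.pi) ×ˢ Icc 0 (2 * Real.pi),
      (∀ z z', dist ((g 0).1 y.1) ((g 1).1 y.2) ≤ dist ((g 0).1 z) ((g 1).1 z')) →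
        jetInvariant (dist ((g 0).1 y.1) ((g 1).1 y.2)) (fun j => iteratedDeriv j (g 0).1 y.1) ≠ 0 := by
    refine IsCompact.eventually_forall_of_forall_eventually (isCompact_Icc.prod isCompact_Icc)
      fun y _ => ?_
    -- A minimizing pair for f is the pair of bounces, where the invariant is nonzero and
    -- continuous. A pair that is not minimizing remains so after perturbation, and the premise
    -- fails.
    by_cases hy : ∀ z z', dist ((f 0).1 y.1) ((f 1).1 y.2) ≤ dist ((f 0).1 z) ((f 1).1 z')
    · obtain ⟨θ, -, h0⟩ := exists_param hf h 0 0
      obtain ⟨θ', -, h1⟩ := exists_param hf h 1 0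
      obtain ⟨e0, e1⟩ := h.marking.eq_of_dist_le h.table (mem_region 0 y.1) (mem_region 1 y.2)
        (by rw [← h0, ← h1]; exact hy θ θ')
      obtain ⟨k1, k2⟩ := jet_eq hf h e0
      have hdist : dist ((f 0).1 y.1) ((f 1).1 y.2) = dist (Υ 0 0) (Υ 1 0) := by rw [e0, e1]
      have hc := continuousAt_jetInvariant (x := (f, y)) cd c0
        (by
          simp only [hdist]
          exact (h.marking.isBounce h.table).1.dist_pos)
        (by simp only [iteratedDeriv_one]; exact (hf.1 0).regular _)
        (by simp only [k1]; exact (h.marking.param 0).curvature_pos 0)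
      refine (hc.eventually_ne ?_).mono fun p hp _ => hp
      simp only [jetInvariant, k1, k2, hdist]
      exact hΥ
    · push Not at hy
      obtain ⟨z, z', hz⟩ := hy
      have c2 : Continuous fun p : (Fin 3 → AnalyticLoop) × (ℝ × ℝ) =>
          dist ((p.1 0).1 z) ((p.1 1).1 z') :=
        ((cj 0 (by norm_num) 0).comp (continuous_fst.prodMk continuous_const)).dist
          ((cj 0 (by norm_num) 1).comp (continuous_fst.prodMk continuous_const))
      refine (ContinuousAt.eventually_lt (x₀ := (f, y)) c2.continuousAt cd.continuousAt hz).mono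
        fun p hp hp' => ?_
      exact absurd (hp' z z') (not_le.2 hp)
  refine key.mono fun g hg hW => ?_
  obtain ⟨Θ, hΘ⟩ := hW.2
  obtain ⟨θ, hθ, h0⟩ := exists_param hW hΘ 0 0
  obtain ⟨θ', hθ', h1⟩ := exists_param hW hΘ 1 0
  refine isNondegenerate_iff.2 ⟨Θ, hΘ, ?_⟩
  obtain ⟨k1, k2⟩ := jet_eq hW hΘ h0
  have := hg (θ, θ') ⟨hθ, hθ'⟩ fun z z' => by
    simp only [h0, h1]
    exact hΘ.marking.dist_le hΘ.table (mem_region 0 z) (mem_region 1 z')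
  simpa only [jetInvariant, k1, k2, h0, h1] using this

end Wsym

theorem isOpen_isNondegenerate {r : WithTop ℕ∞} (hr : 4 ≤ r) :
    IsOpen[tableTopology r] {D : Bsym | IsNondegenerate D.1} := by
  let := loopTopology r
  rw [isOpen_coinduced]
  change IsOpen (toTable ⁻¹' {D : Bsym | IsNondegenerate D.1})
  rw [isOpen_iff_mem_nhds]
  intro f hf
  filter_upwards [continuous_subtype_val.continuousAt.eventually
    (Wsym.eventually_isNondegenerate hr f.2 hf)] with g hg
  exact hg g.2

/-! ### Bounded holomorphic extensions to strips -/

theorem AnalyticAt.exists_uniform_extension {u : ℝ → ℝ} {x : ℝ} (hu : AnalyticAt ℝ u x) :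
    ∃ δ > 0, ∃ B : ℝ, ∀ x' : ℝ, |x' - x| < δ → ∃ H : ℂ → ℂ,
      DifferentiableOn ℂ H (Metric.ball x' δ) ∧ (∀ z ∈ Metric.ball (x' : ℂ) δ, ‖H z‖ ≤ B) ∧
      ∀ y : ℝ, |y - x'| < δ → H y = u y := by
  obtain ⟨H, hH, hHu⟩ := hu.exists_complexification
  obtain ⟨r₁, h₁, hb₁⟩ := Metric.eventually_nhds_iff.1 (hH.eventually_analyticAt.and
    (hH.continuousAt.norm.eventually_lt_const (lt_add_one _)))
  obtain ⟨r₂, h₂, hb₂⟩ := Metric.eventually_nhds_iff.1 hHu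
  have sub : ∀ x' : ℝ, |x' - x| < min r₁ r₂ / 2 → ∀ z ∈ Metric.ball (x' : ℂ) (min r₁ r₂ / 2),
      dist z x < min r₁ r₂ := fun x' hx z hz => by
    have h1 : dist (x' : ℂ) x < min r₁ r₂ / 2 := by
      rw [dist_eq_norm, ← Complex.ofReal_sub, Complex.norm_real]; exact hx
    linarith [dist_triangle z x' x, Metric.mem_ball.1 hz]
  refine ⟨min r₁ r₂ / 2, by positivity, ‖H x‖ + 1, fun x' hx' => ⟨H, fun z hz => ?_, fun z hz => ?_,
    fun y hy => ?_⟩⟩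
  · exact (hb₁ ((sub x' hx' z hz).trans_le (min_le_left _ _))).1.differentiableAt.differentiableWithinAt
  · exact (hb₁ ((sub x' hx' z hz).trans_le (min_le_left _ _))).2.le
  · refine hb₂ ?_
    rw [Real.dist_eq]
    have := abs_sub_le y x' x
    linarith [min_le_right r₁ r₂]

/-- A periodic analytic function has a bounded holomorphic extension to a strip. -/
theorem AnalyticOnNhd.exists_strip_extension {u : ℝ → ℝ} (hu : AnalyticOnNhd ℝ u univ) {L : ℝ}
    (hL : 0 < L) (hper : Function.Periodic u L) :
    ∃ ρ > 0, ∃ B : ℝ, ∃ H : ℂ → ℂ, DifferentiableOn ℂ H {z | |z.im| < ρ} ∧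
      (∀ z : ℂ, |z.im| < ρ → ‖H z‖ ≤ B) ∧ ∀ x : ℝ, H x = u x := by
  have hcomp : ∃ δ > 0, ∃ B : ℝ, ∀ x ∈ Icc 0 L, ∃ H : ℂ → ℂ,
      DifferentiableOn ℂ H (Metric.ball x δ) ∧ (∀ z ∈ Metric.ball (x : ℂ) δ, ‖H z‖ ≤ B) ∧
      ∀ y : ℝ, |y - x| < δ → H y = u y := by
    -- Compactness of one period provides a common radius and a common bound for the local
    -- extensions.
    refine (isCompact_Icc (a := (0 : ℝ)) (b := L)).induction_on (p := fun S => ∃ δ > 0, ∃ B : ℝ, ∀ x ∈ S, ∃ H : ℂ → ℂ,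
      DifferentiableOn ℂ H (Metric.ball x δ) ∧ (∀ z ∈ Metric.ball (x : ℂ) δ, ‖H z‖ ≤ B) ∧
      ∀ y : ℝ, |y - x| < δ → H y = u y) ⟨1, one_pos, 0, by simp⟩ ?_ ?_ ?_
    · rintro S T hST ⟨δ, hδ, B, h⟩
      exact ⟨δ, hδ, B, fun x hx => h x (hST hx)⟩
    · rintro S T ⟨δ, hδ, B, h⟩ ⟨δ', hδ', B', h'⟩
      refine ⟨min δ δ', lt_min hδ hδ', max B B', fun x hx => ?_⟩
      rcases hx with hx | hx
      · obtain ⟨H, a, b, c⟩ := h x hx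
        have s := Metric.ball_subset_ball (x := (x : ℂ)) (min_le_left δ δ')
        exact ⟨H, a.mono s, fun z hz => (b z (s hz)).trans (le_max_left _ _),
          fun y hy => c y (hy.trans_le (min_le_left _ _))⟩
      · obtain ⟨H, a, b, c⟩ := h' x hx
        have s := Metric.ball_subset_ball (x := (x : ℂ)) (min_le_right δ δ')
        exact ⟨H, a.mono s, fun z hz => (b z (s hz)).trans (le_max_right _ _),
          fun y hy => c y (hy.trans_le (min_le_right _ _))⟩
    · intro x _
      obtain ⟨δ, hδ, B, h⟩ := (hu x (mem_univ x)).exists_uniform_extension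
      refine ⟨Metric.ball x δ, mem_nhdsWithin_of_mem_nhds (Metric.ball_mem_nhds x hδ), δ, hδ, B,
        fun x' hx' => h x' ?_⟩
      rwa [← Real.dist_eq]
  obtain ⟨δ, hδ, B, hloc⟩ := hcomp
  have hall : ∀ x : ℝ, ∃ H : ℂ → ℂ,
      DifferentiableOn ℂ H (Metric.ball x δ) ∧ (∀ z ∈ Metric.ball (x : ℂ) δ, ‖H z‖ ≤ B) ∧
      ∀ y : ℝ, |y - x| < δ → H y = u y := fun x => by
    -- Any centre is brought into one period by a translation, with the same radius and bound.
    obtain ⟨k, hk, -⟩ := existsUnique_sub_zsmul_mem_Ico hL x 0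
    rw [zero_add, zsmul_eq_mul] at hk
    obtain ⟨H, a, b, c⟩ := hloc _ (Ico_subset_Icc_self hk)
    have m : ∀ z ∈ Metric.ball (x : ℂ) δ,
        z - ((k * L : ℝ) : ℂ) ∈ Metric.ball ((x - k * L : ℝ) : ℂ) δ := fun z hz => by
      rw [Metric.mem_ball, dist_eq_norm] at hz ⊢
      convert! hz using 2
      push_cast; ring
    refine ⟨fun z => H (z - ((k * L : ℝ) : ℂ)), fun z hz => ?_, fun z hz => b _ (m z hz),
      fun y hy => ?_⟩
    · have := (a _ (m z hz)).differentiableAt (Metric.isOpen_ball.mem_nhds (m z hz))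
      exact (this.comp (f := fun z => z - ((k * L : ℝ) : ℂ)) z
        (differentiableAt_id.sub_const _)).differentiableWithinAt
    · simp only
      rw [← Complex.ofReal_sub, c _ (by rwa [sub_sub_sub_cancel_right])]
      exact_mod_cast hper.sub_int_mul_eq k
  choose H a b c using hall
  have mem : ∀ z : ℂ, |z.im| < δ → z ∈ Metric.ball (z.re : ℂ) δ := fun z hz => by
    rw [Metric.mem_ball, dist_eq_norm]
    have : z - (z.re : ℂ) = z.im * Complex.I := by
      rw [sub_eq_iff_eq_add, add_comm]; exact (Complex.re_add_im z).symm
    rw [this, norm_mul, Complex.norm_I, mul_one, Complex.norm_real]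
    exact hz
  -- Two local extensions agree at real points near z.re, hence on the convex intersection of their
  -- discs by the identity theorem.
  have glue : ∀ z₀ : ℂ, ∀ z ∈ Metric.ball (z₀.re : ℂ) δ, H z.re z = H z₀.re z := fun z₀ z hz => by
    have hz' := mem_ball_iff_norm.1 hz
    have him : |z.im| < δ := by
      have := (Complex.abs_im_le_norm (z - z₀.re)).trans_lt hz'
      simpa using this
    have hre : |z.re - z₀.re| < δ := by
      have := (Complex.abs_re_le_norm (z - z₀.re)).trans_lt hz'
      simpa using this
    have o := Metric.isOpen_ball (x := (z.re : ℂ)) (ε := δ)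
    have o' := Metric.isOpen_ball (x := (z₀.re : ℂ)) (ε := δ)
    have pre : IsPreconnected (Metric.ball (z.re : ℂ) δ ∩ Metric.ball (z₀.re : ℂ) δ) :=
      ((convex_ball _ _).inter (convex_ball _ _)).isPreconnected
    have h0 : (z.re : ℂ) ∈ Metric.ball (z.re : ℂ) δ ∩ Metric.ball (z₀.re : ℂ) δ := by
      refine ⟨Metric.mem_ball_self hδ, ?_⟩
      rw [mem_ball_iff_norm, ← Complex.ofReal_sub, Complex.norm_real]
      exact hre
    refine AnalyticOnNhd.eqOn_of_preconnected_of_frequently_eq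
      (((a z.re).mono inter_subset_left).analyticOnNhd (o.inter o'))
      (((a z₀.re).mono inter_subset_right).analyticOnNhd (o.inter o')) pre h0 ?_ ⟨mem z him, hz⟩
    have t : Tendsto (fun y : ℝ => (y : ℂ)) (𝓝[≠] z.re) (𝓝[≠] (z.re : ℂ)) :=
      tendsto_nhdsWithin_of_tendsto_nhds_of_eventually_within _
        (Complex.continuous_ofReal.continuousAt.tendsto.mono_left nhdsWithin_le_nhds)
        (by filter_upwards [self_mem_nhdsWithin] with y hy
            exact fun h => hy (Complex.ofReal_injective h))
    refine t.frequently (Eventually.frequently ?_)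
    filter_upwards [mem_nhdsWithin_of_mem_nhds (Metric.ball_mem_nhds z.re (sub_pos.2 hre)),
      mem_nhdsWithin_of_mem_nhds (Metric.ball_mem_nhds z.re hδ)] with y hy hy'
    rw [Metric.mem_ball, Real.dist_eq] at hy hy'
    rw [c _ _ hy', c]
    linarith [abs_sub_le y z.re z₀.re]
  refine ⟨δ, hδ, B, fun z => H z.re z, fun z hz => ?_, fun z hz => b _ _ (mem z hz), fun x => ?_⟩
  · have hn := Metric.isOpen_ball.mem_nhds (mem z hz)
    have h1 := (a z.re).differentiableAt hn
    refine (h1.congr_of_eventuallyEq ?_).differentiableWithinAt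
    filter_upwards [hn] with w hw
    exact glue z w hw
  · simp only [Complex.ofReal_re]
    exact c x x (by simpa using hδ)

/-- Boundedness is what makes a small multiple of the extension uniformly small on the strip; it is
used to show that stretched loops converge in the analytic topology. -/
theorem AnalyticLoop.exists_bounded_extension (f : AnalyticLoop) :
    ∃ ρ > 0, ∃ B : ℝ, ∃ F, f.IsExtension ρ F ∧ ∀ z : ℂ, |z.im| < ρ → ∀ i, ‖F z i‖ ≤ B := by
  have ha : ∀ i, AnalyticOnNhd ℝ (fun x => f.1 x i) univ := fun i x hx =>
    (EuclideanSpace.proj i : Plane →L[ℝ] ℝ).analyticAt _ |>.comp (f.2.1 x hx)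
  have hp : ∀ i, Function.Periodic (fun x => f.1 x i) (2 * Real.pi) := fun i x => by
    simp only [f.2.2 x]
  have key := fun i => (ha i).exists_strip_extension Real.two_pi_pos (hp i)
  choose ρ hρ B H h1 h2 h3 using key
  refine ⟨min (ρ 0) (ρ 1), lt_min (hρ 0) (hρ 1), max (B 0) (B 1), fun z i => H i z, ⟨?_, ?_⟩, ?_⟩
  · refine differentiableOn_pi.2 fun i => (h1 i).mono fun z hz => ?_
    have hz : |z.im| < min (ρ 0) (ρ 1) := hz
    fin_cases i
    · exact hz.trans_le (min_le_left _ _)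
    · exact hz.trans_le (min_le_right _ _)
  · exact fun x i => h3 i x
  · intro z hz i
    fin_cases i
    · exact (h2 0 z (hz.trans_le (min_le_left _ _))).trans (le_max_left _ _)
    · exact (h2 1 z (hz.trans_le (min_le_right _ _))).trans (le_max_right _ _)

/-! ### Every table of the class is enclosed by loops -/

/-- Starting from a point of a bounded set, one leaves the set in both directions of any line, so
the point lies between two boundary points. -/
theorem convexHull_frontier_eq {O : Set Plane} (hc : IsCompact O) (hO : Convex ℝ O) :
    convexHull ℝ (frontier O) = O := by
  refine (convexHull_min hc.isClosed.frontier_subset hO).antisymm fun p hp => ?_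
  obtain ⟨R, hR, hb⟩ := hc.isBounded.subset_closedBall_lt 0 p
  obtain ⟨v, hv⟩ := exists_norm_eq Plane (show 0 ≤ R + 1 by linarith)
  have key : ∀ w : Plane, ‖w‖ = R + 1 → ∃ t : ℝ, 0 ≤ t ∧ p + t • w ∈ frontier O := fun w hw => by
    have hq : p + w ∉ O := fun h => by
      have := hb h
      rw [Metric.mem_closedBall, dist_self_add_left, hw] at this
      linarith
    obtain ⟨x, hx, hxO⟩ : (segment ℝ p (p + w) ∩ frontier O).Nonempty := by
      by_contra! hne
      have hi : ∀ x ∈ segment ℝ p (p + w), x ∈ O → x ∈ interior O := fun x hx hxO => by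
        by_contra hxi
        have : x ∈ segment ℝ p (p + w) ∩ frontier O := ⟨hx, subset_closure hxO, hxi⟩
        rw [hne] at this
        exact this
      obtain ⟨x, -, h1, h2⟩ := (convex_segment (𝕜 := ℝ) p (p + w)).isPreconnected (interior O) Oᶜ
        isOpen_interior hc.isClosed.isOpen_compl
        (fun x hx => (em (x ∈ O)).imp (hi x hx) id)
        ⟨p, left_mem_segment ℝ _ _, hi p (left_mem_segment ℝ _ _) hp⟩
        ⟨p + w, right_mem_segment ℝ _ _, hq⟩
      exact h2 (interior_subset h1)
    rw [segment_eq_image'] at hx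
    obtain ⟨t, ht, rfl⟩ := hx
    exact ⟨t, ht.1, by simpa using hxO⟩
  obtain ⟨t, ht, h1⟩ := key v hv
  obtain ⟨t', ht', h2⟩ := key (-v) (by rw [norm_neg, hv])
  refine (convex_convexHull ℝ _).segment_subset (subset_convexHull ℝ _ h1)
    (subset_convexHull ℝ _ h2) ?_
  rcases (add_nonneg ht ht').eq_or_lt' with h0 | h0
  · have : t = 0 := by linarith
    rw [this, zero_smul, add_zero]
    exact left_mem_segment ℝ _ _
  · refine ⟨t' / (t + t'), t / (t + t'), by positivity, by positivity, by field_simp; ring, ?_⟩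
    match_scalars
    · field_simp; ring
    · field_simp; ring

/-- The arc-length parametrization is rescaled to period 2π; its convex hull is the obstacle,
because a compact convex set is the hull of its boundary. -/
theorem IsObstacle.exists_loop {O : Set Plane} (hO : IsObstacle O) :
    ∃ f : AnalyticLoop, IsConvexLoop f ∧ region f = O := by
  obtain ⟨α, h⟩ := hO.boundary
  obtain ⟨L, hL, hper, hinj⟩ := h.closed_simple
  have π0 := Real.pi_pos
  set κ := L / (2 * Real.pi) with hκ
  have κ0 : 0 < κ := by positivity
  have κL : κ * (2 * Real.pi) = L := by rw [hκ]; field_simp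
  have hf : AnalyticOnNhd ℝ (fun θ => α (κ * θ)) univ := fun θ _ =>
    AnalyticAt.fun_comp (g := α) (f := fun θ => κ * θ) (h.analytic _ (mem_univ _))
      (analyticAt_const.mul analyticAt_id)
  have hd : ∀ θ, HasDerivAt (fun θ => α (κ * θ)) (κ • deriv α (κ * θ)) θ := fun θ => by
    have := (h.hasDerivAt (κ * θ)).scomp θ ((hasDerivAt_id θ).const_mul κ)
    rwa [mul_one] at this
  have hr : range (fun θ => α (κ * θ)) = frontier O := by
    rw [← h.range_eq]
    refine Subset.antisymm (range_comp_subset_range (fun θ => κ * θ) α) ?_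
    rintro _ ⟨s, rfl⟩
    exact ⟨κ⁻¹ * s, by simp only [mul_inv_cancel_left₀ κ0.ne']⟩
  let f : AnalyticLoop := ⟨fun θ => α (κ * θ), hf, fun θ => by
    simp only [mul_add, κL]; exact hper _⟩
  have hreg : region f = O := by
    rw [region, show range f.1 = frontier O from hr, convexHull_frontier_eq hO.compact hO.convex]
  refine ⟨f, ⟨fun θ => ?_, fun θ hθ θ' hθ' he => ?_, ?_⟩, hreg⟩
  · rw [(hd θ).deriv]
    refine smul_ne_zero κ0.ne' (norm_ne_zero_iff.1 ?_)
    rw [h.unit_speed]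
    exact one_ne_zero
  · have m : ∀ θ ∈ Ico 0 (2 * Real.pi), κ * θ ∈ Ico 0 L := fun θ hθ =>
      ⟨mul_nonneg κ0.le hθ.1, by rw [← κL]; exact mul_lt_mul_of_pos_left hθ.2 κ0⟩
    exact mul_left_cancel₀ κ0.ne' (hinj (m θ hθ) (m θ' hθ') he)
  · rw [hreg]; exact hr.symm

theorem toTable_surjective : Function.Surjective toTable := by
  rintro ⟨D, hD⟩
  obtain ⟨Υ, h⟩ := id hD
  choose f hf hfD using fun i => (h.table.obstacle i).exists_loop
  have e : (fun i => region (f i)) = D := funext hfD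
  exact ⟨⟨f, hf, by rw [e]; exact hD⟩, Subtype.ext e⟩

/-! ### Linear images of obstacles -/

theorem eventually_eq_of_hasDerivAt_zero {f : ℝ → ℝ} {x : ℝ}
    (h : ∀ᶠ y in 𝓝 x, HasDerivAt f 0 y) : ∀ᶠ y in 𝓝 x, f y = f x := by
  obtain ⟨r, hr, hb⟩ := Metric.eventually_nhds_iff_ball.1 h
  filter_upwards [Metric.ball_mem_nhds x hr] with y hy
  refine (convex_ball x r).is_const_of_fderivWithin_eq_zero (𝕜 := ℝ)
    (fun z hz => (hb z hz).differentiableAt.differentiableWithinAt) (fun z hz => ?_) hy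
    (Metric.mem_ball_self hr)
  rw [(hb z hz).hasFDerivAt.hasFDerivWithinAt.fderivWithin
    (Metric.isOpen_ball.uniqueDiffWithinAt hz)]
  ext; simp

/-- Locally τ differs by a constant from the analytic primitive of w. -/
theorem analyticAt_of_hasDerivAt {w τ : ℝ → ℝ} (hw : ∀ s, AnalyticAt ℝ w s)
    (hτ : ∀ s, HasDerivAt τ (w s) s) (s : ℝ) : AnalyticAt ℝ τ s := by
  obtain ⟨P, hP, hd⟩ := (hw s).exists_primitive
  have hc : ∀ᶠ y in 𝓝 s, P y - τ y = P s - τ s := by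
    refine eventually_eq_of_hasDerivAt_zero (f := fun y => P y - τ y) (hd.mono fun y hy => ?_)
    have := hy.sub (hτ y)
    rwa [sub_self] at this
  refine (hP.sub (analyticAt_const (v := P s - τ s))).congr ?_
  filter_upwards [hc] with y hy
  simp only [Pi.sub_apply]
  rw [← hy]
  ring

namespace IsArcLengthParam

variable {O : Set Plane} {α : ℝ → Plane}

/-- The speed of the image of an arc-length parametrized curve. -/
noncomputable def speed (A : Plane ≃L[ℝ] Plane) (α : ℝ → Plane) (s : ℝ) : ℝ := ‖A (deriv α s)‖

theorem image_deriv_ne_zero (h : IsArcLengthParam O α) (A : Plane ≃L[ℝ] Plane) (s : ℝ) :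
    A (deriv α s) ≠ 0 := by
  rw [Ne, A.map_eq_zero_iff, ← norm_eq_zero, h.unit_speed]
  exact one_ne_zero

theorem speed_pos (h : IsArcLengthParam O α) (A : Plane ≃L[ℝ] Plane) (s : ℝ) : 0 < speed A α s :=
  norm_pos_iff.2 (h.image_deriv_ne_zero A s)

theorem analyticAt_speed (h : IsArcLengthParam O α) (A : Plane ≃L[ℝ] Plane) (s : ℝ) :
    AnalyticAt ℝ (speed A α) s := by
  have h1 : AnalyticAt ℝ (deriv α) s := (h.analytic s (mem_univ s)).deriv
  have h2 : ContDiffAt ℝ ω (fun s => ‖A (deriv α s)‖) s :=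
    (A.contDiff.contDiffAt.comp s h1.contDiffAt).norm ℝ (h.image_deriv_ne_zero A s)
  exact h2.analyticAt

theorem le_speed (h : IsArcLengthParam O α) (A : Plane ≃L[ℝ] Plane) :
    ∃ m > 0, ∀ s, m ≤ speed A α s := by
  obtain ⟨C, hC, hA⟩ := (A.symm : Plane →L[ℝ] Plane).bound
  refine ⟨C⁻¹, inv_pos.2 hC, fun s => ?_⟩
  have := hA (A (deriv α s))
  simp only [ContinuousLinearEquiv.coe_coe, A.symm_apply_apply, h.unit_speed] at this
  rw [speed, inv_le_iff_one_le_mul₀ hC, mul_comm]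
  exact this

theorem periodic_deriv {L : ℝ} (hper : Function.Periodic α L) : Function.Periodic (deriv α) L :=
  fun s => by rw [← deriv_comp_add_const, funext hper]

/-- `τ` is the arc length of the image of an arc-length parametrized curve, and `σ` its inverse. -/
structure LengthInverse (A : Plane ≃L[ℝ] Plane) (α : ℝ → Plane) (τ σ : ℝ → ℝ) : Prop where
  zero : τ 0 = 0
  hasDerivAt_length : ∀ s, HasDerivAt τ (speed A α s) s
  left_inv : ∀ s, σ (τ s) = s
  right_inv : ∀ t, τ (σ t) = t
  analyticAt : ∀ t, AnalyticAt ℝ σ t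

theorem LengthInverse.apply_zero {A : Plane ≃L[ℝ] Plane} {τ σ : ℝ → ℝ}
    (hl : LengthInverse A α τ σ) : σ 0 = 0 := by
  have := hl.left_inv 0
  rwa [hl.zero] at this

theorem LengthInverse.hasDerivAt (h : IsArcLengthParam O α) {A : Plane ≃L[ℝ] Plane} {τ σ : ℝ → ℝ}
    (hl : LengthInverse A α τ σ) (t : ℝ) : HasDerivAt σ (speed A α (σ t))⁻¹ t :=
  HasDerivAt.of_local_left_inverse (hl.analyticAt t).continuousAt (hl.hasDerivAt_length _)
    (h.speed_pos A _).ne' (.of_forall hl.right_inv)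

theorem LengthInverse.strictMono (h : IsArcLengthParam O α) {A : Plane ≃L[ℝ] Plane} {τ σ : ℝ → ℝ}
    (hl : LengthInverse A α τ σ) : StrictMono τ :=
  strictMono_of_hasDerivAt_pos hl.hasDerivAt_length (h.speed_pos A)

theorem exists_lengthInverse (h : IsArcLengthParam O α) (A : Plane ≃L[ℝ] Plane) :
    ∃ τ σ : ℝ → ℝ, LengthInverse A α τ σ := by
  have wa := h.analyticAt_speed A
  have wp := h.speed_pos A
  have wc : Continuous (speed A α) := continuous_iff_continuousAt.2 fun s => (wa s).continuousAt
  set τ : ℝ → ℝ := fun s => ∫ x in (0 : ℝ)..s, speed A α x with hτ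
  have τd : ∀ s, HasDerivAt τ (speed A α s) s := fun s => wc.integral_hasStrictDerivAt 0 s |>.hasDerivAt
  have τ0 : τ 0 = 0 := by simp [hτ]
  have τm : StrictMono τ := strictMono_of_hasDerivAt_pos τd wp
  have τc : Continuous τ := continuous_iff_continuousAt.2 fun s => (τd s).continuousAt
  obtain ⟨m, hm, hle⟩ := h.le_speed A
  -- The speed is bounded below by m > 0, so τ grows at least linearly at both ends; this gives
  -- surjectivity.
  have mono : Monotone fun s => τ s - m * s := by
    have d : ∀ s, HasDerivAt (fun s => τ s - m * s) (speed A α s - m) s := fun s => by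
      have := (τd s).sub ((hasDerivAt_id s).const_mul m)
      rwa [mul_one] at this
    exact monotone_of_deriv_nonneg (fun s => (d s).differentiableAt) fun s => by
      rw [(d s).deriv]; linarith [hle s]
  have surj : Function.Surjective τ := by
    refine τc.surjective ?_ ?_
    · refine tendsto_atTop_mono' _ ?_ (tendsto_id.const_mul_atTop hm)
      filter_upwards [eventually_ge_atTop 0] with s hs
      have := mono hs
      simp only [τ0, mul_zero, sub_zero] at this
      simpa using this
    · refine tendsto_atBot_mono' _ ?_ (tendsto_id.const_mul_atBot hm)
      filter_upwards [eventually_le_atBot 0] with s hs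
      have := mono hs
      simp only [τ0, mul_zero, sub_zero] at this
      simpa using this
  set E := τm.orderIsoOfSurjective τ surj with hE
  have e1 : ∀ s, E.symm (τ s) = s := fun s => E.symm_apply_apply s
  have e2 : ∀ t, τ (E.symm t) = t := fun t => E.apply_symm_apply t
  refine ⟨τ, E.symm, τ0, τd, e1, e2, fun t => ?_⟩
  obtain ⟨g, ga, -, hg, -⟩ := (analyticAt_of_hasDerivAt wa τd (E.symm t)).exists_local_inverse_real
    (τd _) (wp _).ne'
  rw [e2] at ga
  refine ga.congr ?_
  filter_upwards [(E.symm.continuous.tendsto t).eventually hg] with y hy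
  rw [← hy, e2]

theorem deriv_image (h : IsArcLengthParam O α) {A : Plane ≃L[ℝ] Plane} {τ σ : ℝ → ℝ}
    (hl : LengthInverse A α τ σ) (t : ℝ) :
    deriv (fun t => A (α (σ t))) t = (speed A α (σ t))⁻¹ • A (deriv α (σ t)) := by
  have := A.hasFDerivAt.comp_hasDerivAt t ((h.hasDerivAt (σ t)).scomp t (hl.hasDerivAt h t))
  rw [map_smul] at this
  exact this.deriv

/-- The image of an arc-length parametrized boundary under a linear isomorphism. -/
theorem image (h : IsArcLengthParam O α) {A : Plane ≃L[ℝ] Plane} {τ σ : ℝ → ℝ}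
    (hl : LengthInverse A α τ σ) : IsArcLengthParam (A '' O) fun t => A (α (σ t)) := by
  have τm := hl.strictMono h
  have σd := hl.hasDerivAt h
  obtain ⟨τ0, τd, hστ, hτσ, σa⟩ := hl
  have d1 : ∀ t, HasDerivAt (fun t => A (α (σ t))) ((speed A α (σ t))⁻¹ • A (deriv α (σ t))) t :=
    fun t => by
      have := A.hasFDerivAt.comp_hasDerivAt t ((h.hasDerivAt (σ t)).scomp t (σd t))
      refine this.congr_deriv ?_
      simp
  refine ⟨fun t _ => ?_, fun t => ?_, ?_, ?_, fun t h0 => ?_⟩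
  · exact (A : Plane →L[ℝ] Plane).analyticAt _ |>.comp
      (AnalyticAt.fun_comp (h.analytic _ (mem_univ _)) (σa t))
  · rw [(d1 t).deriv, norm_smul, norm_inv, Real.norm_of_nonneg (h.speed_pos A _).le]
    exact inv_mul_cancel₀ (h.speed_pos A _).ne'
  · obtain ⟨L, hL, hper, hinj⟩ := h.closed_simple
    have hw : ∀ s, speed A α (s + L) = speed A α s := fun s => by
      rw [speed, periodic_deriv hper, speed]
    -- The speed is periodic, so advancing by one period adds the constant length τ(L), which is the
    -- period of the image curve.
    have hτL : ∀ s, τ (s + L) = τ s + τ L := fun s => by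
      have hd : ∀ s, HasDerivAt (fun s => τ (s + L) - τ s) 0 s := fun s => by
        have := ((τd (s + L)).comp_add_const s L).sub (τd s)
        rwa [hw, sub_self] at this
      have := is_const_of_deriv_eq_zero (fun s => (hd s).differentiableAt) (fun s => (hd s).deriv) s 0
      simp only [zero_add, τ0] at this
      linarith
    refine ⟨τ L, by rw [← τ0]; exact τm hL, fun t => ?_, fun t ht t' ht' he => ?_⟩
    · have : σ (t + τ L) = σ t + L := by
        rw [← hστ (σ t + L), hτL, hτσ]
      simp only [this, hper (σ t)]
    · have m : ∀ t ∈ Ico 0 (τ L), σ t ∈ Ico 0 L := fun t ht => by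
        have h1 := ht.1
        have h2 := ht.2
        rw [← hτσ t] at h1 h2
        rw [← τ0] at h1
        exact ⟨τm.le_iff_le.1 h1, τm.lt_iff_lt.1 h2⟩
      have := hinj (m t ht) (m t' ht') (A.injective he)
      rw [← hτσ t, this, hτσ]
  · rw [show A '' O = A.toHomeomorph '' O from rfl, ← A.toHomeomorph.image_frontier, ← h.range_eq]
    ext p
    constructor
    · rintro ⟨t, rfl⟩
      exact ⟨_, mem_range_self (σ t), rfl⟩
    · rintro ⟨_, ⟨s, rfl⟩, rfl⟩
      exact ⟨τ s, by simp only [hστ]; rfl⟩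
  · have d2 : HasDerivAt (deriv α) (iteratedDeriv 2 α (σ t)) (σ t) := by
      simpa using h.hasDerivAt_iteratedDeriv 1 (σ t)
    have σd' : HasDerivAt (deriv σ) (deriv (deriv σ) t) t := (σa t).deriv.differentiableAt.hasDerivAt
    have σe : deriv σ t = (speed A α (σ t))⁻¹ := (σd t).deriv
    have e : deriv (fun t => A (α (σ t))) = fun t => A (deriv σ t • deriv α (σ t)) := funext fun t => by
      rw [(d1 t).deriv, (σd t).deriv, map_smul]
    have d3 := A.hasFDerivAt.comp_hasDerivAt t (σd'.smul (d2.scomp t (σd t)))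
    rw [iteratedDeriv_succ, iteratedDeriv_one, e] at h0
    have h1 := d3.deriv.symm.trans h0
    simp only [ContinuousLinearEquiv.coe_coe] at h1
    rw [A.map_eq_zero_iff] at h1
    -- Pairing with α'' eliminates the tangential term, since α' and α'' are orthogonal, and leaves
    -- a nonzero multiple of ‖α''‖².
    have h2 := congrArg (fun v => inner ℝ v (iteratedDeriv 2 α (σ t))) h1
    have h3 := h.inner_one_two (σ t)
    rw [iteratedDeriv_one] at h3
    simp only [inner_add_left, real_inner_smul_left, h3, inner_zero_left, mul_zero, add_zero, σe,
      Function.comp] at h2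
    have w0 := inv_ne_zero (h.speed_pos A (σ t)).ne'
    rcases mul_eq_zero.1 h2 with h4 | h4
    · exact w0 h4
    · rcases mul_eq_zero.1 h4 with h5 | h5
      · exact w0 h5
      · exact h.curved _ (inner_self_eq_zero.1 h5)

/-- The curvature of the image of an arc-length parametrized curve. -/
theorem curvature_image (h : IsArcLengthParam O α) {A : Plane ≃L[ℝ] Plane} {μ : ℝ} (hμ : 0 < μ)
    (hA : ∀ v w, Plane.cross (A v) (A w) = μ * Plane.cross v w) {τ σ : ℝ → ℝ}
    (hl : LengthInverse A α τ σ) (t : ℝ) :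
    curvature (fun t => A (α (σ t))) t = μ * curvature α (σ t) / speed A α (σ t) ^ 3 := by
  have hβ := h.image hl
  have σa := hl.analyticAt
  have σd := hl.hasDerivAt h
  have d2 : HasDerivAt (deriv α) (iteratedDeriv 2 α (σ t)) (σ t) := by
    simpa using h.hasDerivAt_iteratedDeriv 1 (σ t)
  have σd' : HasDerivAt (deriv σ) (deriv (deriv σ) t) t := (σa t).deriv.differentiableAt.hasDerivAt
  have σe : deriv σ t = (speed A α (σ t))⁻¹ := (σd t).deriv
  have e : deriv (fun t => A (α (σ t))) = fun t => A (deriv σ t • deriv α (σ t)) := funext fun t => by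
    have := A.hasFDerivAt.comp_hasDerivAt t ((h.hasDerivAt (σ t)).scomp t (σd t))
    rw [(σd t).deriv]
    exact this.deriv
  have d3 := A.hasFDerivAt.comp_hasDerivAt t (σd'.smul (d2.scomp t (σd t)))
  have e2 : iteratedDeriv 2 (fun t => A (α (σ t))) t = A ((deriv σ t) • (speed A α (σ t))⁻¹ •
      iteratedDeriv 2 α (σ t) + deriv (deriv σ) t • deriv α (σ t)) := by
    rw [iteratedDeriv_succ, iteratedDeriv_one, e]
    exact d3.deriv
  have w0 := h.speed_pos A (σ t)
  have k1 : curvature (fun t => A (α (σ t))) t ^ 2 =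
      Plane.cross (iteratedDeriv 1 (fun t => A (α (σ t))) t)
        (iteratedDeriv 2 (fun t => A (α (σ t))) t) ^ 2 := by
    rw [Plane.cross_sq, hβ.norm_deriv, hβ.inner_one_two, curvature]
    ring
  have k2 : Plane.cross (deriv α (σ t)) (iteratedDeriv 2 α (σ t)) ^ 2 = curvature α (σ t) ^ 2 := by
    have := h.inner_one_two (σ t)
    rw [iteratedDeriv_one] at this
    rw [Plane.cross_sq, h.unit_speed, this, curvature]
    ring
  have k3 : ∀ (a b c : ℝ) (v w : Plane), Plane.cross (a • v) (a • b • w + c • v) =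
      a * a * b * Plane.cross v w := fun a b c v w => by
    simp only [Plane.cross, PiLp.add_apply, PiLp.smul_apply, smul_eq_mul]
    ring
  rw [iteratedDeriv_one, e, e2, hA, k3, σe, mul_pow, mul_pow, k2] at k1
  refine (pow_left_inj₀ (hβ.curvature_pos t).le ?_ two_ne_zero).1 ?_
  · have := h.curvature_pos (σ t)
    positivity
  · rw [k1]
    field_simp

end IsArcLengthParam

theorem IsTable.image {D : Fin 3 → Set Plane} (h : IsTable D) (A : Plane ≃L[ℝ] Plane) :
    IsTable fun i => A '' D i := by
  refine ⟨fun i => ⟨(h.obstacle i).compact.image A.continuous,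
    (h.obstacle i).convex.linear_image (A : Plane →ₗ[ℝ] Plane), ?_⟩, fun i j k hij hki hkj => ?_⟩
  · obtain ⟨α, hα⟩ := (h.obstacle i).boundary
    obtain ⟨τ, σ, hl⟩ := hα.exists_lengthInverse A
    exact ⟨_, hα.image hl⟩
  · rw [← image_union]
    have := (A : Plane →ₗ[ℝ] Plane).image_convexHull (D i ∪ D j)
    simp only [LinearEquiv.coe_coe, ContinuousLinearEquiv.coe_toLinearEquiv] at this
    rw [← this]
    exact disjoint_image_of_injective A.injective (h.non_eclipse i j k hij hki hkj)

/-! ### Symmetry of germs -/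

theorem AnalyticAt.eventuallyEq_of_iteratedDeriv {f g : ℝ → ℝ} {x : ℝ} (hf : AnalyticAt ℝ f x)
    (hg : AnalyticAt ℝ g x) (h : ∀ k, iteratedDeriv k f x = iteratedDeriv k g x) : f =ᶠ[𝓝 x] g := by
  have h1 := hf.hasFPowerSeriesAt
  simp only [h] at h1
  filter_upwards [h1.eventually_hasSum_sub, hg.hasFPowerSeriesAt.eventually_hasSum_sub] with y a b
  exact a.unique b

theorem AnalyticAt.eventually_even {f : ℝ → ℝ} (hf : AnalyticAt ℝ f 0)
    (h : ∀ k, Odd k → iteratedDeriv k f 0 = 0) : ∀ᶠ s in 𝓝 (0 : ℝ), f (-s) = f s := by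
  refine AnalyticAt.eventuallyEq_of_iteratedDeriv (AnalyticAt.fun_comp_of_eq (f := fun s => -s) hf
    analyticAt_id.neg neg_zero) hf fun k => ?_
  rw [iteratedDeriv_comp_neg, neg_zero]
  rcases Nat.even_or_odd k with hk | hk
  · rw [hk.neg_one_pow, one_smul]
  · rw [h k hk, smul_zero]

theorem iteratedDeriv_eq_zero_of_even {f : ℝ → ℝ} (h : ∀ᶠ s in 𝓝 (0 : ℝ), f (-s) = f s) {k : ℕ}
    (hk : Odd k) : iteratedDeriv k f 0 = 0 := by
  have := Filter.EventuallyEq.iteratedDeriv_eq k (f := fun s => f (-s)) h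
  rw [iteratedDeriv_comp_neg, neg_zero, hk.neg_one_pow, neg_one_smul] at this
  linarith

theorem tendsto_neg_zero : Tendsto (fun s : ℝ => -s) (𝓝 0) (𝓝 0) := by
  simpa using (continuous_neg (G := ℝ)).tendsto 0

/-- A rotating frame is determined by its angular velocity. -/
theorem eventually_eq_of_rotation {a b a' b' κ : ℝ → ℝ}
    (h : ∀ᶠ s in 𝓝 (0 : ℝ), HasDerivAt a (-(κ s * b s)) s ∧ HasDerivAt b (κ s * a s) s)
    (h' : ∀ᶠ s in 𝓝 (0 : ℝ), HasDerivAt a' (-(κ s * b' s)) s ∧ HasDerivAt b' (κ s * a' s) s)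
    (n : ∀ s, a s ^ 2 + b s ^ 2 = 1) (n' : ∀ s, a' s ^ 2 + b' s ^ 2 = 1)
    (a0 : a 0 = a' 0) (b0 : b 0 = b' 0) : ∀ᶠ s in 𝓝 (0 : ℝ), a s = a' s := by
  -- The scalar product of the two frames has zero derivative and equals 1 at the start, so the unit
  -- vectors coincide.
  have hc : ∀ᶠ s in 𝓝 (0 : ℝ), a s * a' s + b s * b' s = a 0 * a' 0 + b 0 * b' 0 := by
    refine eventually_eq_of_hasDerivAt_zero (f := fun s => a s * a' s + b s * b' s) ?_
    filter_upwards [h, h'] with s h1 h2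
    refine ((h1.1.mul h2.1).add (h1.2.mul h2.2)).congr_deriv ?_
    ring
  filter_upwards [hc] with s hs
  have : (a s - a' s) ^ 2 + (b s - b' s) ^ 2 = 0 := by
    rw [← a0, ← b0] at hs
    linear_combination n s + n' s - 2 * hs - 2 * n 0
  nlinarith [sq_nonneg (a s - a' s), sq_nonneg (b s - b' s)]

namespace IsBounce

variable {O O' : Set Plane} {α α' : ℝ → Plane} {q q' : Plane}

/-- The Frenet equations in the frame at the bounce. The curvature is an unsigned norm; it equals
the signed one near 0 because they agree in sign at the bounce, by `inner_two_normal`. -/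
theorem eventually_frame (h : IsBounce O α q) : ∀ᶠ s in 𝓝 (0 : ℝ),
    HasDerivAt (fun s => inner ℝ (deriv α s) (deriv α 0))
      (-(curvature α s * inner ℝ (deriv α s) (normal α q))) s ∧
    HasDerivAt (fun s => inner ℝ (deriv α s) (normal α q))
      (curvature α s * inner ℝ (deriv α s) (deriv α 0)) s := by
  have c1 := h.continuous_deriv
  have c2 : Continuous (iteratedDeriv 2 α) := h.param.contDiff.continuous_iteratedDeriv 2 (by simp)
  have hc : Continuous fun s => inner ℝ (deriv α s) (deriv α 0) *
      inner ℝ (iteratedDeriv 2 α s) (normal α q) -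
      inner ℝ (deriv α s) (normal α q) * inner ℝ (iteratedDeriv 2 α s) (deriv α 0) := by fun_prop
  have h0 : 0 < inner ℝ (deriv α 0) (deriv α 0) * inner ℝ (iteratedDeriv 2 α 0) (normal α q) -
      inner ℝ (deriv α 0) (normal α q) * inner ℝ (iteratedDeriv 2 α 0) (deriv α 0) := by
    rw [h.perp_normal, h.inner_two_normal, real_inner_self_eq_norm_sq, h.param.unit_speed]
    simpa using h.param.curvature_pos 0
  filter_upwards [hc.continuousAt.eventually_const_lt h0] with s hs
  have d : ∀ v, HasDerivAt (fun s => inner ℝ (deriv α s) v) (inner ℝ (iteratedDeriv 2 α s) v) s :=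
    fun v => by simpa using h.hasDerivAt_iteratedDeriv v 1 s
  have e1 := h.inner_eq (deriv α s) (deriv α s)
  have e2 := h.inner_eq (deriv α s) (iteratedDeriv 2 α s)
  have e3 := h.inner_eq (iteratedDeriv 2 α s) (iteratedDeriv 2 α s)
  have e4 := h.param.inner_one_two s
  rw [iteratedDeriv_one] at e4
  rw [real_inner_self_eq_norm_sq, h.param.unit_speed] at e1
  rw [e4] at e2
  rw [IsArcLengthParam.inner_two_two] at e3
  set a := inner ℝ (deriv α s) (deriv α 0)
  set b := inner ℝ (deriv α s) (normal α q)
  set x := inner ℝ (iteratedDeriv 2 α s) (deriv α 0) with hx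
  set y := inner ℝ (iteratedDeriv 2 α s) (normal α q) with hy
  have k : curvature α s = a * y - b * x := by
    refine (pow_left_inj₀ (h.param.curvature_pos s).le hs.le two_ne_zero).1 ?_
    rw [e3]
    linear_combination (x * x + y * y) * e1 - (a * x + b * y) * e2
  refine ⟨(d (deriv α 0)).congr_deriv ?_, (d (normal α q)).congr_deriv ?_⟩
  · rw [← hx, k]
    linear_combination x * e1 - a * e2
  · rw [← hy, k]
    linear_combination y * e1 - b * e2

theorem frame_sq (h : IsBounce O α q) (s : ℝ) :
    inner ℝ (deriv α s) (deriv α 0) ^ 2 + inner ℝ (deriv α s) (normal α q) ^ 2 = 1 := by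
  rw [← Plane.norm_sq_eq (h.param.unit_speed 0) h.norm_normal h.perp_normal, h.param.unit_speed,
    one_pow]

theorem eventually_inner_deriv_eq (h : IsBounce O α q) (h' : IsBounce O' α' q')
    (hκ : curvature α =ᶠ[𝓝 0] curvature α') :
    ∀ᶠ s in 𝓝 (0 : ℝ), inner ℝ (deriv α s) (deriv α 0) = inner ℝ (deriv α' s) (deriv α' 0) := by
  refine eventually_eq_of_rotation (κ := curvature α) h.eventually_frame ?_ h.frame_sq h'.frame_sq ?_ ?_
  · filter_upwards [h'.eventually_frame, hκ] with s h1 h2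
    rw [h2]
    exact h1
  · rw [real_inner_self_eq_norm_sq, real_inner_self_eq_norm_sq, h.param.unit_speed,
      h'.param.unit_speed]
  · rw [h.perp_normal, h'.perp_normal]

/-- For even curvature, reversing the parameter and the sign of the normal component gives another
solution of the same Frenet equations with the same initial frame. -/
theorem eventually_inner_deriv_neg (h : IsBounce O α q)
    (hκ : ∀ᶠ s in 𝓝 (0 : ℝ), curvature α (-s) = curvature α s) :
    ∀ᶠ s in 𝓝 (0 : ℝ), inner ℝ (deriv α (-s)) (deriv α 0) = inner ℝ (deriv α s) (deriv α 0) := by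
  refine eventually_eq_of_rotation (κ := curvature α)
    (b := fun s => -inner ℝ (deriv α (-s)) (normal α q)) ?_ h.eventually_frame (fun s => ?_) h.frame_sq
    (by rw [neg_zero]) (by rw [neg_zero, h.perp_normal, neg_zero])
  · filter_upwards [tendsto_neg_zero.eventually h.eventually_frame, hκ] with s h1 h2
    constructor
    · have := h1.1.comp s (hasDerivAt_neg s)
      refine this.congr_deriv ?_
      rw [h2]; ring
    · have := (h1.2.comp s (hasDerivAt_neg s)).neg
      refine this.congr_deriv ?_
      rw [h2]; ring
  · rw [neg_sq]; exact h.frame_sq _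

end IsBounce

/-! ### Stretching a table along the tangent direction of the orbit -/

/-- Multiplication by `m` of the component along `e`. -/
noncomputable def stretchMap (e : Plane) (m : ℝ) : Plane →L[ℝ] Plane :=
  ContinuousLinearMap.id ℝ Plane + ((m - 1) • innerSL ℝ e).smulRight e

theorem stretchMap_apply (e : Plane) (m : ℝ) (v : Plane) :
    stretchMap e m v = v + ((m - 1) * inner ℝ v e) • e := by
  simp [stretchMap, real_inner_comm e v]

/-- `A` multiplies by `μ` the component along the unit vector `e`. -/
structure IsStretch (A : Plane ≃L[ℝ] Plane) (e : Plane) (μ : ℝ) : Prop where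
  norm_eq : ‖e‖ = 1
  pos : 0 < μ
  apply : ∀ v, A v = v + ((μ - 1) * inner ℝ v e) • e

theorem exists_isStretch {e : Plane} (he : ‖e‖ = 1) {μ : ℝ} (hμ : 0 < μ) :
    ∃ A, IsStretch A e μ := by
  have hSS : ∀ m m', m * m' = 1 → ∀ v, stretchMap e m (stretchMap e m' v) = v := fun m m' h v => by
    rw [stretchMap_apply, stretchMap_apply, inner_add_left, real_inner_smul_left, real_inner_self_eq_norm_sq, he, add_assoc,
      ← add_smul]
    have : (m' - 1) * inner ℝ v e + (m - 1) * (inner ℝ v e + (m' - 1) * inner ℝ v e * 1 ^ 2) = 0 := by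
      linear_combination inner ℝ v e * h
    rw [this, zero_smul, add_zero]
  exact ⟨ContinuousLinearEquiv.equivOfInverse (stretchMap e μ) (stretchMap e μ⁻¹) (hSS _ _ (inv_mul_cancel₀ hμ.ne'))
    (hSS _ _ (mul_inv_cancel₀ hμ.ne')), he, hμ, stretchMap_apply e μ⟩

namespace IsStretch

variable {A : Plane ≃L[ℝ] Plane} {e : Plane} {μ : ℝ}

theorem norm_sq (h : IsStretch A e μ) (v : Plane) :
    ‖A v‖ ^ 2 = ‖v‖ ^ 2 + (μ ^ 2 - 1) * inner ℝ v e ^ 2 := by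
  rw [h.apply, norm_add_sq_real, norm_smul, h.norm_eq, inner_smul_right, mul_one, Real.norm_eq_abs,
    sq_abs]
  ring

theorem inner_of_perp (h : IsStretch A e μ) (v : Plane) {w : Plane} (hw : inner ℝ e w = 0) :
    inner ℝ (A v) w = inner ℝ v w := by
  rw [h.apply, inner_add_left, real_inner_smul_left, hw, mul_zero, add_zero]

theorem apply_of_perp (h : IsStretch A e μ) {w : Plane} (hw : inner ℝ e w = 0) : A w = w := by
  rw [h.apply, real_inner_comm, hw, mul_zero, zero_smul, add_zero]

theorem apply_self (h : IsStretch A e μ) : A e = μ • e := by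
  rw [h.apply, real_inner_self_eq_norm_sq, h.norm_eq]
  module

theorem cross (h : IsStretch A e μ) (v w : Plane) :
    Plane.cross (A v) (A w) = μ * Plane.cross v w := by
  have he : e 0 ^ 2 + e 1 ^ 2 = 1 := by
    have := EuclideanSpace.real_norm_sq_eq e
    rw [h.norm_eq, Fin.sum_univ_two] at this
    linarith
  rw [h.apply, h.apply]
  simp only [Plane.cross, PiLp.add_apply, PiLp.smul_apply, smul_eq_mul, PiLp.inner_apply,
    Fin.sum_univ_two, RCLike.inner_apply, conj_trivial]
  linear_combination (μ - 1) * (v 0 * w 1 - v 1 * w 0) * he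

theorem speed_eq (h : IsStretch A e μ) {O : Set Plane} {α : ℝ → Plane} (hα : IsArcLengthParam O α)
    (s : ℝ) : IsArcLengthParam.speed A α s = √(1 + (μ ^ 2 - 1) * inner ℝ (deriv α s) e ^ 2) := by
  have := h.norm_sq (deriv α s)
  rw [hα.unit_speed, one_pow] at this
  rw [← this, Real.sqrt_sq (norm_nonneg _)]
  rfl

end IsStretch

namespace IsArcLengthParam.LengthInverse

variable {O O' : Set Plane} {α α' : ℝ → Plane} {A : Plane ≃L[ℝ] Plane} {τ σ τ' σ' : ℝ → ℝ}

theorem tendsto (hl : LengthInverse A α τ σ) : Tendsto σ (𝓝 0) (𝓝 0) := by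
  have := (hl.analyticAt 0).continuousAt.tendsto
  rwa [hl.apply_zero] at this

theorem eventually_eq (hl : LengthInverse A α τ σ) (hl' : LengthInverse A α' τ' σ')
    (hw : ∀ᶠ s in 𝓝 (0 : ℝ), speed A α s = speed A α' s) : ∀ᶠ t in 𝓝 (0 : ℝ), σ t = σ' t := by
  have hτ : ∀ᶠ s in 𝓝 (0 : ℝ), τ s - τ' s = τ 0 - τ' 0 := by
    refine eventually_eq_of_hasDerivAt_zero (f := fun s => τ s - τ' s) (hw.mono fun s hs => ?_)
    have := (hl.hasDerivAt_length s).sub (hl'.hasDerivAt_length s)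
    rwa [hs, sub_self] at this
  filter_upwards [hl.tendsto.eventually hτ] with t ht
  rw [hl.right_inv, hl.zero, hl'.zero, sub_zero, sub_eq_zero] at ht
  conv_rhs => rw [ht, hl'.left_inv]

theorem eventually_neg (hl : LengthInverse A α τ σ)
    (hw : ∀ᶠ s in 𝓝 (0 : ℝ), speed A α (-s) = speed A α s) : ∀ᶠ t in 𝓝 (0 : ℝ), σ (-t) = -σ t := by
  have hτ : ∀ᶠ s in 𝓝 (0 : ℝ), τ s + τ (-s) = τ 0 + τ (-0) := by
    refine eventually_eq_of_hasDerivAt_zero (f := fun s => τ s + τ (-s)) (hw.mono fun s hs => ?_)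
    have := (hl.hasDerivAt_length s).add ((hl.hasDerivAt_length (-s)).comp s (hasDerivAt_neg s))
    refine this.congr_deriv ?_
    rw [hs]; ring
  filter_upwards [hl.tendsto.eventually hτ] with t ht
  rw [hl.right_inv, neg_zero, hl.zero, zero_add, ← neg_eq_iff_add_eq_zero] at ht
  rw [ht, hl.left_inv]

end IsArcLengthParam.LengthInverse

theorem Plane.cross_eq {e u : Plane} (he : ‖e‖ = 1) (hu : ‖u‖ = 1) (h : inner ℝ e u = 0)
    (v w : Plane) : Plane.cross v w =
      Plane.cross e u * (inner ℝ v e * inner ℝ w u - inner ℝ v u * inner ℝ w e) := by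
  have key : ∀ v : Plane, v = inner ℝ v e • e + inner ℝ v u • u := fun v => by
    refine Plane.eq_of_inner he hu h ?_ ?_
    · rw [inner_add_left, real_inner_smul_left, real_inner_smul_left, real_inner_self_eq_norm_sq, he,
        real_inner_comm e u, h]
      ring
    · rw [inner_add_left, real_inner_smul_left, real_inner_smul_left, real_inner_self_eq_norm_sq, hu, h]
      ring
  conv_lhs => rw [key v, key w]
  simp only [Plane.cross, PiLp.add_apply, PiLp.smul_apply, smul_eq_mul]
  ring

theorem AnalyticOnNhd.iteratedDeriv_map {g : ℝ → Plane} (hg : AnalyticOnNhd ℝ g univ)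
    (A : Plane →L[ℝ] Plane) (n : ℕ) (x : ℝ) :
    iteratedDeriv n (fun x => A (g x)) x = A (iteratedDeriv n g x) := by
  induction n generalizing x with
  | zero => simp
  | succ n ih =>
    rw [iteratedDeriv_succ, funext ih]
    exact (A.hasFDerivAt.comp_hasDerivAt x (hg.hasDerivAt_iteratedDeriv n x)).deriv

/-- The curvature at the bounce point, and its second derivative, of a stretched obstacle. -/
theorem IsBounce.stretch_curvature {O : Set Plane} {α : ℝ → Plane} {q : Plane} (h : IsBounce O α q)
    (hκ : deriv (curvature α) 0 = 0) {A : Plane ≃L[ℝ] Plane} {μ : ℝ}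
    (hA : IsStretch A (deriv α 0) μ) {β : ℝ → Plane} (hβ : IsArcLengthParam (A '' O) β)
    (hκβ : deriv (curvature β) 0 = 0) (h0 : β 0 = A (α 0)) :
    curvature β 0 = curvature α 0 / μ ^ 2 ∧
      iteratedDeriv 2 (curvature β) 0 = iteratedDeriv 2 (curvature α) 0 / μ ^ 4 +
        3 * curvature α 0 ^ 3 * (μ ^ 2 - 1) / μ ^ 6 := by
  have ha : AnalyticOnNhd ℝ (fun y => A (α y)) univ := fun y _ =>
    ((A : Plane →L[ℝ] Plane).analyticAt _).comp (h.param.analytic y (mem_univ y))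
  have hfr : ∀ y, A (α y) ∈ frontier (A '' O) := fun y => by
    rw [show A '' O = A.toHomeomorph '' O from rfl, ← A.toHomeomorph.image_frontier, ← h.param.range_eq]
    exact ⟨_, mem_range_self y, rfl⟩
  have hJ : ∀ n, iteratedDeriv n (fun y => A (α y)) 0 = A (iteratedDeriv n α 0) := fun n =>
    h.param.analytic.iteratedDeriv_map (A : Plane →L[ℝ] Plane) n 0
  obtain ⟨j1, j2⟩ := hβ.jet_eq hκβ ha hfr h0.symm (by
    rw [← iteratedDeriv_one, hJ, iteratedDeriv_one]
    exact h.param.image_deriv_ne_zero A 0)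
  rw [← j1, ← j2]
  have n1 := h.param.unit_speed 0
  set κ := curvature α 0 with hκ0
  set κ₂ := iteratedDeriv 2 (curvature α) 0
  have κpos : 0 < κ := h.param.curvature_pos 0
  have μpos := hA.pos
  -- This is the sign of the orientation of the frame; only its square enters the curvature
  -- formulas.
  set ε := Plane.cross (deriv α 0) (normal α q)
  have hε : ε ^ 2 = 1 := by
    rw [Plane.cross_sq, n1, h.norm_normal, h.perp_normal]; norm_num
  have i2 := h.inner_two_tan
  have i2' := h.inner_two_normal
  have i3 := h.inner_three_tan
  have i3' := h.inner_three_normal hκ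
  have i4' := h.inner_four_normal hκ
  have e1 : inner ℝ (deriv α 0) (deriv α 0) = (1 : ℝ) := by
    rw [real_inner_self_eq_norm_sq, n1]; norm_num
  have c := fun m n => Plane.cross_eq n1 h.norm_normal h.perp_normal (iteratedDeriv m α 0)
    (iteratedDeriv n α 0)
  have c12 : Plane.cross (iteratedDeriv 1 α 0) (iteratedDeriv 2 α 0) = ε * κ := by
    rw [c, iteratedDeriv_one, e1, i2', i2, ← hκ0]; ring
  have c13 : Plane.cross (iteratedDeriv 1 α 0) (iteratedDeriv 3 α 0) = 0 := by
    rw [c, iteratedDeriv_one, i3', h.perp_normal]; ring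
  have c23 : Plane.cross (iteratedDeriv 2 α 0) (iteratedDeriv 3 α 0) = ε * κ ^ 3 := by
    rw [c, i2, i2', i3, ← hκ0]; ring
  have c14 : Plane.cross (iteratedDeriv 1 α 0) (iteratedDeriv 4 α 0) = ε * (κ₂ - κ ^ 3) := by
    rw [c, iteratedDeriv_one, e1, i4', h.perp_normal, ← hκ0]; ring
  have A1 : A (iteratedDeriv 1 α 0) = μ • deriv α 0 := by rw [iteratedDeriv_one, hA.apply_self]
  have iA : ∀ v, inner ℝ (deriv α 0) (A v) = μ * inner ℝ v (deriv α 0) := fun v => by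
    rw [hA.apply, inner_add_right, inner_smul_right, e1, real_inner_comm]; ring
  have m1 : ‖A (iteratedDeriv 1 α 0)‖ ^ 2 = μ ^ 2 := by
    rw [A1, norm_smul, n1, mul_one, Real.norm_eq_abs, sq_abs]
  have m2 : ‖A (iteratedDeriv 2 α 0)‖ ^ 2 = κ ^ 2 := by
    rw [hA.norm_sq, i2, hκ0, curvature]; ring
  have m12 : inner ℝ (A (iteratedDeriv 1 α 0)) (A (iteratedDeriv 2 α 0)) = (0 : ℝ) := by
    rw [A1, real_inner_smul_left, iA, i2]; ring
  have m13 : inner ℝ (A (iteratedDeriv 1 α 0)) (A (iteratedDeriv 3 α 0)) = -(μ ^ 2 * κ ^ 2) := by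
    rw [A1, real_inner_smul_left, iA, i3]; ring
  have K : jetCurvature (fun j => iteratedDeriv j (fun y => A (α y)) 0) = κ / μ ^ 2 := by
    rw [jetCurvature, hJ, hJ, hA.cross, c12, m1]
    have : (μ * (ε * κ)) ^ 2 / (μ ^ 2) ^ 3 = (κ / μ ^ 2) ^ 2 := by
      rw [mul_pow, mul_pow, hε]; field_simp
    rw [this, Real.sqrt_sq (by positivity)]
  refine ⟨K, ?_⟩
  rw [jetCurvature₂, K]
  simp only [hJ, hA.cross, c12, c13, c23, c14, m1, m2, m12, m13]
  have q1 : (μ * (ε * κ)) ^ 2 = μ ^ 2 * κ ^ 2 := by rw [mul_pow, mul_pow, hε]; ring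
  have q2 : 2 * (μ * (ε * κ)) * (μ * (ε * κ ^ 3) + μ * (ε * (κ₂ - κ ^ 3))) = 2 * μ ^ 2 * κ * κ₂ := by
    linear_combination 2 * μ ^ 2 * κ * κ₂ * hε
  rw [q1, q2]
  field_simp
  ring

/-- The orbit segment is orthogonal to the stretched direction, so its displacement vector is
unchanged, and the image boundaries are still met orthogonally. -/
theorem BilliardStep.stretch {S O O' : Set Plane} {α β : ℝ → Plane} (h : BilliardStep S α β (0, 0) (0, 0))
    (hα : IsArcLengthParam O α) (hβ : IsArcLengthParam O' β) {A : Plane ≃L[ℝ] Plane} {e : Plane}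
    {μ : ℝ} (hA : IsStretch A e μ) (he : inner ℝ e (β 0 - α 0) = 0) {τ σ τ' σ' : ℝ → ℝ}
    (hl : IsArcLengthParam.LengthInverse A α τ σ) (hl' : IsArcLengthParam.LengthInverse A β τ' σ') :
    BilliardStep (A '' S) (fun t => A (α (σ t))) (fun t => A (β (σ' t))) (0, 0) (0, 0) := by
  obtain ⟨h1, h2, h3, h4, h5, h6⟩ := h
  have d0 := inv_ne_zero (dist_ne_zero.2 h3)
  simp only [inner_smul_right] at h5 h6
  have h5 := (mul_eq_zero.1 h5.symm).resolve_left d0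
  have h6 := (mul_eq_zero.1 h6.symm).resolve_left d0
  have hd : A (β 0) - A (α 0) = β 0 - α 0 := by rw [← map_sub, hA.apply_of_perp he]
  simp only [BilliardStep, hα.deriv_image hl, hβ.deriv_image hl', hl.apply_zero, hl'.apply_zero, hd,
    inner_smul_right, real_inner_smul_left, hA.inner_of_perp _ he, h5, h6, mul_zero, and_true]
  refine ⟨mem_image_of_mem _ h1, mem_image_of_mem _ h2, A.injective.ne h3, ?_⟩
  have := image_openSegment ℝ (A : Plane →ₗ[ℝ] Plane).toAffineMap (α 0) (β 0)
  simp only [LinearMap.coe_toAffineMap, LinearEquiv.coe_coe,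
    ContinuousLinearEquiv.coe_toLinearEquiv] at this
  rw [← this]
  exact disjoint_image_of_injective A.injective h4

namespace IsSymMarking

variable {D : Fin 3 → Set Plane} {Υ : Fin 3 → ℝ → Plane}

/-- Stretching along the tangent direction of the orbit preserves the symmetry of a table. -/
theorem stretch (h : IsSymMarking D Υ) {A : Plane ≃L[ℝ] Plane} {μ : ℝ}
    (hA : IsStretch A (deriv (Υ 0) 0) μ) {τ σ : Fin 3 → ℝ → ℝ}
    (hl : ∀ i, IsArcLengthParam.LengthInverse A (Υ i) (τ i) (σ i)) :
    IsSymMarking (fun i => A '' D i) fun i t => A (Υ i (σ i t)) := by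
  obtain ⟨b0, b1⟩ := h.marking.isBounce h.table
  have hp := h.marking.param
  have perp := b0.perp
  have perp' : inner ℝ (deriv (Υ 0) 0) (Υ 0 0 - Υ 1 0) = 0 := by
    rw [← neg_sub, inner_neg_right, perp, neg_zero]
  -- both tangents at the bounce points are parallel
  have hsq : ∀ v, inner ℝ v (deriv (Υ 0) 0) ^ 2 = inner ℝ v (deriv (Υ 1) 0) ^ 2 := fun v => by
    have z : inner ℝ (deriv (Υ 1) 0) (IsBounce.normal (Υ 0) (Υ 1 0)) = 0 := by
      rw [IsBounce.normal, inner_smul_right, b1.perp, mul_zero]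
    have e1 := b0.inner_eq (deriv (Υ 1) 0) (deriv (Υ 1) 0)
    rw [z, real_inner_self_eq_norm_sq, (hp 1).unit_speed] at e1
    rw [b0.inner_eq v (deriv (Υ 1) 0), z]
    linear_combination inner ℝ v (deriv (Υ 0) 0) ^ 2 * e1
  have κeq : curvature (Υ 0) =ᶠ[𝓝 0] curvature (Υ 1) :=
    ((hp 0).analyticAt_curvature 0).eventuallyEq_of_iteratedDeriv ((hp 1).analyticAt_curvature 0)
      h.same_jets
  have κ0 := ((hp 0).analyticAt_curvature 0).eventually_even h.even_jet_zero
  have κ1 := ((hp 1).analyticAt_curvature 0).eventually_even h.even_jet_one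
  have w0 : ∀ s, IsArcLengthParam.speed A (Υ 0) s =
      √(1 + (μ ^ 2 - 1) * inner ℝ (deriv (Υ 0) s) (deriv (Υ 0) 0) ^ 2) := hA.speed_eq (hp 0)
  have w1 : ∀ s, IsArcLengthParam.speed A (Υ 1) s =
      √(1 + (μ ^ 2 - 1) * inner ℝ (deriv (Υ 1) s) (deriv (Υ 1) 0) ^ 2) := fun s => by
    rw [hA.speed_eq (hp 1), hsq]
  have weq : ∀ᶠ s in 𝓝 (0 : ℝ), IsArcLengthParam.speed A (Υ 0) s = IsArcLengthParam.speed A (Υ 1) s :=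
    (b0.eventually_inner_deriv_eq b1 κeq).mono fun s hs => by rw [w0, w1, hs]
  have weven0 : ∀ᶠ s in 𝓝 (0 : ℝ),
      IsArcLengthParam.speed A (Υ 0) (-s) = IsArcLengthParam.speed A (Υ 0) s :=
    (b0.eventually_inner_deriv_neg κ0).mono fun s hs => by rw [w0, w0, hs]
  have weven1 : ∀ᶠ s in 𝓝 (0 : ℝ),
      IsArcLengthParam.speed A (Υ 1) (-s) = IsArcLengthParam.speed A (Υ 1) s :=
    (b1.eventually_inner_deriv_neg κ1).mono fun s hs => by rw [w1, w1, hs]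
  -- The image curvature is μκ/speed³ taken at the old parameter. The speed depends on the tangent
  -- angle, hence only on the germ of the curvature, so equality and evenness of germs pass to the
  -- image.
  have hκ := fun i t => (hp i).curvature_image hA.pos hA.cross (hl i) t
  have σeq := (hl 0).eventually_eq (hl 1) weq
  refine ⟨h.table.image A, ⟨fun i => (hp i).image (hl i), ?_, ?_⟩, fun k => ?_, fun k hk => ?_,
    fun k hk => ?_⟩
  · rw [← image_iUnion]
    exact h.marking.go.stretch (hp 0) (hp 1) hA perp (hl 0) (hl 1)
  · rw [← image_iUnion]
    exact h.marking.back.stretch (hp 1) (hp 0) hA perp' (hl 1) (hl 0)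
  · refine Filter.EventuallyEq.iteratedDeriv_eq k ?_
    filter_upwards [σeq, (hl 1).tendsto.eventually κeq, (hl 1).tendsto.eventually weq] with t h1 h2 h3
    rw [hκ, hκ, h1, h2, h3]
  · refine iteratedDeriv_eq_zero_of_even ?_ hk
    filter_upwards [(hl 0).eventually_neg weven0, (hl 0).tendsto.eventually κ0,
      (hl 0).tendsto.eventually weven0] with t h1 h2 h3
    rw [hκ, hκ, h1, h2, h3]
  · refine iteratedDeriv_eq_zero_of_even ?_ hk
    filter_upwards [(hl 1).eventually_neg weven1, (hl 1).tendsto.eventually κ1,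
      (hl 1).tendsto.eventually weven1] with t h1 h2 h3
    rw [hκ, hκ, h1, h2, h3]

end IsSymMarking

/-! ### Density of nondegeneracy: stretching destroys the equation a₁ = 0. -/

theorem birkhoff_eq_zero_iff {ℓ K K₂ : ℝ} (hℓ : 0 < ℓ) (hK : 0 < K) :
    birkhoffCoeff (ℓ, K) * K₂ + birkhoffRest (ℓ, K) = 0 ↔ ℓ * K₂ = K ^ 2 * (2 + K * ℓ) := by
  have hev := foldedEigenvalue_pos (ℓ, K)
  have : birkhoffCoeff (ℓ, K) * K₂ + birkhoffRest (ℓ, K) = foldedEigenvalue (ℓ, K) /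
      (4 * K * (2 + K * ℓ)) * (K ^ 2 * (2 + K * ℓ) - ℓ * K₂) := by
    simp only [birkhoffCoeff, birkhoffRest]
    field_simp
    ring
  rw [this, mul_eq_zero, or_iff_right (by positivity), sub_eq_zero, eq_comm]

/-- A stretched degenerate table is nondegenerate. -/
theorem IsSymMarking.isNondegenerate_stretch {D : Fin 3 → Set Plane} {Υ : Fin 3 → ℝ → Plane}
    (h : IsSymMarking D Υ) (hD : ¬ IsNondegenerate D) {A : Plane ≃L[ℝ] Plane} {μ : ℝ}
    (hA : IsStretch A (deriv (Υ 0) 0) μ) (hμ : μ ≠ 1) : IsNondegenerate fun i => A '' D i := by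
  choose τ σ hl using fun i => (h.marking.param i).exists_lengthInverse A
  have h' := h.stretch hA hl
  have b0 := (h.marking.isBounce h.table).1
  have h0 : birkhoffCoeff (dist (Υ 0 0) (Υ 1 0), curvature (Υ 0) 0) *
      iteratedDeriv 2 (curvature (Υ 0)) 0 +
        birkhoffRest (dist (Υ 0 0) (Υ 1 0), curvature (Υ 0) 0) = 0 := by
    by_contra hn
    exact hD (isNondegenerate_iff.2 ⟨Υ, h, hn⟩)
  refine isNondegenerate_iff.2 ⟨_, h', fun h1 => hμ ?_⟩
  have o : deriv (curvature (Υ 0)) 0 = 0 := by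
    rw [← iteratedDeriv_one]; exact h.even_jet_zero 1 odd_one
  have o' : deriv (curvature fun t => A (Υ 0 (σ 0 t))) 0 = 0 := by
    rw [← iteratedDeriv_one]; exact h'.even_jet_zero 1 odd_one
  have p' : IsArcLengthParam (A '' D 0) fun t => A (Υ 0 (σ 0 t)) := h'.marking.param 0
  have z' : A (Υ 0 (σ 0 0)) = A (Υ 0 0) := by rw [(hl 0).apply_zero]
  obtain ⟨k1, k2⟩ := b0.stretch_curvature o hA p' o' z'
  have hdist : dist (A (Υ 0 (σ 0 0))) (A (Υ 1 (σ 1 0))) = dist (Υ 0 0) (Υ 1 0) := by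
    rw [(hl 0).apply_zero, (hl 1).apply_zero, dist_comm, dist_eq_norm, ← map_sub,
      hA.apply_of_perp b0.perp, dist_comm, dist_eq_norm]
  have ℓ0 := b0.dist_pos
  have K0 := (h.marking.param 0).curvature_pos 0
  have μ0 := hA.pos
  rw [k1, k2, hdist] at h1
  rw [birkhoff_eq_zero_iff ℓ0 K0] at h0
  rw [birkhoff_eq_zero_iff ℓ0 (by positivity)] at h1
  set ℓ := dist (Υ 0 0) (Υ 1 0)
  set K := curvature (Υ 0) 0
  set K₂ := iteratedDeriv 2 (curvature (Υ 0)) 0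
  field_simp at h1
  -- If both tables were degenerate, subtracting μ² times the first condition from the cleared
  -- second one would leave only this term.
  have e : (4 * (K ^ 3 * ℓ)) * (μ ^ 2 - 1) = 0 := by
    linear_combination h1 - μ ^ 2 * h0
  have e2 := (mul_eq_zero.1 e).resolve_left (by positivity)
  exact (pow_eq_one_iff_of_nonneg μ0.le two_ne_zero).1 (by linarith)

/-! ### Linear images of loops -/

/-- The linear image of a loop. -/
def AnalyticLoop.map (A : Plane →L[ℝ] Plane) (f : AnalyticLoop) : AnalyticLoop :=
  ⟨fun x => A (f.1 x), fun x hx => (A.analyticAt _).comp (f.2.1 x hx), fun x => by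
    simp only [f.2.2 x]⟩

theorem IsStretch.coe_eq {A : Plane ≃L[ℝ] Plane} {e : Plane} {μ : ℝ} (h : IsStretch A e μ) :
    (A : Plane →L[ℝ] Plane) = stretchMap e μ := by
  ext1 v
  rw [stretchMap_apply]
  exact h.apply v

/-- The stretched loops depend continuously on the factor, in the analytic topology. -/
theorem AnalyticLoop.tendsto_stretch (f : AnalyticLoop) (e : Plane) :
    Tendsto (fun m : ℝ => f.map (stretchMap e m)) (𝓝 1) (@nhds _ (loopTopology ⊤) f) := by
  let := loopTopology ⊤
  rw [tendsto_nhds]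
  intro V hV hf
  obtain ⟨ρ, hρ, B, F, hF, hB⟩ := f.exists_bounded_extension
  obtain ⟨ε, hε, h⟩ := hV ρ hρ f hf F hF
  set C := (|B| * |e 0| + |B| * |e 1|) * (|e 0| + |e 1|) with hC
  have hev : ∀ᶠ m : ℝ in 𝓝 1, |m - 1| * C < ε := by
    have c : Continuous fun m : ℝ => |m - 1| * C := by fun_prop
    refine c.continuousAt.eventually_lt_const ?_
    simpa using hε
  filter_upwards [hev] with m hm
  -- The stretched extension differs from F by m − 1 times a bounded holomorphic map on the same
  -- strip.
  refine h _ (fun z i => F z i + (m - 1) * (F z 0 * e 0 + F z 1 * e 1) * e i) ⟨?_, fun x i => ?_⟩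
    fun z hz => ?_
  · have hd := differentiableOn_pi.1 hF.1
    exact differentiableOn_pi.2 fun i => (hd i).add (((((hd 0).mul_const _).add
      ((hd 1).mul_const _)).const_mul _).mul_const _)
  · change F x i + (m - 1) * (F x 0 * e 0 + F x 1 * e 1) * e i = ((stretchMap e m (f.1 x) i : ℝ) : ℂ)
    rw [stretchMap_apply, hF.2, hF.2, hF.2]
    simp only [PiLp.add_apply, PiLp.smul_apply, smul_eq_mul, PiLp.inner_apply, Fin.sum_univ_two,
      RCLike.inner_apply, conj_trivial]
    push_cast
    ring
  · refine (pi_norm_le_iff_of_nonneg hε.le).2 fun i => ?_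
    have hB' : ∀ i, ‖F z i‖ ≤ |B| := fun i => (hB z hz i).trans (le_abs_self B)
    have he : |e i| ≤ |e 0| + |e 1| := by
      fin_cases i
      · simp
      · simp
    have h1 : ‖F z 0 * e 0 + F z 1 * e 1‖ ≤ |B| * |e 0| + |B| * |e 1| := by
      refine (norm_add_le _ _).trans ?_
      rw [norm_mul, norm_mul, Complex.norm_real, Complex.norm_real, Real.norm_eq_abs, Real.norm_eq_abs]
      gcongr
      · exact hB' 0
      · exact hB' 1
    have e1 : ((m : ℂ) - 1) * (F z 0 * e 0 + F z 1 * e 1) * e i =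
        ((m - 1 : ℝ) : ℂ) * ((F z 0 * e 0 + F z 1 * e 1) * ((e i : ℝ) : ℂ)) := by
      push_cast; ring
    simp only [Pi.sub_apply, add_sub_cancel_left]
    rw [e1, norm_mul, norm_mul, Complex.norm_real, Complex.norm_real, Real.norm_eq_abs,
      Real.norm_eq_abs]
    refine le_trans ?_ hm.le
    rw [hC]
    gcongr

theorem AnalyticLoop.region_map (A : Plane ≃L[ℝ] Plane) (f : AnalyticLoop) :
    region (f.map (A : Plane →L[ℝ] Plane)) = A '' region f := by
  have := (A : Plane →ₗ[ℝ] Plane).image_convexHull (range f.1)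
  rw [region, region]
  refine Eq.trans ?_ this.symm
  rw [← range_comp]
  rfl

theorem IsConvexLoop.map {f : AnalyticLoop} (h : IsConvexLoop f) (A : Plane ≃L[ℝ] Plane) :
    IsConvexLoop (f.map (A : Plane →L[ℝ] Plane)) := by
  refine ⟨fun θ h0 => h.regular θ ?_, fun θ hθ θ' hθ' he => h.simple hθ hθ' (A.injective he), ?_⟩
  · have hd : HasDerivAt f.1 (deriv f.1 θ) θ := (f.2.1 θ (mem_univ θ)).differentiableAt.hasDerivAt
    have := ((A : Plane →L[ℝ] Plane).hasFDerivAt.comp_hasDerivAt θ hd).deriv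
    have h1 : A (deriv f.1 θ) = 0 := this.symm.trans h0
    exact A.map_eq_zero_iff.1 h1
  · rw [AnalyticLoop.region_map, show A '' region f = A.toHomeomorph '' region f from rfl,
      ← A.toHomeomorph.image_frontier, h.convex, ← range_comp]
    rfl

/-- The perturbed triples of loops. -/
theorem Wsym.map_stretch {f : Fin 3 → AnalyticLoop} (hf : f ∈ Wsym)
    (hn : ¬ IsNondegenerate fun i => region (f i)) :
    ∃ e : Plane, ∀ m : ℝ, 0 < m → m ≠ 1 → (fun i => (f i).map (stretchMap e m)) ∈ Wsym ∧
      IsNondegenerate fun i => region ((f i).map (stretchMap e m)) := by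
  obtain ⟨Υ, h⟩ := hf.2
  refine ⟨deriv (Υ 0) 0, fun m hm hm1 => ?_⟩
  obtain ⟨A, hA⟩ := exists_isStretch ((h.marking.param 0).unit_speed 0) hm
  have hN := h.isNondegenerate_stretch hn hA hm1
  have e : (fun i => region ((f i).map (stretchMap (deriv (Υ 0) 0) m))) =
      fun i => A '' region (f i) := funext fun i => by
    rw [← hA.coe_eq, AnalyticLoop.region_map]
  rw [← e] at hN
  refine ⟨⟨fun i => ?_, ?_⟩, hN⟩
  · rw [← hA.coe_eq]
    exact (hf.1 i).map A
  · obtain ⟨Θ, hΘ, -⟩ := hN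
    exact ⟨Θ, hΘ⟩

theorem dense_isNondegenerate (r : WithTop ℕ∞) :
    @Dense Bsym (tableTopology r) {D : Bsym | IsNondegenerate D.1} := by
  let τ := tableTopology r
  intro D
  by_cases hD : IsNondegenerate D.1
  · exact subset_closure hD
  obtain ⟨f, rfl⟩ := toTable_surjective D
  rw [mem_closure_iff]
  intro U hU hfU
  let := loopTopology r
  obtain ⟨U', hU', hUU'⟩ := isOpen_induced_iff.1 (isOpen_coinduced.1 hU)
  obtain ⟨e, he⟩ := Wsym.map_stretch f.2 hD
  -- The analytic topology is finer than every C^r topology, so convergence there serves all r at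
  -- once.
  have ht : Tendsto (fun (m : ℝ) (i : Fin 3) => (f.1 i).map (stretchMap e m)) (𝓝 1) (𝓝 f.1) :=
    tendsto_pi_nhds.2 fun i => ((f.1 i).tendsto_stretch e).mono_right
      (nhds_mono (AnalyticLoop.loopTopology_top_le r))
  have hfU' : f.1 ∈ U' := by
    have : f ∈ Subtype.val ⁻¹' U' := by rw [hUU']; exact hfU
    exact this
  have hev := (ht.eventually (hU'.mem_nhds hfU')).and (lt_mem_nhds (one_pos (α := ℝ)))
  obtain ⟨m, ⟨hmU, hm0⟩, hm1⟩ :=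
    ((hev.filter_mono nhdsWithin_le_nhds).and (self_mem_nhdsWithin (s := {(1 : ℝ)}ᶜ))).exists
  obtain ⟨hW, hN⟩ := he m hm0 hm1
  refine ⟨toTable ⟨_, hW⟩, ?_, hN⟩
  have : (⟨_, hW⟩ : Wsym) ∈ Subtype.val ⁻¹' U' := hmU
  rw [hUU'] at this
  exact this

theorem mainTheorem9 :
    (∃ c f : ℝ × ℝ → ℝ,
      ContinuousOn c {p | 0 < p.1 ∧ 0 < p.2} ∧
      (∀ p : ℝ × ℝ, 0 < p.1 → 0 < p.2 → c p ≠ 0) ∧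
      Continuous f ∧
      ∀ (D : Fin 3 → Set Plane) (Υ : Fin 3 → ℝ → Plane), IsSymMarking D Υ →
        Nonempty (Folding D Υ) ∧
        ∀ (W : Folding D Υ) (a : ℝ), W.IsFirstBirkhoffInvariant a ↔
          a = c (dist (Υ 0 0) (Υ 1 0), curvature (Υ 0) 0) * iteratedDeriv 2 (curvature (Υ 0)) 0
              + f (dist (Υ 0 0) (Υ 1 0), curvature (Υ 0) 0)) ∧
    (∀ r : WithTop ℕ∞, 4 ≤ r → IsOpen[tableTopology r] {D : Bsym | IsNondegenerate D.1}) ∧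
    (∀ r : WithTop ℕ∞, @Dense Bsym (tableTopology r) {D : Bsym | IsNondegenerate D.1}) := by
  refine ⟨⟨birkhoffCoeff, birkhoffRest, continuousOn_birkhoffCoeff,
    fun p h1 h2 => birkhoffCoeff_ne_zero h1 h2, continuous_birkhoffRest, fun D Υ h =>
      ⟨h.nonempty_folding, h.isFirstBirkhoffInvariant_iff⟩⟩,
    fun r hr => isOpen_isNondegenerate hr, dense_isNondegenerate⟩
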